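/- **One-dimensional modular dioperads are Morita contexts with trace.** *Cobordisms.* Let $\overrightarrow{\mathsf{Cob}}=\overrightarrow{\mathsf{Cob}}[1]$ be the following symmetric monoidal simplicial category. An object $S$ is a compact smooth $1$-manifold with boundary (possibly empty or disconnected) together with an orientation of $S$ and an orientation (a sign at each point) of $\partial S$; a boundary point is called outgoing ($+$) if its sign agrees with the boundary orientation induced by that of $S$, and incoming ($-$) otherwise. A morphism $S\to T$ is a finite set $\gamma$ of oriented points in the interior of $T$ together with a diffeomorphism from $S$ to the manifold $T[\gamma]$ obtained by cutting $T$ along $\gamma$, compatible with the orientations of the manifolds and of their boundaries (both boundary points of $T[\gamma]$ over a point of $\gamma$ carry the sign of that point); a $k$-simplex of morphisms is a smooth family of these parametrized by the simplex $\Delta^k$. The tensor product is disjoint union. Let $\mathsf{Cob}=\mathsf{Cob}[1]$ be defined in the same way, omitting the orientations of the boundaries and of the points of $\gamma$. Let $I_a^b$ be the interval $[0,1]$ with sign $a\in\{-,+\}$ (incoming/outgoing) at $0$ and $b$ at $1$, let $I$ be $[0,1]$ as an object of $\mathsf{Cob}$, and let $S^1$ be the circle. Let $\mathcal C$ be a symmetric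 monoidal category, regarded as a discrete simplicial category. A $1$-dimensional modular dioperad (respectively modular operad) in $\mathcal C$ is a (strong) symmetric monoidal simplicial functor from $\overrightarrow{\mathsf{Cob}}$ (respectively $\mathsf{Cob}$) to $\mathcal C$; morphisms are symmetric monoidal natural transformations. *Morita contexts with trace.* A Morita context with trace in $\mathcal C$ consists of non-unital associative algebras $A$ and $B$, an $(A,B)$-bimodule $Q$ and a $(B,A)$-bimodule $R$ with actions $\lambda_Q:A\otimes Q\to Q$, $\rho_Q:Q\otimes B\to Q$, $\lambda_R:B\otimes R\to R$, $\rho_R:R\otimes A\to R$, an object $M$, and morphisms $$\alpha: Q\otimes_B R\to A,\qquad \beta: R\otimes_A Q\to B,\qquad \mathrm{tr}_A:A\to M,\qquad \mathrm{tr}_B:B\to M,$$ where a morphism from $Q\otimes_B R$ means a $B$-balanced morphism from $Q\otimes R$ (one that coequalizes the two morphisms $Q\otimes B\otimes R\to Q\otimes R$ given by the actions of $B$), and likewise for $R\otimes_A Q$, such that * $\alpha$ and $\beta$ are morphisms of $(A,A)$-bimodules and of $(B,B)$-bimodules respectively; * $\mathrm{tr}_A$ and $\mathrm{tr}_B$ are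 traces, i.e. their composites with the multiplications of $A$ and of $B$ are invariant under the symmetry of $A\otimes A$ and of $B\otimes B$; * $\lambda_Q\circ(\alpha\otimes Q)=\rho_Q\circ(Q\otimes\beta)$ on $Q\otimes R\otimes Q$, and $\lambda_R\circ(\beta\otimes R)=\rho_R\circ(R\otimes\alpha)$ on $R\otimes Q\otimes R$; * $\mathrm{tr}_A\circ\alpha=\mathrm{tr}_B\circ\beta\circ\sigma$ on $Q\otimes R$, where $\sigma:Q\otimes R\to R\otimes Q$ is the symmetry. A morphism of Morita contexts with trace is a quintuple of morphisms between the objects $A,B,Q,R,M$ commuting with the ten structure morphisms. **Theorem.** (1) For a $1$-dimensional modular dioperad $\mathcal P$ in $\mathcal C$, the objects $$A=\mathcal P(I_-^+),\quad B=\mathcal P(I_+^-),\quad Q=\mathcal P(I_-^-),\quad R=\mathcal P(I_+^+),\quad M=\mathcal P(S^1),$$ with the products, actions and $\alpha,\beta$ induced by cutting an interval at its midpoint, and $\mathrm{tr}_A,\mathrm{tr}_B$ induced by cutting the circle at one point, form a Morita context with trace, and this defines an equivalence from the category of $1$-dimensional modular dioperads in $\mathcal C$ to the category of Morita contexts with trace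 in $\mathcal C$. (2) Similarly, $\mathcal P\mapsto(\mathcal P(I)\to\mathcal P(S^1))$ defines an equivalence from the category of $1$-dimensional modular operads in $\mathcal C$ to the category of non-unital associative algebras $A$ in $\mathcal C$ equipped with an object $M$ and a trace $\mathrm{tr}:A\to M$ (that is, a morphism such that $\mathrm{tr}\circ m=\mathrm{tr}\circ m\circ\sigma$ for the product $m$ and the symmetry $\sigma$ of $A\otimes A$). -/

import Mathlib

open CategoryTheory MonoidalCategory

universe v u

noncomputable section

namespace OneCob

section Geometry

open Set Topology
open scoped Manifold ContDiff

/-- The inclusion `[0,1] ⊆ ℝ` as a model with corners. A manifold modelled on it is a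
one-dimensional manifold with boundary: its charts take values in open subsets of `[0,1]`, which
may contain the left end `0`, the right end `1`, both or neither. Unlike charts with values in the
single half-line `[0,∞)`, such charts can be chosen orientation preserving at every boundary point
of an oriented one-dimensional manifold. -/
def J : ModelWithCorners ℝ ℝ unitInterval :=
  ModelWithCorners.ofConvexRange
    { toFun := fun t => (t : ℝ)
      invFun := fun t => projIcc 0 1 zero_le_one t
      source := univ
      target := Icc 0 1
      map_source' := fun t _ => t.2
      map_target' := fun _ _ => mem_univ _
      left_inv' := fun t _ => projIcc_val zero_le_one t
      right_inv' := fun _ ht => congrArg Subtype.val (projIcc_of_mem zero_le_one ht) }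
    rfl (convex_Icc 0 1) continuous_subtype_val (continuous_projIcc (h := zero_le_one))
    (by simp [interior_Icc])

theorem J_apply (t : unitInterval) : J t = (t : ℝ) := rfl

theorem J_symm_apply (t : ℝ) : J.symm t = projIcc 0 1 zero_le_one t := rfl

theorem range_J : range J = Icc (0 : ℝ) 1 := by
  ext t
  constructor
  · rintro ⟨s, rfl⟩; exact s.2
  · intro ht; exact ⟨⟨t, ht⟩, rfl⟩

section slope

variable {M N P : Type} [TopologicalSpace M] [ChartedSpace unitInterval M]
  [TopologicalSpace N] [ChartedSpace unitInterval N]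
  [TopologicalSpace P] [ChartedSpace unitInterval P]

/-- The derivative at `x`, as a real number, of a map between manifolds modelled on `[0,1]`, read
in the preferred charts at `x` and at `f x`. If both atlases are oriented, then `0 < slope f x` says
that `f` is at `x` an orientation-preserving immersion. -/
def slope (f : M → N) (x : M) : ℝ := mfderiv J J f x (1 : ℝ)

variable (M) in
/-- The atlas of `M` is oriented: every chart has positive derivative with respect to the preferred
charts, that is, all transition maps are increasing. An orientation of a smooth one-dimensional
manifold is given by such an atlas. -/
def OrientedAtlas : Prop :=
  ∀ e ∈ atlas unitInterval M, ∀ x ∈ e.source, 0 < slope e x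

theorem slope_id (x : M) : slope (id : M → M) x = 1 := by
  unfold slope; rw [mfderiv_id]; rfl

theorem slope_comp {g : N → P} {f : M → N} (x : M) (hg : MDifferentiableAt J J g (f x))
    (hf : MDifferentiableAt J J f x) : slope (g ∘ f) x = slope g (f x) * slope f x := by
  unfold slope
  rw [mfderiv_comp x hg hf]
  have h : ∀ (L : ℝ →L[ℝ] ℝ) (a : ℝ), L a = L 1 * a := by
    intro L a
    rw [mul_comm, ← smul_eq_mul, ← map_smul]; simp
  exact h (mfderiv J J g (f x)) _

theorem slope_inl (x : M) : slope (Sum.inl : M → M ⊕ N) x = 1 := by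
  unfold slope
  rw [mfderiv_sumInl (p := (Sum.inl x : M ⊕ N))]; rfl

theorem slope_inr (x : N) : slope (Sum.inr : N → M ⊕ N) x = 1 := by
  unfold slope
  rw [mfderiv_sumInr]; rfl

theorem slope_comp_inl {f : M ⊕ N → P} (x : M) (hf : MDifferentiableAt J J f (Sum.inl x)) :
    slope f (Sum.inl x) = slope (f ∘ Sum.inl) x := by
  rw [slope_comp x hf ((ContMDiff.inl (I := J) (n := 1)).mdifferentiable one_ne_zero x),
    slope_inl, mul_one]

theorem slope_comp_inr {f : M ⊕ N → P} (x : N) (hf : MDifferentiableAt J J f (Sum.inr x)) :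
    slope f (Sum.inr x) = slope (f ∘ Sum.inr) x := by
  rw [slope_comp x hf ((ContMDiff.inr (I := J) (n := 1)).mdifferentiable one_ne_zero x),
    slope_inr, mul_one]

theorem slope_pos_of_sum {f : M ⊕ N → P} (hf : ContMDiff J J ∞ f)
    (hl : ∀ x, 0 < slope (f ∘ Sum.inl) x) (hr : ∀ x, 0 < slope (f ∘ Sum.inr) x) (p : M ⊕ N) :
    0 < slope f p := by
  have hd : MDifferentiable J J f := hf.mdifferentiable (by simp)
  rcases p with x | x
  · rw [slope_comp_inl x (hd _)]; exact hl x
  · rw [slope_comp_inr x (hd _)]; exact hr x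

theorem pos_inl (x : M) : 0 < slope (Sum.inl : M → M ⊕ N) x := by
  rw [slope_inl]; exact one_pos

theorem pos_inr (x : N) : 0 < slope (Sum.inr : N → M ⊕ N) x := by
  rw [slope_inr]; exact one_pos

theorem pos_comp {g : N → P} {f : M → N} (hg : ContMDiff J J ∞ g) (hf : ContMDiff J J ∞ f)
    (x : M) (pg : 0 < slope g (f x)) (pf : 0 < slope f x) : 0 < slope (g ∘ f) x := by
  rw [slope_comp x (hg.mdifferentiable (by simp) _) (hf.mdifferentiable (by simp) _)]
  exact mul_pos pg pf

theorem pos_sumMap {M' N' : Type} [TopologicalSpace M'] [ChartedSpace unitInterval M']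
    [TopologicalSpace N'] [ChartedSpace unitInterval N'] {f : M → M'} {g : N → N'}
    (hf : ContMDiff J J ∞ f) (hg : ContMDiff J J ∞ g) (pf : ∀ x, 0 < slope f x)
    (pg : ∀ x, 0 < slope g x) : ∀ p, 0 < slope (Sum.map f g) p :=
  slope_pos_of_sum (hf.sumMap hg)
    (fun x => pos_comp (g := Sum.inl) ContMDiff.inl hf x (pos_inl _) (pf x))
    (fun x => pos_comp (g := Sum.inr) ContMDiff.inr hg x (pos_inr _) (pg x))

theorem pos_sumAssoc : ∀ p, 0 < slope (Diffeomorph.sumAssoc J M ∞ N P) p :=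
  slope_pos_of_sum (Diffeomorph.sumAssoc J M ∞ N P).contMDiff
    (slope_pos_of_sum ((Diffeomorph.sumAssoc J M ∞ N P).contMDiff.comp ContMDiff.inl)
      (fun x => pos_inl x)
      (fun x => pos_comp (g := Sum.inr) (f := Sum.inl) ContMDiff.inr ContMDiff.inl x
        (pos_inr _) (pos_inl x)))
    (fun x => pos_comp (g := Sum.inr) (f := Sum.inr) ContMDiff.inr ContMDiff.inr x
      (pos_inr _) (pos_inr x))

/-- A map that agrees with a smooth function of one real variable in the preferred charts. -/
theorem contMDiffAt_and_slope {f : M → N} {x : M} (hf : ContinuousAt f x) {g : ℝ → ℝ}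
    (hg : ContDiff ℝ ∞ g)
    (h : writtenInExtChartAt J J x f =ᶠ[𝓝[range J] (extChartAt J x x)] g) :
    ContMDiffAt J J ∞ f x ∧ slope f x = deriv g (extChartAt J x x) := by
  have hx : extChartAt J x x ∈ range J := mem_range_self _
  refine ⟨contMDiffAt_iff.2 ⟨hf, (hg.contDiffAt.contDiffWithinAt).congr_of_eventuallyEq h
    (h.self_of_nhdsWithin hx)⟩, ?_⟩
  have hd : HasFDerivWithinAt (writtenInExtChartAt J J x f) (fderiv ℝ g (extChartAt J x x))
      (range J) (extChartAt J x x) :=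
    ((hg.differentiable (by simp)) _).hasFDerivAt.hasFDerivWithinAt.congr_of_eventuallyEq h
      (h.self_of_nhdsWithin hx)
  have hm : HasMFDerivAt J J f x (fderiv ℝ g (extChartAt J x x)) := ⟨hf, hd⟩
  unfold slope
  rw [hm.mfderiv]
  exact fderiv_apply_one_eq_deriv

theorem orientedAtlas_sum (hM : IsManifold J ∞ M) (hN : IsManifold J ∞ N)
    (oM : OrientedAtlas M) (oN : OrientedAtlas N) : OrientedAtlas (M ⊕ N) := by
  intro e he p hp
  have hd : MDifferentiableAt J J e p :=
    (contMDiffAt_of_mem_maximalAtlas (IsManifold.subset_maximalAtlas (I := J) (n := ∞) he) hp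
      ).mdifferentiableAt (by simp)
  rcases ChartedSpace.mem_atlas_sum he with ⟨f, hf, rfl⟩ | ⟨f, hf, rfl⟩
  · rcases p with x | x
    · rw [slope_comp_inl x hd]
      have : (f.lift_openEmbedding (X' := M ⊕ N) IsOpenEmbedding.inl : M ⊕ N → unitInterval)
          ∘ Sum.inl = f := by
        ext y; simp [Sum.inl_injective.extend_apply]
      rw [this]
      exact oM f hf x (by simpa using hp)
    · simp at hp
  · rcases p with x | x
    · simp at hp
    · rw [slope_comp_inr x hd]
      have : (f.lift_openEmbedding (X' := M ⊕ N) IsOpenEmbedding.inr : M ⊕ N → unitInterval)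
          ∘ Sum.inr = f := by
        ext y; simp [Sum.inr_injective.extend_apply]
      rw [this]
      exact oN f hf x (by simpa using hp)

theorem boundary_inl {x : M} : (Sum.inl x : M ⊕ N) ∈ J.boundary (M ⊕ N) ↔ x ∈ J.boundary M := by
  rw [ModelWithCorners.boundary_disjointUnion]; simp

theorem boundary_inr {x : N} : (Sum.inr x : M ⊕ N) ∈ J.boundary (M ⊕ N) ↔ x ∈ J.boundary N := by
  rw [ModelWithCorners.boundary_disjointUnion]; simp

end slope


/-- A compact oriented smooth one-dimensional manifold with boundary (possibly empty or
disconnected) whose boundary points carry labels in `Λ`.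

For `Λ = ℤˣ = {1, -1}`, a labelling of the boundary is an orientation of this zero-dimensional
manifold, and `Mfd ℤˣ` has the objects of the directed category of one-dimensional cobordisms. For
`Λ = Unit` there is no datum on the boundary, and `Mfd Unit` has the objects of the undirected
one. -/
structure Mfd (Λ : Type) : Type 1 where
  carrier : Type
  [top : TopologicalSpace carrier]
  [t2 : T2Space carrier]
  [compact : CompactSpace carrier]
  [charted : ChartedSpace unitInterval carrier]
  [smooth : IsManifold J ∞ carrier]
  oriented : OrientedAtlas carrier
  label : J.boundary carrier → Λ

attribute [instance] Mfd.top Mfd.t2 Mfd.compact Mfd.charted Mfd.smooth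

variable {Λ : Type}

/-- A morphism `S ⟶ T` consists of a closed hypersurface `γ` in the interior of `T`, that is, a
finite set of points, with a label (for `Λ = ℤˣ`, an orientation) of each, and a diffeomorphism from
`S` to the manifold `T[γ]` obtained by cutting `T` along `γ`, compatible with the orientations and
with the labels, where the two boundary points of `T[γ]` over a point of `γ` carry the label of that
point.

It is encoded by the composite of `S ≅ T[γ]` with the map `T[γ] → T`. This is an
orientation-preserving immersion onto `T` under which distinct points of `S` are identified only if
they are boundary points with the same label lying over a point in the interior of `T`; the
hypersurface `γ` is the set of interior points of `T` that are images of boundary points of `S`,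
with the labels of the latter. Composition of morphisms is composition of maps. -/
@[ext]
structure Mfd.Hom (S T : Mfd Λ) where
  toFun : S.carrier → T.carrier
  smooth : ContMDiff J J ∞ toFun
  slope_pos : ∀ x, 0 < slope toFun x
  surj : Function.Surjective toFun
  map_interior : ∀ x, x ∉ J.boundary S.carrier → toFun x ∉ J.boundary T.carrier
  label_boundary : ∀ (x : J.boundary S.carrier) (h : toFun x ∈ J.boundary T.carrier),
    T.label ⟨toFun x, h⟩ = S.label x
  glue : ∀ x y, toFun x = toFun y → x ≠ y → toFun x ∉ J.boundary T.carrier ∧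
    ∃ (hx : x ∈ J.boundary S.carrier) (hy : y ∈ J.boundary S.carrier),
      S.label ⟨x, hx⟩ = S.label ⟨y, hy⟩

namespace Mfd

theorem Hom.mdiff {S T : Mfd Λ} (f : Hom S T) : MDifferentiable J J f.toFun :=
  f.smooth.mdifferentiable (by simp)

/-- The identity: the empty hypersurface and the identity diffeomorphism. -/
def Hom.id (S : Mfd Λ) : Hom S S where
  toFun := _root_.id
  smooth := contMDiff_id
  slope_pos x := by rw [slope_id]; exact one_pos
  surj := Function.surjective_id
  map_interior _ h := h
  label_boundary _ _ := rfl
  glue _ _ h hne := absurd h hne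

/-- Composition. -/
def Hom.comp {S T U : Mfd Λ} (f : Hom S T) (g : Hom T U) : Hom S U where
  toFun := g.toFun ∘ f.toFun
  smooth := g.smooth.comp f.smooth
  slope_pos x := by
    rw [slope_comp x (g.mdiff _) (f.mdiff _)]
    exact mul_pos (g.slope_pos _) (f.slope_pos _)
  surj := g.surj.comp f.surj
  map_interior x hx := g.map_interior _ (f.map_interior x hx)
  label_boundary x h := by
    have hf : f.toFun x ∈ J.boundary T.carrier := by
      by_contra hf
      exact g.map_interior _ hf h
    exact (g.label_boundary ⟨f.toFun x, hf⟩ h).trans (f.label_boundary x hf)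
  glue x y h hne := by
    by_cases hxy : f.toFun x = f.toFun y
    · obtain ⟨h1, h2⟩ := f.glue x y hxy hne
      exact ⟨g.map_interior _ h1, h2⟩
    · obtain ⟨h1, hx, hy, h2⟩ := g.glue _ _ h hxy
      have hx' : x ∈ J.boundary S.carrier := by
        by_contra hc
        exact f.map_interior _ hc hx
      have hy' : y ∈ J.boundary S.carrier := by
        by_contra hc
        exact f.map_interior _ hc hy
      exact ⟨h1, hx', hy', by
        rw [← f.label_boundary ⟨x, hx'⟩ hx, ← f.label_boundary ⟨y, hy'⟩ hy, h2]⟩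

instance : Category (Mfd Λ) where
  Hom := Hom
  id := Hom.id
  comp := Hom.comp

@[ext]
theorem hom_ext {S T : Mfd Λ} {f g : S ⟶ T} (h : ∀ x, Hom.toFun f x = Hom.toFun g x) : f = g :=
  Hom.ext (funext h)

@[simp]
theorem id_toFun (S : Mfd Λ) (x : S.carrier) : Hom.toFun (𝟙 S) x = x := rfl

@[simp]
theorem comp_toFun {S T U : Mfd Λ} (f : S ⟶ T) (g : T ⟶ U) (x : S.carrier) :
    Hom.toFun (f ≫ g) x = Hom.toFun g (Hom.toFun f x) := rfl

/-- An orientation- and label-preserving diffeomorphism is a morphism. -/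
def ofDiffeo {S T : Mfd Λ} (e : S.carrier ≃ₘ^∞⟮J, J⟯ T.carrier) (pe : ∀ x, 0 < slope e x)
    (hb : ∀ x, x ∈ J.boundary S.carrier ↔ e x ∈ J.boundary T.carrier)
    (hl : ∀ (x : S.carrier) (h : x ∈ J.boundary S.carrier),
      T.label ⟨e x, (hb x).1 h⟩ = S.label ⟨x, h⟩) : S ⟶ T where
  toFun := e
  smooth := e.contMDiff
  slope_pos := pe
  surj := e.surjective
  map_interior x hx h := hx ((hb x).2 h)
  label_boundary x _ := hl x x.2
  glue _ _ h hne := absurd (e.injective h) hne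

/-- An orientation- and label-preserving diffeomorphism is an isomorphism. -/
def isoOfDiffeo {S T : Mfd Λ} (e : S.carrier ≃ₘ^∞⟮J, J⟯ T.carrier) (pe : ∀ x, 0 < slope e x)
    (hb : ∀ x, x ∈ J.boundary S.carrier ↔ e x ∈ J.boundary T.carrier)
    (hl : ∀ (x : S.carrier) (h : x ∈ J.boundary S.carrier),
      T.label ⟨e x, (hb x).1 h⟩ = S.label ⟨x, h⟩) : S ≅ T where
  hom := ofDiffeo e pe hb hl
  inv := ofDiffeo e.symm
    (fun y => by
      have h := slope_comp y (e.contMDiff.mdifferentiable (by simp) (e.symm y))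
        (e.symm.contMDiff.mdifferentiable (by simp) y)
      have h' : (e ∘ e.symm : T.carrier → T.carrier) = id := by ext; simp
      rw [h', slope_id] at h
      exact pos_of_mul_pos_right (h ▸ one_pos) (pe _).le)
    (fun y => by rw [hb]; simp)
    (fun y h => by
      rw [← hl]
      congr 2
      simp)
  hom_inv_id := hom_ext fun x => e.symm_apply_apply x
  inv_hom_id := hom_ext fun x => e.apply_symm_apply x

/-- The empty manifold. -/
def empty (Λ : Type) : Mfd Λ :=
  letI : ChartedSpace unitInterval Empty := ChartedSpace.empty _ _
  { carrier := Empty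
    oriented := fun _ _ x => x.elim
    label := fun x => x.1.elim }

/-- The disjoint union. -/
def sum (S T : Mfd Λ) : Mfd Λ where
  carrier := S.carrier ⊕ T.carrier
  oriented := orientedAtlas_sum S.smooth T.smooth S.oriented T.oriented
  label p := match p with
    | ⟨Sum.inl x, h⟩ => S.label ⟨x, boundary_inl.1 h⟩
    | ⟨Sum.inr x, h⟩ => T.label ⟨x, boundary_inr.1 h⟩

/-- The disjoint union of morphisms. -/
def sumMap {S S' T T' : Mfd Λ} (f : S ⟶ S') (g : T ⟶ T') : sum S T ⟶ sum S' T' where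
  toFun := Sum.map (Hom.toFun f) (Hom.toFun g)
  smooth := ContMDiff.sumMap f.smooth g.smooth
  slope_pos := pos_sumMap f.smooth g.smooth f.slope_pos g.slope_pos
  surj := f.surj.sumMap g.surj
  map_interior p hp := by
    rcases p with x | x
    · exact fun h => f.map_interior x (fun h' => hp (boundary_inl.2 h')) (boundary_inl.1 h)
    · exact fun h => g.map_interior x (fun h' => hp (boundary_inr.2 h')) (boundary_inr.1 h)
  label_boundary p hp := by
    rcases p with ⟨x | x, h⟩
    · exact f.label_boundary ⟨x, boundary_inl.1 h⟩ (boundary_inl.1 hp)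
    · exact g.label_boundary ⟨x, boundary_inr.1 h⟩ (boundary_inr.1 hp)
  glue p q h hne := by
    rcases p with x | x <;> rcases q with y | y
    · obtain ⟨h1, hx, hy, h2⟩ := f.glue x y (Sum.inl_injective h)
        (fun h' => hne (congrArg _ h'))
      exact ⟨fun h' => h1 (boundary_inl.1 h'), boundary_inl.2 hx, boundary_inl.2 hy, h2⟩
    · exact absurd h (by simp)
    · exact absurd h (by simp)
    · obtain ⟨h1, hx, hy, h2⟩ := g.glue x y (Sum.inr_injective h)
        (fun h' => hne (congrArg _ h'))
      exact ⟨fun h' => h1 (boundary_inr.1 h'), boundary_inr.2 hx, boundary_inr.2 hy, h2⟩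

instance : IsEmpty (empty Λ).carrier := inferInstanceAs (IsEmpty Empty)

/-- The associativity isomorphism of the disjoint union. -/
def assocIso (S T U : Mfd Λ) : sum (sum S T) U ≅ sum S (sum T U) :=
  isoOfDiffeo (S := sum (sum S T) U) (T := sum S (sum T U))
    (Diffeomorph.sumAssoc J S.carrier ∞ T.carrier U.carrier)
    pos_sumAssoc
    (by
      rintro ((x | x) | x)
      · exact (boundary_inl.trans boundary_inl).trans boundary_inl.symm
      · exact (boundary_inl.trans boundary_inr).trans (boundary_inr.trans boundary_inl).symm
      · exact boundary_inr.trans (boundary_inr.trans boundary_inr).symm)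
    (by rintro ((x | x) | x) h <;> rfl)

/-- The symmetry of the disjoint union. -/
def braidIso (S T : Mfd Λ) : sum S T ≅ sum T S :=
  isoOfDiffeo (S := sum S T) (T := sum T S) (Diffeomorph.sumComm J S.carrier ∞ T.carrier)
    (slope_pos_of_sum (Diffeomorph.sumComm J _ ∞ _).contMDiff
      (fun x => pos_inr x) (fun x => pos_inl x))
    (by
      rintro (x | x)
      · exact boundary_inl.trans boundary_inr.symm
      · exact boundary_inr.trans boundary_inl.symm)
    (by rintro (x | x) h <;> rfl)

/-- The right unit isomorphism. -/
def rightUnitIso (S : Mfd Λ) : sum S (empty Λ) ≅ S :=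
  isoOfDiffeo (S := sum S (empty Λ)) (T := S)
    (Diffeomorph.sumEmpty J S.carrier (M' := (empty Λ).carrier) ∞)
    (slope_pos_of_sum (Diffeomorph.sumEmpty J S.carrier ∞).contMDiff
      (fun x => (slope_id x).symm ▸ one_pos) (fun x => isEmptyElim x))
    (by
      rintro (x | x)
      · exact boundary_inl
      · exact isEmptyElim x)
    (by
      intro x h
      match x with
      | Sum.inl x => rfl
      | Sum.inr x => exact (IsEmpty.false x).elim)

/-- The left unit isomorphism. -/
def leftUnitIso (S : Mfd Λ) : sum (empty Λ) S ≅ S := braidIso _ _ ≪≫ rightUnitIso S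

instance : MonoidalCategoryStruct (Mfd Λ) where
  tensorObj := sum
  tensorUnit := empty Λ
  tensorHom := sumMap
  whiskerLeft S _ _ f := sumMap (𝟙 S) f
  whiskerRight f T := sumMap f (𝟙 T)
  associator := assocIso
  leftUnitor := leftUnitIso
  rightUnitor := rightUnitIso

instance : MonoidalCategory (Mfd Λ) :=
  MonoidalCategory.ofTensorHom
    (id_tensorHom_id := fun S T => hom_ext (by rintro (x | x) <;> rfl))
    (id_tensorHom := fun _ _ _ _ => rfl)
    (tensorHom_id := fun _ _ => rfl)
    (tensorHom_comp_tensorHom := fun _ _ _ _ => hom_ext (by rintro (x | x) <;> rfl))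
    (associator_naturality := fun _ _ _ => hom_ext (by rintro ((x | x) | x) <;> rfl))
    (leftUnitor_naturality := fun _ => hom_ext (by
      rintro (x | x)
      · exact isEmptyElim (α := (empty Λ).carrier) x
      · rfl))
    (rightUnitor_naturality := fun _ => hom_ext (by
      rintro (x | x)
      · rfl
      · exact isEmptyElim (α := (empty Λ).carrier) x))
    (pentagon := fun _ _ _ _ => hom_ext (by rintro (((x | x) | x) | x) <;> rfl))
    (triangle := fun _ _ => hom_ext (by
      rintro ((x | x) | x)
      · rfl
      · exact isEmptyElim (α := (empty Λ).carrier) x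
      · rfl))

instance : SymmetricCategory (Mfd Λ) where
  braiding := braidIso
  braiding_naturality_right _ _ _ _ := hom_ext (by rintro (x | x) <;> rfl)
  braiding_naturality_left _ _ := hom_ext (by rintro (x | x) <;> rfl)
  hexagon_forward _ _ _ := hom_ext (by rintro ((x | x) | x) <;> rfl)
  hexagon_reverse _ _ _ := hom_ext (by rintro (x | (x | x)) <;> rfl)
  symmetry _ _ := hom_ext (by rintro (x | x) <;> rfl)


/-- A family of morphisms `S ⟶ T` parametrized by the standard simplex is smooth if the
corresponding map from the product of the simplex with `S` to `T` is. Such a family is a fibred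
diffeomorphism onto the result of cutting `T` along an isotopy of hypersurfaces. -/
def IsSmoothFamily {S T : Mfd Λ} {k : ℕ} (σ : stdSimplex ℝ (Fin (k + 1)) → (S ⟶ T)) : Prop :=
  ∃ F : (Fin (k + 1) → ℝ) × S.carrier → T.carrier,
    ContMDiffOn (𝓘(ℝ, Fin (k + 1) → ℝ).prod J) J ∞ F (stdSimplex ℝ (Fin (k + 1)) ×ˢ univ) ∧
    ∀ (t : stdSimplex ℝ (Fin (k + 1))) (x : S.carrier), F ((t : Fin (k + 1) → ℝ), x) = Hom.toFun (σ t) x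

theorem IsSmoothFamily.comp_map {S T : Mfd Λ} {k l : ℕ}
    {σ : stdSimplex ℝ (Fin (k + 1)) → (S ⟶ T)} (h : IsSmoothFamily σ)
    (f : Fin (l + 1) → Fin (k + 1)) : IsSmoothFamily fun t => σ (stdSimplex.map f t) := by
  obtain ⟨F, hF, hσ⟩ := h
  have hL : ContDiff ℝ ∞ (FunOnFinite.linearMap ℝ ℝ f) :=
    (LinearMap.toContinuousLinearMap (FunOnFinite.linearMap ℝ ℝ f)).contDiff
  refine ⟨fun p => F (FunOnFinite.linearMap ℝ ℝ f p.1, p.2), ?_, fun t x => ?_⟩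
  · refine hF.comp (t := stdSimplex ℝ (Fin (k + 1)) ×ˢ univ)
      (f := fun p : (Fin (l + 1) → ℝ) × S.carrier => (FunOnFinite.linearMap ℝ ℝ f p.1, p.2))
      ?_ ?_
    · exact ((hL.contMDiff.comp contMDiff_fst).prodMk contMDiff_snd).contMDiffOn
    · rintro ⟨t, x⟩ ⟨ht, -⟩
      exact ⟨stdSimplex.image_linearMap f ⟨t, ht, rfl⟩, mem_univ _⟩
  · exact hσ (stdSimplex.map f t) x

theorem IsSmoothFamily.comp {S T U : Mfd Λ} {k : ℕ} {σ : stdSimplex ℝ (Fin (k + 1)) → (S ⟶ T)}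
    {τ : stdSimplex ℝ (Fin (k + 1)) → (T ⟶ U)} (h : IsSmoothFamily σ) (h' : IsSmoothFamily τ) :
    IsSmoothFamily fun t => σ t ≫ τ t := by
  obtain ⟨F, hF, hσ⟩ := h
  obtain ⟨G, hG, hτ⟩ := h'
  refine ⟨fun p => G (p.1, F p), ?_, fun t x => ?_⟩
  · refine hG.comp (t := stdSimplex ℝ (Fin (k + 1)) ×ˢ univ)
      (f := fun p : (Fin (k + 1) → ℝ) × S.carrier => (p.1, F p)) ?_ ?_
    · exact contMDiff_fst.contMDiffOn.prodMk hF
    · rintro ⟨t, x⟩ ⟨ht, -⟩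
      exact ⟨ht, mem_univ _⟩
  · simp only [hσ, hτ, comp_toFun]

theorem isSmoothFamily_const {S T : Mfd Λ} (k : ℕ) (f : S ⟶ T) :
    IsSmoothFamily (k := k) fun _ => f :=
  ⟨fun p => Hom.toFun f p.2, (f.smooth.comp contMDiff_snd).contMDiffOn, fun _ _ => rfl⟩

/-- The simplicial set of morphisms from `S` to `T`: the `k`-simplices are the smooth families of
morphisms parametrized by the standard `k`-simplex. Composition and disjoint union of simplices are
given pointwise, so that the vertices form the category `Mfd Λ`. -/
def simplicialHom (S T : Mfd Λ) : SSet.{0} where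
  obj n := {σ : stdSimplex ℝ (Fin (n.unop.len + 1)) → (S ⟶ T) // IsSmoothFamily σ}
  map f := TypeCat.ofHom fun σ => ⟨fun t => σ.1 (stdSimplex.map f.unop.toOrderHom t), σ.2.comp_map _⟩
  map_id n := by
    ext σ t x
    simp
  map_comp f g := by
    ext σ t x
    simp [stdSimplex.map_comp_apply]


end Mfd

theorem extChartAt_J (x y : unitInterval) : extChartAt J x y = (y : ℝ) := by
  rw [extChartAt, chartAt_self_eq]
  rfl

theorem mem_boundary_unitInterval (x : unitInterval) :
    x ∈ J.boundary unitInterval ↔ x = 0 ∨ x = 1 := by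
  have : x ∈ J.boundary unitInterval ↔ (x : ℝ) ∈ frontier (range J) := by
    rw [ModelWithCorners.boundary]
    show extChartAt J x x ∈ frontier (range J) ↔ _
    rw [extChartAt_J]
  rw [this, range_J, frontier_Icc zero_le_one, mem_insert_iff, mem_singleton_iff, Subtype.ext_iff,
    Subtype.ext_iff]
  rfl

theorem unitInterval_map {f : unitInterval → unitInterval} {g : ℝ → ℝ} (hg : ContDiff ℝ ∞ g)
    (h : ∀ x, (f x : ℝ) = g x) (x : unitInterval) :
    ContMDiffAt J J ∞ f x ∧ slope f x = deriv g x := by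
  have := contMDiffAt_and_slope (f := f) (x := x)
    (by
      have : Continuous f := by
        rw [continuous_induced_rng]
        exact (hg.continuous.comp continuous_subtype_val).congr fun x => (h x).symm
      exact this.continuousAt) hg
    (by
      filter_upwards [self_mem_nhdsWithin] with t ht
      rw [range_J] at ht
      rw [writtenInExtChartAt, Function.comp_apply, Function.comp_apply, extChartAt_J, extChartAt,
        chartAt_self_eq]
      show (f (projIcc 0 1 zero_le_one t) : ℝ) = g t
      rw [h, projIcc_of_mem _ ht])
  rwa [extChartAt_J] at this

theorem orientedAtlas_unitInterval : OrientedAtlas unitInterval := by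
  intro e he x _
  rw [chartedSpaceSelf_atlas] at he
  subst he
  have := slope_id x
  show 0 < slope id x
  rw [this]; exact one_pos

/-- `t ↦ t / 2` on `[0,1]`. -/
def halfLeft (t : unitInterval) : unitInterval :=
  ⟨(t : ℝ) / 2, by have := t.2.1; positivity, by have := t.2.2; linarith⟩

/-- `t ↦ (t + 1) / 2` on `[0,1]`. -/
def halfRight (t : unitInterval) : unitInterval :=
  ⟨((t : ℝ) + 1) / 2, by have := t.2.1; positivity, by have := t.2.2; linarith⟩

/-- The map `[0,1] ⊔ [0,1] → [0,1]` laying the two intervals end to end. -/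
def halves : unitInterval ⊕ unitInterval → unitInterval := Sum.elim halfLeft halfRight

theorem halfLeft_spec (x : unitInterval) :
    ContMDiffAt J J ∞ halfLeft x ∧ slope halfLeft x = 1 / 2 := by
  have h := unitInterval_map (f := halfLeft) (g := fun t => t / 2) (by fun_prop) (fun _ => rfl) x
  refine ⟨h.1, h.2.trans ?_⟩
  simp

theorem halfRight_spec (x : unitInterval) :
    ContMDiffAt J J ∞ halfRight x ∧ slope halfRight x = 1 / 2 := by
  have h := unitInterval_map (f := halfRight) (g := fun t => (t + 1) / 2) (by fun_prop)
    (fun _ => rfl) x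
  refine ⟨h.1, h.2.trans ?_⟩
  simp

theorem halves_smooth : ContMDiff J J ∞ halves :=
  ContMDiff.sumElim (fun x => (halfLeft_spec x).1) (fun x => (halfRight_spec x).1)

theorem halves_pos : ∀ p, 0 < slope halves p :=
  slope_pos_of_sum halves_smooth
    (fun x => by
      show 0 < slope halfLeft x
      rw [(halfLeft_spec x).2]; norm_num)
    (fun x => by
      show 0 < slope halfRight x
      rw [(halfRight_spec x).2]; norm_num)

theorem halves_surjective : Function.Surjective halves := by
  intro t
  rcases le_total (t : ℝ) (1 / 2) with h | h
  · exact ⟨Sum.inl ⟨2 * t, by have := t.2.1; positivity, by linarith⟩,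
      Subtype.ext (by simp [halves, halfLeft])⟩
  · exact ⟨Sum.inr ⟨2 * t - 1, by linarith, by have := t.2.2; linarith⟩,
      Subtype.ext (by simp [halves, halfRight])⟩

theorem halves_eq_zero {p : unitInterval ⊕ unitInterval} (h : halves p = 0) : p = Sum.inl 0 := by
  rcases p with x | x <;> have := congrArg Subtype.val h <;>
    simp only [halves, Sum.elim_inl, Sum.elim_inr, halfLeft, halfRight, Icc.coe_zero] at this
  · exact congrArg _ (Subtype.ext (by simpa using this))
  · have := x.2.1; linarith

theorem halves_eq_one {p : unitInterval ⊕ unitInterval} (h : halves p = 1) : p = Sum.inr 1 := by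
  rcases p with x | x <;> have := congrArg Subtype.val h <;>
    simp only [halves, Sum.elim_inl, Sum.elim_inr, halfLeft, halfRight, Icc.coe_one] at this
  · have := x.2.2; linarith
  · exact congrArg _ (Subtype.ext (by show (x : ℝ) = 1; linarith))

theorem halves_eq_halves {p q : unitInterval ⊕ unitInterval} (h : halves p = halves q)
    (hne : p ≠ q) : (p = Sum.inl 1 ∧ q = Sum.inr 0) ∨ (p = Sum.inr 0 ∧ q = Sum.inl 1) := by
  rcases p with x | x <;> rcases q with y | y <;> have := congrArg Subtype.val h <;>
    simp only [halves, Sum.elim_inl, Sum.elim_inr, halfLeft, halfRight] at this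
  · exact absurd (congrArg _ (Subtype.ext (by linarith))) hne
  · have hx := x.2.2
    have hy := y.2.1
    exact Or.inl ⟨congrArg _ (Subtype.ext (by show (x : ℝ) = 1; linarith)),
      congrArg _ (Subtype.ext (by show (y : ℝ) = 0; linarith))⟩
  · have hx := x.2.1
    have hy := y.2.2
    exact Or.inr ⟨congrArg _ (Subtype.ext (by show (x : ℝ) = 0; linarith)),
      congrArg _ (Subtype.ext (by show (y : ℝ) = 1; linarith))⟩
  · exact absurd (congrArg _ (Subtype.ext (by linarith))) hne

theorem halves_inl_one_ne : halves (Sum.inl 1) ∉ J.boundary unitInterval := by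
  rw [mem_boundary_unitInterval]
  rintro (h | h)
  · have := Sum.inl_injective (halves_eq_zero h)
    exact one_ne_zero this
  · simpa using halves_eq_one h

namespace Mfd

open Classical in
/-- The interval `[0,1]`, with the boundary point `0` labelled `a` and `1` labelled `b`.

For `Λ = ℤˣ`, the orientation of the boundary induced by that of `[0,1]` is `-1` at `0` and `1` at
`1`. A boundary point is outgoing if its label agrees with the induced orientation, and incoming
otherwise. So `interval 1 1` is incoming at `0` and outgoing at `1`, `interval (-1) (-1)` is outgoing
at `0` and incoming at `1`, both ends of `interval 1 (-1)` are incoming, and both ends of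
`interval (-1) 1` are outgoing. -/
def interval (a b : Λ) : Mfd Λ where
  carrier := unitInterval
  charted := chartedSpaceSelf _
  oriented := orientedAtlas_unitInterval
  label x := if x.1 = 0 then a else b

theorem interval_label_zero (a b : Λ) (h : (0 : unitInterval) ∈ J.boundary unitInterval) :
    (interval a b).label ⟨(0 : unitInterval), h⟩ = a := if_pos rfl

theorem interval_label_one (a b : Λ) (h : (1 : unitInterval) ∈ J.boundary unitInterval) :
    (interval a b).label ⟨(1 : unitInterval), h⟩ = b := if_neg (one_ne_zero (α := unitInterval))

/-- The morphism given by cutting `[0,1]` at its midpoint, labelled `b`. -/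
def glue (a b c : Λ) : interval a b ⊗ interval b c ⟶ interval a c where
  toFun := halves
  smooth := halves_smooth
  slope_pos := halves_pos
  surj := halves_surjective
  map_interior p hp h := by
    rcases (mem_boundary_unitInterval _).1 h with h | h
    · have := halves_eq_zero h
      subst this
      exact hp (boundary_inl.2 ((mem_boundary_unitInterval 0).2 (Or.inl rfl)))
    · have := halves_eq_one h
      subst this
      exact hp (boundary_inr.2 ((mem_boundary_unitInterval 1).2 (Or.inr rfl)))
  label_boundary := by
    rintro ⟨p, hp⟩ h
    rcases (mem_boundary_unitInterval _).1 h with h' | h'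
    · have := halves_eq_zero h'
      subst this
      have e : (⟨halves (Sum.inl 0), h⟩ : J.boundary unitInterval) = ⟨0, h' ▸ h⟩ :=
        Subtype.ext h'
      exact ((congrArg (interval a c).label e).trans (interval_label_zero a c _)).trans
        (interval_label_zero a b _).symm
    · have := halves_eq_one h'
      subst this
      have e : (⟨halves (Sum.inr 1), h⟩ : J.boundary unitInterval) = ⟨1, h' ▸ h⟩ :=
        Subtype.ext h'
      exact ((congrArg (interval a c).label e).trans (interval_label_one a c _)).trans
        (interval_label_one b c _).symm
  glue p q h hne := by
    have h0 := (mem_boundary_unitInterval 0).2 (Or.inl rfl)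
    have h1 := (mem_boundary_unitInterval 1).2 (Or.inr rfl)
    rcases halves_eq_halves h hne with ⟨rfl, rfl⟩ | ⟨rfl, rfl⟩
    · exact ⟨halves_inl_one_ne, boundary_inl.2 h1, boundary_inr.2 h0,
        (interval_label_one a b _).trans (interval_label_zero b c _).symm⟩
    · exact ⟨h ▸ halves_inl_one_ne, boundary_inr.2 h0, boundary_inl.2 h1,
        (interval_label_zero b c _).trans (interval_label_one a b _).symm⟩

end Mfd

/-- The inclusion of the open interval as a chart of `ℝ` with values in `[0,1]`. -/
def iooChart : OpenPartialHomeomorph ℝ unitInterval where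
  toFun := projIcc 0 1 zero_le_one
  invFun := Subtype.val
  source := Ioo 0 1
  target := Subtype.val ⁻¹' Ioo 0 1
  map_source' t ht := by
    rw [mem_preimage, projIcc_of_mem _ (Ioo_subset_Icc_self ht)]; exact ht
  map_target' _ ht := ht
  left_inv' t ht := by rw [projIcc_of_mem _ (Ioo_subset_Icc_self ht)]
  right_inv' t _ := projIcc_val _ t
  open_source := isOpen_Ioo
  open_target := isOpen_Ioo.preimage continuous_subtype_val
  continuousOn_toFun := continuous_projIcc.continuousOn
  continuousOn_invFun := continuous_subtype_val.continuousOn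

/-- The circle `ℝ / ℤ`. -/
abbrev Circ : Type := AddCircle (1 : ℝ)

/-- The chart of `ℝ / ℤ` with values in `(0,1) ⊆ [0,1]` inverse to `t ↦ t + a`. -/
def circChart (a : ℝ) : OpenPartialHomeomorph Circ unitInterval :=
  ((AddCircle.openPartialHomeomorphCoe (1 : ℝ) a).symm.trans
    (Homeomorph.addRight (-a)).toOpenPartialHomeomorph).trans iooChart

theorem circChart_source (a : ℝ) : (circChart a).source = {(a : Circ)}ᶜ := by
  ext x
  have := (AddCircle.openPartialHomeomorphCoe (1 : ℝ) a).map_target (x := x)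
  simp [circChart, iooChart] at this ⊢
  intro h
  constructor
  · linarith [(this h).1]
  · linarith [(this h).2]

theorem addRight_neg_symm_apply (a t : ℝ) : (Homeomorph.addRight (-a)).symm t = t + a := by
  show t + -(-a) = t + a
  rw [neg_neg]

theorem circChart_target (a : ℝ) : (circChart a).target = Subtype.val ⁻¹' Ioo 0 1 := by
  ext x
  simp [circChart, iooChart, addRight_neg_symm_apply]
  intro h h'
  have h2 : (x : ℝ) < 1 := h'
  exact ⟨h, by linarith⟩

theorem circChart_symm_apply (a : ℝ) (t : unitInterval) :
    (circChart a).symm t = (((t : ℝ) + a : ℝ) : Circ) := by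
  simp [circChart, iooChart, addRight_neg_symm_apply]

theorem circChart_coe (a t : ℝ) (ht : t ∈ Ioo a (a + 1)) :
    (circChart a (t : Circ) : ℝ) = t - a := by
  have h : t - a ∈ Ioo (0 : ℝ) 1 := ⟨by linarith [ht.1], by linarith [ht.2]⟩
  have h2 : (circChart a).symm ⟨t - a, Ioo_subset_Icc_self h⟩ = (t : Circ) := by
    rw [circChart_symm_apply]; congr 1; simp
  rw [← h2, (circChart a).right_inv (by rw [circChart_target]; exact h)]

theorem mem_circChart_source (x : Circ) :
    x ∈ (circChart (AddCircle.equivIco (1 : ℝ) 0 x - 1 / 2)).source := by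
  rw [circChart_source]
  intro h
  have hx : ((AddCircle.equivIco (1 : ℝ) 0 x : ℝ) : Circ) = x :=
    (AddCircle.equivIco (1 : ℝ) 0).symm_apply_apply x
  generalize (AddCircle.equivIco (1 : ℝ) 0 x : ℝ) = r at h hx
  have h1 : ((r - 1 / 2 : ℝ) : Circ) = (r : Circ) := by rw [hx]; exact h.symm
  have h2 : r - 1 / 2 = r := by
    rw [AddCircle.coe_eq_coe_iff_of_mem_Ico (a := r - 1 / 2) ⟨by linarith, by linarith⟩
      ⟨by linarith, by linarith⟩] at h1
    exact h1
  linarith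

instance : ChartedSpace unitInterval Circ where
  atlas := range circChart
  chartAt x := circChart (AddCircle.equivIco (1 : ℝ) 0 x - 1 / 2)
  mem_chart_source := mem_circChart_source
  chart_mem_atlas _ := mem_range_self _

/-- Read in a chart, the covering map `ℝ → ℝ / ℤ` is locally a translation. -/
theorem circChart_coe_eventually (a s : ℝ) (hs : (s : Circ) ∈ (circChart a).source) :
    ∃ c : ℝ, ∀ᶠ t : ℝ in 𝓝 s, (circChart a (t : Circ) : ℝ) = t + c := by
  rw [circChart_source] at hs
  have h0 := (AddCircle.openPartialHomeomorphCoe (1 : ℝ) a).map_target (x := (s : Circ)) hs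
  have h1 := (AddCircle.openPartialHomeomorphCoe (1 : ℝ) a).right_inv (x := (s : Circ)) hs
  generalize (AddCircle.openPartialHomeomorphCoe (1 : ℝ) a).symm (s : Circ) = r at h0 h1
  have h0' : r ∈ Ioo a (a + 1) := h0
  have h1' : (r : Circ) = (s : Circ) := h1
  refine ⟨r - s - a, ?_⟩
  have hc : Filter.Tendsto (fun t => t + (r - s)) (𝓝 s) (𝓝 r) := by
    have : Continuous fun t : ℝ => t + (r - s) := by fun_prop
    simpa using this.tendsto s
  filter_upwards [hc.eventually (isOpen_Ioo.mem_nhds h0')] with t ht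
  have e : ((t + (r - s) : ℝ) : Circ) = (t : Circ) := by
    rw [AddCircle.coe_add, AddCircle.coe_sub, h1', sub_self, add_zero]
  rw [← e, circChart_coe a _ ht]
  ring

/-- The same, for the covering map restricted to a translate of `[0,1]`. -/
theorem circChart_projIcc_eventually (a b s : ℝ)
    (hs : ((s + b : ℝ) : Circ) ∈ (circChart a).source) :
    ∃ c : ℝ, (fun t : ℝ => (circChart a (((projIcc (0 : ℝ) 1 zero_le_one t : ℝ) + b : ℝ) : Circ) : ℝ))
      =ᶠ[𝓝[range J] s] fun t => t + c := by
  obtain ⟨c, hc⟩ := circChart_coe_eventually a (s + b) hs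
  refine ⟨b + c, ?_⟩
  have ht : Filter.Tendsto (fun t : ℝ => t + b) (𝓝 s) (𝓝 (s + b)) :=
    (continuous_id.add continuous_const).tendsto s
  filter_upwards [self_mem_nhdsWithin, (ht.eventually hc).filter_mono nhdsWithin_le_nhds]
    with t h1 h2
  rw [range_J] at h1
  rw [projIcc_of_mem _ h1, h2]
  ring

instance : IsManifold J ∞ Circ := by
  refine isManifold_of_contDiffOn J ∞ Circ ?_
  rintro _ _ ⟨a, rfl⟩ ⟨b, rfl⟩ s ⟨hs, hr⟩
  have hs' := hr
  rw [range_J] at hs'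
  rw [mem_preimage, J_symm_apply, OpenPartialHomeomorph.trans_source, mem_inter_iff,
    mem_preimage, circChart_symm_apply, projIcc_of_mem _ hs'] at hs
  obtain ⟨c, hc⟩ := circChart_projIcc_eventually b a s hs.2
  have hc' : (J ∘ ((circChart a).symm.trans (circChart b)) ∘ J.symm)
      =ᶠ[𝓝[range J] s] fun t => t + c := by
    filter_upwards [hc] with t ht
    rw [← ht, Function.comp_apply, Function.comp_apply, J_symm_apply, J_apply,
      OpenPartialHomeomorph.trans_apply, circChart_symm_apply]
  have hd : ContDiff ℝ ∞ fun t : ℝ => t + c := by fun_prop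
  exact hd.contDiffAt.contDiffWithinAt.congr_of_eventuallyEq
    (hc'.filter_mono (nhdsWithin_mono _ inter_subset_right)) (hc'.self_of_nhdsWithin hr)

theorem chartAt_circ (x : Circ) : ∃ a, chartAt unitInterval x = circChart a := ⟨_, rfl⟩

theorem orientedAtlas_circ : OrientedAtlas Circ := by
  rintro _ ⟨b, rfl⟩ x hx
  obtain ⟨a, ha⟩ := chartAt_circ x
  have hxa : x ∈ (circChart a).source := ha ▸ mem_chart_source unitInterval x
  have hx' : ((extChartAt J x x + a : ℝ) : Circ) = x := by
    rw [extChartAt, ha]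
    show (((circChart a x : ℝ) + a : ℝ) : Circ) = x
    rw [← circChart_symm_apply, (circChart a).left_inv hxa]
  obtain ⟨c, hc⟩ := circChart_projIcc_eventually b a (extChartAt J x x) (by rwa [hx'])
  have := (contMDiffAt_and_slope (f := circChart b) (x := x) (g := fun t => t + c)
    ((circChart b).continuousAt hx) (by fun_prop) (by
      filter_upwards [hc] with t ht
      rw [← ht, writtenInExtChartAt, Function.comp_apply, Function.comp_apply, extChartAt_J,
        extChartAt, ha]
      show (circChart b ((circChart a).symm (projIcc 0 1 zero_le_one t)) : ℝ) = _
      rw [circChart_symm_apply])).2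
  rw [this]
  simp

theorem not_mem_boundary_circ (x : Circ) : x ∉ J.boundary Circ := by
  obtain ⟨a, ha⟩ := chartAt_circ x
  have hxa : x ∈ (circChart a).source := ha ▸ mem_chart_source unitInterval x
  have h := (circChart a).map_source hxa
  rw [circChart_target] at h
  intro h'
  have h2 : extChartAt J x x ∈ frontier (range J) := h'
  rw [extChartAt, ha, range_J, frontier_Icc zero_le_one] at h2
  have h3 : (circChart a x : ℝ) ∈ ({0, 1} : Set ℝ) := h2
  rcases h3 with h3 | h3
  · exact h.1.ne' h3
  · exact h.2.ne h3

/-- The quotient map `[0,1] → ℝ / ℤ`. -/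
def wrap (t : unitInterval) : Circ := ((t : ℝ) : Circ)

theorem wrap_spec (x : unitInterval) : ContMDiffAt J J ∞ wrap x ∧ slope wrap x = 1 := by
  obtain ⟨a, ha⟩ := chartAt_circ (wrap x)
  have hxa : wrap x ∈ (circChart a).source := ha ▸ mem_chart_source unitInterval (wrap x)
  obtain ⟨c, hc⟩ := circChart_projIcc_eventually a 0 x
    (by rw [add_zero]; exact hxa)
  have := contMDiffAt_and_slope (f := wrap) (x := x) (g := fun t => t + c)
    ((AddCircle.continuous_mk' (1 : ℝ)).comp continuous_subtype_val).continuousAt (by fun_prop) (by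
      rw [extChartAt_J]
      filter_upwards [hc] with t ht
      rw [← ht, writtenInExtChartAt, Function.comp_apply, Function.comp_apply, extChartAt,
        extChartAt, ha, chartAt_self_eq]
      show (circChart a (wrap (projIcc 0 1 zero_le_one t)) : ℝ) = _
      rw [add_zero]
      rfl)
  refine ⟨this.1, this.2.trans ?_⟩
  simp

theorem wrap_surjective : Function.Surjective wrap := fun x =>
  ⟨⟨AddCircle.equivIco (1 : ℝ) 0 x, by
    have := (AddCircle.equivIco (1 : ℝ) 0 x).2
    exact ⟨this.1, this.2.le.trans_eq (zero_add 1)⟩⟩, (AddCircle.equivIco (1 : ℝ) 0).symm_apply_apply x⟩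

theorem wrap_eq_wrap {x y : unitInterval} (h : wrap x = wrap y) (hne : x ≠ y) :
    (x = 0 ∧ y = 1) ∨ (x = 1 ∧ y = 0) := by
  have key : ∀ {x y : unitInterval}, x ≠ 1 → y ≠ 1 → wrap x = wrap y → x = y := by
    intro x y hx hy h
    have hx' : (x : ℝ) ∈ Ico (0 : ℝ) (0 + 1) :=
      ⟨x.2.1, by rw [zero_add]; exact lt_of_le_of_ne x.2.2 fun h => hx (Subtype.ext h)⟩
    have hy' : (y : ℝ) ∈ Ico (0 : ℝ) (0 + 1) :=
      ⟨y.2.1, by rw [zero_add]; exact lt_of_le_of_ne y.2.2 fun h => hy (Subtype.ext h)⟩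
    exact Subtype.ext ((AddCircle.coe_eq_coe_iff_of_mem_Ico hx' hy').1 h)
  have h01 : wrap 0 = wrap 1 := by
    show ((0 : ℝ) : Circ) = ((1 : ℝ) : Circ)
    rw [AddCircle.coe_period, AddCircle.coe_zero]
  by_cases hx : x = 1
  · subst hx
    right
    exact ⟨rfl, (key zero_ne_one (fun hy => hne hy.symm) (h01.trans h)).symm⟩
  · by_cases hy : y = 1
    · subst hy
      left
      exact ⟨(key zero_ne_one hx (h01.trans h.symm)).symm, rfl⟩
    · exact absurd (key hx hy h) hne

namespace Mfd

/-- The circle `ℝ / ℤ`. -/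
def circle (Λ : Type) : Mfd Λ where
  carrier := Circ
  oriented := orientedAtlas_circ
  label x := absurd x.2 (not_mem_boundary_circ x.1)

/-- The morphism given by cutting the circle `ℝ / ℤ` at the point `0`, labelled `a`. -/
def close (a : Λ) : interval a a ⟶ circle Λ where
  toFun := wrap
  smooth x := (wrap_spec x).1
  slope_pos x := (wrap_spec x).2.symm ▸ one_pos
  surj := wrap_surjective
  map_interior _ _ := not_mem_boundary_circ _
  label_boundary _ h := absurd h (not_mem_boundary_circ _)
  glue x y h hne := by
    have h0 := (mem_boundary_unitInterval 0).2 (Or.inl rfl)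
    have h1 := (mem_boundary_unitInterval 1).2 (Or.inr rfl)
    refine ⟨not_mem_boundary_circ _, ?_⟩
    rcases wrap_eq_wrap h hne with ⟨rfl, rfl⟩ | ⟨rfl, rfl⟩
    · exact ⟨h0, h1, (interval_label_zero a a _).trans (interval_label_one a a _).symm⟩
    · exact ⟨h1, h0, (interval_label_one a a _).trans (interval_label_zero a a _).symm⟩

end Mfd

end Geometry

/-- A symmetric monoidal simplicial functor from the symmetric monoidal simplicial category of
one-dimensional cobordisms to the discrete symmetric monoidal category `C`: a strong symmetric
monoidal functor such that the maps on morphisms are the restrictions to vertices of maps from the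
simplicial sets of morphisms to constant simplicial sets. Since a map to a constant simplicial set
is determined by its values on vertices, there is at most one such extension, and it is compatible
with the composition and the tensor product of simplices of all dimensions. -/
structure Operad (Λ : Type) (C : Type u) [Category.{v} C] [MonoidalCategory C]
    [SymmetricCategory C] where
  functor : Mfd Λ ⥤ C
  [braided : functor.Braided]
  simplicial : ∀ S T : Mfd Λ,
    ∃ φ : Mfd.simplicialHom S T ⋙ uliftFunctor.{v} ⟶
        (Functor.const SimplexCategoryᵒᵖ).obj (ULift.{0} (functor.obj S ⟶ functor.obj T)),
      ∀ f : S ⟶ T, (φ.app (Opposite.op (SimplexCategory.mk 0))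
        ⟨⟨fun _ => f, Mfd.isSmoothFamily_const 0 f⟩⟩).down = functor.map f

namespace Operad

attribute [instance] Operad.braided

variable {Λ : Type} {C : Type u} [Category.{v} C] [MonoidalCategory C] [SymmetricCategory C]

/-- Morphisms are symmetric monoidal natural transformations. -/
@[ext]
structure Hom (P Q : Operad Λ C) where
  app : P.functor ⟶ Q.functor
  isMonoidal : NatTrans.IsMonoidal app

instance : Category (Operad Λ C) where
  Hom := Hom
  id P := ⟨𝟙 _, inferInstance⟩
  comp f g := ⟨f.app ≫ g.app, by
    have := f.isMonoidal
    have := g.isMonoidal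
    infer_instance⟩

@[simp]
theorem id_app (P : Operad Λ C) : Hom.app (𝟙 P) = 𝟙 _ := rfl

@[simp]
theorem comp_app {P Q R : Operad Λ C} (f : P ⟶ Q) (g : Q ⟶ R) :
    Hom.app (f ≫ g) = Hom.app f ≫ Hom.app g := rfl

open Functor.LaxMonoidal

/-- The operation induced by gluing two intervals. -/
def mul (P : Operad Λ C) (a b c : Λ) :
    P.functor.obj (Mfd.interval a b) ⊗ P.functor.obj (Mfd.interval b c) ⟶
      P.functor.obj (Mfd.interval a c) :=
  μ P.functor _ _ ≫ P.functor.map (Mfd.glue a b c)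

/-- The operation induced by closing up an interval to a circle. -/
def trace (P : Operad Λ C) (a : Λ) :
    P.functor.obj (Mfd.interval a a) ⟶ P.functor.obj (Mfd.circle Λ) :=
  P.functor.map (Mfd.close a)

theorem mul_app {P Q : Operad Λ C} (f : P ⟶ Q) (a b c : Λ) :
    P.mul a b c ≫ (Hom.app f).app (Mfd.interval a c) =
      ((Hom.app f).app (Mfd.interval a b) ⊗ₘ (Hom.app f).app (Mfd.interval b c)) ≫
        Q.mul a b c := by
  have := f.isMonoidal
  simp [mul, NatTrans.IsMonoidal.tensor_assoc]

theorem trace_app {P Q : Operad Λ C} (f : P ⟶ Q) (a : Λ) :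
    P.trace a ≫ (Hom.app f).app (Mfd.circle Λ) =
      (Hom.app f).app (Mfd.interval a a) ≫ Q.trace a := by
  simp [trace]

end Operad

section Algebra

variable {C : Type u} [Category.{v} C]

theorem square_comp {X Z X' Z' X'' Z'' : C} {m : X ⟶ Z}
    {m' : X' ⟶ Z'} {m'' : X'' ⟶ Z''} {f : X ⟶ X'} {h : Z ⟶ Z'}
    {f' : X' ⟶ X''} {h' : Z' ⟶ Z''} (e : m ≫ h = f ≫ m')
    (e' : m' ≫ h' = f' ≫ m'') : m ≫ h ≫ h' = (f ≫ f') ≫ m'' := by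
  rw [← Category.assoc, e, Category.assoc, e', ← Category.assoc]

variable [MonoidalCategory C]

theorem tensorHom_square_comp {X Y Z X' Y' Z' X'' Y'' Z'' : C} {m : X ⊗ Y ⟶ Z}
    {m' : X' ⊗ Y' ⟶ Z'} {m'' : X'' ⊗ Y'' ⟶ Z''} {f : X ⟶ X'} {g : Y ⟶ Y'} {h : Z ⟶ Z'}
    {f' : X' ⟶ X''} {g' : Y' ⟶ Y''} {h' : Z' ⟶ Z''} (e : m ≫ h = (f ⊗ₘ g) ≫ m')
    (e' : m' ≫ h' = (f' ⊗ₘ g') ≫ m'') : m ≫ h ≫ h' = ((f ≫ f') ⊗ₘ (g ≫ g')) ≫ m'' := by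
  rw [← Category.assoc, e, Category.assoc, e', ← Category.assoc, tensorHom_comp_tensorHom]

variable (C) in
/-- An object `A` with a multiplication, and a morphism from `A` to a further object `M`. -/
structure AlgTraceData where
  A : C
  M : C
  mul : A ⊗ A ⟶ A
  tr : A ⟶ M

variable (C) in
/-- The objects and structure morphisms underlying a Morita context with trace. -/
structure MoritaTraceData where
  A : C
  B : C
  Q : C
  R : C
  M : C
  mulA : A ⊗ A ⟶ A
  mulB : B ⊗ B ⟶ B
  lQ : A ⊗ Q ⟶ Q
  rQ : Q ⊗ B ⟶ Q
  lR : B ⊗ R ⟶ R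
  rR : R ⊗ A ⟶ R
  α : Q ⊗ R ⟶ A
  β : R ⊗ Q ⟶ B
  trA : A ⟶ M
  trB : B ⟶ M

namespace AlgTraceData

/-- Morphisms are pairs of morphisms commuting with the structure morphisms. -/
@[ext]
structure Hom (X Y : AlgTraceData C) where
  A : X.A ⟶ Y.A
  M : X.M ⟶ Y.M
  mul : X.mul ≫ A = (A ⊗ₘ A) ≫ Y.mul
  tr : X.tr ≫ M = A ≫ Y.tr

instance : Category (AlgTraceData C) where
  Hom := Hom
  id X := { A := 𝟙 _, M := 𝟙 _, mul := by simp, tr := by simp }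
  comp f g :=
    { A := f.A ≫ g.A
      M := f.M ≫ g.M
      mul := tensorHom_square_comp f.mul g.mul
      tr := square_comp f.tr g.tr }
  id_comp _ := by ext <;> simp
  comp_id _ := by ext <;> simp
  assoc _ _ _ := by ext <;> simp

/-- `A` is a non-unital associative algebra and `tr` is a trace on it. -/
structure IsAlgebraWithTrace [BraidedCategory C] (X : AlgTraceData C) : Prop where
  assoc : X.mul ▷ X.A ≫ X.mul = (α_ X.A X.A X.A).hom ≫ X.A ◁ X.mul ≫ X.mul
  trace : (β_ X.A X.A).hom ≫ X.mul ≫ X.tr = X.mul ≫ X.tr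

variable (C) in
/-- The property of being a non-unital associative algebra with a trace. -/
def algebraWithTrace [BraidedCategory C] : ObjectProperty (AlgTraceData C) :=
  IsAlgebraWithTrace

end AlgTraceData

namespace MoritaTraceData

/-- Morphisms are quintuples of morphisms commuting with the ten structure morphisms. -/
@[ext]
structure Hom (X Y : MoritaTraceData C) where
  A : X.A ⟶ Y.A
  B : X.B ⟶ Y.B
  Q : X.Q ⟶ Y.Q
  R : X.R ⟶ Y.R
  M : X.M ⟶ Y.M
  mulA : X.mulA ≫ A = (A ⊗ₘ A) ≫ Y.mulA
  mulB : X.mulB ≫ B = (B ⊗ₘ B) ≫ Y.mulB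
  lQ : X.lQ ≫ Q = (A ⊗ₘ Q) ≫ Y.lQ
  rQ : X.rQ ≫ Q = (Q ⊗ₘ B) ≫ Y.rQ
  lR : X.lR ≫ R = (B ⊗ₘ R) ≫ Y.lR
  rR : X.rR ≫ R = (R ⊗ₘ A) ≫ Y.rR
  α : X.α ≫ A = (Q ⊗ₘ R) ≫ Y.α
  β : X.β ≫ B = (R ⊗ₘ Q) ≫ Y.β
  trA : X.trA ≫ M = A ≫ Y.trA
  trB : X.trB ≫ M = B ≫ Y.trB

instance : Category (MoritaTraceData C) where
  Hom := Hom
  id X :=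
    { A := 𝟙 _, B := 𝟙 _, Q := 𝟙 _, R := 𝟙 _, M := 𝟙 _
      mulA := by simp
      mulB := by simp
      lQ := by simp
      rQ := by simp
      lR := by simp
      rR := by simp
      α := by simp
      β := by simp
      trA := by simp
      trB := by simp }
  comp f g :=
    { A := f.A ≫ g.A, B := f.B ≫ g.B, Q := f.Q ≫ g.Q, R := f.R ≫ g.R, M := f.M ≫ g.M
      mulA := tensorHom_square_comp f.mulA g.mulA
      mulB := tensorHom_square_comp f.mulB g.mulB
      lQ := tensorHom_square_comp f.lQ g.lQ
      rQ := tensorHom_square_comp f.rQ g.rQ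
      lR := tensorHom_square_comp f.lR g.lR
      rR := tensorHom_square_comp f.rR g.rR
      α := tensorHom_square_comp f.α g.α
      β := tensorHom_square_comp f.β g.β
      trA := square_comp f.trA g.trA
      trB := square_comp f.trB g.trB }
  id_comp _ := by ext <;> simp
  comp_id _ := by ext <;> simp
  assoc _ _ _ := by ext <;> simp

/-- The axioms of a Morita context with trace. Algebras are not required to have units. A morphism
out of a relative tensor product `Q ⊗_B R`, the coequalizer of the two morphisms
`Q ⊗ B ⊗ R ⟶ Q ⊗ R` given by the actions of `B`, is the same as a morphism out of `Q ⊗ R` that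
coequalizes these two (`α_balanced`); stated in this way, no existence of coequalizers in `C` is
needed. The same applies to `β`. -/
structure IsMoritaContextWithTrace [BraidedCategory C] (X : MoritaTraceData C) : Prop where
  /-- `A` is an associative algebra. -/
  assocA : X.mulA ▷ X.A ≫ X.mulA = (α_ X.A X.A X.A).hom ≫ X.A ◁ X.mulA ≫ X.mulA
  /-- `B` is an associative algebra. -/
  assocB : X.mulB ▷ X.B ≫ X.mulB = (α_ X.B X.B X.B).hom ≫ X.B ◁ X.mulB ≫ X.mulB
  /-- `Q` is a left `A`-module. -/
  lQ_assoc : X.mulA ▷ X.Q ≫ X.lQ = (α_ X.A X.A X.Q).hom ≫ X.A ◁ X.lQ ≫ X.lQ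
  /-- `Q` is a right `B`-module. -/
  rQ_assoc : X.rQ ▷ X.B ≫ X.rQ = (α_ X.Q X.B X.B).hom ≫ X.Q ◁ X.mulB ≫ X.rQ
  /-- The two actions on `Q` commute. -/
  lQ_rQ : X.lQ ▷ X.B ≫ X.rQ = (α_ X.A X.Q X.B).hom ≫ X.A ◁ X.rQ ≫ X.lQ
  /-- `R` is a left `B`-module. -/
  lR_assoc : X.mulB ▷ X.R ≫ X.lR = (α_ X.B X.B X.R).hom ≫ X.B ◁ X.lR ≫ X.lR
  /-- `R` is a right `A`-module. -/
  rR_assoc : X.rR ▷ X.A ≫ X.rR = (α_ X.R X.A X.A).hom ≫ X.R ◁ X.mulA ≫ X.rR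
  /-- The two actions on `R` commute. -/
  lR_rR : X.lR ▷ X.A ≫ X.rR = (α_ X.B X.R X.A).hom ≫ X.B ◁ X.rR ≫ X.lR
  /-- `α` is defined on `Q ⊗_B R`. -/
  α_balanced : X.rQ ▷ X.R ≫ X.α = (α_ X.Q X.B X.R).hom ≫ X.Q ◁ X.lR ≫ X.α
  /-- `β` is defined on `R ⊗_A Q`. -/
  β_balanced : X.rR ▷ X.Q ≫ X.β = (α_ X.R X.A X.Q).hom ≫ X.R ◁ X.lQ ≫ X.β
  /-- `α` is a morphism of left `A`-modules. -/
  α_left : X.lQ ▷ X.R ≫ X.α = (α_ X.A X.Q X.R).hom ≫ X.A ◁ X.α ≫ X.mulA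
  /-- `α` is a morphism of right `A`-modules. -/
  α_right : X.α ▷ X.A ≫ X.mulA = (α_ X.Q X.R X.A).hom ≫ X.Q ◁ X.rR ≫ X.α
  /-- `β` is a morphism of left `B`-modules. -/
  β_left : X.lR ▷ X.Q ≫ X.β = (α_ X.B X.R X.Q).hom ≫ X.B ◁ X.β ≫ X.mulB
  /-- `β` is a morphism of right `B`-modules. -/
  β_right : X.β ▷ X.B ≫ X.mulB = (α_ X.R X.Q X.B).hom ≫ X.R ◁ X.rQ ≫ X.β
  /-- Compatibility of `α` and `β` on `Q ⊗_B R ⊗_A Q`. -/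
  compatQ : X.α ▷ X.Q ≫ X.lQ = (α_ X.Q X.R X.Q).hom ≫ X.Q ◁ X.β ≫ X.rQ
  /-- Compatibility of `β` and `α` on `R ⊗_A Q ⊗_B R`. -/
  compatR : X.β ▷ X.R ≫ X.lR = (α_ X.R X.Q X.R).hom ≫ X.R ◁ X.α ≫ X.rR
  /-- `trA` is a trace. -/
  traceA : (β_ X.A X.A).hom ≫ X.mulA ≫ X.trA = X.mulA ≫ X.trA
  /-- `trB` is a trace. -/
  traceB : (β_ X.B X.B).hom ≫ X.mulB ≫ X.trB = X.mulB ≫ X.trB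
  /-- The two traces agree, under the symmetry of `C`, on `Q ⊗ R` and `R ⊗ Q`. -/
  trace_compat : X.α ≫ X.trA = (β_ X.Q X.R).hom ≫ X.β ≫ X.trB

variable (C) in
/-- The property of being a Morita context with trace. -/
def moritaContextWithTrace [BraidedCategory C] : ObjectProperty (MoritaTraceData C) :=
  IsMoritaContextWithTrace

end MoritaTraceData

end Algebra

section Evaluation

variable (C : Type u) [Category.{v} C] [MonoidalCategory C] [SymmetricCategory C]

/-- One-dimensional modular operads in the discrete symmetric monoidal category `C`. -/
abbrev ModularOperad := Operad Unit C

/-- One-dimensional modular dioperads in the discrete symmetric monoidal category `C`. -/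
abbrev ModularDioperad := Operad ℤˣ C

/-- The algebra and the trace of a one-dimensional modular operad. -/
def ModularOperad.data : ModularOperad C ⥤ AlgTraceData C where
  obj P :=
    { A := P.functor.obj (Mfd.interval () ())
      M := P.functor.obj (Mfd.circle Unit)
      mul := P.mul () () ()
      tr := P.trace () }
  map f :=
    { A := (Operad.Hom.app f).app _
      M := (Operad.Hom.app f).app _
      mul := Operad.mul_app f _ _ _
      tr := Operad.trace_app f _ }
  map_id _ := rfl
  map_comp _ _ := rfl

/-- The Morita context and the traces of a one-dimensional modular dioperad. The four intervals are
`A` (incoming at `0`, outgoing at `1`), `B` (outgoing at `0`, incoming at `1`), `Q` (incoming at both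
ends) and `R` (outgoing at both ends). -/
def ModularDioperad.data : ModularDioperad C ⥤ MoritaTraceData C where
  obj P :=
    { A := P.functor.obj (Mfd.interval 1 1)
      B := P.functor.obj (Mfd.interval (-1) (-1))
      Q := P.functor.obj (Mfd.interval 1 (-1))
      R := P.functor.obj (Mfd.interval (-1) 1)
      M := P.functor.obj (Mfd.circle ℤˣ)
      mulA := P.mul 1 1 1
      mulB := P.mul (-1) (-1) (-1)
      lQ := P.mul 1 1 (-1)
      rQ := P.mul 1 (-1) (-1)
      lR := P.mul (-1) (-1) 1
      rR := P.mul (-1) 1 1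
      α := P.mul 1 (-1) 1
      β := P.mul (-1) 1 (-1)
      trA := P.trace 1
      trB := P.trace (-1) }
  map f :=
    { A := (Operad.Hom.app f).app _
      B := (Operad.Hom.app f).app _
      Q := (Operad.Hom.app f).app _
      R := (Operad.Hom.app f).app _
      M := (Operad.Hom.app f).app _
      mulA := Operad.mul_app f _ _ _
      mulB := Operad.mul_app f _ _ _
      lQ := Operad.mul_app f _ _ _
      rQ := Operad.mul_app f _ _ _
      lR := Operad.mul_app f _ _ _
      rR := Operad.mul_app f _ _ _
      α := Operad.mul_app f _ _ _
      β := Operad.mul_app f _ _ _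
      trA := Operad.trace_app f _
      trB := Operad.trace_app f _ }
  map_id _ := rfl
  map_comp _ _ := rfl

end Evaluation

end OneCob

end

/-! An isotopy of cobordisms is a 1-simplex of morphisms, so a simplicial functor to a discrete
category takes equal values on isotopic morphisms (`Operad.map_isotopic`). Conversely, a functor
that identifies isotopic morphisms is simplicial (`exists_simplicial`). The theorem therefore
amounts to a presentation of the symmetric monoidal category of cobordisms modulo isotopy: its
objects are generated by intervals and the circle, its morphisms by gluing two intervals and closing
up one, subject to associativity of gluing and invariance of closing under cyclic rotation. A model
of this presentation, for any set of labels `Λ`, is a `TrData` with `TrData.IsTr`. For `Λ = Unit` it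
is an algebra with trace. For `Λ = ℤˣ` the sixteen instances of associativity are the sixteen module
and compatibility axioms of a Morita context, and the instances of cyclic invariance are the trace
axioms.

Generation. A compact manifold is covered by finitely many embedded arcs and can be cut into
intervals (`exists_cutting`). Whenever a morphism identifies two ends of intervals, it factors up to
isotopy through a gluing or a closing (`exists_merge_seg`, `exists_merge_circ`); after finitely many
such steps a diffeomorphism remains (`exists_gen_comp`). Diffeomorphisms permute the components, and
on a single component they are isotopic to the identity: for intervals and for lifts of circle maps
by convex combination. Hence every morphism between disjoint unions of intervals and circles is
generated (`Gen.total`).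

Sufficiency of the relations. The relation `R` pairs a cobordism with each morphism of `C` built in
the same way; it has to be single-valued. A cobordism determines, for every component of the target,
which components of the source lie in it, and the linear or cyclic order of the images of their left
ends. The morphism of `C` multiplies the factors in this order: associativity removes the choice of
brackets, cyclic invariance the choice of the first factor on a circle, and coherence of symmetric
monoidal categories (`Can.unique`) the choice of a permutation. The predicate `N` says that a
morphism of `C` has this form. It is quantified over all names of components and over all relations
`Q` containing the actual positions, which lets it pass through disjoint unions and composites. It
is stable under isotopy because left ends of distinct components never collide (`Isotopic.srt`), and
under composition because orders concatenate (`srt_flatten`). It determines the morphism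
(`N.unique`), so `R` is the graph of a function (`R.unique`).

Conclusion. A choice of a word for each manifold extends the data to a symmetric monoidal functor,
and each identity needed is an instance of `R.unique`. Morphisms of data extend uniquely by
induction on `R` (`R.hom`, `R.evIso`), which gives full faithfulness. -/

noncomputable section

namespace OneCob

section

/-! ### Coherence for permutations of tensor factors -/

section Permutation

variable {C : Type u} [Category.{v} C] [MonoidalCategory C]

/-- The tensor product of a list of objects, bracketed to the right. -/
@[reducible]
def tl {ι : Type} (X : ι → C) : List ι → C
  | [] => 𝟙_ C
  | i :: l => X i ⊗ tl X l

section swap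

variable [SymmetricCategory C]

/-- The exchange of the first two factors. -/
def sw (a b Z : C) : a ⊗ (b ⊗ Z) ⟶ b ⊗ (a ⊗ Z) :=
  (α_ a b Z).inv ≫ (β_ a b).hom ▷ Z ≫ (α_ b a Z).hom

theorem sw_nat (a b : C) {Z Z' : C} (φ : Z ⟶ Z') :
    a ◁ (b ◁ φ) ≫ sw a b Z' = sw a b Z ≫ b ◁ (a ◁ φ) := by
  simp only [sw, Category.assoc, associator_inv_naturality_right_assoc, whisker_exchange_assoc,
    associator_naturality_right]

theorem sw_sw (a b Z : C) : sw a b Z ≫ sw b a Z = 𝟙 _ := by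
  simp [sw, ← comp_whiskerRight_assoc]

/-- This is the Yang–Baxter equation tensored with the remaining factors. It settles the case of
`Can.ext` in which both exchanged factors stand before the one that is moved to the front. -/
theorem sw_yang_baxter (a b i Z : C) :
    sw a b (i ⊗ Z) ≫ b ◁ sw a i Z ≫ sw b i (a ⊗ Z) =
      a ◁ sw b i Z ≫ sw a i (b ⊗ Z) ≫ i ◁ sw a b Z := by
  have h := congrArg (fun f => a ◁ (α_ b i Z).inv ≫ (α_ a (b ⊗ i) Z).inv ≫ f ▷ Z ≫
    (α_ i (b ⊗ a) Z).hom ≫ i ◁ (α_ b a Z).hom) (BraidedCategory.yang_baxter a b i)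
  simp only [comp_whiskerRight, Category.assoc] at h
  simp only [sw, MonoidalCategory.whiskerLeft_comp, Category.assoc]
  convert h using 1 <;> monoidal

end swap

variable {ι : Type} (X : ι → C)

/-- Concatenation of tensor products of lists. -/
def app : ∀ l l' : List ι, tl X l ⊗ tl X l' ≅ tl X (l ++ l')
  | [], l' => λ_ (tl X l')
  | i :: l, l' => α_ (X i) (tl X l) (tl X l') ≪≫ whiskerLeftIso (X i) (app l l')

theorem app_nil (l' : List ι) : app X [] l' = λ_ (tl X l') := rfl

theorem app_cons (i : ι) (l l' : List ι) :
    (app X (i :: l) l').hom = (α_ (X i) (tl X l) (tl X l')).hom ≫ X i ◁ (app X l l').hom := rfl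

theorem app_cons_inv (i : ι) (l l' : List ι) :
    (app X (i :: l) l').inv = X i ◁ (app X l l').inv ≫ (α_ (X i) (tl X l) (tl X l')).inv := rfl

variable {X}

/-- The tensor product of morphisms between tensor products of lists. -/
def appHom {κ : Type} {Y : κ → C} {l1 l2 : List ι} {m1 m2 : List κ} (φ : tl X l1 ⟶ tl Y m1)
    (ψ : tl X l2 ⟶ tl Y m2) : tl X (l1 ++ l2) ⟶ tl Y (m1 ++ m2) :=
  (app X l1 l2).inv ≫ (φ ⊗ₘ ψ) ≫ (app Y m1 m2).hom

theorem app_appHom {κ : Type} {Y : κ → C} {l1 l2 : List ι} {m1 m2 : List κ} (φ : tl X l1 ⟶ tl Y m1)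
    (ψ : tl X l2 ⟶ tl Y m2) :
    (app X l1 l2).hom ≫ appHom φ ψ = (φ ⊗ₘ ψ) ≫ (app Y m1 m2).hom := by
  simp [appHom]

theorem appHom_comp {κ μ : Type} {Y : κ → C} {Z : μ → C} {l1 l2 : List ι} {m1 m2 : List κ}
    {n1 n2 : List μ} (φ : tl X l1 ⟶ tl Y m1) (ψ : tl X l2 ⟶ tl Y m2)
    (φ' : tl Y m1 ⟶ tl Z n1) (ψ' : tl Y m2 ⟶ tl Z n2) :
    appHom φ ψ ≫ appHom φ' ψ' = appHom (φ ≫ φ') (ψ ≫ ψ') := by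
  simp only [appHom, Category.assoc, Iso.hom_inv_id_assoc, tensorHom_comp_tensorHom_assoc]

theorem appHom_id (l1 l2 : List ι) : appHom (𝟙 (tl X l1)) (𝟙 (tl X l2)) = 𝟙 _ := by
  simp [appHom]

variable (X) [SymmetricCategory C]

/-- Canonical isomorphisms between tensor products of lists that are permutations of each other. -/
inductive Can : ∀ l l' : List ι, (tl X l ⟶ tl X l') → Prop
  | nil : Can [] [] (𝟙 _)
  | cons (i : ι) {l l' : List ι} {φ : tl X l ⟶ tl X l'} :
      Can l l' φ → Can (i :: l) (i :: l') (X i ◁ φ)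
  | swap (i j : ι) (l : List ι) : Can (i :: j :: l) (j :: i :: l) (sw (X i) (X j) (tl X l))
  | trans {l l' l'' : List ι} {φ : tl X l ⟶ tl X l'} {ψ : tl X l' ⟶ tl X l''} :
      Can l l' φ → Can l' l'' ψ → Can l l'' (φ ≫ ψ)

variable {X}

theorem Can.refl (l : List ι) : Can X l l (𝟙 _) := by
  induction l with
  | nil => exact .nil
  | cons i l ih => simpa using ih.cons i

theorem Can.perm {l l' : List ι} {φ : tl X l ⟶ tl X l'} (h : Can X l l' φ) : l.Perm l' := by
  induction h with
  | nil => exact .nil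
  | cons i _ ih => exact ih.cons i
  | swap i j l => exact .swap j i l
  | trans _ _ h1 h2 => exact h1.trans h2

theorem Can.symm {l l' : List ι} {φ : tl X l ⟶ tl X l'} (h : Can X l l' φ) :
    ∃ ψ, Can X l' l ψ ∧ φ ≫ ψ = 𝟙 _ ∧ ψ ≫ φ = 𝟙 _ := by
  induction h with
  | nil => exact ⟨_, .nil, by simp, by simp⟩
  | cons i _ ih =>
    obtain ⟨ψ, h, h1, h2⟩ := ih
    exact ⟨_, h.cons i, by rw [← MonoidalCategory.whiskerLeft_comp, h1, whiskerLeft_id],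
      by rw [← MonoidalCategory.whiskerLeft_comp, h2, whiskerLeft_id]⟩
  | swap i j l => exact ⟨_, .swap j i l, sw_sw _ _ _, sw_sw _ _ _⟩
  | trans _ _ ih1 ih2 =>
    obtain ⟨ψ, h, h1, h2⟩ := ih1
    obtain ⟨ψ', h', h1', h2'⟩ := ih2
    refine ⟨_, h'.trans h, ?_, ?_⟩
    · rw [Category.assoc, reassoc_of% h1', h1]
    · rw [Category.assoc, reassoc_of% h2, h2']

variable (X) in
/-- Moving one factor to the front. -/
inductive Ext (i : ι) : ∀ l m : List ι, (tl X l ⟶ X i ⊗ tl X m) → Prop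
  | head (l : List ι) : Ext i (i :: l) l (𝟙 _)
  | tail (j : ι) {l m : List ι} {φ : tl X l ⟶ X i ⊗ tl X m} :
      Ext i l m φ → Ext i (j :: l) (j :: m) (X j ◁ φ ≫ sw (X j) (X i) (tl X m))

theorem Ext.mem {i : ι} {l m : List ι} {φ} (h : Ext X i l m φ) : i ∈ l := by
  induction h with
  | head l => simp
  | tail j _ ih => simp [ih]

theorem Ext.sublist {i : ι} {l m : List ι} {φ} (h : Ext X i l m φ) : m.Sublist l := by
  induction h with
  | head l => simp
  | tail j _ ih => simp [ih]

/-- Without repetitions the name `i` occurs only once, so `head` and `tail` never compete. The same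
argument gives `Ext.unique`. -/
theorem Ext.unique_list {i : ι} {l m m' : List ι} {φ φ'} (hl : l.Nodup) (h : Ext X i l m φ)
    (h' : Ext X i l m' φ') : m = m' := by
  induction h generalizing m' with
  | head l =>
    cases h' with
    | head => rfl
    | tail j h => exact absurd h.mem (List.nodup_cons.1 hl).1
  | tail j h ih =>
    cases h' with
    | head => exact absurd h.mem (List.nodup_cons.1 hl).1
    | tail j h' => rw [ih (List.nodup_cons.1 hl).2 h']

theorem Ext.unique {i : ι} {l m : List ι} {φ φ'} (hl : l.Nodup) (h : Ext X i l m φ)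
    (h' : Ext X i l m φ') : φ = φ' := by
  induction h with
  | head l =>
    cases h' with
    | head => rfl
    | tail j h => exact absurd h.mem (List.nodup_cons.1 hl).1
  | tail j h ih =>
    cases h' with
    | head => exact absurd h.mem (List.nodup_cons.1 hl).1
    | tail j h' => rw [ih (List.nodup_cons.1 hl).2 h']

/-- A canonical isomorphism is compatible with moving a factor to the front. -/
theorem Can.ext {i : ι} {l l' m' : List ι} {φ : tl X l ⟶ tl X l'} (h : Can X l l' φ)
    {ε' : tl X l' ⟶ X i ⊗ tl X m'} (h' : Ext X i l' m' ε') :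
    ∃ m ε φ', Ext X i l m ε ∧ Can X m m' φ' ∧ φ ≫ ε' = ε ≫ X i ◁ φ' := by
  induction h generalizing m' with
  | nil => cases h'
  | cons j h ih =>
    cases h' with
    | head => exact ⟨_, _, _, .head _, h, by simp⟩
    | tail _ h' =>
      obtain ⟨m, ε, φ', h1, h2, h3⟩ := ih h'
      refine ⟨_, _, _, h1.tail j, h2.cons j, ?_⟩
      rw [← MonoidalCategory.whiskerLeft_comp_assoc, h3, MonoidalCategory.whiskerLeft_comp,
        Category.assoc, sw_nat, Category.assoc]
  | swap a b l =>
    cases h' with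
    | head => exact ⟨_, _, _, (Ext.head l).tail a, Can.refl _, by simp⟩
    | tail _ h' =>
      cases h' with
      | head => exact ⟨_, _, _, .head _, Can.refl _, by simp [sw_sw]⟩
      | tail _ h' =>
        refine ⟨_, _, _, (h'.tail b).tail a, .swap a b _, ?_⟩
        simp only [MonoidalCategory.whiskerLeft_comp, Category.assoc]
        rw [← sw_yang_baxter, ← reassoc_of% (sw_nat (X a) (X b))]
  | trans h1 h2 ih1 ih2 =>
    obtain ⟨m, ε, φ', e1, c1, q1⟩ := ih2 h'
    obtain ⟨m2, ε2, φ2, e2, c2, q2⟩ := ih1 e1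
    refine ⟨_, _, _, e2, c2.trans c1, ?_⟩
    rw [Category.assoc, q1, reassoc_of% q2, MonoidalCategory.whiskerLeft_comp]

/-- The constructors `cons` and `swap` end in nonempty lists, so only `nil` and composites remain.
The source is empty only up to a proof, which `eqToHom` records. -/
theorem Can.nil_eq {l : List ι} {φ : tl X l ⟶ tl X []} (h : Can X l [] φ) :
    ∃ e : l = [], φ = eqToHom (by rw [e]) := by
  generalize hl : ([] : List ι) = l' at φ h
  induction h with
  | nil => exact ⟨rfl, by simp⟩
  | cons => cases hl
  | swap => cases hl
  | trans h1 h2 ih1 ih2 =>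
    obtain ⟨e, h⟩ := ih2 hl
    obtain ⟨e', h'⟩ := ih1 (hl.trans e.symm)
    exact ⟨e'.trans e, by rw [h, h', eqToHom_trans]⟩

/-- Coherence: on lists without repetitions, a permutation induces only one isomorphism. -/
theorem Can.unique {l l' : List ι} (hl : l.Nodup) {φ ψ : tl X l ⟶ tl X l'} (h : Can X l l' φ)
    (h' : Can X l l' ψ) : φ = ψ := by
  induction l' generalizing l with
  | nil =>
    obtain ⟨e, h⟩ := h.nil_eq
    obtain ⟨e', h'⟩ := h'.nil_eq
    rw [h, h']
  | cons i m' ih =>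
    -- Both isomorphisms factor as moving the head `i` of the target to the front of the source,
    -- followed by a canonical isomorphism of the rest. The first move is unique, and the induction
    -- hypothesis compares the rests.
    obtain ⟨m, ε, φ', e1, c1, q1⟩ := h.ext (Ext.head m')
    obtain ⟨m2, ε2, φ2, e2, c2, q2⟩ := h'.ext (Ext.head m')
    obtain rfl := e1.unique_list hl e2
    obtain rfl := e1.unique hl e2
    obtain rfl := ih (hl.sublist e1.sublist) c1 c2
    rw [Category.comp_id] at q1 q2
    rw [q1, q2]

theorem Can.append_left (l : List ι) {l1 l2 : List ι} {φ} (h : Can X l1 l2 φ) :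
    Can X (l ++ l1) (l ++ l2) (appHom (𝟙 (tl X l)) φ) := by
  induction l with
  | nil =>
    have : appHom (𝟙 (tl X [])) φ = φ := by simp [appHom, app_nil]
    rw [this]; exact h
  | cons i l ih =>
    have : appHom (𝟙 (tl X (i :: l))) φ = X i ◁ appHom (𝟙 (tl X l)) φ := by
      simp [appHom, app_cons, app_cons_inv]
    rw [this]; exact ih.cons i

theorem Can.append_right {l1 l2 : List ι} {φ} (h : Can X l1 l2 φ) (l : List ι) :
    Can X (l1 ++ l) (l2 ++ l) (appHom φ (𝟙 (tl X l))) := by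
  induction h with
  | nil => rw [appHom_id]; exact Can.refl _
  | @cons i l1 l2 φ h ih =>
    have : appHom (l1 := i :: l1) (m1 := i :: l2) (X i ◁ φ) (𝟙 (tl X l)) =
        (X i ◁ appHom φ (𝟙 (tl X l)) : tl X (i :: (l1 ++ l)) ⟶ tl X (i :: (l2 ++ l))) := by
      simp [appHom, app_cons, app_cons_inv]
    rw [this]; exact ih.cons i
  | swap i j l1 =>
    have : appHom (l1 := i :: j :: l1) (m1 := j :: i :: l1) (sw (X i) (X j) (tl X l1))
        (𝟙 (tl X l)) = (sw (X i) (X j) (tl X (l1 ++ l)) :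
          tl X (i :: j :: (l1 ++ l)) ⟶ tl X (j :: i :: (l1 ++ l))) := by
      have h := sw_nat (X i) (X j) (app X l1 l).hom
      rw [appHom, Iso.inv_comp_eq]
      simp only [app_cons, tensorHom_id, MonoidalCategory.whiskerLeft_comp, Category.assoc]
      rw [h]
      simp only [sw]
      monoidal
    rw [this]; exact .swap i j _
  | trans h1 h2 ih1 ih2 =>
    have := ih1.trans ih2
    rwa [appHom_comp, Category.comp_id] at this

theorem Can.append {l1 l2 m1 m2 : List ι} {φ ψ} (h : Can X l1 l2 φ) (h' : Can X m1 m2 ψ) :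
    Can X (l1 ++ m1) (l2 ++ m2) (appHom φ ψ) := by
  have := (h.append_right m1).trans (h'.append_left l2)
  rwa [appHom_comp, Category.comp_id, Category.id_comp] at this

/-- The associativity of concatenation. -/
theorem can_assoc (l1 l2 l3 : List ι) : ∃ c, Can X ((l1 ++ l2) ++ l3) (l1 ++ (l2 ++ l3)) c ∧
    (app X l1 l2).hom ▷ tl X l3 ≫ (app X (l1 ++ l2) l3).hom ≫ c =
      (α_ _ _ _).hom ≫ tl X l1 ◁ (app X l2 l3).hom ≫ (app X l1 (l2 ++ l3)).hom := by
  induction l1 with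
  | nil =>
    refine ⟨_, Can.refl _, ?_⟩
    simp [app_nil]
  | cons i l ih =>
    obtain ⟨c, hc, h⟩ := ih
    refine ⟨_, hc.cons i, ?_⟩
    simp only [List.cons_append, app_cons, comp_whiskerRight, Category.assoc]
    have := congrArg (fun f => (α_ (X i) (tl X l) (tl X l2)).hom ▷ tl X l3 ≫
      (α_ (X i) (tl X l ⊗ tl X l2) (tl X l3)).hom ≫ X i ◁ f) h
    simp only [MonoidalCategory.whiskerLeft_comp] at this
    convert this using 1 <;> simp

theorem can_right_nil (l : List ι) : ∃ c, Can X (l ++ []) l c ∧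
    (app X l []).hom ≫ c = (ρ_ (tl X l)).hom := by
  induction l with
  | nil => exact ⟨_, Can.refl _, by simp [app_nil, unitors_equal]⟩
  | cons i l ih =>
    obtain ⟨c, hc, h⟩ := ih
    refine ⟨_, hc.cons i, ?_⟩
    simp only [app_cons, Category.assoc]
    rw [← MonoidalCategory.whiskerLeft_comp, h]
    simp

/-- Exchanging the two halves of a list. -/
theorem can_comm (l1 l2 : List ι) : ∃ c, Can X (l1 ++ l2) (l2 ++ l1) c ∧
    (app X l1 l2).hom ≫ c = (β_ _ _).hom ≫ (app X l2 l1).hom := by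
  -- One factor is moved past a whole list; the factors of `l1` are then treated one at a time.
  have key : ∀ (i : ι) (l m : List ι), ∃ c, Can X (i :: (l ++ m)) (l ++ i :: m) c ∧
      X i ◁ (app X l m).hom ≫ c = (α_ _ _ _).inv ≫ (β_ (X i) (tl X l)).hom ▷ tl X m ≫
        (α_ _ _ _).hom ≫ (app X l (i :: m)).hom := by
    intro i l m
    induction l with
    | nil => exact ⟨_, Can.refl _, by simp [app_nil]⟩
    | cons j l ih =>
      obtain ⟨c, hc, h⟩ := ih
      refine ⟨_, (Can.swap i j _).trans (hc.cons j), ?_⟩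
      have h2 := congrArg (fun f => (α_ (X i) (X j ⊗ tl X l) (tl X m)).inv ≫
        (α_ (X i) (X j) (tl X l)).inv ▷ (tl X m) ≫ ((β_ (X i) (X j)).hom ▷ tl X l) ▷ tl X m ≫
        (α_ (X j ⊗ X i) (tl X l) (tl X m)).hom ≫ (α_ (X j) (X i) (tl X l ⊗ tl X m)).hom ≫
         X j ◁ f) h
      have h3 := sw_nat (X i) (X j) (app X l m).hom
      simp only [List.append_eq, List.cons_append, app_cons, BraidedCategory.braiding_tensor_right_hom,
        comp_whiskerRight, MonoidalCategory.whiskerLeft_comp, Category.assoc] at h2 ⊢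
      rw [reassoc_of% h3]
      convert h2 using 1
      · simp only [sw]; monoidal
      · monoidal
  induction l1 with
  | nil =>
    obtain ⟨c, hc, h⟩ := can_right_nil (X := X) l2
    obtain ⟨d, hd, h1, h2⟩ := hc.symm
    refine ⟨d, hd, ?_⟩
    have : (app X l2 []).hom = (ρ_ _).hom ≫ d := by
      rw [← h, Category.assoc, h1, Category.comp_id]
    rw [this, app_nil]
    simp
  | cons i l ih =>
    obtain ⟨c, hc, h⟩ := ih
    obtain ⟨d, hd, h'⟩ := key i l2 l
    refine ⟨_, (hc.cons i).trans hd, ?_⟩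
    have h2 := congrArg (fun f => (α_ (X i) (tl X l) (tl X l2)).hom ≫ X i ◁ f) h
    simp only [MonoidalCategory.whiskerLeft_comp, Category.assoc, app_cons] at h2 ⊢
    rw [reassoc_of% h2, h', BraidedCategory.braiding_tensor_left_hom]
    simp

end Permutation

end

/-! ### Iterated products along lists of components -/

section

/-- A component of a one-dimensional manifold: an interval with labelled ends, or a circle. -/
inductive Atom (Λ : Type) : Type
  | seg (a b : Λ)
  | circ

variable {Λ : Type} {C : Type u} [Category.{v} C] [MonoidalCategory C]

variable (Λ C) in
/-- Objects and operations indexed by the components of one-dimensional manifolds. -/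
structure TrData where
  obj : Atom Λ → C
  mul (a b c : Λ) : obj (.seg a b) ⊗ obj (.seg b c) ⟶ obj (.seg a c)
  tr (a : Λ) : obj (.seg a a) ⟶ obj .circ

/-- Associativity of the operations and invariance of the traces under cyclic permutations. -/
structure TrData.IsTr [BraidedCategory C] (D : TrData Λ C) : Prop where
  assoc (a b c d : Λ) : D.mul a b c ▷ D.obj (.seg c d) ≫ D.mul a c d =
    (α_ _ _ _).hom ≫ D.obj (.seg a b) ◁ D.mul b c d ≫ D.mul a b d
  cyc (a b : Λ) : D.mul a b a ≫ D.tr a = (β_ _ _).hom ≫ D.mul b a b ≫ D.tr b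

/-- The object of a named component. -/
@[reducible]
def TrData.lab (D : TrData Λ C) (ι : Type) (p : ι × Atom Λ) : C := D.obj p.2

variable {ι κ μ : Type} (D : TrData Λ C)

/-- The iterated product along a composable list of intervals, closed up in the case of a circle. -/
inductive Chain : ∀ (l : List (ι × Atom Λ)) (t : Atom Λ), (tl (D.lab ι) l ⟶ D.obj t) → Prop
  | single (i : ι) (t : Atom Λ) : Chain [(i, t)] t (ρ_ (D.obj t)).hom
  | mul (i : ι) (a b c : Λ) {l : List (ι × Atom Λ)} {φ : tl (D.lab ι) l ⟶ D.obj (.seg b c)} :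
      Chain l (.seg b c) φ → Chain ((i, .seg a b) :: l) (.seg a c)
        (D.obj (.seg a b) ◁ φ ≫ D.mul a b c)
  | tr (a : Λ) {l : List (ι × Atom Λ)} {φ : tl (D.lab ι) l ⟶ D.obj (.seg a a)} :
      Chain l (.seg a a) φ → Chain l .circ (φ ≫ D.tr a)

variable {D}

theorem Chain.ne_nil {l : List (ι × Atom Λ)} {t : Atom Λ} {φ} (h : Chain D l t φ) : l ≠ [] := by
  induction h with
  | single => simp
  | mul => simp
  | tr _ _ ih => exact ih

theorem Chain.head {l : List (ι × Atom Λ)} {a b : Λ} {φ} (h : Chain D l (.seg a b) φ) :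
    ∃ i x m, l = (i, .seg a x) :: m := by
  cases h with
  | single i => exact ⟨i, b, [], rfl⟩
  | mul i _ x _ h => exact ⟨i, x, _, rfl⟩

/-- A multiplication has intervals on both sides, so a circle can occur only as the single entry of
a list. This case is treated apart when orders are composed. -/
theorem Chain.all_seg {l : List (ι × Atom Λ)} {t : Atom Λ} {φ} (h : Chain D l t φ) :
    (t = .circ ∧ ∃ i, l = [(i, .circ)]) ∨ ∀ p ∈ l, p.2 ≠ .circ := by
  induction h with
  | single i t =>
    cases t with
    | seg a b => right; simp
    | circ => left; exact ⟨rfl, i, rfl⟩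
  | mul i a b c h ih =>
    rcases ih with ⟨h, -⟩ | ih
    · cases h
    · right; simpa using ih
  | tr a h ih =>
    rcases ih with ⟨h, -⟩ | ih
    · cases h
    · exact Or.inr ih

/-- The first entry carries both of its labels and so fixes the label at which the rest of the
product starts. -/
theorem Chain.unique_seg {l : List (ι × Atom Λ)} {a c : Λ} {φ φ'} (h : Chain D l (.seg a c) φ)
    (h' : Chain D l (.seg a c) φ') : φ = φ' := by
  induction l generalizing a with
  | nil => exact absurd rfl h.ne_nil
  | cons p l ih =>
    cases h with
    | single i =>
      cases h' with
      | single => rfl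
      | mul _ _ _ _ h' => exact absurd rfl h'.ne_nil
    | mul i _ b _ h =>
      cases h' with
      | single => exact absurd rfl h.ne_nil
      | mul _ _ _ _ h' => rw [ih h h']

/-- For a product closed up to a circle, the label at which it is closed is the left label of the
first interval, hence determined by the list. -/
theorem Chain.unique {l : List (ι × Atom Λ)} {t : Atom Λ} {φ φ'} (h : Chain D l t φ)
    (h' : Chain D l t φ') : φ = φ' := by
  cases h with
  | single i =>
    cases h' with
    | single => rfl
    | mul _ _ _ _ h' => exact absurd rfl h'.ne_nil
    | tr a h' =>
      obtain ⟨i, x, m, e⟩ := h'.head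
      cases e
  | mul i a b c h => exact (h.mul i a b c).unique_seg h'
  | tr a h =>
    cases h' with
    | single =>
      obtain ⟨i, x, m, e⟩ := h.head
      cases e
    | tr a' h' =>
      obtain ⟨i, x, m, e⟩ := h.head
      obtain ⟨i', x', m', e'⟩ := h'.head
      rw [e] at e'
      cases e'
      rw [h.unique_seg h']

theorem Chain.append_nil {l : List (ι × Atom Λ)} {t : Atom Λ} {φ} (h : Chain D l t φ) :
    Chain D (l ++ []) t ((app _ l []).inv ≫ φ ▷ 𝟙_ C ≫ (ρ_ _).hom) := by
  induction h with
  | single i t =>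
    have : (app (D.lab ι) [(i, t)] []).inv ≫ (ρ_ (D.obj t)).hom ▷ 𝟙_ C ≫ (ρ_ _).hom =
        (ρ_ _).hom := by
      rw [Iso.inv_comp_eq, app_cons, app_nil]
      simp [unitors_equal]
    rw [this]; exact .single i t
  | @mul i a b c l φ h ih =>
    have : (app (D.lab ι) ((i, .seg a b) :: l) []).inv ≫
        (D.obj (.seg a b) ◁ φ ≫ D.mul a b c) ▷ 𝟙_ C ≫ (ρ_ _).hom =
        D.obj (.seg a b) ◁ ((app (D.lab ι) l []).inv ≫ φ ▷ 𝟙_ C ≫ (ρ_ _).hom) ≫ D.mul a b c := by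
      rw [Iso.inv_comp_eq, app_cons]
      simp
    rw [this]; exact ih.mul i a b c
  | @tr a l φ h ih =>
    have : (app (D.lab ι) l []).inv ≫ (φ ≫ D.tr a) ▷ 𝟙_ C ≫ (ρ_ _).hom =
        ((app (D.lab ι) l []).inv ≫ φ ▷ 𝟙_ C ≫ (ρ_ _).hom) ≫ D.tr a := by
      simp
    rw [this]; exact ih.tr a

theorem Chain.cons_inv {l : List (ι × Atom Λ)} (hl : l ≠ []) {i : ι} {a b c : Λ} {φ}
    (h : Chain D ((i, .seg a b) :: l) (.seg a c) φ) :
    ∃ φ', Chain D l (.seg b c) φ' ∧ φ = D.obj (.seg a b) ◁ φ' ≫ D.mul a b c := by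
  cases h with
  | single => exact absurd rfl hl
  | mul _ _ _ _ h => exact ⟨_, h, rfl⟩

variable (D) in
/-- A family of iterated products, one for each component in a list. The components of the source
that are multiplied together are subject to a condition `G`. -/
inductive Fam (G : κ × Atom Λ → List (ι × Atom Λ) → Prop) :
    ∀ (l : List (κ × Atom Λ)) (m : List (ι × Atom Λ)), (tl (D.lab ι) m ⟶ tl (D.lab κ) l) → Prop
  | nil : Fam G [] [] (𝟙 _)
  | cons (p : κ × Atom Λ) {w m : List (ι × Atom Λ)} {l : List (κ × Atom Λ)}
      {φ : tl (D.lab ι) w ⟶ D.obj p.2} {Ψ : tl (D.lab ι) m ⟶ tl (D.lab κ) l} :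
      Chain D w p.2 φ → G p w → Fam G l m Ψ → Fam G (p :: l) (w ++ m)
        ((app _ w m).inv ≫ (φ ⊗ₘ Ψ))

variable {G : κ × Atom Λ → List (ι × Atom Λ) → Prop}

theorem Fam.mono {G' : κ × Atom Λ → List (ι × Atom Λ) → Prop} {l m Ψ} (h : Fam D G l m Ψ)
    (hG : ∀ p ∈ l, ∀ w, w ⊆ m → G p w → G' p w) : Fam D G' l m Ψ := by
  induction h with
  | nil => exact .nil
  | cons p hc hg h ih =>
    exact .cons p hc (hG p (by simp) _ (by simp) hg)
      (ih fun q hq w hw => hG q (by simp [hq]) w fun x hx => List.mem_append_right _ (hw hx))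

variable [SymmetricCategory C]

/-- Generalized associativity: `hD.assoc` moves the brackets along the first list, so a product
bracketed to the right can be broken at any place. `Chain.join` is the converse. -/
theorem Chain.split (hD : D.IsTr) {l1 l2 : List (ι × Atom Λ)} {a c : Λ} {φ}
    (h : Chain D (l1 ++ l2) (.seg a c) φ) (h1 : l1 ≠ []) (h2 : l2 ≠ []) :
    ∃ b φ1 φ2, Chain D l1 (.seg a b) φ1 ∧ Chain D l2 (.seg b c) φ2 ∧
      (app _ l1 l2).hom ≫ φ = (φ1 ⊗ₘ φ2) ≫ D.mul a b c := by
  induction l1 generalizing a with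
  | nil => exact absurd rfl h1
  | cons p l1 ih =>
    obtain ⟨i, x, m, e⟩ := h.head
    obtain ⟨rfl, -⟩ := List.cons_eq_cons.1 e
    obtain ⟨φ', h', rfl⟩ := h.cons_inv (by simp [h2])
    rcases eq_or_ne l1 [] with rfl | h1'
    · refine ⟨x, _, _, .single i _, h', ?_⟩
      rw [app_cons, app_nil, MonoidalCategory.tensorHom_def]
      simp
    · obtain ⟨b, φ1, φ2, c1, c2, q⟩ := ih h' h1'
      refine ⟨b, _, φ2, c1.mul i a x b, c2, ?_⟩
      rw [app_cons, Category.assoc, ← MonoidalCategory.whiskerLeft_comp_assoc, q]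
      have := hD.assoc a x b c
      simp only [MonoidalCategory.tensorHom_def, comp_whiskerRight, Category.assoc,
        MonoidalCategory.whiskerLeft_comp] at this ⊢
      rw [← whisker_exchange_assoc, this]
      simp

theorem Chain.join (hD : D.IsTr) {l1 l2 : List (ι × Atom Λ)} {a b c : Λ} {φ1 φ2}
    (h1 : Chain D l1 (.seg a b) φ1) (h2 : Chain D l2 (.seg b c) φ2) :
    Chain D (l1 ++ l2) (.seg a c) ((app _ l1 l2).inv ≫ (φ1 ⊗ₘ φ2) ≫ D.mul a b c) := by
  induction l1 generalizing a with
  | nil => exact absurd rfl h1.ne_nil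
  | cons p l1 ih =>
    obtain ⟨i, x, m, e⟩ := h1.head
    obtain ⟨rfl, -⟩ := List.cons_eq_cons.1 e
    rcases eq_or_ne l1 [] with rfl | h1'
    · cases h1 with
      | single =>
        have : (app _ [(i, .seg a b)] l2).inv ≫ ((ρ_ (D.obj (.seg a b))).hom ⊗ₘ φ2) ≫ D.mul a b c =
            D.obj (.seg a b) ◁ φ2 ≫ D.mul a b c := by
          rw [Iso.inv_comp_eq, app_cons, app_nil, MonoidalCategory.tensorHom_def]
          simp
        rw [this]; exact h2.mul i a b c
      | mul _ _ _ _ h => exact absurd rfl h.ne_nil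
    · obtain ⟨φ', h', rfl⟩ := h1.cons_inv h1'
      have : (app _ ((i, .seg a x) :: l1) l2).inv ≫
          ((D.obj (.seg a x) ◁ φ' ≫ D.mul a x b) ⊗ₘ φ2) ≫ D.mul a b c =
          D.obj (.seg a x) ◁ ((app _ l1 l2).inv ≫ (φ' ⊗ₘ φ2) ≫ D.mul x b c) ≫ D.mul a x c := by
        rw [Iso.inv_comp_eq, app_cons]
        have := hD.assoc a x b c
        simp only [MonoidalCategory.tensorHom_def, comp_whiskerRight, Category.assoc,
          MonoidalCategory.whiskerLeft_comp] at this ⊢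
        rw [← whisker_exchange_assoc, this, whiskerLeft_hom_inv_assoc]
        simp
      rw [this]; exact (ih h').mul i a x c

/-- Rotating a list of intervals does not change the value of the closed-up product. -/
theorem Chain.rotate (hD : D.IsTr) {l1 l2 : List (ι × Atom Λ)} (hl1 : l1 ≠ []) (hl2 : l2 ≠ [])
    {φ} (h : Chain D (l1 ++ l2) .circ φ) :
    ∃ c ψ, Can (D.lab ι) (l1 ++ l2) (l2 ++ l1) c ∧ Chain D (l2 ++ l1) .circ ψ ∧ φ = c ≫ ψ := by
  generalize hl : l1 ++ l2 = l at φ h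
  cases h with
  | single =>
    have := congrArg List.length hl
    have h1 := List.length_pos_iff.2 hl1
    have h2 := List.length_pos_iff.2 hl2
    simp at this; omega
  | tr a h =>
    subst hl
    -- Break the product where the list is cut, exchange the two parts by `hD.cyc`, and join them in
    -- the other order.
    obtain ⟨b, φ1, φ2, c1, c2, q⟩ := h.split hD hl1 hl2
    obtain ⟨c, hc, q'⟩ := can_comm (X := D.lab ι) l1 l2
    refine ⟨c, _, hc, (c2.join hD c1).tr b, ?_⟩
    rw [← cancel_epi (app _ l1 l2).hom, reassoc_of% q, reassoc_of% q', hD.cyc a b, Category.assoc,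
      Iso.hom_inv_id_assoc]
    simp

theorem can_assoc' {X : ι → C} (l1 l2 l3 : List ι) :
    ∃ c, Can X (l1 ++ (l2 ++ l3)) ((l1 ++ l2) ++ l3) c ∧
    tl X l1 ◁ (app X l2 l3).hom ≫ (app X l1 (l2 ++ l3)).hom ≫ c =
      (α_ _ _ _).inv ≫ (app X l1 l2).hom ▷ tl X l3 ≫ (app X (l1 ++ l2) l3).hom := by
  obtain ⟨c, hc, h⟩ := can_assoc (X := X) l1 l2 l3
  obtain ⟨d, hd, h1, h2⟩ := hc.symm
  refine ⟨d, hd, ?_⟩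
  rw [Iso.eq_inv_comp, ← reassoc_of% h, h1, Category.comp_id]

/-- Concatenating the source lists reassociates them. This is recorded by a canonical isomorphism
`c` rather than by an equality of lists, along which morphisms would have to be transported;
`Fam.split` does the same. -/
theorem Fam.append {l l' : List (κ × Atom Λ)} {m m' : List (ι × Atom Λ)} {Ψ Ψ'}
    (h : Fam D G l m Ψ) (h' : Fam D G l' m' Ψ') :
    ∃ n c Φ, Fam D G (l ++ l') n Φ ∧ Can (D.lab ι) (m ++ m') n c ∧ appHom Ψ Ψ' = c ≫ Φ := by
  induction h with
  | nil => exact ⟨m', _, _, h', Can.refl _, by simp [appHom, app_nil]⟩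
  | @cons p w m l φ Ψ hc hg h ih =>
    obtain ⟨n, c, Φ, hf, hn, q⟩ := ih
    obtain ⟨d, hd, q'⟩ := can_assoc (X := D.lab ι) w m m'
    refine ⟨_, _, _, .cons p hc hg hf, hd.trans (hn.append_left w), ?_⟩
    rw [appHom, Iso.inv_comp_eq] at q
    rw [appHom, Iso.inv_comp_eq, ← cancel_epi ((app _ w m).hom ▷ _)]
    simp only [Category.assoc, List.cons_append]
    rw [reassoc_of% q', appHom]
    simp only [Category.assoc, Iso.hom_inv_id_assoc, tensorHom_comp_tensorHom, app_cons]
    simp only [whiskerLeft_comp_tensorHom]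
    rw [Category.id_comp, ← q]
    simp [MonoidalCategory.tensorHom_def]

theorem sw_nat3 {a b Z a' b' Z' : C} (f : a ⟶ a') (g : b ⟶ b') (h : Z ⟶ Z') :
    (f ⊗ₘ (g ⊗ₘ h)) ≫ sw a' b' Z' = sw a b Z ≫ (g ⊗ₘ (f ⊗ₘ h)) := by
  simp only [sw, Category.assoc, associator_inv_naturality_assoc, ← associator_naturality]
  simp only [← tensorHom_id, tensorHom_comp_tensorHom_assoc, BraidedCategory.braiding_naturality,
    Category.comp_id, Category.id_comp]

/-- Two components of the target that change places carry whole blocks of factors with them; this is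
the exchange of the blocks. -/
theorem can_swap {X : ι → C} (l1 l2 l3 : List ι) :
    ∃ c, Can X (l1 ++ (l2 ++ l3)) (l2 ++ (l1 ++ l3)) c ∧
    tl X l1 ◁ (app X l2 l3).hom ≫ (app X l1 (l2 ++ l3)).hom ≫ c =
      sw _ _ _ ≫ tl X l2 ◁ (app X l1 l3).hom ≫ (app X l2 (l1 ++ l3)).hom := by
  obtain ⟨c1, h1, q1⟩ := can_assoc' (X := X) l1 l2 l3
  obtain ⟨c2, h2, q2⟩ := can_comm (X := X) l1 l2
  obtain ⟨c3, h3, q3⟩ := can_assoc (X := X) l2 l1 l3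
  refine ⟨_, h1.trans ((h2.append_right l3).trans h3), ?_⟩
  rw [reassoc_of% q1, reassoc_of% (app_appHom c2 (𝟙 (tl X l3))), tensorHom_id,
    ← comp_whiskerRight_assoc, q2, comp_whiskerRight_assoc, q3]
  simp [sw]

/-- Families of iterated products are compatible with permutations of the components of the
target. -/
theorem Fam.can {l l' : List (κ × Atom Λ)} {c} (hc : Can (D.lab κ) l l' c)
    {m : List (ι × Atom Λ)} {Ψ} (h : Fam D G l m Ψ) :
    ∃ m' c' Ψ', Fam D G l' m' Ψ' ∧ Can (D.lab ι) m m' c' ∧ Ψ ≫ c = c' ≫ Ψ' := by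
  induction hc generalizing m with
  | nil => exact ⟨_, _, _, h, Can.refl _, by simp⟩
  | cons p hc ih =>
    cases h with
    | cons _ hw hg h =>
      obtain ⟨m', c', Ψ', h1, h2, q⟩ := ih h
      refine ⟨_, _, _, .cons p hw hg h1, h2.append_left _, ?_⟩
      simp only [appHom, Category.assoc, Iso.hom_inv_id_assoc]
      rw [MonoidalCategory.id_tensorHom, whiskerLeft_comp_tensorHom, ← q]
      simp [MonoidalCategory.tensorHom_def]
  | swap p q l =>
    cases h with
    | @cons _ w m _ φ Ψ hw hg h =>
      cases h with
      | @cons _ w' m _ φ' Ψ hw' hg' h =>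
        obtain ⟨c, hc, e⟩ := can_swap (X := D.lab ι) w w' m
        refine ⟨_, c, _, .cons q hw' hg' (.cons p hw hg h), hc, ?_⟩
        rw [← cancel_epi (app _ w (w' ++ m)).hom, ← cancel_epi (tl (D.lab ι) w ◁ (app _ w' m).hom),
          reassoc_of% e]
        simp only [Iso.hom_inv_id_assoc, Category.assoc, whiskerLeft_comp_tensorHom_assoc,
          whiskerLeft_comp_tensorHom]
        exact sw_nat3 _ _ _
  | trans h1 h2 ih1 ih2 =>
    obtain ⟨m', c', Ψ', g1, g2, q⟩ := ih1 h
    obtain ⟨m2, c2, Ψ2, g3, g4, q2⟩ := ih2 g1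
    exact ⟨_, _, _, g3, g2.trans g4, by rw [reassoc_of% q, q2, Category.assoc]⟩

theorem Fam.split {l l' : List (κ × Atom Λ)} {m : List (ι × Atom Λ)} {Ψ}
    (h : Fam D G (l ++ l') m Ψ) :
    ∃ m1 m2 Ψ1 Ψ2 c, Fam D G l m1 Ψ1 ∧ Fam D G l' m2 Ψ2 ∧ Can (D.lab ι) m (m1 ++ m2) c ∧
      Ψ = c ≫ appHom Ψ1 Ψ2 := by
  induction l generalizing m with
  | nil => exact ⟨[], m, _, _, _, .nil, h, Can.refl _, by simp [appHom, app_nil]⟩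
  | cons p l ih =>
    cases h with
    | @cons _ w m _ φ Ψ hw hg h =>
      obtain ⟨m1, m2, Ψ1, Ψ2, c, h1, h2, hc, rfl⟩ := ih h
      obtain ⟨d, hd, q⟩ := can_assoc' (X := D.lab ι) w m1 m2
      refine ⟨_, _, _, _, _, .cons p hw hg h1, h2, (hc.append_left w).trans hd, ?_⟩
      rw [← cancel_epi (app _ w m).hom, Category.assoc, reassoc_of% (app_appHom (𝟙 (tl _ w)) c),
        Iso.hom_inv_id_assoc, MonoidalCategory.id_tensorHom]
      rw [← whiskerLeft_comp_tensorHom]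
      congr 1
      rw [← cancel_epi (tl (D.lab ι) w ◁ (app _ m1 m2).hom), reassoc_of% q]
      erw [app_appHom]
      simp only [app_cons, appHom, whiskerLeft_comp_tensorHom, Iso.hom_inv_id_assoc,
        whiskerRight_comp_tensorHom_assoc, associator_naturality_assoc, Iso.inv_hom_id_assoc]
      simp [MonoidalCategory.tensorHom_def]

/-- An iterated product of iterated products. -/
theorem Chain.comp (hD : D.IsTr) {l : List (κ × Atom Λ)} {t : Atom Λ} {φ} (h : Chain D l t φ)
    {m : List (ι × Atom Λ)} {Ψ} (h' : Fam D G l m Ψ) : Chain D m t (Ψ ≫ φ) := by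
  induction h generalizing m with
  | single i t =>
    cases h' with
    | @cons _ w _ _ φ _ hw _ h' =>
      cases h' with
      | nil =>
        have := hw.append_nil
        simpa [MonoidalCategory.tensorHom_def] using this
  | mul i a b c h ih =>
    cases h' with
    | @cons _ w _ _ φ _ hw _ h' =>
      have := hw.join hD (ih h')
      simpa [MonoidalCategory.tensorHom_def] using this
  | tr a h ih =>
    have := (ih h').tr a
    simpa using this

/-- Composition of families of iterated products. -/
theorem Fam.comp (hD : D.IsTr) {G' : μ × Atom Λ → List (κ × Atom Λ) → Prop}
    {G'' : μ × Atom Λ → List (ι × Atom Λ) → Prop}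
    {l : List (μ × Atom Λ)} {m : List (κ × Atom Λ)} {Ψ} (h : Fam D G' l m Ψ)
    (hG : ∀ p ∈ l, ∀ w n φ Φ, w ⊆ m → Chain D w p.2 φ → G' p w → Fam D G w n Φ → G'' p n)
    {n : List (ι × Atom Λ)} {Φ} (h' : Fam D G m n Φ) :
    ∃ n' c Φ', Fam D G'' l n' Φ' ∧ Can (D.lab ι) n n' c ∧ Φ ≫ Ψ = c ≫ Φ' := by
  induction h generalizing n with
  | nil =>
    cases h' with
    | nil => exact ⟨_, _, _, .nil, .nil, by simp⟩
  | cons p hw hg h ih =>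
    obtain ⟨n1, n2, Φ1, Φ2, c, h1, h2, hc, rfl⟩ := h'.split
    obtain ⟨n', d, Φ', h3, hd, q⟩ := ih
      (fun p hp w n φ Φ hw => hG p (by simp [hp]) w n φ Φ
        fun x hx => List.mem_append_right _ (hw hx)) h2
    refine ⟨_, _, _, .cons p (hw.comp hD h1) (hG p (by simp) _ _ _ _ (by simp) hw hg h1) h3,
      hc.trans (hd.append_left n1), ?_⟩
    simp only [appHom, Category.assoc, Iso.hom_inv_id_assoc, tensorHom_comp_tensorHom,
      Category.id_comp, q]

open Classical in
/-- The value of a family of iterated products is determined up to permutation, if the position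
of each factor is. -/
theorem Fam.unique {G' : κ × Atom Λ → List (ι × Atom Λ) → Prop} (comp : ι → κ)
    (h1 : ∀ p w, G p w → ∀ i ∈ w, comp i.1 = p.1) (h1' : ∀ p w, G' p w → ∀ i ∈ w, comp i.1 = p.1)
    (h2 : ∀ p w w' φ φ', G p w → G' p w' → w.Perm w' → Chain D w p.2 φ → Chain D w' p.2 φ' →
      ∃ c, Can (D.lab ι) w w' c ∧ φ = c ≫ φ')
    {l : List (κ × Atom Λ)} (hl : (l.map Prod.fst).Nodup) {m m' : List (ι × Atom Λ)} {Ψ Ψ'}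
    (h : Fam D G l m Ψ) (h' : Fam D G' l m' Ψ') (hm : m.Perm m') :
    ∃ c, Can (D.lab ι) m m' c ∧ Ψ = c ≫ Ψ' := by
  have mem : ∀ {G : κ × Atom Λ → List (ι × Atom Λ) → Prop},
      (∀ p w, G p w → ∀ i ∈ w, comp i.1 = p.1) → ∀ {l : List (κ × Atom Λ)} {m Ψ}, Fam D G l m Ψ →
      ∀ i ∈ m, comp i.1 ∈ l.map Prod.fst := by
    intro G hG l m Ψ h
    induction h with
    | nil => simp
    | cons p hw hg h ih =>
      intro i hi
      rcases List.mem_append.1 hi with hi | hi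
      · simp [hG _ _ hg i hi]
      · exact List.mem_cons_of_mem _ (ih i hi)
  -- The factors of the first product are those whose name is sent to `p.1` by `comp`. Filtering
  -- recovers them, so a permutation of the whole source list restricts to one of `w`.
  have filt : ∀ {G : κ × Atom Λ → List (ι × Atom Λ) → Prop},
      (∀ p w, G p w → ∀ i ∈ w, comp i.1 = p.1) → ∀ {p : κ × Atom Λ} {w} {l : List (κ × Atom Λ)}
      {m Ψ}, Fam D G l m Ψ → G p w → p.1 ∉ l.map Prod.fst →
      (w ++ m).filter (fun i => comp i.1 = p.1) = w := by
    intro G hG p w l m Ψ h hg hp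
    rw [List.filter_append, List.filter_eq_self.2, List.filter_eq_nil_iff.2, List.append_nil]
    · intro i hi hc
      exact hp (of_decide_eq_true hc ▸ mem hG h i hi)
    · intro i hi
      exact decide_eq_true (hG _ _ hg i hi)
  induction h generalizing m' with
  | nil =>
    cases h' with
    | nil => exact ⟨_, .nil, by simp⟩
  | @cons p w m l φ Ψ hw hg h ih =>
    cases h' with
    | @cons _ w' m' _ φ' Ψ' hw' hg' h' =>
      have hp : p.1 ∉ l.map Prod.fst := (List.nodup_cons.1 hl).1
      have e : w.Perm w' := by
        have := hm.filter (fun i => comp i.1 = p.1)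
        rwa [filt h1 h hg hp, filt h1' h' hg' hp] at this
      have e' : m.Perm m' :=
        (List.perm_append_left_iff w).1 (hm.trans (e.symm.append_right m'))
      obtain ⟨c, hc, rfl⟩ := h2 p w w' φ φ' hg hg' e hw hw'
      obtain ⟨d, hd, rfl⟩ := ih (List.nodup_cons.1 hl).2 h' e'
      refine ⟨_, hc.append hd, ?_⟩
      simp [appHom]

end

/-! ### Words in intervals and circles, and normal forms -/

section

variable {Λ : Type}

/-- An interval or a circle, as a manifold. -/
@[reducible]
def Atom.mfd : Atom Λ → Mfd Λ
  | .seg a b => Mfd.interval a b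
  | .circ => Mfd.circle Λ

variable (Λ) in
/-- Bracketed disjoint unions of intervals and circles. -/
inductive Word : Type
  | unit
  | atom (t : Atom Λ)
  | tensor (V W : Word)

namespace Word

/-- The manifold described by a word. -/
@[reducible]
def mfd : Word Λ → Mfd Λ
  | unit => 𝟙_ (Mfd Λ)
  | atom t => t.mfd
  | tensor V W => V.mfd ⊗ W.mfd

/-- The set of components. -/
@[reducible]
def Pos : Word Λ → Type
  | unit => Empty
  | atom _ => Unit
  | tensor V W => V.Pos ⊕ W.Pos

/-- The component of a point. -/
def comp : ∀ W : Word Λ, W.mfd.carrier → W.Pos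
  | unit => fun x => Empty.elim x
  | atom _ => fun _ => ()
  | tensor V W => Sum.map V.comp W.comp

/-- The coordinate of a point in its component. -/
def coord : ∀ W : Word Λ, W.mfd.carrier → ℝ
  | unit => fun x => Empty.elim x
  | atom (.seg _ _) => fun x : unitInterval => (x : ℝ)
  | atom .circ => fun x : Circ => (AddCircle.equivIco (1 : ℝ) 0 x : ℝ)
  | tensor V W => Sum.elim V.coord W.coord

/-- The parametrization of a component by the unit interval. -/
def arc : ∀ W : Word Λ, W.Pos → unitInterval → W.mfd.carrier
  | unit => fun i => Empty.elim i
  | atom (.seg _ _) => fun _ x => x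
  | atom .circ => fun _ x => wrap x
  | tensor V W => fun i x => match i with
    | Sum.inl i => Sum.inl (V.arc i x)
    | Sum.inr i => Sum.inr (W.arc i x)

/-- The type of a component. -/
def typ : ∀ W : Word Λ, W.Pos → Atom Λ
  | unit => fun i => Empty.elim i
  | atom t => fun _ => t
  | tensor V W => Sum.elim V.typ W.typ

/-- The list of components, with given names. -/
@[reducible]
def enum {ι : Type} : ∀ W : Word Λ, (W.Pos → ι) → List (ι × Atom Λ)
  | unit => fun _ => []
  | atom t => fun r => [(r (), t)]
  | tensor V W => fun r => V.enum (fun i => r (Sum.inl i)) ++ W.enum (fun i => r (Sum.inr i))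

theorem mem_enum {ι : Type} {W : Word Λ} {r : W.Pos → ι} {p : ι × Atom Λ} :
    p ∈ W.enum r ↔ ∃ i, p = (r i, W.typ i) := by
  induction W with
  | unit => simp
  | atom t =>
    constructor
    · intro h
      exact ⟨(), List.mem_singleton.1 h⟩
    · rintro ⟨i, h⟩
      exact List.mem_singleton.2 h
  | tensor V W hV hW =>
    rw [List.mem_append, hV, hW]
    constructor
    · rintro (⟨i, h⟩ | ⟨i, h⟩)
      · exact ⟨Sum.inl i, h⟩
      · exact ⟨Sum.inr i, h⟩
    · rintro ⟨i | i, h⟩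
      · exact Or.inl ⟨i, h⟩
      · exact Or.inr ⟨i, h⟩

theorem enum_nodup {ι : Type} {W : Word Λ} {r : W.Pos → ι} (hr : Function.Injective r) :
    ((W.enum r).map Prod.fst).Nodup := by
  induction W with
  | unit => exact List.nodup_nil
  | atom t => exact List.nodup_singleton _
  | tensor V W hV hW =>
    rw [List.map_append, List.nodup_append]
    refine ⟨hV fun i j h => Sum.inl_injective (hr h), hW fun i j h => Sum.inr_injective (hr h), ?_⟩
    intro a ha b hb
    obtain ⟨p, hp, rfl⟩ := List.mem_map.1 ha
    obtain ⟨q, hq, rfl⟩ := List.mem_map.1 hb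
    obtain ⟨i, rfl⟩ := mem_enum.1 hp
    obtain ⟨j, rfl⟩ := mem_enum.1 hq
    intro h
    cases hr h

end Word

/-- Two morphisms are joined by a smooth family. -/
def Isotopic {S T : Mfd Λ} (f g : S ⟶ T) : Prop :=
  ∃ σ : stdSimplex ℝ (Fin 2) → (S ⟶ T), Mfd.IsSmoothFamily (k := 1) σ ∧
    σ (stdSimplex.vertex 0) = f ∧ σ (stdSimplex.vertex 1) = g

variable {C : Type u} [Category.{v} C] [MonoidalCategory C]

/-- The tensor product described by a word. -/
@[reducible]
def TrData.ev (D : TrData Λ C) : Word Λ → C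
  | .unit => 𝟙_ C
  | .atom t => D.obj t
  | .tensor V W => D.ev V ⊗ D.ev W

/-- The tensor product described by a word, as the tensor product of its list of components. -/
def TrData.flat (D : TrData Λ C) {ι : Type} :
    ∀ (W : Word Λ) (r : W.Pos → ι), D.ev W ≅ tl (D.lab ι) (W.enum r)
  | .unit, _ => Iso.refl _
  | .atom t, _ => (ρ_ (D.obj t)).symm
  | .tensor V W, r => (D.flat V (fun i => r (Sum.inl i)) ⊗ᵢ D.flat W (fun i => r (Sum.inr i))) ≪≫
      app _ _ _

theorem TrData.flat_tensor (D : TrData Λ C) {ι : Type} (V W : Word Λ) (r : (V.tensor W).Pos → ι) :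
    (D.flat (.tensor V W) r).hom = ((D.flat V (fun i => r (Sum.inl i))).hom ⊗ₘ
      (D.flat W (fun i => r (Sum.inr i))).hom) ≫ (app (D.lab ι) _ _).hom := rfl

theorem TrData.flat_atom (D : TrData Λ C) {ι : Type} (t : Atom Λ) (r : (Word.atom t).Pos → ι) :
    (D.flat (.atom t) r).hom = (ρ_ (D.obj t)).inv := rfl

theorem TrData.flat_unit (D : TrData Λ C) {ι : Type} (r : (Word.unit (Λ := Λ)).Pos → ι) :
    (D.flat .unit r).hom = 𝟙 _ := rfl

section app

variable {ι : Type}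

/-- This and the next four lemmas concern arbitrary objects and morphisms instead of `D.flat`, so
that the cases of the generators in `N` follow from them by unification. -/
theorem assoc_app {A A' A'' : C} {X : ι → C} {l1 l2 l3 : List ι} (f : A ⟶ tl X l1)
    (g : A' ⟶ tl X l2) (h : A'' ⟶ tl X l3) {c}
    (e : (app X l1 l2).hom ▷ tl X l3 ≫ (app X (l1 ++ l2) l3).hom ≫ c =
      (α_ _ _ _).hom ≫ tl X l1 ◁ (app X l2 l3).hom ≫ (app X l1 (l2 ++ l3)).hom) :
    (α_ A A' A'').hom ≫ (f ⊗ₘ ((g ⊗ₘ h) ≫ (app X l2 l3).hom)) ≫ (app X l1 (l2 ++ l3)).hom =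
      ((((f ⊗ₘ g) ≫ (app X l1 l2).hom) ⊗ₘ h) ≫ (app X (l1 ++ l2) l3).hom) ≫ c := by
  rw [← tensorHom_comp_whiskerLeft_assoc, ← tensorHom_comp_whiskerRight_assoc]
  simp only [Category.assoc]
  rw [e, associator_naturality_assoc]

theorem runitInv_app {A : C} {X : ι → C} {l : List ι} (f : A ⟶ tl X l) {c d}
    (e : (app X l []).hom ≫ c = (ρ_ (tl X l)).hom) (h : c ≫ d = 𝟙 _) :
    (ρ_ A).inv ≫ (f ⊗ₘ 𝟙 _) ≫ (app X l []).hom = f ≫ d := by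
  rw [tensorHom_id, ← rightUnitor_inv_naturality_assoc]
  congr 1
  rw [Iso.inv_comp_eq, ← e, Category.assoc, h, Category.comp_id]

theorem runit_app {A : C} {X : ι → C} {l : List ι} (f : A ⟶ tl X l) {c}
    (e : (app X l []).hom ≫ c = (ρ_ (tl X l)).hom) :
    (ρ_ A).hom ≫ f = ((f ⊗ₘ 𝟙 _) ≫ (app X l []).hom) ≫ c := by
  rw [Category.assoc, e, tensorHom_id, rightUnitor_naturality]

theorem glue_app {X : ι → C} {Z : C} {i j : ι} (m : X i ⊗ X j ⟶ Z) :
    m ≫ (ρ_ Z).inv = (((ρ_ (X i)).inv ⊗ₘ (ρ_ (X j)).inv) ≫ (app X [i] [j]).hom) ≫ 𝟙 _ ≫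
      (app X [i, j] []).inv ≫ ((X i ◁ (ρ_ (X j)).hom ≫ m) ⊗ₘ 𝟙 (𝟙_ C)) := by
  rw [app_cons, app_cons_inv, app_cons_inv, app_nil, app_nil]
  simp [MonoidalCategory.tensorHom_def]

theorem close_app {X : ι → C} {Z : C} {i : ι} (m : X i ⟶ Z) :
    m ≫ (ρ_ Z).inv = (ρ_ (X i)).inv ≫ 𝟙 _ ≫
      (app X [i] []).inv ≫ (((ρ_ (X i)).hom ≫ m) ⊗ₘ 𝟙 (𝟙_ C)) := by
  rw [app_cons_inv, app_nil]
  simp [MonoidalCategory.tensorHom_def]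

end app

variable [SymmetricCategory C]

/-- The pairs of a morphism of cobordisms and a morphism of `C` that are built in the same way from
the structure morphisms, gluing and closing, up to isotopy. -/
inductive R (D : TrData Λ C) : ∀ V W : Word Λ, (V.mfd ⟶ W.mfd) → (D.ev V ⟶ D.ev W) → Prop
  | id (V : Word Λ) : R D V V (𝟙 _) (𝟙 _)
  | comp {U V W : Word Λ} {f : U.mfd ⟶ V.mfd} {g : V.mfd ⟶ W.mfd} {φ ψ} :
      R D U V f φ → R D V W g ψ → R D U W (f ≫ g) (φ ≫ ψ)
  | tensor {V V' W W' : Word Λ} {f : V.mfd ⟶ W.mfd} {g : V'.mfd ⟶ W'.mfd} {φ ψ} :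
      R D V W f φ → R D V' W' g ψ → R D (.tensor V V') (.tensor W W') (f ⊗ₘ g) (φ ⊗ₘ ψ)
  | assoc (U V W : Word Λ) : R D (.tensor (.tensor U V) W) (.tensor U (.tensor V W))
      (α_ _ _ _).hom (α_ _ _ _).hom
  | runit (V : Word Λ) : R D (.tensor V .unit) V (ρ_ _).hom (ρ_ _).hom
  | runitInv (V : Word Λ) : R D V (.tensor V .unit) (ρ_ _).inv (ρ_ _).inv
  | braid (V W : Word Λ) : R D (.tensor V W) (.tensor W V) (β_ _ _).hom (β_ _ _).hom
  | glue (a b c : Λ) : R D (.tensor (.atom (.seg a b)) (.atom (.seg b c))) (.atom (.seg a c))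
      (Mfd.glue a b c) (D.mul a b c)
  | close (a : Λ) : R D (.atom (.seg a a)) (.atom .circ) (Mfd.close a) (D.tr a)
  | isotopy {V W : Word Λ} {f g : V.mfd ⟶ W.mfd} {φ} :
      R D V W f φ → Isotopic f g → R D V W g φ

/-- By the hexagon and symmetry, the inverse associator is a composite of associators and
symmetries. Therefore `R` needs no generator for it; the left unitor is treated likewise in
`lunit_eq`. -/
theorem assoc_inv_eq (A B E : C) : (α_ A B E).inv = (β_ A (B ⊗ E)).hom ≫ (α_ B E A).hom ≫
    (β_ B (E ⊗ A)).hom ≫ (α_ E A B).hom ≫ (β_ E (A ⊗ B)).hom := by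
  rw [← Category.comp_id (α_ A B E).inv, Iso.inv_comp_eq, reassoc_of% (BraidedCategory.hexagon_forward A B E),
    BraidedCategory.braiding_naturality_right_assoc]
  simp only [BraidedCategory.braiding_tensor_right_hom, Category.assoc, Iso.hom_inv_id_assoc,
    Iso.inv_hom_id_assoc, ← comp_whiskerRight_assoc, SymmetricCategory.symmetry, id_whiskerRight,
    Category.id_comp, ← MonoidalCategory.whiskerLeft_comp_assoc, whiskerLeft_id]
  simp

theorem lunit_eq (A : C) : (λ_ A).hom = (β_ _ _).hom ≫ (ρ_ A).hom := by simp

variable {D : TrData Λ C}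

theorem R.assocInv (U V W : Word Λ) : R D (.tensor U (.tensor V W)) (.tensor (.tensor U V) W)
    (α_ _ _ _).inv (α_ _ _ _).inv := by
  rw [assoc_inv_eq, assoc_inv_eq]
  exact (R.braid U (.tensor V W)).comp ((R.assoc V W U).comp ((R.braid V (.tensor W U)).comp
    ((R.assoc W U V).comp (R.braid W (.tensor U V)))))

theorem R.lunit (V : Word Λ) : R D (.tensor .unit V) V (λ_ _).hom (λ_ _).hom := by
  rw [lunit_eq, lunit_eq]
  exact (R.braid .unit V).comp (R.runit V)

/-- The condition that a list of names is that of the intervals and circles mapped to the component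
with a given name, in their linear or cyclic order. -/
def Geo {ι κ : Type} (Q : ι → κ → ℝ → Prop) (p : κ × Atom Λ) (w : List (ι × Atom Λ)) : Prop :=
  ∃ xs : List ℝ, List.Forall₂ (fun i x => Q i.1 p.1 x) w xs ∧
    match p.2 with
    | .seg _ _ => xs.Pairwise (· < ·)
    | .circ => ∃ y : ℝ, xs.Pairwise fun x x' => Int.fract (x - y) < Int.fract (x' - y)

theorem geo_single {ι κ : Type} {Q : ι → κ → ℝ → Prop} {p : κ × Atom Λ} {q : ι × Atom Λ} {x : ℝ}
    (h : Q q.1 p.1 x) : Geo Q p [q] := by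
  refine ⟨[x], by simpa using h, ?_⟩
  rcases p with ⟨k, _ | _⟩ <;> simp

/-- A morphism is a family of iterated products, up to a permutation of the factors. -/
def NF (D : TrData Λ C) {ι κ : Type} (Q : ι → κ → ℝ → Prop) {V : Word Λ} (r : V.Pos → ι)
    (L : List (κ × Atom Λ)) (φ : D.ev V ⟶ tl (D.lab κ) L) : Prop :=
  ∃ m Ψ c, Fam D (Geo Q) L m Ψ ∧ Can (D.lab ι) (V.enum r) m c ∧ φ = (D.flat V r).hom ≫ c ≫ Ψ

section NF

variable {ι κ : Type} {Q : ι → κ → ℝ → Prop}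

theorem NF.append {V W : Word Λ} {r : (V.tensor W).Pos → ι} {L L' : List (κ × Atom Λ)} {φ ψ}
    (h : NF D Q (V := V) (fun i => r (Sum.inl i)) L φ)
    (h' : NF D Q (V := W) (fun i => r (Sum.inr i)) L' ψ) :
    NF D Q (V := V.tensor W) r (L ++ L') ((φ ⊗ₘ ψ) ≫ (app _ L L').hom) := by
  obtain ⟨m, Ψ, c, hf, hc, rfl⟩ := h
  obtain ⟨m', Ψ', c', hf', hc', rfl⟩ := h'
  obtain ⟨n, d, Φ, hf2, hd, q⟩ := hf.append hf'
  refine ⟨n, Φ, _, hf2, (hc.append hc').trans hd, ?_⟩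
  rw [Category.assoc, ← q, TrData.flat_tensor, Category.assoc,
    reassoc_of% (app_appHom c c'), app_appHom, tensorHom_comp_tensorHom_assoc,
    tensorHom_comp_tensorHom_assoc, Category.assoc, Category.assoc]

theorem NF.pre_can {V V' : Word Λ} {r : V.Pos → ι} {r' : V'.Pos → ι} {L : List (κ × Atom Λ)} {φ}
    (h : NF D Q r L φ) {θ : D.ev V' ⟶ D.ev V} {c} (hc : Can (D.lab ι) (V'.enum r') (V.enum r) c)
    (hθ : θ ≫ (D.flat V r).hom = (D.flat V' r').hom ≫ c) : NF D Q r' L (θ ≫ φ) := by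
  obtain ⟨m, Ψ, d, hf, hd, rfl⟩ := h
  exact ⟨m, Ψ, _, hf, hc.trans hd, by rw [reassoc_of% hθ, Category.assoc]⟩

theorem NF.id {V : Word Λ} {r : V.Pos → ι} {r' : V.Pos → κ} (h : ∀ i, ∃ x, Q (r i) (r' i) x) :
    NF D Q r (V.enum r') (D.flat V r').hom := by
  induction V with
  | unit => exact ⟨_, _, _, .nil, .nil, by rw [TrData.flat_unit, TrData.flat_unit]; simp⟩
  | atom t =>
    obtain ⟨x, hx⟩ := h ()
    refine ⟨_, _, _, .cons (r' (), t) (.single (r ()) t) (geo_single hx) .nil, Can.refl _, ?_⟩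
    rw [TrData.flat_atom, TrData.flat_atom, app_cons_inv, app_nil]
    simp [MonoidalCategory.tensorHom_def]
  | tensor V W hV hW =>
    exact NF.append (hV fun i => h (Sum.inl i)) (hW fun i => h (Sum.inr i))

end NF

/-- The normal form of the morphism of `C` associated with a morphism of cobordisms: it multiplies
the factors in the order in which the components of the source appear in the target. -/
def N (D : TrData Λ C) (V W : Word Λ) (f : V.mfd ⟶ W.mfd) (φ : D.ev V ⟶ D.ev W) : Prop :=
  ∀ (ι κ : Type) (r : V.Pos → ι) (r' : W.Pos → κ) (Q : ι → κ → ℝ → Prop), Function.Injective r' →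
    (∀ i, Q (r i) (r' (W.comp (f.toFun (V.arc i 0)))) (W.coord (f.toFun (V.arc i 0)))) →
    NF D Q r (W.enum r') (φ ≫ (D.flat W r').hom)

namespace N

variable {ι : Type}

/-- The common form of the structural generators, which only permute factors: `s` assigns to each
component of the target the unique component of the source lying over it, and each product has a
single factor. -/
theorem perm {V W : Word Λ} {f : V.mfd ⟶ W.mfd} {θ : D.ev V ⟶ D.ev W} (s : W.Pos → V.Pos)
    (hs : ∀ i, W.comp (f.toFun (V.arc (s i) 0)) = i)
    (h : ∀ (ι : Type) (r : V.Pos → ι), ∃ c, Can (D.lab ι) (V.enum r) (W.enum fun i => r (s i)) c ∧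
      θ ≫ (D.flat W fun i => r (s i)).hom = (D.flat V r).hom ≫ c) : N D V W f θ := by
  intro ι κ r r' Q hr' hQ
  obtain ⟨c, hc, e⟩ := h ι r
  have hid : ∀ i, ∃ x, Q (r (s i)) (r' i) x := fun i => ⟨_, by
    have := hQ (s i)
    rwa [hs] at this⟩
  exact (NF.id (r := fun i => r (s i)) hid).pre_can hc e

theorem comp_arc_zero {W : Word Λ} (i : W.Pos) : W.comp (W.arc i 0) = i := by
  induction W with
  | unit => exact Empty.elim i
  | atom t => rfl
  | tensor V W hV hW =>
    rcases i with i | i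
    · exact congrArg Sum.inl (hV i)
    · exact congrArg Sum.inr (hW i)

theorem id (V : Word Λ) : N D V V (𝟙 _) (𝟙 _) :=
  perm (fun i => i) (fun i => comp_arc_zero i) fun ι r => ⟨_, Can.refl _, by simp⟩

theorem tensor {V V' W W' : Word Λ} {f : V.mfd ⟶ W.mfd} {g : V'.mfd ⟶ W'.mfd} {φ ψ}
    (h : N D V W f φ) (h' : N D V' W' g ψ) :
    N D (.tensor V V') (.tensor W W') (f ⊗ₘ g) (φ ⊗ₘ ψ) := by
  intro ι κ r r' Q hr' hQ
  have h1 := h ι κ (fun i => r (Sum.inl i)) (fun i => r' (Sum.inl i)) Q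
    (fun i j e => Sum.inl_injective (hr' e)) (fun i => hQ (Sum.inl i))
  have h2 := h' ι κ (fun i => r (Sum.inr i)) (fun i => r' (Sum.inr i)) Q
    (fun i j e => Sum.inr_injective (hr' e)) (fun i => hQ (Sum.inr i))
  have := h1.append (r := r) h2
  rwa [← tensorHom_comp_tensorHom, Category.assoc] at this

theorem braid_app {A A' : C} {X : ι → C} {l l' : List ι} (f : A ⟶ tl X l) (g : A' ⟶ tl X l') {c}
    (e : (app X l l').hom ≫ c = (β_ _ _).hom ≫ (app X l' l).hom) :
    (β_ A A').hom ≫ (g ⊗ₘ f) ≫ (app X l' l).hom = ((f ⊗ₘ g) ≫ (app X l l').hom) ≫ c := by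
  rw [Category.assoc, e, BraidedCategory.braiding_naturality_assoc]

theorem assoc (U V W : Word Λ) : N D (.tensor (.tensor U V) W) (.tensor U (.tensor V W))
    (α_ _ _ _).hom (α_ _ _ _).hom := by
  refine perm (Sum.elim (fun i => Sum.inl (Sum.inl i))
    (Sum.elim (fun i => Sum.inl (Sum.inr i)) (fun i => Sum.inr i))) ?_ ?_
  · rintro (i | i | i)
    · exact congrArg Sum.inl (comp_arc_zero i)
    · exact congrArg (fun i => Sum.inr (Sum.inl i)) (comp_arc_zero i)
    · exact congrArg (fun i => Sum.inr (Sum.inr i)) (comp_arc_zero i)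
  · intro ι r
    obtain ⟨c, hc, e⟩ := can_assoc (X := D.lab ι) (U.enum fun i => r (Sum.inl (Sum.inl i)))
      (V.enum fun i => r (Sum.inl (Sum.inr i))) (W.enum fun i => r (Sum.inr i))
    refine ⟨c, hc, ?_⟩
    exact assoc_app _ _ _ e

theorem runit (V : Word Λ) : N D (.tensor V .unit) V (ρ_ _).hom (ρ_ _).hom := by
  refine perm Sum.inl (fun i => comp_arc_zero i) fun ι r => ?_
  obtain ⟨c, hc, e⟩ := can_right_nil (X := D.lab ι) (V.enum fun i => r (Sum.inl i))
  refine ⟨c, hc, ?_⟩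
  exact runit_app _ e

theorem runitInv (V : Word Λ) : N D V (.tensor V .unit) (ρ_ _).inv (ρ_ _).inv := by
  refine perm (Sum.elim (fun i => i) fun i => Empty.elim i) ?_ fun ι r => ?_
  · rintro (i | i)
    · exact congrArg Sum.inl (comp_arc_zero i)
    · exact Empty.elim i
  obtain ⟨c, hc, e⟩ := can_right_nil (X := D.lab ι) (V.enum r)
  obtain ⟨d, hd, h1, h2⟩ := hc.symm
  refine ⟨d, hd, ?_⟩
  exact runitInv_app _ e h1

theorem braid (V W : Word Λ) : N D (.tensor V W) (.tensor W V) (β_ _ _).hom (β_ _ _).hom := by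
  refine perm (Sum.elim Sum.inr Sum.inl) ?_ fun ι r => ?_
  · rintro (i | i)
    · exact congrArg Sum.inl (comp_arc_zero i)
    · exact congrArg Sum.inr (comp_arc_zero i)
  obtain ⟨c, hc, e⟩ := can_comm (X := D.lab ι) (V.enum fun i => r (Sum.inl i))
    (W.enum fun i => r (Sum.inr i))
  refine ⟨c, hc, ?_⟩
  exact braid_app _ _ e

theorem glue (a b c : Λ) : N D (.tensor (.atom (.seg a b)) (.atom (.seg b c))) (.atom (.seg a c))
    (Mfd.glue a b c) (D.mul a b c) := by
  intro ι κ r r' Q hr' hQ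
  refine ⟨_, _, _, .cons (r' (), .seg a c)
    (.mul (r (Sum.inl ())) a b c (.single (r (Sum.inr ())) _)) ?_ .nil, Can.refl _, ?_⟩
  -- These are the positions of the left ends of the two halves in the glued interval.
  · refine ⟨[0, 1 / 2], ?_, by norm_num⟩
    have h1 := hQ (Sum.inl ())
    have h2 := hQ (Sum.inr ())
    have e1 : (halfLeft 0 : ℝ) = 0 := by simp [halfLeft]
    have e2 : (halfRight 0 : ℝ) = 1 / 2 := by simp [halfRight]
    refine .cons ?_ (.cons ?_ .nil)
    · rw [← e1]; exact h1
    · rw [← e2]; exact h2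
  · exact glue_app (X := D.lab ι) (i := (r (Sum.inl ()), .seg a b)) (j := (r (Sum.inr ()), .seg b c)) (D.mul a b c)

theorem close (a : Λ) : N D (.atom (.seg a a)) (.atom .circ) (Mfd.close a) (D.tr a) := by
  intro ι κ r r' Q hr' hQ
  refine ⟨_, _, _, .cons (r' (), .circ) (.tr a (.single (r ()) _)) (geo_single (hQ ())) .nil,
    Can.refl _, ?_⟩
  exact close_app (X := D.lab ι) (i := (r (), .seg a a)) (D.tr a)

end N

end

section

/-! ### Calculus on manifolds modelled on the unit interval -/

section LocalGeometry

open Set Topology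
open scoped Manifold ContDiff

theorem inverse_hasDerivWithinAt {A B : Set ℝ} {p q : ℝ → ℝ} {t d : ℝ} (hp : HasDerivWithinAt p d A (q t))
    (hd : d ≠ 0) (hq : ContinuousWithinAt q B t) (hm : MapsTo q B A) (ht : t ∈ B)
    (hpq : ∀ t ∈ B, p (q t) = t) : HasDerivWithinAt q d⁻¹ B t := by
  have hf : HasFDerivWithinAt p
      (ContinuousLinearEquiv.unitsEquivAut ℝ (Units.mk0 d hd) : ℝ →L[ℝ] ℝ) A (q t) := by
    have e : (ContinuousLinearEquiv.unitsEquivAut ℝ (Units.mk0 d hd) : ℝ →L[ℝ] ℝ) =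
        ContinuousLinearMap.toSpanSingleton ℝ d := by ext; simp
    rw [e]
    exact hp.hasFDerivWithinAt
  have h := hf.of_local_left_inverse (g := q) (s := B)
    (tendsto_nhdsWithin_iff.2 ⟨hq, by filter_upwards [self_mem_nhdsWithin] with x hx using hm hx⟩)
    ht (by filter_upwards [self_mem_nhdsWithin] with x hx using hpq x hx)
  have e : (1 : ℝ) * d⁻¹ = d⁻¹ := one_mul _
  rw [← e]
  exact h.hasDerivWithinAt

/-- Bootstrapping: the derivative of `q` is `1 / p' ∘ q`, so if `q` is `n` times continuously
differentiable then so is its derivative. Derivatives within sets are used because charts of a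
manifold with boundary have values in `[0,1]`. -/
theorem inverse_contDiffOn {A B : Set ℝ} (hA : UniqueDiffOn ℝ A) (hB : UniqueDiffOn ℝ B)
    {p q : ℝ → ℝ} (hp : ContDiffOn ℝ ∞ p A) (hd : ∀ t ∈ A, derivWithin p A t ≠ 0)
    (hq : ContinuousOn q B) (hm : MapsTo q B A) (hpq : ∀ t ∈ B, p (q t) = t) :
    ContDiffOn ℝ ∞ q B := by
  have h1 : ∀ t ∈ B, HasDerivWithinAt q (derivWithin p A (q t))⁻¹ B t := fun t ht =>
    inverse_hasDerivWithinAt ((hp.differentiableOn (by simp)) _ (hm ht)).hasDerivWithinAt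
      (hd _ (hm ht)) (hq t ht) hm ht hpq
  have h2 : ContDiffOn ℝ ∞ (fun t => (derivWithin p A t)⁻¹) A :=
    ((contDiffOn_infty_iff_derivWithin hA).1 hp).2.inv hd
  rw [contDiffOn_infty]
  intro n
  induction n with
  | zero => exact contDiffOn_zero.2 hq
  | succ n ih =>
    rw [Nat.cast_add, Nat.cast_one, contDiffOn_succ_iff_derivWithin hB]
    refine ⟨fun t ht => (h1 t ht).differentiableWithinAt, by simp, ?_⟩
    have h3 : ContDiffOn ℝ n (fun t => (derivWithin p A (q t))⁻¹) B :=
      (h2.of_le (by exact_mod_cast le_top)).comp ih hm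
    exact h3.congr fun t ht => (h1 t ht).derivWithin (hB t ht)

variable {M N : Type} [TopologicalSpace M] [ChartedSpace unitInterval M]
  [TopologicalSpace N] [ChartedSpace unitInterval N]

/-- The extended charts of `[0,1]` are the inclusion into `ℝ`, and the topology is the induced one.
-/
theorem contMDiffWithinAt_unitInterval {E H X : Type} [NormedAddCommGroup E] [NormedSpace ℝ E]
    [TopologicalSpace H] {I : ModelWithCorners ℝ E H} [TopologicalSpace X] [ChartedSpace H X]
    {f : X → unitInterval} {s : Set X} {x : X} :
    ContMDiffWithinAt I J ∞ f s x ↔ ContMDiffWithinAt I 𝓘(ℝ, ℝ) ∞ (fun y => (f y : ℝ)) s x := by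
  rw [contMDiffWithinAt_iff_target]
  have : extChartAt J (f x) ∘ f = fun y => (f y : ℝ) := by
    ext y; exact extChartAt_J _ _
  rw [this]
  refine ⟨fun h => h.2, fun h => ⟨?_, h⟩⟩
  exact Topology.IsInducing.subtypeVal.continuousWithinAt_iff.2 h.continuousWithinAt

theorem contMDiffAt_unitInterval {f : M → unitInterval} {x : M} :
    ContMDiffAt J J ∞ f x ↔ ContMDiffAt J 𝓘(ℝ, ℝ) ∞ (fun y => (f y : ℝ)) x :=
  contMDiffWithinAt_unitInterval

theorem hasDerivWithinAt_slope {f : M → unitInterval} {x : M} (h : MDifferentiableAt J J f x) :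
    HasDerivWithinAt (fun t => (f ((extChartAt J x).symm t) : ℝ)) (slope f x) (Icc 0 1)
      (extChartAt J x x) := by
  let L : ℝ →L[ℝ] ℝ := mfderiv J J f x
  have h1 : HasFDerivWithinAt (writtenInExtChartAt J J x f) L (range J) (extChartAt J x x) :=
    h.hasMFDerivAt.2
  rw [range_J] at h1
  have h2 : HasDerivWithinAt (writtenInExtChartAt J J x f) (L 1) (Icc 0 1) (extChartAt J x x) :=
    h1.hasDerivWithinAt
  refine h2.congr_of_eventuallyEq_of_mem ?_ ?_
  · exact Filter.Eventually.of_forall fun t => (extChartAt_J _ _).symm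
  · rw [← range_J]; exact mem_range_self _

/-- Together with `hasDerivWithinAt_slope` this translates between `slope` and derivatives within
`[0,1]`, so that positivity becomes a matter of one-variable calculus. -/
theorem slope_eq {f : M → unitInterval} {x : M} {d : ℝ} (hc : ContinuousAt f x)
    (h : HasDerivWithinAt (fun t => (f ((extChartAt J x).symm t) : ℝ)) d (Icc 0 1)
      (extChartAt J x x)) : MDifferentiableAt J J f x ∧ slope f x = d := by
  let L : ℝ →L[ℝ] ℝ := ContinuousLinearMap.toSpanSingleton ℝ d
  have hL : L 1 = d := one_smul ℝ d
  have hm : HasMFDerivAt J J f x L := by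
    refine ⟨hc, ?_⟩
    rw [range_J]
    have h' := h.congr_of_eventuallyEq_of_mem (f₁ := writtenInExtChartAt J J x f)
      (Filter.Eventually.of_forall fun t => (extChartAt_J _ _))
      (by rw [← range_J]; exact mem_range_self _)
    exact h'.hasFDerivWithinAt
  refine ⟨hm.mdifferentiableAt, ?_⟩
  unfold slope
  rw [hm.mfderiv]
  exact hL

variable [IsManifold J ∞ N]

theorem mdifferentiableAt_chart {e : OpenPartialHomeomorph N unitInterval}
    (he : e ∈ atlas unitInterval N) {y : N} (hy : y ∈ e.source) : MDifferentiableAt J J e y :=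
  (contMDiffAt_of_mem_maximalAtlas (IsManifold.subset_maximalAtlas (I := J) (n := ∞) he) hy
    ).mdifferentiableAt (by simp)

theorem contMDiffAt_chart_symm {e : OpenPartialHomeomorph N unitInterval}
    (he : e ∈ atlas unitInterval N) {t : unitInterval} (ht : t ∈ e.target) :
    ContMDiffAt J J ∞ e.symm t :=
  contMDiffAt_symm_of_mem_maximalAtlas (IsManifold.subset_maximalAtlas (I := J) (n := ∞) he) ht

theorem contMDiffAt_iff_chart {e : OpenPartialHomeomorph N unitInterval}
    (he : e ∈ atlas unitInterval N) {f : M → N} {x : M} (hx : f x ∈ e.source) :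
    ContMDiffAt J J ∞ f x ↔ ContinuousAt f x ∧ ContMDiffAt J J ∞ (e ∘ f) x := by
  rw [contMDiffAt_unitInterval (f := e ∘ f)]
  have := contMDiffWithinAt_iff_target_of_mem_maximalAtlas (I := J) (s := univ) (f := f)
    (IsManifold.subset_maximalAtlas (I := J) (n := ∞) he) hx
  rw [continuousWithinAt_univ] at this
  exact this

/-- A chart of an oriented atlas has positive slope, so composing with it does not change signs.
Positivity can thus be tested in any chart. -/
theorem slope_chart_pos_iff (oN : OrientedAtlas N) {e : OpenPartialHomeomorph N unitInterval}
    (he : e ∈ atlas unitInterval N) {f : M → N} {x : M} (hx : f x ∈ e.source)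
    (hf : MDifferentiableAt J J f x) : 0 < slope (e ∘ f) x ↔ 0 < slope f x := by
  rw [slope_comp x (mdifferentiableAt_chart he hx) hf]
  exact mul_pos_iff_of_pos_left (oN e he _ hx)

theorem slope_chart_symm_pos (oN : OrientedAtlas N) {e : OpenPartialHomeomorph N unitInterval}
    (he : e ∈ atlas unitInterval N) {t : unitInterval} (ht : t ∈ e.target) :
    0 < slope e.symm t := by
  have hd := (contMDiffAt_chart_symm he ht).mdifferentiableAt (by simp)
  rw [← slope_chart_pos_iff oN he (e.map_target ht) hd]
  have h : slope (e ∘ e.symm) t = slope id t := by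
    have : (e ∘ e.symm : unitInterval → unitInterval) =ᶠ[𝓝 t] id := by
      filter_upwards [e.open_target.mem_nhds ht] with x hx using e.right_inv hx
    unfold slope
    rw [this.mfderiv_eq]
    rfl
  rw [h, slope_id]
  exact one_pos

end LocalGeometry

end

section

/-! ### Oriented paths, and the points that a morphism can identify -/

section Paths

open Set Topology
open scoped Manifold ContDiff

theorem continuous_projIcc01 : Continuous (projIcc (0 : ℝ) 1 zero_le_one) := continuous_projIcc

theorem projIcc01_coe (s : unitInterval) : projIcc (0 : ℝ) 1 zero_le_one s = s := projIcc_val _ s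

theorem extChartAt_symm_unitInterval (s : unitInterval) (t : ℝ) :
    (extChartAt J s).symm t = projIcc 0 1 zero_le_one t := by
  rw [extChartAt, chartAt_self_eq]; rfl

section reading

variable {N : Type} [TopologicalSpace N]

/-- A path in a manifold, read in a chart. -/
def rd (e : OpenPartialHomeomorph N unitInterval) (c : unitInterval → N) (t : ℝ) : ℝ :=
  e (c (projIcc 0 1 zero_le_one t))

theorem rd_coe (e : OpenPartialHomeomorph N unitInterval) (c : unitInterval → N)
    (s : unitInterval) : rd e c s = e (c s) := by
  rw [rd, projIcc01_coe]

variable {e : OpenPartialHomeomorph N unitInterval} {c : unitInterval → N} {s : unitInterval}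

theorem eq_of_rd_eq {e : OpenPartialHomeomorph N unitInterval} {c c' : unitInterval → N} {t t' : ℝ}
    (h : rd e c t = rd e c' t') (ht : c (projIcc 0 1 zero_le_one t) ∈ e.source)
    (ht' : c' (projIcc 0 1 zero_le_one t') ∈ e.source) :
    c (projIcc 0 1 zero_le_one t) = c' (projIcc 0 1 zero_le_one t') :=
  e.injOn ht ht' (Subtype.ext h)

theorem rd_continuousWithinAt (hs : c s ∈ e.source) (hc : ContinuousAt c s) :
    ContinuousWithinAt (rd e c) (Icc 0 1) s := by
  have h1 : ContinuousAt (fun t : ℝ => c (projIcc 0 1 zero_le_one t)) (s : ℝ) := by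
    refine ContinuousAt.comp (g := c) ?_ continuous_projIcc01.continuousAt
    rwa [projIcc01_coe]
  have h2 : ContinuousAt e (c (projIcc 0 1 zero_le_one (s : ℝ))) := by
    rw [projIcc01_coe]; exact e.continuousAt hs
  exact (continuous_subtype_val.continuousAt.comp
    (h2.comp (f := fun t : ℝ => c (projIcc 0 1 zero_le_one t)) h1)).continuousWithinAt

theorem rd_continuousOn (hc : Continuous c) {A : Set ℝ} (hA : A ⊆ Icc 0 1)
    (h : ∀ t ∈ A, c (projIcc 0 1 zero_le_one t) ∈ e.source) : ContinuousOn (rd e c) A := by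
  intro t ht
  have := rd_continuousWithinAt (h t ht) hc.continuousAt
  rw [projIcc_of_mem _ (hA ht)] at this
  exact this.mono hA

variable [ChartedSpace unitInterval N] [IsManifold J ∞ N]

theorem rd_contDiffWithinAt (he : e ∈ atlas unitInterval N) (hs : c s ∈ e.source)
    (hc : ContMDiffAt J J ∞ c s) : ContDiffWithinAt ℝ ∞ (rd e c) (Icc 0 1) s := by
  have h := contMDiffAt_unitInterval.1 ((contMDiffAt_iff_chart he hs).1 hc).2
  have h2 := (contMDiffAt_iff.1 h).2
  rw [range_J, extChartAt_J] at h2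
  refine h2.congr_of_mem (fun t _ => ?_) s.2
  simp only [Function.comp_apply, extChartAt_symm_unitInterval]
  rfl

theorem rd_deriv (oN : OrientedAtlas N) (he : e ∈ atlas unitInterval N) (hs : c s ∈ e.source)
    (hc : MDifferentiableAt J J c s) (pc : 0 < slope c s) :
    ∃ d > 0, HasDerivWithinAt (rd e c) d (Icc 0 1) s := by
  refine ⟨_, (slope_chart_pos_iff oN he hs hc).2 pc, ?_⟩
  have h := hasDerivWithinAt_slope ((mdifferentiableAt_chart he hs).comp s hc)
  rw [extChartAt_J] at h
  refine h.congr_of_mem (fun t _ => ?_) s.2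
  rw [extChartAt_symm_unitInterval]
  rfl

/-- Converse to `rd_contDiffWithinAt` and `rd_deriv`. It is used for paths constructed by hand,
which are checked in one chart. -/
theorem of_rd (oN : OrientedAtlas N) (he : e ∈ atlas unitInterval N) (hs : c s ∈ e.source)
    (hc : ContinuousAt c s) (h : ContDiffWithinAt ℝ ∞ (rd e c) (Icc 0 1) s) {d : ℝ} (hd : 0 < d)
    (h' : HasDerivWithinAt (rd e c) d (Icc 0 1) s) : ContMDiffAt J J ∞ c s ∧ 0 < slope c s := by
  have hec : ContinuousAt (e ∘ c) s := (e.continuousAt hs).comp hc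
  have h1 : ContMDiffAt J J ∞ c s := by
    refine (contMDiffAt_iff_chart he hs).2 ⟨hc, contMDiffAt_unitInterval.2 (contMDiffAt_iff.2
      ⟨continuous_subtype_val.continuousAt.comp hec, ?_⟩)⟩
    rw [range_J, extChartAt_J]
    refine h.congr_of_mem (fun t _ => ?_) s.2
    simp only [Function.comp_apply, extChartAt_symm_unitInterval]
    rfl
  refine ⟨h1, (slope_chart_pos_iff oN he hs (h1.mdifferentiableAt (by simp))).1 ?_⟩
  rw [(slope_eq (f := e ∘ c) (x := s) (d := d) hec ?_).2]
  · exact hd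
  · rw [extChartAt_J]
    refine h'.congr_of_mem (fun t _ => ?_) s.2
    rw [extChartAt_symm_unitInterval]
    rfl

theorem rd_strictMonoOn (oN : OrientedAtlas N) (he : e ∈ atlas unitInterval N)
    (hc : ContMDiff J J ∞ c) (pc : ∀ s, 0 < slope c s) {a b : ℝ} (ha : 0 ≤ a) (hb : b ≤ 1)
    (h : ∀ t ∈ Icc a b, c (projIcc 0 1 zero_le_one t) ∈ e.source) :
    StrictMonoOn (rd e c) (Icc a b) := by
  refine strictMonoOn_of_deriv_pos (convex_Icc a b)
    (rd_continuousOn hc.continuous (Icc_subset_Icc ha hb) h) fun t ht => ?_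
  rw [interior_Icc] at ht
  have h01 : t ∈ Ioo (0 : ℝ) 1 := ⟨ha.trans_lt ht.1, ht.2.trans_le hb⟩
  obtain ⟨d, hd, h'⟩ := rd_deriv oN he (h t (Ioo_subset_Icc_self ht))
    (hc.mdifferentiable (by simp) _) (pc _)
  rw [projIcc_of_mem _ (Ioo_subset_Icc_self h01)] at h'
  rw [(h'.hasDerivAt (Icc_mem_nhds h01.1 h01.2)).deriv]
  exact hd

theorem exists_left {U : Set unitInterval} (hU : U ∈ 𝓝 (0 : unitInterval)) :
    ∃ η ∈ Ioo (0 : ℝ) 1, ∀ t ∈ Icc 0 η, projIcc (0 : ℝ) 1 zero_le_one t ∈ U := by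
  have h : projIcc (0 : ℝ) 1 zero_le_one ⁻¹' U ∈ 𝓝 (0 : ℝ) := by
    refine continuous_projIcc01.continuousAt.preimage_mem_nhds ?_
    rwa [projIcc_left]
  obtain ⟨ε, hε, hb⟩ := Metric.mem_nhds_iff.1 h
  -- The bound `1 / 2` keeps `η` below `1`.
  refine ⟨min (ε / 2) (1 / 2), ⟨by positivity, by linarith [min_le_right (ε / 2) (1 / 2)]⟩,
    fun t ht => hb ?_⟩
  rw [Metric.mem_ball, Real.dist_eq, sub_zero, abs_of_nonneg ht.1]
  linarith [ht.2, min_le_left (ε / 2) (1 / 2)]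

theorem exists_right {U : Set unitInterval} (hU : U ∈ 𝓝 (1 : unitInterval)) :
    ∃ η ∈ Ioo (0 : ℝ) 1, ∀ t ∈ Icc η 1, projIcc (0 : ℝ) 1 zero_le_one t ∈ U := by
  have h : projIcc (0 : ℝ) 1 zero_le_one ⁻¹' U ∈ 𝓝 (1 : ℝ) := by
    refine continuous_projIcc01.continuousAt.preimage_mem_nhds ?_
    rwa [projIcc_right]
  obtain ⟨ε, hε, hb⟩ := Metric.mem_nhds_iff.1 h
  refine ⟨1 - min (ε / 2) (1 / 2), ⟨by linarith [min_le_right (ε / 2) (1 / 2)],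
    by linarith [lt_min (half_pos hε) one_half_pos]⟩, fun t ht => hb ?_⟩
  rw [Metric.mem_ball, Real.dist_eq, abs_of_nonpos (by linarith [ht.2])]
  linarith [ht.1, min_le_left (ε / 2) (1 / 2)]

/-- Both functions increase from the same value, so by the intermediate value theorem both take
every slightly larger value. -/
theorem exists_common_left {F G : ℝ → ℝ} {a b a' b' : ℝ} (h : a < b) (h' : a' < b')
    (cF : ContinuousOn F (Icc a b)) (cG : ContinuousOn G (Icc a' b'))
    (mF : StrictMonoOn F (Icc a b)) (mG : StrictMonoOn G (Icc a' b')) (e : F a = G a') :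
    ∃ s ∈ Ioo a b, ∃ s' ∈ Ioo a' b', F s = G s' := by
  have h1 := mF (left_mem_Icc.2 h.le) (right_mem_Icc.2 h.le) h
  have h2 := mG (left_mem_Icc.2 h'.le) (right_mem_Icc.2 h'.le) h'
  obtain ⟨v, hv1, hv2⟩ := exists_between (lt_min h1 (e ▸ h2))
  obtain ⟨s, hs, rfl⟩ := intermediate_value_Ioo h.le cF ⟨hv1, hv2.trans_le (min_le_left _ _)⟩
  obtain ⟨s', hs', e'⟩ := intermediate_value_Ioo h'.le cG
    ⟨e ▸ hv1, hv2.trans_le (min_le_right _ _)⟩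
  exact ⟨s, hs, s', hs', e'.symm⟩

theorem exists_common_right {F G : ℝ → ℝ} {a b a' b' : ℝ} (h : a < b) (h' : a' < b')
    (cF : ContinuousOn F (Icc a b)) (cG : ContinuousOn G (Icc a' b'))
    (mF : StrictMonoOn F (Icc a b)) (mG : StrictMonoOn G (Icc a' b')) (e : F b = G b') :
    ∃ s ∈ Ioo a b, ∃ s' ∈ Ioo a' b', F s = G s' := by
  have h1 := mF (left_mem_Icc.2 h.le) (right_mem_Icc.2 h.le) h
  have h2 := mG (left_mem_Icc.2 h'.le) (right_mem_Icc.2 h'.le) h'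
  obtain ⟨v, hv1, hv2⟩ := exists_between (max_lt h1 (e ▸ h2))
  obtain ⟨s, hs, rfl⟩ := intermediate_value_Ioo h.le cF ⟨(le_max_left _ _).trans_lt hv1, hv2⟩
  obtain ⟨s', hs', e'⟩ := intermediate_value_Ioo h'.le cG
    ⟨(le_max_right _ _).trans_lt hv1, e ▸ hv2⟩
  exact ⟨s, hs, s', hs', e'.symm⟩

variable {c' : unitInterval → N}

/-- In a chart around the common starting point both paths are strictly increasing from the same
value, so they run through the same points for a while. In particular they meet at interior
parameters. -/
theorem exists_meet_left (oN : OrientedAtlas N) (hc : ContMDiff J J ∞ c) (pc : ∀ s, 0 < slope c s)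
    (hc' : ContMDiff J J ∞ c') (pc' : ∀ s, 0 < slope c' s) (h : c 0 = c' 0) :
    ∃ s s' : unitInterval, s ≠ 0 ∧ s ≠ 1 ∧ s' ≠ 0 ∧ s' ≠ 1 ∧ c s = c' s' := by
  obtain ⟨η, hη, h1⟩ := exists_left (hc.continuous.continuousAt.preimage_mem_nhds
    (chart_source_mem_nhds unitInterval (c 0)))
  obtain ⟨η', hη', h1'⟩ := exists_left (hc'.continuous.continuousAt.preimage_mem_nhds
    (by rw [← h]; exact chart_source_mem_nhds unitInterval (c 0)))
  have he := chart_mem_atlas unitInterval (c 0)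
  obtain ⟨s, hs, s', hs', e⟩ := exists_common_left (F := rd (chartAt unitInterval (c 0)) c)
    (G := rd (chartAt unitInterval (c 0)) c') hη.1 hη'.1
    (rd_continuousOn hc.continuous (Icc_subset_Icc_right hη.2.le) h1)
    (rd_continuousOn hc'.continuous (Icc_subset_Icc_right hη'.2.le) h1')
    (rd_strictMonoOn oN he hc pc le_rfl hη.2.le h1)
    (rd_strictMonoOn oN he hc' pc' le_rfl hη'.2.le h1')
    (by rw [rd, rd, projIcc_left]; exact congrArg (fun x => (chartAt unitInterval (c 0) x : ℝ)) h)
  have hs1 : s ∈ Ioo (0 : ℝ) 1 := ⟨hs.1, hs.2.trans hη.2⟩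
  have hs1' : s' ∈ Ioo (0 : ℝ) 1 := ⟨hs'.1, hs'.2.trans hη'.2⟩
  have e2 := eq_of_rd_eq e (h1 s (Ioo_subset_Icc_self hs)) (h1' s' (Ioo_subset_Icc_self hs'))
  rw [projIcc_of_mem _ (Ioo_subset_Icc_self hs1), projIcc_of_mem _ (Ioo_subset_Icc_self hs1')] at e2
  exact ⟨_, _, fun h => hs1.1.ne' (congrArg Subtype.val h),
    fun h => hs1.2.ne (congrArg Subtype.val h), fun h => hs1'.1.ne' (congrArg Subtype.val h),
    fun h => hs1'.2.ne (congrArg Subtype.val h), e2⟩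

theorem exists_meet_right (oN : OrientedAtlas N) (hc : ContMDiff J J ∞ c) (pc : ∀ s, 0 < slope c s)
    (hc' : ContMDiff J J ∞ c') (pc' : ∀ s, 0 < slope c' s) (h : c 1 = c' 1) :
    ∃ s s' : unitInterval, s ≠ 0 ∧ s ≠ 1 ∧ s' ≠ 0 ∧ s' ≠ 1 ∧ c s = c' s' := by
  obtain ⟨η, hη, h1⟩ := exists_right (hc.continuous.continuousAt.preimage_mem_nhds
    (chart_source_mem_nhds unitInterval (c 1)))
  obtain ⟨η', hη', h1'⟩ := exists_right (hc'.continuous.continuousAt.preimage_mem_nhds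
    (by rw [← h]; exact chart_source_mem_nhds unitInterval (c 1)))
  have he := chart_mem_atlas unitInterval (c 1)
  obtain ⟨s, hs, s', hs', e⟩ := exists_common_right (F := rd (chartAt unitInterval (c 1)) c)
    (G := rd (chartAt unitInterval (c 1)) c') hη.2 hη'.2
    (rd_continuousOn hc.continuous (Icc_subset_Icc_left hη.1.le) h1)
    (rd_continuousOn hc'.continuous (Icc_subset_Icc_left hη'.1.le) h1')
    (rd_strictMonoOn oN he hc pc hη.1.le le_rfl h1)
    (rd_strictMonoOn oN he hc' pc' hη'.1.le le_rfl h1')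
    (by rw [rd, rd, projIcc_right]; exact congrArg (fun x => (chartAt unitInterval (c 1) x : ℝ)) h)
  have hs1 : s ∈ Ioo (0 : ℝ) 1 := ⟨hη.1.trans hs.1, hs.2⟩
  have hs1' : s' ∈ Ioo (0 : ℝ) 1 := ⟨hη'.1.trans hs'.1, hs'.2⟩
  have e2 := eq_of_rd_eq e (h1 s (Ioo_subset_Icc_self hs)) (h1' s' (Ioo_subset_Icc_self hs'))
  rw [projIcc_of_mem _ (Ioo_subset_Icc_self hs1), projIcc_of_mem _ (Ioo_subset_Icc_self hs1')] at e2
  exact ⟨_, _, fun h => hs1.1.ne' (congrArg Subtype.val h),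
    fun h => hs1.2.ne (congrArg Subtype.val h), fun h => hs1'.1.ne' (congrArg Subtype.val h),
    fun h => hs1'.2.ne (congrArg Subtype.val h), e2⟩

end reading

variable {Λ : Type}

namespace Word

theorem comp_arc {W : Word Λ} (i : W.Pos) (s : unitInterval) : W.comp (W.arc i s) = i := by
  induction W with
  | unit => exact Empty.elim i
  | atom t => rfl
  | tensor V W hV hW =>
    rcases i with i | i
    · exact congrArg Sum.inl (hV i)
    · exact congrArg Sum.inr (hW i)

theorem exists_arc {W : Word Λ} (x : W.mfd.carrier) : ∃ s, W.arc (W.comp x) s = x := by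
  induction W with
  | unit => exact Empty.elim x
  | atom t =>
    cases t with
    | seg a b => exact ⟨x, rfl⟩
    | circ => exact wrap_surjective x
  | tensor V W hV hW =>
    rcases x with x | x
    · exact (hV x).imp fun s hs => congrArg Sum.inl hs
    · exact (hW x).imp fun s hs => congrArg Sum.inr hs

theorem contMDiff_arc {W : Word Λ} (i : W.Pos) : ContMDiff J J ∞ (W.arc i) := by
  induction W with
  | unit => exact Empty.elim i
  | atom t =>
    cases t with
    | seg a b => exact contMDiff_id
    | circ => exact fun x => (wrap_spec x).1
  | tensor V W hV hW =>
    rcases i with i | i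
    · exact ContMDiff.inl.comp (hV i)
    · exact ContMDiff.inr.comp (hW i)

theorem slope_arc {W : Word Λ} (i : W.Pos) (s : unitInterval) : 0 < slope (W.arc i) s := by
  induction W with
  | unit => exact Empty.elim i
  | atom t =>
    cases t with
    | seg a b => exact (slope_id s).symm ▸ one_pos
    | circ => exact (wrap_spec s).2.symm ▸ one_pos
  | tensor V W hV hW =>
    rcases i with i | i
    · exact pos_comp (g := Sum.inl) ContMDiff.inl (contMDiff_arc i) s (pos_inl _) (hV i)
    · exact pos_comp (g := Sum.inr) ContMDiff.inr (contMDiff_arc i) s (pos_inr _) (hW i)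

theorem arc_injective {W : Word Λ} {i : W.Pos} {a b : Λ} (h : W.typ i = .seg a b) :
    Function.Injective (W.arc i) := by
  induction W with
  | unit => exact Empty.elim i
  | atom t => subst h; exact fun _ _ h => h
  | tensor V W hV hW =>
    rcases i with i | i
    · exact Sum.inl_injective.comp (hV h)
    · exact Sum.inr_injective.comp (hW h)

theorem arc_mem_boundary {W : Word Λ} {i : W.Pos} {s : unitInterval} :
    W.arc i s ∈ J.boundary W.mfd.carrier ↔ (∃ a b, W.typ i = .seg a b) ∧ (s = 0 ∨ s = 1) := by
  induction W with
  | unit => exact Empty.elim i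
  | atom t =>
    cases t with
    | seg a b =>
      have : (∃ a' b', (Word.atom (Atom.seg a b)).typ i = .seg a' b') := ⟨a, b, rfl⟩
      exact (mem_boundary_unitInterval s).trans (by simp only [this, true_and])
    | circ =>
      refine ⟨fun h => absurd h (not_mem_boundary_circ _), ?_⟩
      rintro ⟨⟨a, b, h⟩, -⟩
      cases (show (Atom.circ : Atom Λ) = .seg a b from h)
  | tensor V W hV hW =>
    rcases i with i | i
    · exact boundary_inl.trans hV
    · exact boundary_inr.trans hW

theorem label_arc_zero {W : Word Λ} {i : W.Pos} {a b : Λ} (h : W.typ i = .seg a b)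
    (h' : W.arc i 0 ∈ J.boundary W.mfd.carrier) : W.mfd.label ⟨W.arc i 0, h'⟩ = a := by
  induction W with
  | unit => exact Empty.elim i
  | atom t => subst h; exact Mfd.interval_label_zero a b _
  | tensor V W hV hW =>
    rcases i with i | i
    · exact hV h _
    · exact hW h _

theorem label_arc_one {W : Word Λ} {i : W.Pos} {a b : Λ} (h : W.typ i = .seg a b)
    (h' : W.arc i 1 ∈ J.boundary W.mfd.carrier) : W.mfd.label ⟨W.arc i 1, h'⟩ = b := by
  induction W with
  | unit => exact Empty.elim i
  | atom t => subst h; exact Mfd.interval_label_one a b _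
  | tensor V W hV hW =>
    rcases i with i | i
    · exact hV h _
    · exact hW h _

end Word

variable {W : Word Λ} {T : Mfd Λ} (f : W.mfd ⟶ T)

theorem contMDiff_comp_arc (i : W.Pos) : ContMDiff J J ∞ (Mfd.Hom.toFun f ∘ W.arc i) :=
  f.smooth.comp (Word.contMDiff_arc i)

theorem slope_comp_arc (i : W.Pos) (s : unitInterval) : 0 < slope (Mfd.Hom.toFun f ∘ W.arc i) s :=
  pos_comp f.smooth (Word.contMDiff_arc i) s (f.slope_pos _) (Word.slope_arc i s)

/-- Only boundary points are identified by a morphism, and a point of an arc with interior parameter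
is not a boundary point. So arcs of different components cannot meet there. -/
theorem eq_of_meet {i j : W.Pos} (h : ∃ s s' : unitInterval, s ≠ 0 ∧ s ≠ 1 ∧ s' ≠ 0 ∧ s' ≠ 1 ∧
    f.toFun (W.arc i s) = f.toFun (W.arc j s')) : i = j := by
  obtain ⟨s, s', h0, h1, -, -, e⟩ := h
  by_contra hij
  obtain ⟨-, hx, -⟩ := f.glue _ _ e fun h => hij (by
    rw [← Word.comp_arc i s, h, Word.comp_arc])
  rcases (Word.arc_mem_boundary.1 hx).2 with h | h
  · exact h0 h
  · exact h1 h

theorem eq_of_left {i j : W.Pos} (h : f.toFun (W.arc i 0) = f.toFun (W.arc j 0)) : i = j :=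
  eq_of_meet f (exists_meet_left T.oriented (contMDiff_comp_arc f i) (slope_comp_arc f i)
    (contMDiff_comp_arc f j) (slope_comp_arc f j) h)

theorem eq_of_right {i j : W.Pos} (h : f.toFun (W.arc i 1) = f.toFun (W.arc j 1)) : i = j :=
  eq_of_meet f (exists_meet_right T.oriented (contMDiff_comp_arc f i) (slope_comp_arc f i)
    (contMDiff_comp_arc f j) (slope_comp_arc f j) h)

/-- Distinct points with the same image are the right end of an interval and the left end of an
interval with the same label. -/
theorem glued_ends {x y : W.mfd.carrier} (h : f.toFun x = f.toFun y) (hne : x ≠ y) :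
    ∃ i j a b c, W.typ i = .seg a b ∧ W.typ j = .seg b c ∧
      ((x = W.arc i 1 ∧ y = W.arc j 0) ∨ (y = W.arc i 1 ∧ x = W.arc j 0)) := by
  obtain ⟨-, hx, hy, hl⟩ := f.glue _ _ h hne
  obtain ⟨s, hs⟩ := Word.exists_arc x
  obtain ⟨s', hs'⟩ := Word.exists_arc y
  generalize W.comp x = i at hs
  generalize W.comp y = j at hs'
  subst hs hs'
  obtain ⟨⟨a, b, hi⟩, h1⟩ := Word.arc_mem_boundary.1 hx
  obtain ⟨⟨a', b', hj⟩, h2⟩ := Word.arc_mem_boundary.1 hy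
  rcases h1 with rfl | rfl <;> rcases h2 with rfl | rfl
  · exact absurd (by rw [eq_of_left f h]) hne
  · rw [Word.label_arc_zero hi, Word.label_arc_one hj] at hl
    subst hl
    exact ⟨j, i, a', a, b, hj, hi, Or.inr ⟨rfl, rfl⟩⟩
  · rw [Word.label_arc_one hi, Word.label_arc_zero hj] at hl
    subst hl
    exact ⟨i, j, a, b, b', hi, hj, Or.inl ⟨rfl, rfl⟩⟩
  · exact absurd (by rw [eq_of_right f h]) hne

/-- Each pair of identified points consists of a right end and a left end. Among three points with
the same image two would be ends of the same kind, which `eq_of_left` and `eq_of_right` exclude. -/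
theorem not_three {x y z : W.mfd.carrier} (hxy : x ≠ y) (hxz : x ≠ z) (hyz : y ≠ z)
    (h : f.toFun x = f.toFun y) : f.toFun x ≠ f.toFun z := by
  intro h'
  obtain ⟨i, j, a, b, c, hi, hj, h1⟩ := glued_ends f h hxy
  obtain ⟨i', j', a', b', c', hi', hj', h2⟩ := glued_ends f h' hxz
  have h3 := h.symm.trans h'
  rcases h1 with ⟨rfl, rfl⟩ | ⟨rfl, rfl⟩ <;> rcases h2 with ⟨h4, rfl⟩ | ⟨rfl, h4⟩
  · exact hyz (by rw [eq_of_left f h3])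
  · exact hxz (by rw [eq_of_right f h'])
  · exact hxz (by rw [eq_of_left f h'])
  · exact hyz (by rw [eq_of_right f h3])

end Paths

end

section

variable {Λ : Type}

/-! ### Injective morphisms and factorization through a cutting -/

section Iso

open Set Topology
open scoped Manifold ContDiff

theorem uniqueDiffOn_chart {M N : Type} [TopologicalSpace M] [ChartedSpace unitInterval M]
    [TopologicalSpace N] [ChartedSpace unitInterval N] {f : M → N} (hf : Continuous f)
    (x : M) (y : N) : UniqueDiffOn ℝ ((extChartAt J x).target ∩
      (extChartAt J x).symm ⁻¹' (f ⁻¹' (extChartAt J y).source)) := by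
  rintro t ⟨ht, ht'⟩
  have h1 : (extChartAt J x).target ∈ 𝓝[range J] t := extChartAt_target_mem_nhdsWithin_of_mem ht
  have h2 : (extChartAt J x).symm ⁻¹' (f ⁻¹' (extChartAt J y).source) ∈ 𝓝[range J] t :=
    (continuousAt_extChartAt_symm'' ht).continuousWithinAt.preimage_mem_nhdsWithin
      (hf.continuousAt.preimage_mem_nhds ((isOpen_extChartAt_source y).mem_nhds ht'))
  exact (J.uniqueDiffOn t (extChartAt_target_subset_range x ht)).mono_nhds
    (nhdsWithin_le_of_mem (Filter.inter_mem h1 h2))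

/-- In charts this is `inverse_contDiffOn`; the positive slopes supply the nonvanishing derivative.
-/
theorem contMDiff_inverse {M N : Type} [TopologicalSpace M] [ChartedSpace unitInterval M]
    [TopologicalSpace N] [ChartedSpace unitInterval N] [IsManifold J ∞ M] [IsManifold J ∞ N]
    (oM : OrientedAtlas M) (oN : OrientedAtlas N) {f : M → N} {g : N → M}
    (hf : ContMDiff J J ∞ f) (pf : ∀ x, 0 < slope f x) (hg : Continuous g)
    (hfg : ∀ y, f (g y) = y) : ContMDiff J J ∞ g := by
  rw [contMDiff_iff]
  refine ⟨hg, fun y x => ?_⟩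
  have hd := (contMDiff_iff.1 hf).2 x y
  have hA := uniqueDiffOn_chart hf.continuous x y
  refine inverse_contDiffOn hA (uniqueDiffOn_chart hg y x) hd ?_ ?_ ?_ ?_
  · rintro t ⟨ht, ht'⟩
    have ht1 : t ∈ Icc (0 : ℝ) 1 := by
      rw [← range_J]; exact extChartAt_target_subset_range x ht
    have hs : projIcc 0 1 zero_le_one t ∈ (chartAt unitInterval x).target := by
      rw [extChartAt, OpenPartialHomeomorph.extend_target] at ht
      exact ht.1
    have hs' : f ((chartAt unitInterval x).symm (projIcc 0 1 zero_le_one t)) ∈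
        (chartAt unitInterval y).source := by
      rw [← extChartAt_source J]; exact ht'
    have d1 := (contMDiffAt_chart_symm (chart_mem_atlas _ x) hs).mdifferentiableAt (by simp)
    have d2 := (hf.mdifferentiable (by simp)
      ((chartAt unitInterval x).symm (projIcc 0 1 zero_le_one t))).comp _ d1
    have d3 := mdifferentiableAt_chart (chart_mem_atlas _ y) hs'
    have p2 : 0 < slope (f ∘ (chartAt unitInterval x).symm) (projIcc 0 1 zero_le_one t) := by
      rw [slope_comp _ (hf.mdifferentiable (by simp) _) d1]
      exact mul_pos (pf _) (slope_chart_symm_pos oM (chart_mem_atlas _ x) hs)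
    have p3 := (slope_chart_pos_iff oN (f := f ∘ (chartAt unitInterval x).symm)
      (x := projIcc 0 1 zero_le_one t) (chart_mem_atlas _ y) hs' d2).2 p2
    have h := hasDerivWithinAt_slope (MDifferentiableAt.comp
      (f := f ∘ (chartAt unitInterval x).symm) (projIcc 0 1 zero_le_one t) d3 d2)
    rw [extChartAt_J, projIcc_of_mem _ ht1] at h
    rw [projIcc_of_mem _ ht1] at p3
    have h2 : HasDerivWithinAt (extChartAt J y ∘ f ∘ (extChartAt J x).symm)
        (slope (chartAt unitInterval y ∘ f ∘ (chartAt unitInterval x).symm) ⟨t, ht1⟩) (Icc 0 1) t := by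
      refine h.congr_of_mem (fun u _ => ?_) ht1
      rw [extChartAt_symm_unitInterval]
      rfl
    rw [(h2.mono ?_).derivWithin (hA t ⟨ht, ht'⟩)]
    · exact p3.ne'
    · rw [← range_J]
      exact inter_subset_left.trans (extChartAt_target_subset_range x)
  · refine (continuousOn_extChartAt x).comp ((hg.comp_continuousOn
      ((continuousOn_extChartAt_symm y).mono inter_subset_left))) ?_
    exact fun t ht => ht.2
  · rintro t ⟨ht, ht'⟩
    refine ⟨(extChartAt J x).map_source ht', ?_⟩
    show f ((extChartAt J x).symm (extChartAt J x (g ((extChartAt J y).symm t)))) ∈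
      (extChartAt J y).source
    rw [(extChartAt J x).left_inv ht', hfg]
    exact (extChartAt J y).map_target ht
  · rintro t ⟨ht, ht'⟩
    show extChartAt J y (f ((extChartAt J x).symm (extChartAt J x (g ((extChartAt J y).symm t))))) = t
    rw [(extChartAt J x).left_inv ht', hfg, (extChartAt J y).right_inv ht]

theorem surjective_real {L : ℝ →L[ℝ] ℝ} (h : L 1 ≠ 0) : Function.Surjective L := fun r =>
  ⟨r / L 1, by
    have : L ((r / L 1) • 1) = (r / L 1) • L 1 := map_smul L _ _
    rw [smul_eq_mul, mul_one, smul_eq_mul, div_mul_cancel₀ r h] at this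
    exact this⟩

/-- An injective morphism is a diffeomorphism. -/
theorem isIso_of_injective {S T : Mfd Λ} (f : S ⟶ T) (h : Function.Injective f.toFun) : IsIso f := by
  let E : S.carrier ≃ₜ T.carrier :=
    Continuous.homeoOfEquivCompactToT2 (f := Equiv.ofBijective f.toFun ⟨h, f.surj⟩)
      f.smooth.continuous
  have hE : ∀ y, f.toFun (E.symm y) = y := fun y => E.apply_symm_apply y
  have hg := contMDiff_inverse S.oriented T.oriented f.smooth f.slope_pos E.symm.continuous hE
  let e : S.carrier ≃ₘ^∞⟮J, J⟯ T.carrier := ⟨E.toEquiv, f.smooth, hg⟩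
  have hb : ∀ x, x ∈ J.boundary S.carrier ↔ f.toFun x ∈ J.boundary T.carrier := by
    intro x
    refine ⟨fun hx => ?_, fun hx => not_not.1 fun hn => f.map_interior x hn hx⟩
    -- The inverse map has nonzero derivative at `f x`, so it would carry the interior point `f x`
    -- to an interior point, whereas it carries it to `x`.
    by_contra hn
    rw [← J.compl_interior, mem_compl_iff, not_not] at hn
    have hd := hg.mdifferentiable (by simp) (f.toFun x)
    have hs := slope_comp (f.toFun x) (f.mdiff (E.symm (f.toFun x))) hd
    have hid : f.toFun ∘ E.symm = id := funext hE
    rw [hid, slope_id] at hs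
    have := MDifferentiableAt.isInteriorPoint_of_surjective_mfderiv (I := J) (I' := J) hd
      (surjective_real (L := mfderiv J J E.symm (f.toFun x))
        (fun h0 => one_ne_zero (hs.trans (by
          have h1 : slope E.symm (f.toFun x) = 0 := h0
          rw [h1, mul_zero])))) hn
    have hx' : E.symm (f.toFun x) = x := E.symm_apply_apply x
    rw [hx'] at this
    rw [← J.compl_interior] at hx
    exact hx this
  exact ⟨⟨(Mfd.isoOfDiffeo e f.slope_pos hb fun x hx => f.label_boundary ⟨x, hx⟩ _).inv,
    (Mfd.isoOfDiffeo e f.slope_pos hb fun x hx => f.label_boundary ⟨x, hx⟩ _).hom_inv_id,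
    (Mfd.isoOfDiffeo e f.slope_pos hb fun x hx => f.label_boundary ⟨x, hx⟩ _).inv_hom_id⟩⟩

theorem injective_of_isIso {S T : Mfd Λ} (f : S ⟶ T) [IsIso f] : Function.Injective f.toFun := by
  intro x y h
  have h2 := congrArg (Mfd.Hom.toFun (inv f)) h
  rwa [← Mfd.comp_toFun, ← Mfd.comp_toFun, IsIso.hom_inv_id] at h2

theorem boundary_of_isIso {S T : Mfd Λ} (f : S ⟶ T) [IsIso f] {x : S.carrier} :
    f.toFun x ∈ J.boundary T.carrier ↔ x ∈ J.boundary S.carrier := by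
  refine ⟨fun hx => not_not.1 fun hn => f.map_interior x hn hx, fun hx => not_not.1 fun hn => ?_⟩
  have := Mfd.Hom.map_interior (inv f) _ hn
  rw [← Mfd.comp_toFun, IsIso.hom_inv_id] at this
  exact this hx

/-- The factorization of a morphism through a cutting of its source. -/
theorem exists_factor {W : Word Λ} {S' T : Mfd Λ} (q : W.mfd ⟶ S') (f : W.mfd ⟶ T)
    (f' : S'.carrier → T.carrier) (hs : ContMDiff J J ∞ f') (hp : ∀ x, 0 < slope f' x)
    (hf : ∀ x, f' (q.toFun x) = f.toFun x)
    (hq : ∀ x ∈ J.boundary W.mfd.carrier, q.toFun x ∉ J.boundary S'.carrier →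
      ∃ z, z ≠ x ∧ q.toFun z = q.toFun x) : ∃ g : S' ⟶ T, q ≫ g = f := by
  -- If `q x` were an interior point, `q` would already identify `x` with some `z`, and then `x`,
  -- `y`, `z` would be three points with the same image under `f`.
  have key : ∀ x y, q.toFun x ≠ q.toFun y → f.toFun x = f.toFun y →
      q.toFun x ∈ J.boundary S'.carrier := by
    intro x y hne h
    by_contra hb
    obtain ⟨-, hx, -⟩ := f.glue x y h fun e => hne (e ▸ rfl)
    obtain ⟨z, hz, e⟩ := hq x hx hb
    refine not_three f (x := x) (y := z) (z := y) hz.symm (fun e' => hne (e' ▸ rfl))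
      (fun e' => hne (e' ▸ e.symm)) ?_ h
    rw [← hf, ← hf, e]
  refine ⟨⟨f', hs, hp, fun y => ?_, fun p hp' => ?_, ?_, fun p p' h hne => ?_⟩,
    Mfd.hom_ext fun x => hf x⟩
  · obtain ⟨x, hx⟩ := f.surj y
    exact ⟨q.toFun x, (hf x).trans hx⟩
  · obtain ⟨x, rfl⟩ := q.surj p
    rw [hf]
    by_cases hx : x ∈ J.boundary W.mfd.carrier
    · obtain ⟨z, hz, e⟩ := hq x hx hp'
      have : f.toFun x = f.toFun z := by rw [← hf, ← hf, e]
      exact (f.glue x z this hz.symm).1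
    · exact f.map_interior x hx
  · rintro ⟨p, hp⟩ h
    obtain ⟨x, rfl⟩ := q.surj p
    have hx : x ∈ J.boundary W.mfd.carrier := not_not.1 fun hn => q.map_interior x hn hp
    have h1 := q.label_boundary ⟨x, hx⟩ hp
    have h' : f.toFun x ∈ J.boundary T.carrier := hf x ▸ h
    have h2 := f.label_boundary ⟨x, hx⟩ h'
    rw [h1, ← h2]
    congr 1
    exact Subtype.ext (hf x)
  · obtain ⟨x, rfl⟩ := q.surj p
    obtain ⟨y, rfl⟩ := q.surj p'
    rw [hf, hf] at h
    obtain ⟨h1, hx, hy, hl⟩ := f.glue x y h fun e => hne (e ▸ rfl)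
    have hx' := key x y hne h
    have hy' := key y x hne.symm h.symm
    rw [hf]
    exact ⟨h1, hx', hy', (q.label_boundary ⟨x, hx⟩ hx').trans
      (hl.trans (q.label_boundary ⟨y, hy⟩ hy').symm)⟩

end Iso

end

section

variable {Λ : Type}

/-! ### Isotopies, and convexity of morphisms to an interval -/

section Isotopy

open Set Topology
open scoped Manifold ContDiff

/-- The barycentric coordinate of index `1` identifies the standard 1-simplex with `[0,1]`. -/
theorem Isotopic.of_family {S T : Mfd Λ} (σ : unitInterval → (S ⟶ T)) (F : ℝ × S.carrier → T.carrier)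
    (hF : ContMDiffOn (𝓘(ℝ, ℝ).prod J) J ∞ F (Icc 0 1 ×ˢ univ))
    (h : ∀ (τ : unitInterval) x, F (τ, x) = (σ τ).toFun x) : Isotopic (σ 0) (σ 1) := by
  have hb : ∀ t : stdSimplex ℝ (Fin 2), (t : Fin 2 → ℝ) 1 ∈ Icc (0 : ℝ) 1 := fun t =>
    mem_Icc_of_mem_stdSimplex t.2 1
  refine ⟨fun t => σ ⟨t 1, hb t⟩, ⟨fun p => F (p.1 1, p.2), ?_, fun t x => h ⟨t 1, hb t⟩ x⟩, ?_, ?_⟩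
  · refine hF.comp (t := Icc 0 1 ×ˢ univ)
      (f := fun p : (Fin 2 → ℝ) × S.carrier => (p.1 1, p.2)) ?_ ?_
    · have : ContDiff ℝ ∞ fun t : Fin 2 → ℝ => t 1 := contDiff_apply ℝ ℝ 1
      exact ((this.contMDiff.comp contMDiff_fst).prodMk contMDiff_snd).contMDiffOn
    · rintro ⟨t, x⟩ ⟨ht, -⟩
      exact ⟨hb ⟨t, ht⟩, mem_univ _⟩
  · congr 1
  · congr 1

theorem Isotopic.refl {S T : Mfd Λ} (f : S ⟶ T) : Isotopic f f :=
  ⟨_, Mfd.isSmoothFamily_const 1 f, rfl, rfl⟩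

theorem Isotopic.symm {S T : Mfd Λ} {f g : S ⟶ T} (h : Isotopic f g) : Isotopic g f := by
  obtain ⟨σ, hσ, rfl, rfl⟩ := h
  refine ⟨_, hσ.comp_map (l := 1) ![1, 0], ?_, ?_⟩
  · rw [stdSimplex.map_vertex]; rfl
  · rw [stdSimplex.map_vertex]; rfl

theorem Isotopic.comp {S T U : Mfd Λ} {f f' : S ⟶ T} {g g' : T ⟶ U} (h : Isotopic f f')
    (h' : Isotopic g g') : Isotopic (f ≫ g) (f' ≫ g') := by
  obtain ⟨σ, hσ, rfl, rfl⟩ := h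
  obtain ⟨τ, hτ, rfl, rfl⟩ := h'
  exact ⟨_, hσ.comp hτ, rfl, rfl⟩

end Isotopy

section Conv

open Set Topology
open scoped Manifold ContDiff

variable {S : Mfd Λ} {a b : Λ}

theorem interval_boundary {x : (Mfd.interval a b).carrier} :
    x ∈ J.boundary (Mfd.interval a b).carrier ↔ x = (0 : unitInterval) ∨ x = (1 : unitInterval) :=
  mem_boundary_unitInterval x

/-- A morphism to an interval, as a map. -/
@[reducible]
def Mfd.Hom.fn (f : S ⟶ Mfd.interval a b) : S.carrier → unitInterval := f.toFun

theorem Mfd.Hom.fn_surj (f : S ⟶ Mfd.interval a b) : Function.Surjective f.fn := f.surj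

variable (f g : S ⟶ Mfd.interval a b)

/-- The convex combinations of two maps to the unit interval. -/
def conv (τ : unitInterval) (x : S.carrier) : unitInterval :=
  ⟨(1 - τ) * f.fn x + τ * g.fn x, by
    have h1 := (f.fn x).2
    have h2 := (g.fn x).2
    have h3 := τ.2
    constructor
    · have := mul_nonneg (sub_nonneg.2 h3.2) h1.1
      have := mul_nonneg h3.1 h2.1
      linarith
    · nlinarith [mul_nonneg (sub_nonneg.2 h3.2) (sub_nonneg.2 h1.2),
        mul_nonneg h3.1 (sub_nonneg.2 h2.2)]⟩

variable {f g}

theorem conv_lt {τ : unitInterval} {x y : S.carrier} (h : f.fn x < f.fn y)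
    (h' : g.fn x < g.fn y) : conv f g τ x < conv f g τ y := by
  have h3 := τ.2
  have h : (f.fn x : ℝ) < f.fn y := h
  have h' : (g.fn x : ℝ) < g.fn y := h'
  show (1 - (τ : ℝ)) * f.fn x + τ * g.fn x < (1 - (τ : ℝ)) * f.fn y + τ * g.fn y
  rcases h3.1.eq_or_lt with h0 | h0
  · rw [← h0]; linarith
  · have := mul_lt_mul_of_pos_left h' h0
    have := mul_le_mul_of_nonneg_left h.le (sub_nonneg.2 h3.2)
    linarith

variable (hfg : ∀ x y, f.fn x ≤ f.fn y ↔ g.fn x ≤ g.fn y)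
include hfg

theorem fn_lt_iff (x y : S.carrier) : f.fn x < f.fn y ↔ g.fn x < g.fn y := by
  rw [← not_le, ← not_le, hfg]

theorem conv_lt_iff {τ : unitInterval} {x y : S.carrier} :
    conv f g τ x < conv f g τ y ↔ f.fn x < f.fn y := by
  have key : ∀ {x y}, f.fn x < f.fn y → conv f g τ x < conv f g τ y := fun h =>
    conv_lt h ((fn_lt_iff hfg _ _).1 h)
  refine ⟨fun h => ?_, key⟩
  rcases lt_trichotomy (f.fn x) (f.fn y) with h1 | h1 | h1
  · exact h1
  · have h2 : g.fn x = g.fn y := le_antisymm ((hfg x y).1 h1.le) ((hfg y x).1 h1.ge)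
    have : conv f g τ x = conv f g τ y := Subtype.ext (by
      show (1 - (τ : ℝ)) * f.fn x + τ * g.fn x = (1 - (τ : ℝ)) * f.fn y + τ * g.fn y
      rw [h1, h2])
    exact absurd this h.ne
  · exact absurd h (key h1).not_gt

theorem conv_eq_iff {τ : unitInterval} {x y : S.carrier} :
    conv f g τ x = conv f g τ y ↔ f.fn x = f.fn y := by
  rw [eq_iff_le_not_lt, eq_iff_le_not_lt, ← not_lt, ← not_lt, conv_lt_iff hfg, conv_lt_iff hfg]

theorem fn_zero {x : S.carrier} (h : f.fn x = 0) : g.fn x = 0 := by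
  obtain ⟨y, hy⟩ := g.fn_surj 0
  have : g.fn x ≤ g.fn y := (hfg x y).1 (h ▸ unitInterval.nonneg')
  exact le_antisymm (this.trans_eq hy) unitInterval.nonneg'

theorem fn_one {x : S.carrier} (h : f.fn x = 1) : g.fn x = 1 := by
  obtain ⟨y, hy⟩ := g.fn_surj 1
  have : g.fn y ≤ g.fn x := (hfg y x).1 (h ▸ unitInterval.le_one')
  exact le_antisymm unitInterval.le_one' (hy.symm.trans_le this)

theorem conv_zero {τ : unitInterval} {x : S.carrier} (h : conv f g τ x = 0) : f.fn x = 0 := by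
  obtain ⟨y, hy⟩ := f.fn_surj 0
  have h1 : ¬ f.fn y < f.fn x := by
    rw [← conv_lt_iff hfg (τ := τ), h]
    exact not_lt.2 unitInterval.nonneg'
  exact le_antisymm ((not_lt.1 h1).trans_eq hy) unitInterval.nonneg'

theorem conv_one {τ : unitInterval} {x : S.carrier} (h : conv f g τ x = 1) : f.fn x = 1 := by
  obtain ⟨y, hy⟩ := f.fn_surj 1
  have h1 : ¬ f.fn x < f.fn y := by
    rw [← conv_lt_iff hfg (τ := τ), h]
    exact not_lt.2 unitInterval.le_one'
  exact le_antisymm unitInterval.le_one' (hy.symm.trans_le (not_lt.1 h1))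

/-- The combination induces the same order as `f`, so it takes the values `0` and `1` only where `f`
does. In `convHom` all conditions involving the boundary of the target are thereby inherited from
`f`. -/
theorem conv_boundary {τ : unitInterval} {x : S.carrier} (h : conv f g τ x = 0 ∨ conv f g τ x = 1) :
    f.fn x = conv f g τ x := by
  rcases h with h | h
  · rw [h, conv_zero hfg h]
  · rw [h, conv_one hfg h]

/-- Choose a section `r` of `f`. Then `g ∘ r` is monotone and surjective, hence continuous, although
`r` need not be. So the combination composed with `r` is a continuous function of one variable from
`0` to `1`. -/
theorem conv_surjective (τ : unitInterval) : Function.Surjective (conv f g τ) := by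
  choose r hr using f.fn_surj
  have hk : ∀ x, g.fn (r (f.fn x)) = g.fn x := fun x =>
    le_antisymm ((hfg _ _).1 (hr _).le) ((hfg _ _).1 (hr _).ge)
  have hm : Monotone fun y => g.fn (r y) := fun y z h =>
    (hfg _ _).1 (((hr y).trans_le h).trans_eq (hr z).symm)
  have hc : Continuous fun y => g.fn (r y) := hm.continuous_of_surjective fun z => by
    obtain ⟨x, hx⟩ := g.fn_surj z
    exact ⟨f.fn x, (hk x).trans hx⟩
  have hc2 : Continuous fun y : unitInterval => conv f g τ (r y) := by
    refine continuous_induced_rng.2 ?_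
    have : Continuous fun y : unitInterval => (1 - (τ : ℝ)) * (y : ℝ) + τ * (g.fn (r y) : ℝ) := by
      fun_prop
    refine this.congr fun y => ?_
    show _ = (1 - (τ : ℝ)) * f.fn (r y) + τ * g.fn (r y)
    rw [show f.fn (r y) = y from hr y]
  intro z
  have h0 : conv f g τ (r 0) = 0 := by
    have h1 : f.fn (r 0) = 0 := hr 0
    have h2 := fn_zero hfg h1
    refine Subtype.ext ?_
    show (1 - (τ : ℝ)) * f.fn (r 0) + τ * g.fn (r 0) = 0
    rw [h1, h2]; simp
  have h1 : conv f g τ (r 1) = 1 := by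
    have h1 : f.fn (r 1) = 1 := hr 1
    have h2 := fn_one hfg h1
    refine Subtype.ext ?_
    show (1 - (τ : ℝ)) * f.fn (r 1) + τ * g.fn (r 1) = 1
    rw [h1, h2]; simp
  obtain ⟨y, hy⟩ := mem_range_of_exists_le_of_exists_ge hc2
    ⟨0, h0.trans_le (unitInterval.nonneg' (t := z))⟩
    ⟨1, (unitInterval.le_one' (t := z)).trans_eq h1.symm⟩
  exact ⟨_, hy⟩

omit hfg

theorem contMDiff_val (f : S ⟶ Mfd.interval a b) :
    ContMDiff J 𝓘(ℝ, ℝ) ∞ fun x => (f.fn x : ℝ) := fun x =>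
  contMDiffAt_unitInterval.1 (f.smooth x)

theorem contMDiff_conv : ContMDiffOn (𝓘(ℝ, ℝ).prod J) 𝓘(ℝ, ℝ) ∞
    (fun p : ℝ × S.carrier => (1 - p.1) * (f.fn p.2 : ℝ) + p.1 * (g.fn p.2 : ℝ)) (Icc 0 1 ×ˢ univ) := by
  have h : ContDiff ℝ ∞ fun q : ℝ × ℝ × ℝ => (1 - q.1) * q.2.1 + q.1 * q.2.2 := by fun_prop
  exact (h.contMDiff.comp (contMDiff_fst.prodMk_space
    (((contMDiff_val f).comp contMDiff_snd).prodMk_space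
      ((contMDiff_val g).comp contMDiff_snd)))).contMDiffOn

theorem contMDiff_conv_const (τ : unitInterval) : ContMDiff J J ∞ (conv f g τ) := by
  intro x
  refine contMDiffAt_unitInterval.2 ?_
  have h : ContDiff ℝ ∞ fun q : ℝ × ℝ => (1 - (τ : ℝ)) * q.1 + τ * q.2 := by fun_prop
  exact (h.contMDiff.comp ((contMDiff_val f).prodMk_space (contMDiff_val g))) x

theorem slope_conv (τ : unitInterval) (x : S.carrier) : 0 < slope (conv f g τ) x := by
  have h1 := hasDerivWithinAt_slope (f.mdiff x)
  have h2 := hasDerivWithinAt_slope (g.mdiff x)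
  have h := (h1.const_mul (1 - (τ : ℝ))).add (h2.const_mul (τ : ℝ))
  rw [(slope_eq (contMDiff_conv_const τ).continuous.continuousAt h).2]
  have p1 := f.slope_pos x
  have p2 := g.slope_pos x
  rcases τ.2.1.eq_or_lt with h0 | h0
  · have e : (1 - (τ : ℝ)) * slope f.fn x + τ * slope g.fn x = slope f.fn x := by rw [← h0]; ring
    exact p1.trans_eq e.symm
  · have := mul_pos h0 p2
    have := mul_nonneg (sub_nonneg.2 τ.2.2) p1.le
    exact add_pos_of_nonneg_of_pos ‹_› ‹_›

/-- A convex combination of morphisms inducing the same order. -/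
def convHom (hfg : ∀ x y, f.fn x ≤ f.fn y ↔ g.fn x ≤ g.fn y) (τ : unitInterval) :
    S ⟶ Mfd.interval a b where
  toFun := conv f g τ
  smooth := contMDiff_conv_const τ
  slope_pos := slope_conv τ
  surj := conv_surjective hfg τ
  map_interior x hx h := f.map_interior x hx (by
    have := conv_boundary hfg (interval_boundary.1 h)
    show f.fn x ∈ _
    rw [this]
    exact h)
  label_boundary x h := by
    have := conv_boundary hfg (interval_boundary.1 h)
    rw [← f.label_boundary x (by show f.fn x ∈ _; rw [this]; exact h)]
    congr 1
    exact Subtype.ext this.symm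
  glue x y h hne := by
    have h' := (conv_eq_iff hfg).1 h
    obtain ⟨h1, h2⟩ := f.glue x y h' hne
    refine ⟨fun hb => h1 ?_, h2⟩
    have := conv_boundary hfg (interval_boundary.1 hb)
    show f.fn x ∈ _
    rw [this]
    exact hb

/-- Morphisms to an interval inducing the same order are isotopic. -/
theorem isotopic_of_le_iff (hfg : ∀ x y, f.fn x ≤ f.fn y ↔ g.fn x ≤ g.fn y) : Isotopic f g := by
  have h := Isotopic.of_family (convHom hfg)
    -- The family must be defined for all real parameters; the projection changes nothing for
    -- parameters in `[0,1]`.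
    (fun p => projIcc 0 1 zero_le_one ((1 - p.1) * (f.fn p.2 : ℝ) + p.1 * (g.fn p.2 : ℝ))) ?_ ?_
  · convert h using 1
    · ext x
      refine Subtype.ext ?_
      show (f.fn x : ℝ) = (1 - ((0 : unitInterval) : ℝ)) * f.fn x + ((0 : unitInterval) : ℝ) * g.fn x
      simp
    · ext x
      refine Subtype.ext ?_
      show (g.fn x : ℝ) = (1 - ((1 : unitInterval) : ℝ)) * f.fn x + ((1 : unitInterval) : ℝ) * g.fn x
      simp
  · intro p hp
    refine contMDiffWithinAt_unitInterval.2 (((contMDiff_conv (f := f) (g := g)) p hp).congr ?_ ?_)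
    · intro q hq
      exact congrArg Subtype.val (projIcc_val zero_le_one (conv f g ⟨q.1, hq.1⟩ q.2))
    · exact congrArg Subtype.val (projIcc_val zero_le_one (conv f g ⟨p.1, hp.1⟩ p.2))
  · intro τ x
    show projIcc _ _ _ ((conv f g τ x : unitInterval) : ℝ) = conv f g τ x
    exact projIcc_val _ _

end Conv

end

section

variable {Λ : Type}

/-! ### Diffeomorphisms of the circle and their lifts -/

section Circle

open Set Topology
open scoped Manifold ContDiff

theorem circ_coe_eq {s t : ℝ} : (s : Circ) = t ↔ ∃ n : ℤ, s = t + n := by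
  rw [← sub_eq_zero, ← AddCircle.coe_sub, AddCircle.coe_eq_zero_iff]
  refine exists_congr fun n => ?_
  rw [zsmul_eq_mul, mul_one]
  constructor <;> intro h <;> linarith

theorem circ_exists (x : Circ) : ∃ t : ℝ, (t : Circ) = x := ⟨_, (AddCircle.equivIco (1 : ℝ) 0).symm_apply_apply x⟩

/-- The lifts to the real line of orientation-preserving diffeomorphisms of the circle. -/
structure IsCircLift (F : ℝ → ℝ) : Prop where
  smooth : ContDiff ℝ ∞ F
  pos : ∀ t, 0 < deriv F t
  add_one : ∀ t, F (t + 1) = F t + 1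

/-- The map of the circle induced by a map of the real line commuting with translations. -/
def circFun (F : ℝ → ℝ) (x : Circ) : Circ := (F (AddCircle.equivIco (1 : ℝ) 0 x) : ℝ)

theorem add_int {F : ℝ → ℝ} (h : ∀ t, F (t + 1) = F t + 1) (t : ℝ) (n : ℤ) : F (t + n) = F t + n := by
  induction n with
  | zero => simp
  | succ n ih =>
    rw [Int.cast_add, Int.cast_one, ← add_assoc, h, ih, add_assoc]
  | pred n ih =>
    have := h (t + ((-n - 1 : ℤ) : ℝ))
    push_cast at this ih ⊢
    rw [show t + (-(n : ℝ) - 1) + 1 = t + -(n : ℝ) by ring, ih] at this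
    linarith

theorem circFun_coe {F : ℝ → ℝ} (h : ∀ t, F (t + 1) = F t + 1) (t : ℝ) :
    circFun F (t : Circ) = (F t : ℝ) := by
  have h1 : ((AddCircle.equivIco (1 : ℝ) 0 (t : Circ) : ℝ) : Circ) = (t : Circ) :=
    (AddCircle.equivIco (1 : ℝ) 0).symm_apply_apply _
  obtain ⟨n, hn⟩ := circ_coe_eq.1 h1
  rw [circFun, hn, add_int h, circ_coe_eq]
  exact ⟨n, rfl⟩

theorem contMDiff_coe_circ : ContMDiff 𝓘(ℝ, ℝ) J ∞ fun t : ℝ => (t : Circ) := by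
  intro s
  refine contMDiffAt_iff_target.2 ⟨(AddCircle.continuous_mk' (1 : ℝ)).continuousAt, ?_⟩
  obtain ⟨a, ha⟩ := chartAt_circ (s : Circ)
  obtain ⟨c, hc⟩ := circChart_coe_eventually a s (ha ▸ mem_chart_source unitInterval (s : Circ))
  have h : ContDiff ℝ ∞ fun t : ℝ => t + c := by fun_prop
  refine h.contMDiff.contMDiffAt.congr_of_eventuallyEq ?_
  filter_upwards [hc] with t ht
  rw [← ht, Function.comp_apply, extChartAt, ha]
  rfl

theorem exists_local_lift (x : Circ) : ∃ r : Circ → ℝ, ContMDiffAt J 𝓘(ℝ, ℝ) ∞ r x ∧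
    ∀ᶠ y in 𝓝 x, (r y : Circ) = y := by
  obtain ⟨a, ha⟩ := chartAt_circ x
  have hx : x ∈ (circChart a).source := ha ▸ mem_chart_source unitInterval x
  refine ⟨fun y => (circChart a y : ℝ) + a, ?_, ?_⟩
  · have h1 : ContMDiffAt J J ∞ (circChart a) x :=
      contMDiffAt_of_mem_maximalAtlas (IsManifold.subset_maximalAtlas (I := J) (n := ∞)
        (mem_range_self a)) hx
    have h : ContDiff ℝ ∞ fun t : ℝ => t + a := by fun_prop
    exact h.contMDiff.contMDiffAt.comp x (contMDiffAt_unitInterval.1 h1)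
  · filter_upwards [(circChart a).open_source.mem_nhds hx] with y hy
    rw [← circChart_symm_apply, (circChart a).left_inv hy]

/-- Locally the induced map is a smooth local section of the covering, followed by `Φ` and the
covering map. -/
theorem contMDiff_circFun_family {Φ : ℝ × ℝ → ℝ} (hΦ : ContDiff ℝ ∞ Φ)
    (h : ∀ τ t, Φ (τ, t + 1) = Φ (τ, t) + 1) :
    ContMDiff (𝓘(ℝ, ℝ).prod J) J ∞ fun p : ℝ × Circ => circFun (fun t => Φ (p.1, t)) p.2 := by
  rintro ⟨τ, x⟩
  obtain ⟨r, hr, hr'⟩ := exists_local_lift x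
  have h1 : ContMDiffAt (𝓘(ℝ, ℝ).prod J) 𝓘(ℝ, ℝ) ∞ (fun p : ℝ × Circ => r p.2) (τ, x) :=
    ContMDiffAt.comp (g := r) (f := fun p : ℝ × Circ => p.2) (τ, x) hr contMDiffAt_snd
  have h2 := (contMDiff_coe_circ (Φ (τ, r x))).comp (τ, x)
    (hΦ.contMDiff.contMDiffAt.comp (τ, x) (contMDiffAt_fst.prodMk_space h1))
  refine h2.congr_of_eventuallyEq ?_
  filter_upwards [continuousAt_snd.eventually hr'] with p hp
  rw [← hp, circFun_coe (h p.1)]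
  rfl

variable {F G : ℝ → ℝ}

theorem circFun_spec (hF : IsCircLift F) (x : Circ) :
    ContMDiffAt J J ∞ (circFun F) x ∧ 0 < slope (circFun F) x := by
  have hc : Continuous (circFun F) :=
    (contMDiff_circFun_family (Φ := fun p => F p.2) (hF.smooth.comp contDiff_snd)
      (fun _ => hF.add_one)).continuous.comp (Continuous.prodMk_right (0 : ℝ))
  obtain ⟨a, ha⟩ := chartAt_circ x
  obtain ⟨b, hb⟩ := chartAt_circ (circFun F x)
  have hx : x ∈ (circChart a).source := ha ▸ mem_chart_source unitInterval x
  have hx' : ((extChartAt J x x + a : ℝ) : Circ) = x := by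
    rw [extChartAt, ha]
    show (((circChart a x : ℝ) + a : ℝ) : Circ) = x
    rw [← circChart_symm_apply, (circChart a).left_inv hx]
  obtain ⟨c, h⟩ := circChart_coe_eventually b (F (extChartAt J x x + a)) (by
    rw [← circFun_coe hF.add_one, hx', ← hb]; exact mem_chart_source _ _)
  have hF' := hF.smooth
  have := contMDiffAt_and_slope (f := circFun F) (x := x) (g := fun u => F (u + a) + c)
    hc.continuousAt (by fun_prop) (by
      have ht : Filter.Tendsto (fun t : ℝ => F (t + a)) (𝓝 (extChartAt J x x))
          (𝓝 (F (extChartAt J x x + a))) :=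
        (hF.smooth.continuous.comp (continuous_id.add continuous_const)).tendsto _
      filter_upwards [self_mem_nhdsWithin, (ht.eventually h).filter_mono nhdsWithin_le_nhds]
        with t h1 h2
      rw [range_J] at h1
      rw [← h2, writtenInExtChartAt, Function.comp_apply, Function.comp_apply, extChartAt,
        extChartAt, ha, hb]
      show (circChart b (circFun F ((circChart a).symm (projIcc 0 1 zero_le_one t))) : ℝ) = _
      rw [circChart_symm_apply, circFun_coe hF.add_one, projIcc_of_mem _ h1])
  refine ⟨this.1, ?_⟩
  rw [this.2, deriv_add_const, deriv_comp_add_const]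
  exact hF.pos _

theorem IsCircLift.strictMono (hF : IsCircLift F) : StrictMono F := strictMono_of_deriv_pos hF.pos

theorem circFun_injective (hF : IsCircLift F) : Function.Injective (circFun F) := by
  intro x y h
  obtain ⟨s, rfl⟩ := circ_exists x
  obtain ⟨t, rfl⟩ := circ_exists y
  rw [circFun_coe hF.add_one, circFun_coe hF.add_one, circ_coe_eq] at h
  obtain ⟨n, hn⟩ := h
  rw [← add_int hF.add_one] at hn
  exact circ_coe_eq.2 ⟨n, hF.strictMono.injective hn⟩

theorem circFun_surjective (hF : IsCircLift F) : Function.Surjective (circFun F) := by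
  intro x
  obtain ⟨s, rfl⟩ := circ_exists x
  have h0 := add_int hF.add_one 0 ⌊s - F 0⌋
  have h1 := add_int hF.add_one 0 (⌊s - F 0⌋ + 1)
  obtain ⟨t, ht⟩ := mem_range_of_exists_le_of_exists_ge hF.smooth.continuous
    (c := s) ⟨_, by rw [h0]; linarith [Int.floor_le (s - F 0)]⟩
    ⟨_, by rw [h1]; push_cast; linarith [Int.lt_floor_add_one (s - F 0)]⟩
  exact ⟨t, by rw [circFun_coe hF.add_one, ht]⟩

/-- The morphism induced by a lift. -/
def circMap (hF : IsCircLift F) : Mfd.circle Λ ⟶ Mfd.circle Λ where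
  toFun := circFun F
  smooth x := (circFun_spec hF x).1
  slope_pos x := (circFun_spec hF x).2
  surj := circFun_surjective hF
  map_interior _ _ := not_mem_boundary_circ _
  label_boundary _ h := absurd h (not_mem_boundary_circ _)
  glue _ _ h hne := absurd (circFun_injective hF h) hne

theorem circMap_congr (hF : IsCircLift F) (hG : IsCircLift G) (h : F = G) :
    circMap (Λ := Λ) hF = circMap hG := by
  subst h; rfl

theorem circMap_coe (hF : IsCircLift F) (t : ℝ) :
    (circMap (Λ := Λ) hF).toFun (t : Circ) = ((F t : ℝ) : Circ) := circFun_coe hF.add_one t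

/-- Positivity of the derivative and commutation with the unit translation are convex conditions.
Two lifts are thus joined by a straight line, which gives the isotopy in `isotopic_circMap`. -/
theorem IsCircLift.conv (hF : IsCircLift F) (hG : IsCircLift G) (τ : unitInterval) :
    IsCircLift fun t => (1 - (τ : ℝ)) * F t + τ * G t where
  smooth := (contDiff_const.mul hF.smooth).add (contDiff_const.mul hG.smooth)
  pos t := by
    have h1 := (hF.smooth.differentiable (by simp)) t
    have h2 := (hG.smooth.differentiable (by simp)) t
    have h := (h1.hasDerivAt.const_mul (1 - (τ : ℝ))).add (h2.hasDerivAt.const_mul (τ : ℝ))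
    rw [show (fun t => (1 - (τ : ℝ)) * F t + τ * G t) = (fun t => (1 - (τ : ℝ)) * F t) +
      fun t => τ * G t from rfl, h.deriv]
    rcases τ.2.1.eq_or_lt with h0 | h0
    · rw [← h0]; simpa using hF.pos t
    · exact add_pos_of_nonneg_of_pos (mul_nonneg (sub_nonneg.2 τ.2.2) (hF.pos t).le)
        (mul_pos h0 (hG.pos t))
  add_one t := by
    rw [hF.add_one, hG.add_one]; ring

theorem isotopic_circMap (hF : IsCircLift F) (hG : IsCircLift G) :
    Isotopic (circMap (Λ := Λ) hF) (circMap hG) := by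
  have h := Isotopic.of_family (S := Mfd.circle Λ) (T := Mfd.circle Λ)
    (fun τ => circMap (hF.conv hG τ))
    (fun p => circFun (fun t => (1 - p.1) * F t + p.1 * G t) p.2)
    (contMDiff_circFun_family (Φ := fun q => (1 - q.1) * F q.2 + q.1 * G q.2) (by
      have := hF.smooth
      have := hG.smooth
      fun_prop) (fun τ t => by
        show (1 - τ) * F (t + 1) + τ * G (t + 1) = (1 - τ) * F t + τ * G t + 1
        rw [hF.add_one, hG.add_one]; ring)).contMDiffOn
    (fun τ x => rfl)
  have e0 : circMap (Λ := Λ) (hF.conv hG 0) = circMap hF := circMap_congr _ _ (by ext t; simp)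
  have e1 : circMap (Λ := Λ) (hF.conv hG 1) = circMap hG := circMap_congr _ _ (by ext t; simp)
  rwa [e0, e1] at h

theorem isCircLift_add (r : ℝ) : IsCircLift fun t => t + r where
  smooth := by fun_prop
  pos t := by simp
  add_one t := by ring

theorem circMap_zero : circMap (Λ := Λ) (isCircLift_add 0) = 𝟙 _ := by
  ext x
  obtain ⟨t, rfl⟩ := circ_exists x
  exact (circMap_coe _ t).trans (congrArg (fun r : ℝ => (r : Circ)) (add_zero t))

theorem exists_lift {c : ℝ → Circ} (hc : Continuous c) :
    ∃ F : ℝ → ℝ, Continuous F ∧ ∀ t, (F t : Circ) = c t := by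
  obtain ⟨r, hr⟩ := circ_exists (c 0)
  obtain ⟨F, ⟨-, hF⟩, -⟩ := (AddCircle.isCoveringMap_coe (1 : ℝ)).existsUnique_continuousMap_lifts
    ⟨c, hc⟩ 0 r hr
  exact ⟨F, F.continuous, fun t => congrFun hF t⟩

/-- A lift of a path, compared with the path read in a chart. -/
theorem rd_eq_lift {c : unitInterval → Circ} (hG : Continuous G)
    (h : ∀ t ∈ Icc (0 : ℝ) 1, (G t : Circ) = c (projIcc 0 1 zero_le_one t)) (s : unitInterval) :
    ∃ e ∈ atlas unitInterval Circ, c s ∈ e.source ∧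
      ∃ k : ℝ, ∀ᶠ t : ℝ in 𝓝[Icc 0 1] s, G t = rd e c t + k := by
  obtain ⟨b, hb⟩ := chartAt_circ (c s)
  have hs : c s ∈ (circChart b).source := hb ▸ mem_chart_source unitInterval (c s)
  have h1 := h s s.2
  rw [projIcc01_coe] at h1
  obtain ⟨k, hk⟩ := circChart_coe_eventually b (G s) (h1 ▸ hs)
  refine ⟨circChart b, mem_range_self b, hs, -k, ?_⟩
  filter_upwards [self_mem_nhdsWithin,
    (hG.continuousAt.eventually hk).filter_mono nhdsWithin_le_nhds] with t h2 h3
  rw [rd, ← h t h2, h3]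
  ring

variable {c : unitInterval → Circ}

theorem lift_deriv (hc : ContMDiff J J ∞ c) (pc : ∀ s, 0 < slope c s) (hG : Continuous G)
    (h : ∀ t ∈ Icc (0 : ℝ) 1, (G t : Circ) = c (projIcc 0 1 zero_le_one t)) (s : unitInterval) :
    ContDiffWithinAt ℝ ∞ G (Icc 0 1) s ∧ ∃ d > 0, HasDerivWithinAt G d (Icc 0 1) s := by
  obtain ⟨e, he, hs, k, hk⟩ := rd_eq_lift hG h s
  constructor
  · exact ((rd_contDiffWithinAt he hs (hc s)).add contDiffWithinAt_const).congr_of_eventuallyEq_of_mem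
      hk s.2
  · obtain ⟨d, hd, h'⟩ := rd_deriv orientedAtlas_circ he hs (hc.mdifferentiable (by simp) s) (pc s)
    exact ⟨d, hd, (h'.add_const k).congr_of_eventuallyEq_of_mem hk s.2⟩

theorem lift_strictMonoOn (hc : ContMDiff J J ∞ c) (pc : ∀ s, 0 < slope c s) (hG : Continuous G)
    (h : ∀ t ∈ Icc (0 : ℝ) 1, (G t : Circ) = c (projIcc 0 1 zero_le_one t)) :
    StrictMonoOn G (Icc 0 1) := by
  refine strictMonoOn_of_deriv_pos (convex_Icc 0 1) hG.continuousOn fun t ht => ?_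
  rw [interior_Icc] at ht
  obtain ⟨-, d, hd, h'⟩ := lift_deriv hc pc hG h ⟨t, Ioo_subset_Icc_self ht⟩
  rw [(h'.hasDerivAt (Icc_mem_nhds ht.1 ht.2)).deriv]
  exact hd

/-- A morphism of the circle is injective, since there is no boundary to identify. Its lift `F` to
the line is increasing, and `F (t + 1) - F t` is a positive integer `n`. If `n > 1`, then `F` takes
the value `F t + 1` strictly between `t` and `t + 1`, against injectivity. -/
theorem exists_circLift (f : Mfd.circle Λ ⟶ Mfd.circle Λ) :
    ∃ (F : ℝ → ℝ) (hF : IsCircLift F), f = circMap hF := by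
  have hinj : ∀ x y : Circ, f.toFun x = f.toFun y → x = y := by
    intro x y h
    by_contra hne
    exact not_mem_boundary_circ x (f.glue x y h hne).2.1
  obtain ⟨F, hc, hF⟩ := exists_lift (c := fun t => f.toFun (t : Circ))
    (f.smooth.continuous.comp (AddCircle.continuous_mk' (1 : ℝ)))
  have hl : ∀ t, ContDiffAt ℝ ∞ F t ∧ 0 < deriv F t := by
    intro t
    -- The shift puts `t` at the midpoint of a parametrized unit interval, where derivatives within
    -- `[0,1]` are ordinary derivatives.
    have hr := isCircLift_add (t - 1 / 2)
    have h1 : ContMDiff J J ∞ (circFun (fun u => u + (t - 1 / 2)) ∘ wrap) := fun s =>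
      (circFun_spec hr _).1.comp s (wrap_spec s).1
    have h2 : ∀ s, 0 < slope (circFun (fun u => u + (t - 1 / 2)) ∘ wrap) s := fun s =>
      pos_comp (fun x => (circFun_spec hr x).1) (fun x => (wrap_spec x).1) s (circFun_spec hr _).2
        ((wrap_spec s).2.symm ▸ one_pos)
    have hl := lift_deriv (G := fun u => F (u + (t - 1 / 2))) (f.smooth.comp h1)
      (fun s => pos_comp f.smooth h1 s (f.slope_pos _) (h2 s)) (by fun_prop)
      (fun u hu => by
        rw [hF, projIcc_of_mem _ hu]
        exact congrArg f.toFun (circFun_coe (F := fun u => u + (t - 1 / 2)) hr.add_one u).symm) ⟨1 / 2, by norm_num, by norm_num⟩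
    have hn : Icc (0 : ℝ) 1 ∈ 𝓝 (1 / 2 : ℝ) := Icc_mem_nhds (by norm_num) (by norm_num)
    obtain ⟨h3, d, hd, h4⟩ := hl
    have h5 := h3.contDiffAt hn
    have h6 := h4.hasDerivAt hn
    constructor
    · have e : F = (fun u => F (u + (t - 1 / 2))) ∘ fun u => u - (t - 1 / 2) := by
        ext u; simp
      rw [e]
      refine ContDiffAt.comp t ?_ (by fun_prop)
      convert h5 using 1
      ring
    · have h7 : deriv (fun u => F (u + (t - 1 / 2))) (1 / 2) = d := h6.deriv
      rw [deriv_comp_add_const, show (1 / 2 + (t - 1 / 2) : ℝ) = t by ring] at h7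
      rw [h7]
      exact hd
  have hm : StrictMono F := strictMono_of_deriv_pos fun t => (hl t).2
  have h1 : ∀ t, F (t + 1) = F t + 1 := by
    intro t
    have e : (F (t + 1) : Circ) = (F t : Circ) := by
      rw [hF, hF]
      congr 1
      exact circ_coe_eq.2 ⟨1, by simp⟩
    obtain ⟨n, hn⟩ := circ_coe_eq.1 e
    have h0 : F t < F (t + 1) := hm (by linarith)
    have hn0 : (0 : ℤ) < n := by
      have : (0 : ℝ) < n := by linarith
      exact_mod_cast this
    by_contra hne
    have hn2 : (1 : ℤ) < n := by
      refine lt_of_le_of_ne hn0 fun h => hne ?_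
      rw [hn, ← h]; simp
    have hn3 : (1 : ℝ) < n := by exact_mod_cast hn2
    obtain ⟨u, hu, hu'⟩ := intermediate_value_Ioo (by linarith : t ≤ t + 1) hc.continuousOn
      (show F t + 1 ∈ Ioo (F t) (F (t + 1)) from ⟨by linarith, by linarith⟩)
    have e2 : (u : Circ) = (t : Circ) := hinj _ _ (by
      rw [← hF, ← hF]
      exact circ_coe_eq.2 ⟨1, by simpa using hu'⟩)
    obtain ⟨m, hm'⟩ := circ_coe_eq.1 e2
    have m1 : (0 : ℝ) < m := by linarith [hu.1]
    have m2 : (m : ℝ) < 1 := by linarith [hu.2]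
    have m3 : (0 : ℤ) < m := by exact_mod_cast m1
    have m4 : m < (1 : ℤ) := by exact_mod_cast m2
    omega
  refine ⟨F, ⟨contDiff_iff_contDiffAt.2 fun t => (hl t).1, fun t => (hl t).2, h1⟩, ?_⟩
  ext x
  obtain ⟨t, rfl⟩ := circ_exists x
  exact (hF t).symm.trans (circFun_coe h1 t).symm

theorem isotopic_circle (f : Mfd.circle Λ ⟶ Mfd.circle Λ) : Isotopic f (𝟙 _) := by
  obtain ⟨F, hF, rfl⟩ := exists_circLift f
  rw [← circMap_zero]
  exact isotopic_circMap hF _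

end Circle

end

section

variable {Λ : Type}

/-! ### Isotopies of disjoint unions, and interpolation with positive derivative -/

section Tensor

open Set Topology
open scoped Manifold ContDiff

/-- Near a point of one summand, `F` is the composite of its restriction to this summand with the
smooth map that is the identity there and constant on the other summand. -/
theorem contMDiffOn_sum {E H X Y Y' Z : Type} [NormedAddCommGroup E] [NormedSpace ℝ E]
    [TopologicalSpace H] {I : ModelWithCorners ℝ E H} [TopologicalSpace X] [ChartedSpace H X]
    [TopologicalSpace Y] [ChartedSpace unitInterval Y] [TopologicalSpace Y']
    [ChartedSpace unitInterval Y'] [TopologicalSpace Z] [ChartedSpace unitInterval Z] {s : Set X}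
    {F : X × (Y ⊕ Y') → Z}
    (hl : ContMDiffOn (I.prod J) J ∞ (fun p : X × Y => F (p.1, Sum.inl p.2)) (s ×ˢ univ))
    (hr : ContMDiffOn (I.prod J) J ∞ (fun p : X × Y' => F (p.1, Sum.inr p.2)) (s ×ˢ univ)) :
    ContMDiffOn (I.prod J) J ∞ F (s ×ˢ univ) := by
  rintro ⟨x, y | y⟩ ⟨hx, -⟩
  · have h1 : ContMDiff J J ∞ (Sum.elim id fun _ => y : Y ⊕ Y' → Y) :=
      contMDiff_id.sumElim contMDiff_const
    have h2 : ContMDiff (I.prod J) (I.prod J) ∞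
        fun p : X × (Y ⊕ Y') => (p.1, (Sum.elim id fun _ => y : Y ⊕ Y' → Y) p.2) :=
      contMDiff_fst.prodMk (h1.comp contMDiff_snd)
    have h3 := ContMDiffWithinAt.comp (x, Sum.inl y) (hl (x, y) ⟨hx, mem_univ _⟩)
      (h2.contMDiffAt.contMDiffWithinAt (s := s ×ˢ univ))
      (fun p (hp : p ∈ s ×ˢ univ) => (⟨hp.1, mem_univ _⟩ : _ ∈ s ×ˢ univ))
    have hn : ∀ᶠ p : X × (Y ⊕ Y') in 𝓝 (x, Sum.inl y), p.2 ∈ range (Sum.inl : Y → Y ⊕ Y') :=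
      continuousAt_snd.eventually (isOpen_range_inl.mem_nhds ⟨y, rfl⟩)
    refine h3.congr_of_eventuallyEq (hn.filter_mono nhdsWithin_le_nhds |>.mono ?_) rfl
    rintro ⟨p, q⟩ ⟨z, rfl⟩
    rfl
  · have h1 : ContMDiff J J ∞ (Sum.elim (fun _ => y) id : Y ⊕ Y' → Y') :=
      contMDiff_const.sumElim contMDiff_id
    have h2 : ContMDiff (I.prod J) (I.prod J) ∞
        fun p : X × (Y ⊕ Y') => (p.1, (Sum.elim (fun _ => y) id : Y ⊕ Y' → Y') p.2) :=
      contMDiff_fst.prodMk (h1.comp contMDiff_snd)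
    have h3 := ContMDiffWithinAt.comp (x, Sum.inr y) (hr (x, y) ⟨hx, mem_univ _⟩)
      (h2.contMDiffAt.contMDiffWithinAt (s := s ×ˢ univ))
      (fun p (hp : p ∈ s ×ˢ univ) => (⟨hp.1, mem_univ _⟩ : _ ∈ s ×ˢ univ))
    have hn : ∀ᶠ p : X × (Y ⊕ Y') in 𝓝 (x, Sum.inr y), p.2 ∈ range (Sum.inr : Y' → Y ⊕ Y') :=
      continuousAt_snd.eventually (isOpen_range_inr.mem_nhds ⟨y, rfl⟩)
    refine h3.congr_of_eventuallyEq (hn.filter_mono nhdsWithin_le_nhds |>.mono ?_) rfl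
    rintro ⟨p, q⟩ ⟨z, rfl⟩
    rfl

theorem Isotopic.tensor {S S' T T' : Mfd Λ} {f f' : S ⟶ T} {g g' : S' ⟶ T'} (h : Isotopic f f')
    (h' : Isotopic g g') : Isotopic (f ⊗ₘ g) (f' ⊗ₘ g') := by
  obtain ⟨σ, ⟨F, hF, hσ⟩, rfl, rfl⟩ := h
  obtain ⟨τ, ⟨G, hG, hτ⟩, rfl, rfl⟩ := h'
  refine ⟨fun t => σ t ⊗ₘ τ t, ⟨fun p => Sum.elim (fun x => Sum.inl (F (p.1, x)))
    (fun x => Sum.inr (G (p.1, x))) p.2, contMDiffOn_sum ?_ ?_, ?_⟩, rfl, rfl⟩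
  · exact ContMDiff.inl.comp_contMDiffOn hF
  · exact ContMDiff.inr.comp_contMDiffOn hG
  · rintro t (x | x)
    · exact congrArg Sum.inl (hσ t x)
    · exact congrArg Sum.inr (hτ t x)

end Tensor

section Blend

open Set Topology
open scoped Manifold ContDiff

/-- Smoothness and positive derivative at a point of the unit interval. -/
def Imm (A : ℝ → ℝ) (t : ℝ) : Prop :=
  ContDiffWithinAt ℝ ∞ A (Icc 0 1) t ∧ ∃ d > 0, HasDerivWithinAt A d (Icc 0 1) t

theorem Imm.congr {A B : ℝ → ℝ} {t : ℝ} (h : Imm A t) (ht : t ∈ Icc (0 : ℝ) 1)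
    (e : ∀ᶠ u in 𝓝[Icc 0 1] t, B u = A u) : Imm B t := by
  obtain ⟨h1, d, hd, h2⟩ := h
  exact ⟨h1.congr_of_eventuallyEq_of_mem e ht, d, hd, h2.congr_of_eventuallyEq_of_mem e ht⟩

theorem imm_id (t : ℝ) : Imm (fun u => u) t :=
  ⟨contDiffWithinAt_id, 1, one_pos, hasDerivWithinAt_id _ _⟩

theorem Imm.affine {A : ℝ → ℝ} {t : ℝ} (h : Imm A t) {m : ℝ} (hm : 0 < m) (r : ℝ) :
    Imm (fun u => r + m * A u) t := by
  obtain ⟨h1, d, hd, h2⟩ := h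
  exact ⟨contDiffWithinAt_const.add (contDiffWithinAt_const.mul h1), m * d, mul_pos hm hd,
    (h2.const_mul m).const_add r⟩

theorem Imm.strictMonoOn {A : ℝ → ℝ} (h : ∀ t ∈ Icc (0 : ℝ) 1, Imm A t) :
    StrictMonoOn A (Icc 0 1) := by
  refine strictMonoOn_of_deriv_pos (convex_Icc 0 1) (fun t ht => (h t ht).1.continuousWithinAt)
    fun t ht => ?_
  rw [interior_Icc] at ht
  obtain ⟨-, d, hd, h'⟩ := h t (Ioo_subset_Icc_self ht)
  rw [(h'.hasDerivAt (Icc_mem_nhds ht.1 ht.2)).deriv]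
  exact hd

/-- The interpolation between two functions. -/
def blend (s₁ s₂ : ℝ) (A B : ℝ → ℝ) (t : ℝ) : ℝ :=
  A t + Real.smoothTransition ((t - s₁) / (s₂ - s₁)) * (B t - A t)

variable {s₁ s₂ : ℝ} {A B : ℝ → ℝ}

theorem blend_left (h : s₁ < s₂) {t : ℝ} (ht : t ≤ s₁) : blend s₁ s₂ A B t = A t := by
  rw [blend, Real.smoothTransition.zero_of_nonpos
    (div_nonpos_of_nonpos_of_nonneg (by linarith) (by linarith)), zero_mul, add_zero]

theorem blend_right (h : s₁ < s₂) {t : ℝ} (ht : s₂ ≤ t) : blend s₁ s₂ A B t = B t := by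
  rw [blend, Real.smoothTransition.one_of_one_le
    ((one_le_div (by linarith)).2 (by linarith)), one_mul]
  ring

/-- With `ρ` the transition function, the derivative of `A + ρ (B - A)` is `(1 - ρ) A' + ρ B' + ρ'
(B - A)`. The last term is nonnegative because `ρ` is increasing and `A ≤ B` on the transition
interval; that is the purpose of `hAB`. -/
theorem imm_blend (h : s₁ < s₂) (hA : ∀ t ∈ Icc (0 : ℝ) 1, t ≤ s₂ → Imm A t)
    (hB : ∀ t ∈ Icc (0 : ℝ) 1, s₁ ≤ t → Imm B t) (hAB : ∀ t ∈ Icc s₁ s₂, A t ≤ B t) {t : ℝ}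
    (ht : t ∈ Icc (0 : ℝ) 1) : Imm (blend s₁ s₂ A B) t := by
  rcases lt_or_ge t s₁ with h1 | h1
  · refine (hA t ht (h1.le.trans h.le)).congr ht (Filter.Eventually.filter_mono nhdsWithin_le_nhds ?_)
    filter_upwards [eventually_lt_nhds h1] with u hu using blend_left h hu.le
  rcases lt_or_ge s₂ t with h2 | h2
  · refine (hB t ht (h.le.trans h2.le)).congr ht (Filter.Eventually.filter_mono nhdsWithin_le_nhds ?_)
    filter_upwards [eventually_gt_nhds h2] with u hu using blend_right h hu.le
  obtain ⟨a1, a, a0, a2⟩ := hA t ht h2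
  obtain ⟨b1, b, b0, b2⟩ := hB t ht h1
  have hρ : ContDiff ℝ ∞ fun u : ℝ => Real.smoothTransition ((u - s₁) / (s₂ - s₁)) :=
    Real.smoothTransition.contDiff.comp (by fun_prop)
  have hm : Monotone fun u : ℝ => Real.smoothTransition ((u - s₁) / (s₂ - s₁)) := fun u v huv =>
    Real.smoothTransition.monotone
      (div_le_div_of_nonneg_right (by linarith) (by linarith))
  have hd := ((hρ.differentiable (by simp)) t).hasDerivAt
  refine ⟨a1.add (hρ.contDiffAt.contDiffWithinAt.mul (b1.sub a1)), _, ?_,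
    a2.add (hd.hasDerivWithinAt.mul (b2.sub a2))⟩
  have r0 := Real.smoothTransition.nonneg ((t - s₁) / (s₂ - s₁))
  have r1 := Real.smoothTransition.le_one ((t - s₁) / (s₂ - s₁))
  have h3 : 0 ≤ deriv (fun u : ℝ => Real.smoothTransition ((u - s₁) / (s₂ - s₁))) t * (B t - A t) :=
    mul_nonneg hm.deriv_nonneg (sub_nonneg.2 (hAB t ⟨h1, h2⟩))
  generalize Real.smoothTransition ((t - s₁) / (s₂ - s₁)) = r at *
  have h4 : 0 < a + r * (b - a) := by
    rcases r0.eq_or_lt with h0 | h0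
    · rw [← h0]; linarith
    · have := mul_pos h0 b0
      have := mul_nonneg (sub_nonneg.2 r1) a0.le
      nlinarith
  linarith

/-- Reparametrizations of an interval are constructed from real functions in this way. The inverse
comes from `isIso_of_injective`, without further calculus. -/
theorem exists_intervalHom (h : ∀ t ∈ Icc (0 : ℝ) 1, Imm A t) (h0 : A 0 = 0) (h1 : A 1 = 1)
    (a b : Λ) : ∃ k : Mfd.interval a b ⟶ Mfd.interval a b,
      (∀ s : unitInterval, (k.fn s : ℝ) = A s) ∧ IsIso k ∧
      ∀ s t : unitInterval, k.fn s ≤ k.fn t ↔ s ≤ t := by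
  have hm := Imm.strictMonoOn h
  have hA : ∀ s : unitInterval, A s ∈ Icc (0 : ℝ) 1 := fun s =>
    ⟨h0 ▸ hm.monotoneOn (left_mem_Icc.2 zero_le_one) s.2 s.2.1,
      h1 ▸ hm.monotoneOn s.2 (right_mem_Icc.2 zero_le_one) s.2.2⟩
  let k : unitInterval → unitInterval := fun s => ⟨A s, hA s⟩
  have hk : StrictMono k := fun s t hst => hm s.2 t.2 hst
  have hc : Continuous k := by
    have h2 : ContinuousOn A (Icc 0 1) := fun t ht => (h t ht).1.continuousWithinAt
    exact continuous_induced_rng.2 (h2.comp_continuous continuous_subtype_val fun s => s.2)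
  have k0 : k 0 = 0 := Subtype.ext h0
  have k1 : k 1 = 1 := Subtype.ext h1
  have hs : ∀ s, ContMDiffAt J J ∞ k s ∧ 0 < slope k s := by
    intro s
    obtain ⟨d1, d, hd, d2⟩ := h s s.2
    have e : ∀ t ∈ Icc (0 : ℝ) 1, rd (chartAt unitInterval s) k t = A t := fun t ht => by
      rw [rd, projIcc_of_mem _ ht, chartAt_self_eq]; rfl
    exact of_rd orientedAtlas_unitInterval (chart_mem_atlas unitInterval s)
      (by rw [chartAt_self_eq]; exact mem_univ _)
      hc.continuousAt (d1.congr_of_mem e s.2) hd (d2.congr_of_mem e s.2)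
  have hb : ∀ s, k s ∈ J.boundary unitInterval → s ∈ J.boundary unitInterval ∧ k s = s := by
    intro s hs
    rw [mem_boundary_unitInterval] at hs ⊢
    rcases hs with h | h
    · have : s = 0 := hk.injective (h.trans k0.symm)
      exact ⟨Or.inl this, by rw [this, k0]⟩
    · have : s = 1 := hk.injective (h.trans k1.symm)
      exact ⟨Or.inr this, by rw [this, k1]⟩
  have hsurj : Function.Surjective k := fun s => mem_range_of_exists_le_of_exists_ge hc
    ⟨0, k0.trans_le (unitInterval.nonneg' (t := s))⟩
    ⟨1, (unitInterval.le_one' (t := s)).trans_eq k1.symm⟩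
  let K : Mfd.interval a b ⟶ Mfd.interval a b :=
    { toFun := k
      smooth := fun s => (hs s).1
      slope_pos := fun s => (hs s).2
      surj := hsurj
      map_interior := fun s hs h => hs (hb s h).1
      label_boundary := fun s h => congrArg (Mfd.interval a b).label (Subtype.ext (hb s.1 h).2)
      glue := fun s t h hne => absurd (hk.injective h) hne }
  exact ⟨K, fun s => rfl, isIso_of_injective K hk.injective, fun s t => hk.le_iff_le⟩

theorem apply_inv {S T : Mfd Λ} (k : S ⟶ T) [IsIso k] (x : T.carrier) :
    k.toFun ((inv k).toFun x) = x := by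
  rw [← Mfd.comp_toFun, IsIso.inv_hom_id]; rfl

theorem isotopic_inv_id {a b : Λ} (k : Mfd.interval a b ⟶ Mfd.interval a b) [IsIso k]
    (hk : ∀ s t : unitInterval, k.fn s ≤ k.fn t ↔ s ≤ t) : Isotopic (inv k) (𝟙 _) := by
  refine isotopic_of_le_iff fun x y => ?_
  rw [← hk]
  have h : ∀ x, k.fn ((inv k).fn x) = x := fun x => apply_inv k x
  rw [h, h]
  rfl

/-- The slope `d + 1` may be any number above the derivative. Divided by a larger `δ`, the estimate
makes the rescaled reading of a path lie above the identity, as `imm_blend` requires. -/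
theorem exists_le_right {P : ℝ → ℝ} {d : ℝ} (h : HasDerivWithinAt P d (Icc 0 1) 1) :
    ∃ s < 1, ∀ t ∈ Icc s 1, P 1 - P t ≤ (d + 1) * (1 - t) := by
  have h1 := (hasDerivWithinAt_iff_tendsto_slope.1 h).eventually (eventually_lt_nhds (lt_add_one d))
  rw [eventually_nhdsWithin_iff, Metric.eventually_nhds_iff] at h1
  obtain ⟨ε, hε, h2⟩ := h1
  refine ⟨1 - min (ε / 2) 1, by have := lt_min (half_pos hε) one_pos; linarith, fun t ht => ?_⟩
  rcases ht.2.eq_or_lt with rfl | h3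
  · simp
  · have h4 := h2 (y := t) (by
      rw [Real.dist_eq, abs_of_neg (by linarith)]
      linarith [ht.1, min_le_left (ε / 2) 1]) ⟨⟨by linarith [ht.1, min_le_right (ε / 2) 1], h3.le⟩, h3.ne⟩
    rw [slope_def_field, div_lt_iff_of_neg (by linarith)] at h4
    linarith

theorem exists_le_left {P : ℝ → ℝ} {d : ℝ} (h : HasDerivWithinAt P d (Icc 0 1) 0) :
    ∃ s > 0, ∀ t ∈ Icc 0 s, P t - P 0 ≤ (d + 1) * t := by
  have h1 := (hasDerivWithinAt_iff_tendsto_slope.1 h).eventually (eventually_lt_nhds (lt_add_one d))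
  rw [eventually_nhdsWithin_iff, Metric.eventually_nhds_iff] at h1
  obtain ⟨ε, hε, h2⟩ := h1
  refine ⟨min (ε / 2) 1, lt_min (half_pos hε) one_pos, fun t ht => ?_⟩
  rcases ht.1.eq_or_lt with rfl | h3
  · simp
  · have h4 := h2 (y := t) (by
      rw [Real.dist_eq, sub_zero, abs_of_pos h3]
      linarith [ht.2, min_le_left (ε / 2) 1]) ⟨⟨h3.le, by linarith [ht.2, min_le_right (ε / 2) 1]⟩, h3.ne'⟩
    rw [slope_def_field, div_lt_iff₀ (by linarith)] at h4
    linarith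

end Blend

end

section

variable {Λ : Type}

/-! ### Straightening, concatenating and closing paths -/

section Straighten

open Set Topology
open scoped Manifold ContDiff

variable {N : Type} [TopologicalSpace N] [ChartedSpace unitInterval N] [IsManifold J ∞ N]
  {c : unitInterval → N} {e : OpenPartialHomeomorph N unitInterval}

theorem imm_rd (oN : OrientedAtlas N) (he : e ∈ atlas unitInterval N) (hc : ContMDiff J J ∞ c)
    (pc : ∀ s, 0 < slope c s) {t : ℝ} (ht : t ∈ Icc (0 : ℝ) 1)
    (hs : c (projIcc 0 1 zero_le_one t) ∈ e.source) : Imm (rd e c) t := by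
  have h1 := rd_contDiffWithinAt he hs (hc _)
  have h2 := rd_deriv oN he hs (hc.mdifferentiable (by simp) _) (pc _)
  rw [projIcc_of_mem _ ht] at h1 h2
  exact ⟨h1, h2⟩

/-- The inverse of the reparametrization is built by blending the identity into an affine rescaling
of the path read in the chart `e`; after reparametrization the path is then affine near its end.
Every slope from `δ₀` on is possible, so that two paths can be given a common slope. -/
theorem exists_straighten_right (oN : OrientedAtlas N) (he : e ∈ atlas unitInterval N)
    (hc : ContMDiff J J ∞ c) (pc : ∀ s, 0 < slope c s) (h : c 1 ∈ e.source) (a b : Λ) :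
    ∃ δ₀ > 0, ∀ δ ≥ δ₀, ∃ k : Mfd.interval a b ⟶ Mfd.interval a b, Isotopic k (𝟙 _) ∧
      k.fn (0 : unitInterval) = 0 ∧ k.fn (1 : unitInterval) = 1 ∧ (∀ t : unitInterval, (t : ℝ) ≤ 1 / 2 → k.fn t = t) ∧
      ∃ t₀ < 1, ∀ t : unitInterval, t₀ ≤ (t : ℝ) →
        (e (c (k.fn t)) : ℝ) = e (c 1) + δ * (t - 1) := by
  obtain ⟨η, hη, hs⟩ := exists_right (hc.continuous.continuousAt.preimage_mem_nhds
    (e.open_source.mem_nhds h))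
  have hI : ∀ t ∈ Icc η 1, Imm (rd e c) t := fun t ht =>
    imm_rd oN he hc pc ⟨hη.1.le.trans ht.1, ht.2⟩ (hs t ht)
  obtain ⟨-, d, hd, hP⟩ := hI 1 ⟨hη.2.le, le_rfl⟩
  obtain ⟨s, hs1, hle⟩ := exists_le_right hP
  refine ⟨d + 1, by positivity, fun δ hδ => ?_⟩
  have hδ0 : 0 < δ := by linarith
  -- The transition takes place beyond `η`, where the path is in the chart, beyond `s`, where the
  -- estimate holds, and beyond `1 / 2`, so that the left half is left fixed.
  obtain ⟨s₁, hs₁, hs₁'⟩ := exists_between (max_lt (max_lt hη.2 hs1) (by norm_num : (1 / 2 : ℝ) < 1))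
  have i1 : η < s₁ := ((le_max_left _ _).trans (le_max_left _ _)).trans_lt hs₁
  have i2 : s < s₁ := ((le_max_right _ _).trans (le_max_left _ _)).trans_lt hs₁
  have i3 : 1 / 2 < s₁ := (le_max_right _ _).trans_lt hs₁
  obtain ⟨s₂, hs₂, hs₂'⟩ := exists_between hs₁'
  -- With `P = rd e c`, this function is `t` before `s₁` and `1 - (P 1 - P t) / δ` after `s₂`. Its
  -- inverse `k` satisfies `P (k t) = P 1 + δ (t - 1)` near `1`.
  have hK : ∀ t ∈ Icc (0 : ℝ) 1, Imm (blend s₁ s₂ (fun u => u)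
      (fun u => (1 - rd e c 1 / δ) + 1 / δ * rd e c u)) t := fun t ht => imm_blend hs₂
    (fun t _ _ => imm_id t)
    (fun t ht ht' => (hI t ⟨i1.le.trans ht', ht.2⟩).affine (by positivity) _)
    (fun t ht => by
      have := hle t ⟨i2.le.trans ht.1, ht.2.trans hs₂'.le⟩
      have h2 : (rd e c 1 - rd e c t) / δ ≤ 1 - t := by
        rw [div_le_iff₀ hδ0]
        have := mul_le_mul_of_nonneg_right hδ (by linarith [ht.2] : 0 ≤ 1 - t)
        linarith
      have h3 : (1 - rd e c 1 / δ) + 1 / δ * rd e c t = 1 - (rd e c 1 - rd e c t) / δ := by ring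
      show t ≤ _
      rw [h3]
      linarith) ht
  obtain ⟨k, hk, hiso, ho⟩ := exists_intervalHom hK
    (blend_left hs₂ (by linarith)) (by
      rw [blend_right hs₂ hs₂'.le]; ring) a b
  have hinv : ∀ s t, k.fn s = t → (inv k).fn t = s := fun s t hst =>
    injective_of_isIso k ((apply_inv k t).trans hst.symm)
  refine ⟨inv k, isotopic_inv_id k ho, ?_, ?_, fun t ht => ?_, ?_⟩
  · refine hinv (0 : unitInterval) (0 : unitInterval) (Subtype.ext ((hk 0).trans (blend_left hs₂ ?_)))
    show (0 : ℝ) ≤ s₁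
    linarith
  · refine hinv (1 : unitInterval) (1 : unitInterval) (Subtype.ext ((hk 1).trans ((blend_right hs₂ hs₂'.le).trans ?_)))
    show 1 - rd e c 1 / δ + 1 / δ * rd e c 1 = (1 : ℝ)
    ring
  · exact hinv t t (Subtype.ext ((hk t).trans (blend_left hs₂ (by linarith))))
  · have m2 : s₂ ∈ Icc (0 : ℝ) 1 := ⟨by linarith, hs₂'.le⟩
    refine ⟨k.fn ⟨s₂, m2⟩, ?_, fun t ht => ?_⟩
    · refine lt_of_le_of_ne (k.fn ⟨s₂, m2⟩).2.2 fun h1 => ?_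
      have h3 : (1 : unitInterval) ≤ ⟨s₂, m2⟩ := (ho _ _).1
        (unitInterval.le_one'.trans_eq (Subtype.ext h1).symm)
      have h4 : (1 : ℝ) ≤ s₂ := h3
      linarith
    · have h1 : k.fn ((inv k).fn t) = t := apply_inv k t
      have h2 : (⟨s₂, m2⟩ : unitInterval) ≤ (inv k).fn t := (ho _ _).1 (by rw [h1]; exact ht)
      have h3 := hk ((inv k).fn t)
      rw [h1, blend_right hs₂ h2, rd_coe] at h3
      have h4 : rd e c 1 = e (c 1) := rd_coe e c 1
      rw [h4] at h3
      rw [h3]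
      field_simp
      ring

/-- The mirror image of `exists_straighten_right`. The additional claim that the left half is mapped
into itself serves the closing of an interval, where both straightenings act on the same interval.
-/
theorem exists_straighten_left (oN : OrientedAtlas N) (he : e ∈ atlas unitInterval N)
    (hc : ContMDiff J J ∞ c) (pc : ∀ s, 0 < slope c s) (h : c 0 ∈ e.source) (a b : Λ) :
    ∃ δ₀ > 0, ∀ δ ≥ δ₀, ∃ k : Mfd.interval a b ⟶ Mfd.interval a b, Isotopic k (𝟙 _) ∧
      k.fn (0 : unitInterval) = 0 ∧ k.fn (1 : unitInterval) = 1 ∧ (∀ t : unitInterval, 1 / 2 ≤ (t : ℝ) → k.fn t = t) ∧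
      (∀ t : unitInterval, (t : ℝ) ≤ 1 / 2 → (k.fn t : ℝ) ≤ 1 / 2) ∧
      ∃ t₀ > 0, ∀ t : unitInterval, (t : ℝ) ≤ t₀ →
        (e (c (k.fn t)) : ℝ) = e (c 0) + δ * t := by
  obtain ⟨η, hη, hs⟩ := exists_left (hc.continuous.continuousAt.preimage_mem_nhds
    (e.open_source.mem_nhds h))
  have hI : ∀ t ∈ Icc 0 η, Imm (rd e c) t := fun t ht =>
    imm_rd oN he hc pc ⟨ht.1, ht.2.trans hη.2.le⟩ (hs t ht)
  obtain ⟨-, d, hd, hP⟩ := hI 0 ⟨le_rfl, hη.1.le⟩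
  obtain ⟨s, hs1, hle⟩ := exists_le_left hP
  refine ⟨d + 1, by positivity, fun δ hδ => ?_⟩
  have hδ0 : 0 < δ := by linarith
  obtain ⟨s₂, hs₂', hs₂⟩ := exists_between (lt_min (lt_min hη.1 hs1) (by norm_num : (0 : ℝ) < 1 / 2))
  have i1 : s₂ < η := hs₂.trans_le ((min_le_left _ _).trans (min_le_left _ _))
  have i2 : s₂ < s := hs₂.trans_le ((min_le_left _ _).trans (min_le_right _ _))
  have i3 : s₂ < 1 / 2 := hs₂.trans_le (min_le_right _ _)
  obtain ⟨s₁, hs₁', hs₁⟩ := exists_between hs₂'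
  have hK : ∀ t ∈ Icc (0 : ℝ) 1, Imm (blend s₁ s₂
      (fun u => (- rd e c 0 / δ) + 1 / δ * rd e c u) fun u => u) t := fun t ht => imm_blend hs₁
    (fun t ht ht' => (hI t ⟨ht.1, ht'.trans i1.le⟩).affine (by positivity) _)
    (fun t _ _ => imm_id t)
    (fun t ht => by
      have := hle t ⟨hs₁'.le.trans ht.1, ht.2.trans i2.le⟩
      have h2 : (rd e c t - rd e c 0) / δ ≤ t := by
        rw [div_le_iff₀ hδ0]
        have := mul_le_mul_of_nonneg_right hδ (hs₁'.le.trans ht.1)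
        linarith
      have h3 : (- rd e c 0 / δ) + 1 / δ * rd e c t = (rd e c t - rd e c 0) / δ := by ring
      show _ ≤ t
      rw [h3]
      exact h2) ht
  obtain ⟨k, hk, hiso, ho⟩ := exists_intervalHom hK
    (by
      rw [blend_left hs₁ hs₁'.le]; ring)
    (blend_right hs₁ (by linarith)) a b
  have hinv : ∀ s t, k.fn s = t → (inv k).fn t = s := fun s t hst =>
    injective_of_isIso k ((apply_inv k t).trans hst.symm)
  have hid : ∀ t : unitInterval, 1 / 2 ≤ (t : ℝ) → k.fn t = t := fun t ht =>
    Subtype.ext ((hk t).trans (blend_right hs₁ (by linarith)))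
  refine ⟨inv k, isotopic_inv_id k ho, ?_, ?_, fun t ht => ?_, fun t ht => ?_, ?_⟩
  · refine hinv (0 : unitInterval) (0 : unitInterval) (Subtype.ext ((hk 0).trans ((blend_left hs₁ hs₁'.le).trans ?_)))
    show - rd e c 0 / δ + 1 / δ * rd e c 0 = (0 : ℝ)
    ring
  · refine hinv (1 : unitInterval) (1 : unitInterval) (hid 1 ?_)
    show (1 / 2 : ℝ) ≤ 1
    norm_num
  · exact hinv t t (hid t ht)
  · have m : (1 / 2 : ℝ) ∈ Icc (0 : ℝ) 1 := ⟨by norm_num, by norm_num⟩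
    have h1 : k.fn ((inv k).fn t) = t := apply_inv k t
    have h2 : (inv k).fn t ≤ ⟨1 / 2, m⟩ := (ho _ _).1 (by
      rw [h1, hid ⟨1 / 2, m⟩ le_rfl]; exact ht)
    exact h2
  · have m2 : s₁ ∈ Icc (0 : ℝ) 1 := ⟨hs₁'.le, by linarith⟩
    refine ⟨k.fn ⟨s₁, m2⟩, ?_, fun t ht => ?_⟩
    · refine lt_of_le_of_ne (k.fn ⟨s₁, m2⟩).2.1 fun h1 => ?_
      have h3 : (⟨s₁, m2⟩ : unitInterval) ≤ 0 := (ho _ _).1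
        ((Subtype.ext h1.symm : k.fn ⟨s₁, m2⟩ = 0).trans_le unitInterval.nonneg')
      have h4 : s₁ ≤ (0 : ℝ) := h3
      linarith
    · have h1 : k.fn ((inv k).fn t) = t := apply_inv k t
      have h2 : (inv k).fn t ≤ (⟨s₁, m2⟩ : unitInterval) := (ho _ _).1 (by rw [h1]; exact ht)
      have h3 := hk ((inv k).fn t)
      rw [h1, blend_left hs₁ h2, rd_coe] at h3
      have h4 : rd e c 0 = e (c 0) := rd_coe e c 0
      rw [h4] at h3
      rw [h3]
      field_simp
      ring

end Straighten

section Concat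

open Set Topology
open scoped Manifold ContDiff

variable {N : Type}

/-- Concatenation of paths. -/
def concat (c c' : unitInterval → N) (t : unitInterval) : N :=
  if (t : ℝ) ≤ 1 / 2 then c (projIcc 0 1 zero_le_one (2 * t))
  else c' (projIcc 0 1 zero_le_one (2 * t - 1))

variable {c c' : unitInterval → N}

theorem concat_left {t : unitInterval} (h : (t : ℝ) ≤ 1 / 2) :
    concat c c' t = c (projIcc 0 1 zero_le_one (2 * t)) := if_pos h

theorem concat_right (hc : c 1 = c' 0) {t : unitInterval} (h : 1 / 2 ≤ (t : ℝ)) :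
    concat c c' t = c' (projIcc 0 1 zero_le_one (2 * t - 1)) := by
  rcases h.eq_or_lt with h | h
  · rw [concat_left h.ge, ← h, projIcc_of_right_le _ (by norm_num), projIcc_of_le_left _ (by norm_num)]
    exact hc
  · exact if_neg (not_le.2 h)

/-- The map from the circle induced by a path with equal ends. -/
def closeFun (c : unitInterval → N) (x : Circ) : N :=
  c (projIcc 0 1 zero_le_one (AddCircle.equivIco (1 : ℝ) 0 x))

theorem closeFun_coe {c : unitInterval → N} (h : c 1 = c 0) (t : unitInterval) :
    closeFun c (wrap t) = c t := by
  have h1 : wrap (projIcc 0 1 zero_le_one (AddCircle.equivIco (1 : ℝ) 0 (wrap t))) = wrap t := by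
    have h2 := (AddCircle.equivIco (1 : ℝ) 0 (wrap t)).2
    rw [wrap, projIcc_of_mem _ ⟨h2.1, h2.2.le.trans_eq (zero_add 1)⟩]
    exact (AddCircle.equivIco (1 : ℝ) 0).symm_apply_apply (wrap t)
  by_cases h2 : projIcc 0 1 zero_le_one (AddCircle.equivIco (1 : ℝ) 0 (wrap t) : ℝ) = t
  · rw [closeFun, h2]
  · rw [closeFun]
    rcases wrap_eq_wrap h1 h2 with ⟨h3, rfl⟩ | ⟨h3, rfl⟩
    · rw [h3, h]
    · rw [h3, h]

variable [TopologicalSpace N] {e : OpenPartialHomeomorph N unitInterval}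

theorem concat_continuous (hc : Continuous c) (hc' : Continuous c') (h : c 1 = c' 0) :
    Continuous (concat c c') := by
  refine continuous_if_le continuous_subtype_val continuous_const ?_ ?_ ?_
  · exact (hc.comp (continuous_projIcc01.comp (by fun_prop))).continuousOn
  · exact (hc'.comp (continuous_projIcc01.comp (by fun_prop))).continuousOn
  · intro t ht
    rw [ht, projIcc_of_right_le _ (by norm_num), projIcc_of_le_left _ (by norm_num)]
    exact h

theorem Imm.comp_affine {A : ℝ → ℝ} {t m r : ℝ} (h : Imm A (m * t + r)) (hm : 0 < m) {s : Set ℝ}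
    (hs : s ∈ 𝓝[Icc 0 1] t) (hs' : ∀ u ∈ s, m * u + r ∈ Icc (0 : ℝ) 1) :
    Imm (fun u => A (m * u + r)) t := by
  obtain ⟨h1, d, hd, h2⟩ := h
  have h3 : ContDiffWithinAt ℝ ∞ (fun u => A (m * u + r)) (s ∩ Icc 0 1) t :=
    h1.comp t (by fun_prop) fun u hu => hs' u hu.1
  have h4 : HasDerivWithinAt (fun u => A (m * u + r)) (d * (m * 1)) (s ∩ Icc 0 1) t :=
    h2.comp t (((hasDerivAt_id t).const_mul m).add_const r).hasDerivWithinAt fun u hu => hs' u hu.1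
  refine ⟨h3.mono_of_mem_nhdsWithin ?_, d * (m * 1), by positivity, h4.mono_of_mem_nhdsWithin ?_⟩
  · exact Filter.inter_mem hs self_mem_nhdsWithin
  · exact Filter.inter_mem hs self_mem_nhdsWithin

variable [ChartedSpace unitInterval N]

/-- A map from the circle is smooth if its composites with the standard paths are. -/
theorem circ_spec {g : Circ → N} {r : ℝ} {s : unitInterval} (hs : (s : ℝ) ∈ Ioo (0 : ℝ) 1)
    (h : ContMDiffAt J J ∞ (fun u : unitInterval => g (((u : ℝ) + r : ℝ) : Circ)) s)
    (p : 0 < slope (fun u : unitInterval => g (((u : ℝ) + r : ℝ) : Circ)) s) :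
    ContMDiffAt J J ∞ g (((s : ℝ) + r : ℝ) : Circ) ∧ 0 < slope g (((s : ℝ) + r : ℝ) : Circ) := by
  have ht : s ∈ (circChart r).target := by rw [circChart_target]; exact hs
  have hx : (((s : ℝ) + r : ℝ) : Circ) ∈ (circChart r).source := by
    rw [← circChart_symm_apply]; exact (circChart r).map_target ht
  have e1 : circChart r (((s : ℝ) + r : ℝ) : Circ) = s := by
    rw [← circChart_symm_apply, (circChart r).right_inv ht]
  have e2 : g =ᶠ[𝓝 (((s : ℝ) + r : ℝ) : Circ)]
      (fun u : unitInterval => g (((u : ℝ) + r : ℝ) : Circ)) ∘ circChart r := by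
    filter_upwards [(circChart r).open_source.mem_nhds hx] with y hy
    rw [Function.comp_apply, ← circChart_symm_apply, (circChart r).left_inv hy]
  have h1 : ContMDiffAt J J ∞ (circChart r) (((s : ℝ) + r : ℝ) : Circ) :=
    contMDiffAt_of_mem_maximalAtlas (IsManifold.subset_maximalAtlas (I := J) (n := ∞)
      (mem_range_self r)) hx
  rw [← e1] at h p
  refine ⟨(h.comp _ h1).congr_of_eventuallyEq e2, ?_⟩
  have h2 : slope g (((s : ℝ) + r : ℝ) : Circ) = slope ((fun u : unitInterval =>
      g (((u : ℝ) + r : ℝ) : Circ)) ∘ circChart r) (((s : ℝ) + r : ℝ) : Circ) := by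
    unfold slope
    rw [e2.mfderiv_eq]
    rfl
  rw [h2, slope_comp _ (h.mdifferentiableAt (by simp)) (h1.mdifferentiableAt (by simp))]
  exact mul_pos p (orientedAtlas_circ _ (mem_range_self r) _ hx)

variable [IsManifold J ∞ N]

/-- Away from the midpoint the concatenation is one of the two paths at double speed. At the
midpoint the two paths, read in the chart `e`, are given by the same affine function, so they fit
together smoothly. -/
theorem concat_spec (oN : OrientedAtlas N) (hc : ContMDiff J J ∞ c) (pc : ∀ s, 0 < slope c s)
    (hc' : ContMDiff J J ∞ c') (pc' : ∀ s, 0 < slope c' s) (h : c 1 = c' 0)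
    (he : e ∈ atlas unitInterval N) (hs : c 1 ∈ e.source) {δ : ℝ} (hδ : 0 < δ)
    (hl : ∃ t₀ < 1, ∀ t : unitInterval, t₀ ≤ (t : ℝ) → (e (c t) : ℝ) = e (c 1) + δ * (t - 1))
    (hr : ∃ t₀ > 0, ∀ t : unitInterval, (t : ℝ) ≤ t₀ → (e (c' t) : ℝ) = e (c' 0) + δ * t)
    (s : unitInterval) : ContMDiffAt J J ∞ (concat c c') s ∧ 0 < slope (concat c c') s := by
  have hcc := concat_continuous hc.continuous hc'.continuous h
  have key : ∀ e' ∈ atlas unitInterval N, concat c c' s ∈ e'.source →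
      Imm (rd e' (concat c c')) s → ContMDiffAt J J ∞ (concat c c') s ∧
        0 < slope (concat c c') s := by
    rintro e' he' hs' ⟨h1, d, hd, h2⟩
    exact of_rd oN he' hs' hcc.continuousAt h1 hd h2
  rcases lt_trichotomy (s : ℝ) (1 / 2) with h1 | h1 | h1
  · have m : 2 * (s : ℝ) + 0 ∈ Icc (0 : ℝ) 1 := ⟨by linarith [s.2.1], by linarith⟩
    have m' : 2 * (s : ℝ) ∈ Icc (0 : ℝ) 1 := ⟨by linarith [s.2.1], by linarith⟩
    have es := concat_left (c := c) (c' := c') h1.le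
    have hI := imm_rd oN (chart_mem_atlas unitInterval (concat c c' s)) hc pc m
      (by rw [add_zero, ← es]; exact mem_chart_source _ _)
    refine key _ (chart_mem_atlas unitInterval (concat c c' s)) (mem_chart_source _ _) ?_
    have hn : Icc (0 : ℝ) 1 ∩ Iio (1 / 2) ∈ 𝓝[Icc 0 1] (s : ℝ) :=
      Filter.inter_mem self_mem_nhdsWithin (nhdsWithin_le_nhds (Iio_mem_nhds h1))
    refine (hI.comp_affine two_pos hn ?_).congr s.2 ?_
    · rintro u ⟨hu, hu'⟩
      have : u < 1 / 2 := hu'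
      exact ⟨by linarith [hu.1], by linarith⟩
    · filter_upwards [hn] with u hu
      have : u < 1 / 2 := hu.2
      rw [rd, rd, projIcc_of_mem _ hu.1, concat_left (t := ⟨u, hu.1⟩) this.le, add_zero]
  · have hs' : concat c c' s ∈ e.source := by
      rw [concat_left h1.le, h1, projIcc_of_right_le _ (by norm_num)]
      exact hs
    refine key e he hs' ?_
    obtain ⟨t₁, ht₁, hl⟩ := hl
    obtain ⟨t₂, ht₂, hr⟩ := hr
    -- Doubling the speed turns the slope `δ` into `2 δ`, and the value at `1 / 2` has to be `e (c
    -- 1)`.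
    have hI := (imm_id (s : ℝ)).affine (m := 2 * δ) (by positivity) ((e (c 1) : ℝ) - δ)
    refine hI.congr s.2 ?_
    have hn : Ioo (t₁ / 2) ((t₂ + 1) / 2) ∈ 𝓝 (s : ℝ) := by
      rw [h1]; exact Ioo_mem_nhds (by linarith) (by linarith)
    filter_upwards [self_mem_nhdsWithin, nhdsWithin_le_nhds hn] with u hu hu'
    rw [rd, projIcc_of_mem _ hu]
    rcases le_total u (1 / 2) with h2 | h2
    · rw [concat_left h2]
      have m : 2 * u ∈ Icc (0 : ℝ) 1 := ⟨by linarith [hu.1], by linarith⟩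
      rw [projIcc_of_mem _ m, hl ⟨2 * u, m⟩ (by show t₁ ≤ 2 * u; linarith [hu'.1])]
      ring
    · rw [concat_right h h2]
      have m : 2 * u - 1 ∈ Icc (0 : ℝ) 1 := ⟨by linarith, by linarith [hu.2]⟩
      rw [projIcc_of_mem _ m, hr ⟨2 * u - 1, m⟩ (by show 2 * u - 1 ≤ t₂; linarith [hu'.2]), ← h]
      ring
  · have m : 2 * (s : ℝ) + (-1) ∈ Icc (0 : ℝ) 1 := ⟨by linarith, by linarith [s.2.2]⟩
    have es := concat_right h h1.le
    have hI := imm_rd oN (chart_mem_atlas unitInterval (concat c c' s)) hc' pc' m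
      (by rw [← sub_eq_add_neg, ← es]; exact mem_chart_source _ _)
    refine key _ (chart_mem_atlas unitInterval (concat c c' s)) (mem_chart_source _ _) ?_
    have hn : Icc (0 : ℝ) 1 ∩ Ioi (1 / 2) ∈ 𝓝[Icc 0 1] (s : ℝ) :=
      Filter.inter_mem self_mem_nhdsWithin (nhdsWithin_le_nhds (Ioi_mem_nhds h1))
    refine (hI.comp_affine two_pos hn ?_).congr s.2 ?_
    · rintro u ⟨hu, hu'⟩
      have : 1 / 2 < u := hu'
      exact ⟨by linarith, by linarith [hu.2]⟩
    · filter_upwards [hn] with u hu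
      have : 1 / 2 < u := hu.2
      rw [rd, rd, projIcc_of_mem _ hu.1, concat_right h (t := ⟨u, hu.1⟩) this.le, sub_eq_add_neg]

/-- Away from `0` the path itself parametrizes the circle. At `0` the circle is parametrized by `u ↦
u - 1 / 2`; this turns the map into the concatenation of the right half of `c` with the left half,
and `concat_spec` applies with slope `δ / 2` because the halves run at half speed. -/
theorem closeFun_spec (oN : OrientedAtlas N) (hc : ContMDiff J J ∞ c) (pc : ∀ s, 0 < slope c s)
    (h : c 1 = c 0) (he : e ∈ atlas unitInterval N) (hs : c 1 ∈ e.source) {δ : ℝ} (hδ : 0 < δ)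
    (hl : ∃ t₀ < 1, ∀ t : unitInterval, t₀ ≤ (t : ℝ) → (e (c t) : ℝ) = e (c 1) + δ * (t - 1))
    (hr : ∃ t₀ > 0, ∀ t : unitInterval, (t : ℝ) ≤ t₀ → (e (c t) : ℝ) = e (c 0) + δ * t)
    (x : Circ) : ContMDiffAt J J ∞ (closeFun c) x ∧ 0 < slope (closeFun c) x := by
  obtain ⟨s, rfl⟩ := wrap_surjective x
  by_cases h01 : (s : ℝ) ∈ Ioo (0 : ℝ) 1
  · have e1 : (fun u : unitInterval => closeFun c (((u : ℝ) + 0 : ℝ) : Circ)) = c := by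
      ext u
      rw [add_zero]
      exact closeFun_coe h u
    have := circ_spec (g := closeFun c) (r := 0) h01 (e1.symm ▸ hc s) (e1.symm ▸ pc s)
    rwa [add_zero] at this
  · have hw : wrap s = ((((1 / 2 : ℝ) + -(1 / 2) : ℝ)) : Circ) := by
      have : (s : ℝ) = 0 ∨ (s : ℝ) = 1 := by
        by_contra hc
        rw [not_or] at hc
        exact h01 ⟨lt_of_le_of_ne s.2.1 (Ne.symm hc.1), lt_of_le_of_ne s.2.2 hc.2⟩
      rw [wrap, circ_coe_eq]
      rcases this with h2 | h2
      · exact ⟨0, by rw [h2]; norm_num⟩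
      · exact ⟨1, by rw [h2]; norm_num⟩
    have m : (1 / 2 : ℝ) ∈ Icc (0 : ℝ) 1 := ⟨by norm_num, by norm_num⟩
    have e1 : (fun u : unitInterval => closeFun c (((u : ℝ) + -(1 / 2) : ℝ) : Circ)) =
        concat (c ∘ halfRight) (c ∘ halfLeft) := by
      have hj : (c ∘ halfRight) 1 = (c ∘ halfLeft) 0 := by
        have a1 : halfRight 1 = 1 := Subtype.ext (by simp [halfRight])
        have a0 : halfLeft 0 = 0 := Subtype.ext (by simp [halfLeft])
        rw [Function.comp_apply, Function.comp_apply, a1, a0, h]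
      ext u
      rcases le_total (u : ℝ) (1 / 2) with h2 | h2
      · have m2 : 2 * (u : ℝ) ∈ Icc (0 : ℝ) 1 := ⟨by linarith [u.2.1], by linarith⟩
        rw [concat_left h2, projIcc_of_mem _ m2, Function.comp_apply, ← closeFun_coe h]
        congr 1
        rw [wrap, circ_coe_eq]
        exact ⟨-1, by simp only [halfRight]; push_cast; ring⟩
      · have m2 : 2 * (u : ℝ) - 1 ∈ Icc (0 : ℝ) 1 := ⟨by linarith, by linarith [u.2.2]⟩
        rw [concat_right hj h2, projIcc_of_mem _ m2, Function.comp_apply, ← closeFun_coe h]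
        congr 1
        rw [wrap, circ_coe_eq]
        exact ⟨0, by simp only [halfLeft]; push_cast; ring⟩
    have a1 : halfRight 1 = 1 := Subtype.ext (by simp [halfRight])
    have a0 : halfLeft 0 = 0 := Subtype.ext (by simp [halfLeft])
    have hL : ContMDiff J J ∞ halfLeft := fun x => (halfLeft_spec x).1
    have hR : ContMDiff J J ∞ halfRight := fun x => (halfRight_spec x).1
    have hj : (c ∘ halfRight) 1 = (c ∘ halfLeft) 0 := by
      rw [Function.comp_apply, Function.comp_apply, a1, a0, h]
    have sp := concat_spec (c := c ∘ halfRight) (c' := c ∘ halfLeft) (e := e) (δ := δ / 2) oN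
      (hc.comp hR)
      (fun x => pos_comp hc hR x (pc _) (by rw [(halfRight_spec x).2]; norm_num))
      (hc.comp hL)
      (fun x => pos_comp hc hL x (pc _) (by rw [(halfLeft_spec x).2]; norm_num)) hj he
      (by rw [Function.comp_apply, a1]; exact hs) (half_pos hδ)
      (by
        obtain ⟨t₀, ht₀, hl⟩ := hl
        refine ⟨2 * t₀ - 1, by linarith, fun t ht => ?_⟩
        have h2 : (halfRight t : ℝ) = ((t : ℝ) + 1) / 2 := rfl
        rw [Function.comp_apply, Function.comp_apply, a1, hl _ (by rw [h2]; linarith), h2]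
        ring)
      (by
        obtain ⟨t₀, ht₀, hr⟩ := hr
        refine ⟨2 * t₀, by linarith, fun t ht => ?_⟩
        have h2 : (halfLeft t : ℝ) = (t : ℝ) / 2 := rfl
        rw [Function.comp_apply, Function.comp_apply, a0, hr _ (by rw [h2]; linarith), h2]
        ring) ⟨1 / 2, m⟩
    rw [hw]
    exact circ_spec (g := closeFun c) (r := -(1 / 2)) (s := ⟨1 / 2, m⟩)
      ⟨by norm_num, by norm_num⟩ (e1.symm ▸ sp.1) (e1.symm ▸ sp.2)

end Concat

end

section

variable {Λ : Type}

/-! ### Factoring through a gluing or a closing -/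

section Merge

open Set Topology
open scoped Manifold ContDiff

theorem concat_halfLeft {N : Type} {c c' : unitInterval → N} (s : unitInterval) :
    concat c c' (halfLeft s) = c s := by
  have h : (halfLeft s : ℝ) = (s : ℝ) / 2 := rfl
  rw [concat_left (by rw [h]; linarith [s.2.2]), h, mul_div_cancel₀ _ (two_ne_zero), projIcc01_coe]

theorem concat_halfRight {N : Type} {c c' : unitInterval → N} (hc : c 1 = c' 0) (s : unitInterval) :
    concat c c' (halfRight s) = c' s := by
  have h : (halfRight s : ℝ) = ((s : ℝ) + 1) / 2 := rfl
  rw [concat_right hc (by rw [h]; linarith [s.2.1]), h, mul_div_cancel₀ _ (two_ne_zero),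
    add_sub_cancel_right, projIcc01_coe]

/-- Up to isotopy, a morphism identifying ends of two intervals factors through their gluing. -/
theorem exists_merge_seg {W : Word Λ} {T : Mfd Λ} {a b c : Λ}
    (f : (Mfd.interval a b ⊗ Mfd.interval b c) ⊗ W.mfd ⟶ T)
    (h : f.toFun (Sum.inl (Sum.inl (1 : unitInterval))) =
      f.toFun (Sum.inl (Sum.inr (0 : unitInterval)))) :
    ∃ g : Mfd.interval a c ⊗ W.mfd ⟶ T, Isotopic f ((Mfd.glue a b c ⊗ₘ 𝟙 W.mfd) ≫ g) := by
  let V : Word Λ := .tensor (.tensor (.atom (.seg a b)) (.atom (.seg b c))) W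
  let i₁ : V.Pos := Sum.inl (Sum.inl ())
  let i₂ : V.Pos := Sum.inl (Sum.inr ())
  have oT := T.oriented
  have c1 := contMDiff_comp_arc (W := V) f i₁
  have p1 := slope_comp_arc (W := V) f i₁
  have c2 := contMDiff_comp_arc (W := V) f i₂
  have p2 := slope_comp_arc (W := V) f i₂
  have he := chart_mem_atlas unitInterval ((f.toFun ∘ V.arc i₁) 1)
  have hs := mem_chart_source unitInterval ((f.toFun ∘ V.arc i₁) 1)
  have hs' := hs
  rw [show (f.toFun ∘ V.arc i₁) 1 = (f.toFun ∘ V.arc i₂) 0 from h] at hs'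
  have hs2 : (f.toFun ∘ V.arc i₂) 0 ∈ (chartAt unitInterval ((f.toFun ∘ V.arc i₁) 1)).source := by
    rw [show (f.toFun ∘ V.arc i₁) 1 = (f.toFun ∘ V.arc i₂) 0 from h]; exact hs'
  obtain ⟨δ₁, -, h1⟩ := exists_straighten_right oT he c1 p1 hs a b
  obtain ⟨δ₂, hδ₂, h2⟩ := exists_straighten_left oT he c2 p2 hs2 b c
  -- The larger of the two thresholds is a slope available on both sides.
  obtain ⟨k₁, ik₁, -, e₁, -, l₁⟩ := h1 _ (le_max_left δ₁ δ₂)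
  obtain ⟨k₂, ik₂, e₂, -, -, -, l₂⟩ := h2 _ (le_max_right δ₁ δ₂)
  let K : V.mfd ⟶ V.mfd := (k₁ ⊗ₘ k₂) ⊗ₘ 𝟙 W.mfd
  have hK : Isotopic f (K ≫ f) := by
    have := (((ik₁.tensor ik₂).tensor (.refl (𝟙 W.mfd))).comp (.refl f)).symm
    rwa [id_tensorHom_id, id_tensorHom_id, Category.id_comp] at this
  have c1' := contMDiff_comp_arc (W := V) (K ≫ f) i₁
  have p1' := slope_comp_arc (W := V) (K ≫ f) i₁
  have c2' := contMDiff_comp_arc (W := V) (K ≫ f) i₂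
  have p2' := slope_comp_arc (W := V) (K ≫ f) i₂
  have hj1 : ((K ≫ f).toFun ∘ V.arc i₁) 1 = (f.toFun ∘ V.arc i₁) 1 :=
    congrArg (fun x => f.toFun (Sum.inl (Sum.inl x))) e₁
  have hj2 : ((K ≫ f).toFun ∘ V.arc i₂) 0 = (f.toFun ∘ V.arc i₂) 0 :=
    congrArg (fun x => f.toFun (Sum.inl (Sum.inr x))) e₂
  have hj : ((K ≫ f).toFun ∘ V.arc i₁) 1 = ((K ≫ f).toFun ∘ V.arc i₂) 0 := by
    rw [hj1, hj2]; exact h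
  have sp := concat_spec oT c1' p1' c2' p2' hj he (hj1 ▸ hs) (lt_of_lt_of_le hδ₂ (le_max_right δ₁ δ₂))
    (by rw [hj1]; exact l₁) (by rw [hj2]; exact l₂)
  let g' : (Mfd.interval a c ⊗ W.mfd).carrier → T.carrier := Sum.elim
    (concat ((K ≫ f).toFun ∘ V.arc i₁) ((K ≫ f).toFun ∘ V.arc i₂)) fun w => f.toFun (Sum.inr w)
  have sg : ContMDiff J J ∞ g' := ContMDiff.sumElim (fun x => (sp x).1)
    (f.smooth.comp ContMDiff.inr)
  obtain ⟨g, hg⟩ := exists_factor (W := V) (S' := Mfd.interval a c ⊗ W.mfd)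
    (Mfd.glue a b c ⊗ₘ 𝟙 W.mfd) (K ≫ f) g' sg
    (slope_pos_of_sum sg (fun x => (sp x).2)
      (fun x => pos_comp f.smooth ContMDiff.inr x (f.slope_pos _) (pos_inr x)))
    (by
      rintro ((x | x) | x)
      · exact concat_halfLeft x
      · exact concat_halfRight hj x
      · rfl)
    (by
      have m1 : halfLeft 1 = halfRight 0 := Subtype.ext (by simp [halfLeft, halfRight])
      rintro ((x | x) | x) hx hx'
      · rcases (mem_boundary_unitInterval x).1 (boundary_inl.1 (boundary_inl.1 hx)) with rfl | rfl
        · exact absurd (boundary_inl.2 ((mem_boundary_unitInterval _).2 (Or.inl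
            (Subtype.ext (by simp [halfLeft] : (halfLeft 0 : ℝ) = 0))))) hx'
        · exact ⟨Sum.inl (Sum.inr (0 : unitInterval)), fun h =>
            Sum.inr_ne_inl (Sum.inl_injective h), congrArg Sum.inl m1.symm⟩
      · rcases (mem_boundary_unitInterval x).1 (boundary_inr.1 (boundary_inl.1 hx)) with rfl | rfl
        · exact ⟨Sum.inl (Sum.inl (1 : unitInterval)), fun h =>
            Sum.inl_ne_inr (Sum.inl_injective h), congrArg Sum.inl m1⟩
        · exact absurd (boundary_inl.2 ((mem_boundary_unitInterval _).2 (Or.inr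
            (Subtype.ext (by simp [halfRight] : (halfRight 1 : ℝ) = 1))))) hx'
      · exact absurd (boundary_inr.2 (boundary_inr.1 hx)) hx')
  exact ⟨g, hg ▸ hK⟩

/-- Up to isotopy, a morphism identifying the ends of an interval factors through its closing. -/
theorem exists_merge_circ {W : Word Λ} {T : Mfd Λ} {a : Λ} (f : Mfd.interval a a ⊗ W.mfd ⟶ T)
    (h : f.toFun (Sum.inl (1 : unitInterval)) = f.toFun (Sum.inl (0 : unitInterval))) :
    ∃ g : Mfd.circle Λ ⊗ W.mfd ⟶ T, Isotopic f ((Mfd.close a ⊗ₘ 𝟙 W.mfd) ≫ g) := by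
  let V : Word Λ := .tensor (.atom (.seg a a)) W
  let i : V.Pos := Sum.inl ()
  have oT := T.oriented
  have c1 := contMDiff_comp_arc (W := V) f i
  have p1 := slope_comp_arc (W := V) f i
  have he := chart_mem_atlas unitInterval ((f.toFun ∘ V.arc i) 1)
  have hs := mem_chart_source unitInterval ((f.toFun ∘ V.arc i) 1)
  have hs' := hs
  rw [show (f.toFun ∘ V.arc i) 1 = (f.toFun ∘ V.arc i) 0 from h] at hs'
  have hs2 : (f.toFun ∘ V.arc i) 0 ∈ (chartAt unitInterval ((f.toFun ∘ V.arc i) 1)).source := by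
    rw [show (f.toFun ∘ V.arc i) 1 = (f.toFun ∘ V.arc i) 0 from h]; exact hs'
  obtain ⟨δ₁, -, h1⟩ := exists_straighten_right oT he c1 p1 hs a a
  obtain ⟨δ₂, hδ₂, h2⟩ := exists_straighten_left oT he c1 p1 hs2 a a
  obtain ⟨k₁, ik₁, z₁, e₁, m₁, t₁, ht₁, l₁⟩ := h1 _ (le_max_left δ₁ δ₂)
  obtain ⟨k₂, ik₂, z₂, e₂, m₂, n₂, t₂, ht₂, l₂⟩ := h2 _ (le_max_right δ₁ δ₂)
  -- The two reparametrizations do not interfere: on the right half `k₂` is the identity, and `k₂`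
  -- keeps the left half inside the left half, where `k₁` is the identity.
  let K : V.mfd ⟶ V.mfd := (k₂ ≫ k₁) ⊗ₘ 𝟙 W.mfd
  have hK : Isotopic f (K ≫ f) := by
    have := (((ik₂.comp ik₁).tensor (.refl (𝟙 W.mfd))).comp (.refl f)).symm
    rwa [Category.id_comp, id_tensorHom_id, Category.id_comp] at this
  have hk : ∀ x : unitInterval, (k₂ ≫ k₁).fn x = k₁.fn (k₂.fn x) := fun x => rfl
  have hKx : ∀ x : unitInterval, ((K ≫ f).toFun ∘ V.arc i) x =
    (f.toFun ∘ V.arc i) (k₁.fn (k₂.fn x)) := fun x => rfl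
  have c1' := contMDiff_comp_arc (W := V) (K ≫ f) i
  have p1' := slope_comp_arc (W := V) (K ≫ f) i
  have hj1 : ((K ≫ f).toFun ∘ V.arc i) 1 = (f.toFun ∘ V.arc i) 1 := by
    rw [hKx, e₂, e₁]
  have hj2 : ((K ≫ f).toFun ∘ V.arc i) 0 = (f.toFun ∘ V.arc i) 0 := by
    rw [hKx, z₂, z₁]
  have hj : ((K ≫ f).toFun ∘ V.arc i) 1 = ((K ≫ f).toFun ∘ V.arc i) 0 := by
    rw [hj1, hj2]; exact h
  have sp := closeFun_spec oT c1' p1' hj he (hj1 ▸ hs) (lt_of_lt_of_le hδ₂ (le_max_right δ₁ δ₂))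
    ⟨max t₁ (1 / 2), max_lt ht₁ (by norm_num), fun t ht => by
      rw [hj1, hKx, m₂ t ((le_max_right _ _).trans ht)]
      exact l₁ t ((le_max_left _ _).trans ht)⟩
    ⟨min t₂ (1 / 2), lt_min ht₂ (by norm_num), fun t ht => by
      rw [hj2, hKx, m₁ _ (n₂ t (ht.trans (min_le_right _ _)))]
      exact l₂ t (ht.trans (min_le_left _ _))⟩
  let g' : (Mfd.circle Λ ⊗ W.mfd).carrier → T.carrier := Sum.elim
    (closeFun ((K ≫ f).toFun ∘ V.arc i)) fun w => f.toFun (Sum.inr w)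
  have sg : ContMDiff J J ∞ g' := ContMDiff.sumElim (fun x => (sp x).1)
    (f.smooth.comp ContMDiff.inr)
  obtain ⟨g, hg⟩ := exists_factor (W := V) (S' := Mfd.circle Λ ⊗ W.mfd)
    (Mfd.close a ⊗ₘ 𝟙 W.mfd) (K ≫ f) g' sg
    (slope_pos_of_sum sg (fun x => (sp x).2)
      (fun x => pos_comp f.smooth ContMDiff.inr x (f.slope_pos _) (pos_inr x)))
    (by
      rintro (x | x)
      · exact closeFun_coe hj x
      · rfl)
    (by
      have m1 : wrap 1 = wrap 0 := circ_coe_eq.2 ⟨1, by simp⟩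
      rintro (x | x) hx hx'
      · rcases (mem_boundary_unitInterval x).1 (boundary_inl.1 hx) with rfl | rfl
        · exact ⟨Sum.inl (1 : unitInterval), fun h =>
            one_ne_zero (α := unitInterval) (Sum.inl_injective h), congrArg Sum.inl m1⟩
        · exact ⟨Sum.inl (0 : unitInterval), fun h =>
            zero_ne_one (α := unitInterval) (Sum.inl_injective h), congrArg Sum.inl m1.symm⟩
      · exact absurd (boundary_inr.2 (boundary_inr.1 hx)) hx')
  exact ⟨g, hg ▸ hK⟩

end Merge

end

section

variable {Λ : Type}

/-! ### Cutting a manifold into intervals -/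

section Arcs

open Set Topology
open scoped Manifold ContDiff

/-- An embedded closed interval in a manifold. -/
structure Arc (T : Mfd Λ) where
  toFun : unitInterval → T.carrier
  smooth : ContMDiff J J ∞ toFun
  slope_pos : ∀ s, 0 < slope toFun s
  injective : Function.Injective toFun
  map_interior : ∀ s, s ≠ 0 → s ≠ 1 → toFun s ∉ J.boundary T.carrier
  isOpen : IsOpen (toFun '' {s | s ≠ 0 ∧ s ≠ 1})

/-- The affine map of the unit interval onto a subinterval. -/
def subArc (p q : unitInterval) (s : unitInterval) : unitInterval :=
  ⟨p + (q - p) * s, by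
    have h1 := p.2; have h2 := q.2; have h3 := s.2
    constructor
    · nlinarith [mul_nonneg h1.1 (sub_nonneg.2 h3.2), mul_nonneg h2.1 h3.1]
    · nlinarith [mul_nonneg (sub_nonneg.2 h1.2) (sub_nonneg.2 h3.2),
        mul_nonneg (sub_nonneg.2 h2.2) h3.1]⟩

theorem subArc_zero (p q : unitInterval) : subArc p q 0 = p := Subtype.ext (by simp [subArc])

theorem subArc_one (p q : unitInterval) : subArc p q 1 = q := Subtype.ext (by simp [subArc])

theorem subArc_spec {p q : unitInterval} (h : p < q) :
    ContMDiff J J ∞ (subArc p q) ∧ ∀ s, 0 < slope (subArc p q) s := by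
  have h' : (p : ℝ) < q := h
  have := unitInterval_map (f := subArc p q) (g := fun t => p + (q - p) * t) (by fun_prop)
    (fun _ => rfl)
  refine ⟨fun s => (this s).1, fun s => (this s).2.symm ▸ ?_⟩
  simp
  exact h'

theorem subArc_strictMono {p q : unitInterval} (h : p < q) : StrictMono (subArc p q) := by
  intro s t hst
  have h' : (p : ℝ) < q := h
  have h2 : (s : ℝ) < t := hst
  have := mul_lt_mul_of_pos_left h2 (sub_pos.2 h')
  show (p : ℝ) + (q - p) * s < p + (q - p) * t
  linarith

theorem exists_subArc {p q u : unitInterval} (h : p < q) (hu : u ∈ Icc p q) :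
    ∃ s, subArc p q s = u := by
  have h' : (p : ℝ) < q := h
  have h1 : (p : ℝ) ≤ u := hu.1
  have h2 : (u : ℝ) ≤ q := hu.2
  refine ⟨⟨(u - p) / (q - p), div_nonneg (by linarith) (by linarith),
    (div_le_one (by linarith)).2 (by linarith)⟩, Subtype.ext ?_⟩
  show (p : ℝ) + (q - p) * ((u - p) / (q - p)) = u
  rw [mul_div_cancel₀ _ (by linarith)]
  ring

theorem subArc_mem_Ioo {p q s : unitInterval} (h : p < q) (h0 : s ≠ 0) (h1 : s ≠ 1) :
    subArc p q s ∈ Ioo p q := by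
  have a := subArc_strictMono h (unitInterval.pos_iff_ne_zero.2 h0)
  have b := subArc_strictMono h (unitInterval.lt_one_iff_ne_one.2 h1)
  rw [subArc_zero] at a
  rw [subArc_one] at b
  exact ⟨a, b⟩

theorem subArc_image {p q : unitInterval} (h : p < q) :
    subArc p q '' {s | s ≠ 0 ∧ s ≠ 1} = Ioo p q := by
  ext u
  constructor
  · rintro ⟨s, hs, rfl⟩
    exact subArc_mem_Ioo h hs.1 hs.2
  · rintro hu
    obtain ⟨s, rfl⟩ := exists_subArc h (Ioo_subset_Icc_self hu)
    refine ⟨s, ⟨?_, ?_⟩, rfl⟩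
    · rintro rfl
      rw [subArc_zero] at hu
      exact lt_irrefl _ hu.1
    · rintro rfl
      rw [subArc_one] at hu
      exact lt_irrefl _ hu.2

/-- Being an interior point can be tested in any chart of the atlas. -/
theorem not_mem_boundary_chart {N : Type} [TopologicalSpace N] [ChartedSpace unitInterval N]
    [IsManifold J ∞ N] {e : OpenPartialHomeomorph N unitInterval} (he : e ∈ atlas unitInterval N)
    {y : N} (hy : y ∈ e.source) (h0 : e y ≠ 0) (h1 : e y ≠ 1) : y ∉ J.boundary N := by
  have h : J.IsInteriorPoint y := by
    rw [J.isInteriorPoint_iff_of_mem_atlas (n := ∞) (by simp) he hy]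
    rw [mem_interior_iff_mem_nhds, OpenPartialHomeomorph.extend_target, range_J]
    have hm : (e y : ℝ) ∈ Ioo (0 : ℝ) 1 := ⟨lt_of_le_of_ne (e y).2.1 fun h => h0 (Subtype.ext h.symm),
      lt_of_le_of_ne (e y).2.2 fun h => h1 (Subtype.ext h)⟩
    refine Filter.inter_mem ?_ (Icc_mem_nhds hm.1 hm.2)
    refine (continuous_projIcc01.continuousAt).preimage_mem_nhds ?_
    show e.target ∈ 𝓝 (projIcc 0 1 zero_le_one (e y : ℝ))
    rw [projIcc01_coe]
    exact e.open_target.mem_nhds (e.map_source hy)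
  intro hb
  rw [← J.compl_interior] at hb
  exact hb h

/-- The arc is the inverse image under a chart of a small closed interval around the value at `x`,
truncated to `[0,1]`. At a boundary point `x` may be an end of the arc, yet the range is still a
neighbourhood. -/
theorem exists_arc_nhds (T : Mfd Λ) (x : T.carrier) : ∃ c : Arc T, range c.toFun ∈ 𝓝 x := by
  have he := chart_mem_atlas unitInterval x
  have hx := mem_chart_source unitInterval x
  generalize chartAt unitInterval x = e at he hx
  obtain ⟨ε, hε, hb⟩ := Metric.isOpen_iff.1 e.open_target _ (e.map_source hx)
  have m1 : max 0 ((e x : ℝ) - ε / 2) ∈ Icc (0 : ℝ) 1 := ⟨le_max_left _ _,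
    max_le zero_le_one (by linarith [(e x).2.2])⟩
  have m2 : min 1 ((e x : ℝ) + ε / 2) ∈ Icc (0 : ℝ) 1 := ⟨le_min zero_le_one
    (by linarith [(e x).2.1]), min_le_left _ _⟩
  let p : unitInterval := ⟨_, m1⟩
  let q : unitInterval := ⟨_, m2⟩
  have hlt : max 0 ((e x : ℝ) - ε / 2) < min 1 ((e x : ℝ) + ε / 2) := by
    have h1 : (0 : ℝ) ≤ e x := (e x).2.1
    have h2 : (e x : ℝ) ≤ 1 := (e x).2.2
    exact max_lt (lt_min one_pos (by linarith)) (lt_min (by linarith) (by linarith))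
  have hpq : p < q := hlt
  have hI : Icc p q ⊆ e.target := by
    intro u hu
    refine hb ?_
    have h1 : (e x : ℝ) - ε / 2 ≤ u := (le_max_right _ _).trans hu.1
    have h2 : (u : ℝ) ≤ e x + ε / 2 := le_trans hu.2 (min_le_right _ _)
    rw [Metric.mem_ball, Subtype.dist_eq, Real.dist_eq, abs_lt]
    constructor <;> linarith
  have hm : ∀ s, subArc p q s ∈ Icc p q := fun s => by
    constructor
    · conv_lhs => rw [← subArc_zero p q]
      exact (subArc_strictMono hpq).monotone unitInterval.nonneg'
    · conv_rhs => rw [← subArc_one p q]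
      exact (subArc_strictMono hpq).monotone unitInterval.le_one'
  have hsm : ContMDiff J J ∞ (e.symm ∘ subArc p q) := fun s =>
    (contMDiffAt_chart_symm he (hI (hm s))).comp s ((subArc_spec hpq).1 s)
  refine ⟨⟨e.symm ∘ subArc p q, hsm, fun s => ?_, ?_, fun s h0 h1 => ?_, ?_⟩, ?_⟩
  · rw [slope_comp s ((contMDiffAt_chart_symm he (hI (hm s))).mdifferentiableAt (by simp))
      ((subArc_spec hpq).1.mdifferentiable (by simp) s)]
    exact mul_pos (slope_chart_symm_pos T.oriented he (hI (hm s))) ((subArc_spec hpq).2 s)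
  · intro s t h
    exact (subArc_strictMono hpq).injective (e.symm.injOn (hI (hm s)) (hI (hm t)) h)
  · have h2 := subArc_mem_Ioo hpq h0 h1
    have h3 : e ((e.symm ∘ subArc p q) s) = subArc p q s := e.right_inv (hI (hm s))
    refine not_mem_boundary_chart he (e.map_target (hI (hm s))) ?_ ?_
    · rw [h3]
      exact (unitInterval.nonneg'.trans_lt h2.1).ne'
    · rw [h3]
      exact (h2.2.trans_le unitInterval.le_one').ne
  · rw [image_comp, subArc_image hpq]
    exact e.isOpen_image_symm_of_subset_target isOpen_Ioo (Ioo_subset_Icc_self.trans hI)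
  · have h1 : e.symm '' (Metric.ball (e x) (ε / 2)) ∈ 𝓝 x := by
      refine (e.isOpen_image_symm_of_subset_target Metric.isOpen_ball
        ((Metric.ball_subset_ball (by linarith)).trans hb)).mem_nhds
        ⟨e x, Metric.mem_ball_self (by linarith), e.left_inv hx⟩
    refine Filter.mem_of_superset h1 ?_
    rintro _ ⟨u, hu, rfl⟩
    rw [Metric.mem_ball, Subtype.dist_eq, Real.dist_eq, abs_lt] at hu
    obtain ⟨s, hs⟩ := exists_subArc (u := u) hpq ⟨max_le u.2.1 (by linarith [hu.1]),
      le_min u.2.2 (by linarith [hu.2])⟩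
    exact ⟨s, congrArg e.symm hs⟩

/-- A path does not pass through a boundary point. -/
theorem boundary_no_cross {N : Type} [TopologicalSpace N] [ChartedSpace unitInterval N]
    [IsManifold J ∞ N] (oN : OrientedAtlas N) {c c' : unitInterval → N}
    (hc : ContMDiff J J ∞ c) (pc : ∀ s, 0 < slope c s)
    (hc' : ContMDiff J J ∞ c') (pc' : ∀ s, 0 < slope c' s) (h : c 0 = c' 1) :
    c 0 ∉ J.boundary N := by
  have he := chart_mem_atlas unitInterval (c 0)
  have hs := mem_chart_source unitInterval (c 0)
  -- If the chart value is `0`, the path `c'` arriving there would have taken negative values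
  -- before. If it is `1`, the path `c` leaving from there would take values above `1`.
  refine not_mem_boundary_chart he hs (fun h0 => ?_) (fun h1 => ?_)
  · obtain ⟨η, hη, h2⟩ := exists_right (hc'.continuous.continuousAt.preimage_mem_nhds
      (by rw [← h]; exact chart_source_mem_nhds unitInterval (c 0)))
    have := rd_strictMonoOn oN he hc' pc' hη.1.le le_rfl h2 (left_mem_Icc.2 hη.2.le)
      (right_mem_Icc.2 hη.2.le) hη.2
    have e1 : rd (chartAt unitInterval (c 0)) c' 1 = 0 := by
      rw [rd, projIcc_right]
      show ((chartAt unitInterval (c 0) (c' 1) : unitInterval) : ℝ) = 0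
      rw [← h, h0]; rfl
    rw [e1] at this
    exact this.not_ge (chartAt unitInterval (c 0) _).2.1
  · obtain ⟨η, hη, h2⟩ := exists_left (hc.continuous.continuousAt.preimage_mem_nhds
      (chart_source_mem_nhds unitInterval (c 0)))
    have := rd_strictMonoOn oN he hc pc le_rfl hη.2.le h2 (left_mem_Icc.2 hη.1.le)
      (right_mem_Icc.2 hη.1.le) hη.1
    have e1 : rd (chartAt unitInterval (c 0)) c 0 = 1 := by
      rw [rd, projIcc_left]
      show ((chartAt unitInterval (c 0) (c 0) : unitInterval) : ℝ) = 1
      rw [h1]; rfl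
    rw [e1] at this
    exact this.not_ge (chartAt unitInterval (c 0) _).2.2

theorem exists_word {α : Type} [Finite α] (t : α → Atom Λ) :
    ∃ (W : Word Λ) (p : W.Pos ≃ α), ∀ i, W.typ i = t (p i) := by
  revert t
  refine Finite.induction_empty_option (P := fun α : Type => ∀ t : α → Atom Λ,
    ∃ (W : Word Λ) (p : W.Pos ≃ α), ∀ i, W.typ i = t (p i)) ?_ ?_ ?_ α
  · intro α β e h t
    obtain ⟨W, p, hp⟩ := h (t ∘ e)
    exact ⟨W, p.trans e, hp⟩
  · intro t
    exact ⟨.unit, ⟨fun i => Empty.elim i, fun i => PEmpty.elim i, fun i => Empty.elim i,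
      fun i => PEmpty.elim i⟩, fun i => Empty.elim i⟩
  · intro α _ h t
    obtain ⟨W, p, hp⟩ := h fun a => t (some a)
    refine ⟨.tensor (.atom (t none)) W,
      ((Equiv.sumComm _ _).trans (Equiv.optionEquivSumPUnit _).symm).trans
        (Equiv.optionCongr p), ?_⟩
    rintro (i | i)
    · rfl
    · exact hp i

theorem exists_map_of_arcs {T : Mfd Λ} (W : Word Λ) (hW : ∀ i, ∃ a b, W.typ i = .seg a b)
    (d : W.Pos → unitInterval → T.carrier) (hd : ∀ i, ContMDiff J J ∞ (d i))
    (pd : ∀ i s, 0 < slope (d i) s) : ∃ g : W.mfd.carrier → T.carrier, ContMDiff J J ∞ g ∧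
      (∀ x, 0 < slope g x) ∧ ∀ i s, g (W.arc i s) = d i s := by
  induction W with
  | unit => exact ⟨fun x => Empty.elim x, fun x => Empty.elim x, fun x => Empty.elim x,
      fun i => Empty.elim i⟩
  | atom t =>
    obtain ⟨a, b, h⟩ := hW ()
    have h : t = .seg a b := h
    subst h
    exact ⟨d (), hd (), pd (), fun _ _ => rfl⟩
  | tensor V W hV hW' =>
    obtain ⟨g, g1, g2, g3⟩ := hV (fun i => hW (Sum.inl i)) (fun i => d (Sum.inl i))
      (fun i => hd _) fun i => pd _
    obtain ⟨g', g1', g2', g3'⟩ := hW' (fun i => hW (Sum.inr i)) (fun i => d (Sum.inr i))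
      (fun i => hd _) fun i => pd _
    refine ⟨Sum.elim g g', ContMDiff.sumElim g1 g1',
      slope_pos_of_sum (ContMDiff.sumElim g1 g1') g2 g2', ?_⟩
    rintro (i | i) s
    · exact g3 i s
    · exact g3' i s

end Arcs

end

section

variable {Λ : Type}

section Covering

open Set Topology
open scoped Manifold ContDiff

/-- The part of an arc is inside or outside of another arc if it avoids the ends of the latter. -/
theorem Arc.dichotomy {T : Mfd Λ} (c c' : Arc T) {p q : unitInterval}
    (h : ∀ s ∈ Ioo p q, c.toFun s ≠ c'.toFun 0 ∧ c.toFun s ≠ c'.toFun 1) :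
    (∀ s ∈ Ioo p q, c.toFun s ∈ range c'.toFun) ∨ ∀ s ∈ Ioo p q, c.toFun s ∉ range c'.toFun := by
  have h1 : IsPreconnected (c.toFun '' Ioo p q) :=
    isPreconnected_Ioo.image _ c.smooth.continuous.continuousOn
  have h2 : IsClosed (range c'.toFun) := (isCompact_range c'.smooth.continuous).isClosed
  have h3 : c.toFun '' Ioo p q ⊆ c'.toFun '' {s | s ≠ 0 ∧ s ≠ 1} ∪ (range c'.toFun)ᶜ := by
    rintro _ ⟨s, hs, rfl⟩
    by_cases hr : c.toFun s ∈ range c'.toFun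
    · obtain ⟨t, ht⟩ := hr
      refine Or.inl ⟨t, ⟨?_, ?_⟩, ht⟩
      · rintro rfl; exact (h s hs).1 ht.symm
      · rintro rfl; exact (h s hs).2 ht.symm
    · exact Or.inr hr
  have h4 : Disjoint (c'.toFun '' {s | s ≠ 0 ∧ s ≠ 1}) (range c'.toFun)ᶜ :=
    disjoint_compl_right_iff_subset.2 (image_subset_range _ _)
  rcases h1.subset_or_subset c'.isOpen h2.isOpen_compl h4 h3 with h5 | h5
  · exact Or.inl fun s hs => image_subset_range _ _ (h5 (mem_image_of_mem _ hs))
  · exact Or.inr fun s hs => h5 (mem_image_of_mem _ hs)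

theorem Arc.exists_cover (T : Mfd Λ) : ∃ (n : ℕ) (c : Fin n → Arc T), ∀ y, ∃ k, y ∈ range (c k).toFun := by
  choose c hc using exists_arc_nhds T
  obtain ⟨t, ht⟩ := isCompact_univ.elim_nhds_subcover (fun x => range (c x).toFun) fun x _ => hc x
  refine ⟨t.card, fun k => c (t.equivFin.symm k), fun y => ?_⟩
  obtain ⟨x, hx, hy⟩ := mem_iUnion₂.1 (ht.2 (mem_univ y))
  exact ⟨t.equivFin ⟨x, hx⟩, by simpa using hy⟩

/-- Cover `T` by finitely many arcs, let `γ` be the set of all their ends, and subdivide each arc at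
the points of `γ`. Of the `m`-th arc keep the pieces whose inside avoids all earlier arcs. The kept
pieces have disjoint insides and cover `T`. The label `l` is used at cut points in the interior of
`T`. -/
theorem exists_cutting (T : Mfd Λ) (l : Λ) : ∃ W : Word Λ, (∀ i, ∃ a b, W.typ i = .seg a b) ∧
    Nonempty (W.mfd ⟶ T) := by
  classical
  obtain ⟨n, c, hc⟩ := Arc.exists_cover T
  let γ : Set T.carrier := ⋃ k, {(c k).toFun 0, (c k).toFun 1}
  have hγ : γ.Finite := finite_iUnion fun k => toFinite _
  let F : Fin n → Set unitInterval := fun k => (c k).toFun ⁻¹' γ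
  have hF : ∀ k, (F k).Finite := fun k => hγ.preimage (c k).injective.injOn
  have h0 : ∀ k, (0 : unitInterval) ∈ F k := fun k => mem_iUnion.2 ⟨k, Or.inl rfl⟩
  have h1 : ∀ k, (1 : unitInterval) ∈ F k := fun k => mem_iUnion.2 ⟨k, Or.inr rfl⟩
  -- A kept piece is given by the number of its arc and two consecutive cut points `p < q` on it.
  let A : Set (Fin n × unitInterval × unitInterval) := {x | x.2.1 ∈ F x.1 ∧ x.2.2 ∈ F x.1 ∧
    x.2.1 < x.2.2 ∧ (∀ s ∈ Ioo x.2.1 x.2.2, s ∉ F x.1) ∧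
    ∀ k < x.1, ∀ s ∈ Ioo x.2.1 x.2.2, (c x.1).toFun s ∉ range (c k).toFun}
  have hA : A.Finite := by
    have hU : (⋃ k, F k).Finite := finite_iUnion hF
    refine (finite_univ.prod (hU.prod hU)).subset ?_
    rintro ⟨k, p, q⟩ ⟨hp, hq, -⟩
    exact ⟨mem_univ _, mem_iUnion.2 ⟨k, hp⟩, mem_iUnion.2 ⟨k, hq⟩⟩
  have : Finite A := hA
  -- The label of an end depends only on the point of `T` over which it lies, so identified ends
  -- automatically have equal labels.
  let L : T.carrier → Λ := fun y => if h : y ∈ J.boundary T.carrier then T.label ⟨y, h⟩ else l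
  let d : A → unitInterval → T.carrier := fun x s => (c x.1.1).toFun (subArc x.1.2.1 x.1.2.2 s)
  have hlt : ∀ x : A, x.1.2.1 < x.1.2.2 := fun x => x.2.2.2.1
  have hd : ∀ x : A, ContMDiff J J ∞ (d x) := fun x =>
    (c x.1.1).smooth.comp (subArc_spec (hlt x)).1
  have pd : ∀ (x : A) s, 0 < slope (d x) s := fun x s => by
    show 0 < slope ((c x.1.1).toFun ∘ subArc x.1.2.1 x.1.2.2) s
    rw [slope_comp s ((c x.1.1).smooth.mdifferentiable (by simp) _)
      ((subArc_spec (hlt x)).1.mdifferentiable (by simp) s)]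
    exact mul_pos ((c x.1.1).slope_pos _) ((subArc_spec (hlt x)).2 s)
  have hend : ∀ (x : A) (s : unitInterval), s = 0 ∨ s = 1 → d x s ∈ γ := by
    rintro x s (rfl | rfl)
    · show (c x.1.1).toFun _ ∈ γ
      rw [subArc_zero]; exact x.2.1
    · show (c x.1.1).toFun _ ∈ γ
      rw [subArc_one]; exact x.2.2.1
  have hin : ∀ (x : A) (s : unitInterval), s ≠ 0 → s ≠ 1 → d x s ∉ γ := fun x s a b =>
    x.2.2.2.2.1 _ (subArc_mem_Ioo (hlt x) a b)
  have huniq : ∀ (x y : A) (s t : unitInterval), s ≠ 0 → s ≠ 1 → t ≠ 0 → t ≠ 1 → d x s = d y t →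
      x = y := by
    rintro ⟨⟨k, p, q⟩, hp, hq, hpq, hF1, hk⟩ ⟨⟨m, p', q'⟩, hp', hq', hpq', hF1', hk'⟩ s t s0 s1 t0 t1 h
    have a := subArc_mem_Ioo hpq s0 s1
    have b := subArc_mem_Ioo hpq' t0 t1
    change (c k).toFun (subArc p q s) = (c m).toFun (subArc p' q' t) at h
    rcases lt_trichotomy k m with h' | h' | h'
    · exact absurd ⟨_, h⟩ (hk' k h' _ b)
    · subst h'
      have e := (c k).injective h
      generalize subArc p q s = w at a e
      generalize subArc p' q' t = w' at b e
      subst e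
      have e1 : p = p' := by
        rcases lt_trichotomy p p' with g | g | g
        · exact absurd hp' (hF1 _ ⟨g, b.1.trans a.2⟩)
        · exact g
        · exact absurd hp (hF1' _ ⟨g, a.1.trans b.2⟩)
      have e2 : q = q' := by
        rcases lt_trichotomy q q' with g | g | g
        · exact absurd hq (hF1' _ ⟨b.1.trans a.2, g⟩)
        · exact g
        · exact absurd hq' (hF1 _ ⟨a.1.trans b.2, g⟩)
      subst e1 e2
      rfl
    · exact absurd ⟨_, h.symm⟩ (hk m h' _ a)
  have hinj : ∀ (x : A), Function.Injective (d x) := fun x s t h =>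
    (subArc_strictMono (hlt x)).injective ((c x.1.1).injective h)
  obtain ⟨W, p, hp⟩ := exists_word fun x : A => Atom.seg (L (d x 0)) (L (d x 1))
  have hW : ∀ i, ∃ a b, W.typ i = .seg a b := fun i => ⟨_, _, hp i⟩
  obtain ⟨g, g1, g2, g3⟩ := exists_map_of_arcs W hW (fun i => d (p i)) (fun i => hd _)
    fun i => pd _
  have hL : ∀ i s, (s = 0 ∨ s = 1) → ∀ h : W.arc i s ∈ J.boundary W.mfd.carrier,
      W.mfd.label ⟨W.arc i s, h⟩ = L (d (p i) s) := by
    rintro i s (rfl | rfl) h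
    · exact Word.label_arc_zero (hp i) h
    · exact Word.label_arc_one (hp i) h
  refine ⟨W, hW, ⟨⟨g, g1, g2, ?_, ?_, ?_, ?_⟩⟩⟩
  · have hK : IsClosed (range g) := (isCompact_range g1.continuous).isClosed
    have hsub : ∀ k, ∀ u ∉ F k, (c k).toFun u ∈ range g := by
      intro k u hu
      -- Take the first arc `m` through the point, and on it the cut points `a` and `b` next to the
      -- point. By `Arc.dichotomy` an earlier arc contains the inside of this piece entirely or
      -- misses it; the former contradicts minimality, so the piece was kept.
      obtain ⟨m, hm, hmin⟩ := exists_minimal_of_wellFoundedLT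
        (fun m => (c k).toFun u ∈ range (c m).toFun) ⟨k, mem_range_self u⟩
      obtain ⟨w, hw⟩ := hm
      have hw' : w ∉ F m := fun h => hu (by
        show (c k).toFun u ∈ γ
        rw [← hw]; exact h)
      have w0 : 0 < w := unitInterval.pos_iff_ne_zero.2 fun h => hw' (h ▸ h0 m)
      have w1 : w < 1 := unitInterval.lt_one_iff_ne_one.2 fun h => hw' (h ▸ h1 m)
      obtain ⟨a, ⟨ha, haw⟩, ha'⟩ := Set.exists_max_image (F m ∩ Iio w) _root_.id
        ((hF m).subset inter_subset_left) ⟨0, h0 m, w0⟩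
      obtain ⟨b, ⟨hb, hbw⟩, hb'⟩ := Set.exists_min_image (F m ∩ Ioi w) _root_.id
        ((hF m).subset inter_subset_left) ⟨1, h1 m, w1⟩
      have hab : ∀ s ∈ Ioo a b, s ∉ F m := by
        intro s hs hsF
        rcases lt_trichotomy s w with g | g | g
        · exact (ha' s ⟨hsF, g⟩).not_gt hs.1
        · exact hw' (g ▸ hsF)
        · exact (hb' s ⟨hsF, g⟩).not_gt hs.2
      have hx : (m, a, b) ∈ A := by
        refine ⟨ha, hb, haw.trans hbw, hab, fun j hj s hs => ?_⟩
        rcases (c m).dichotomy (c j) (p := a) (q := b) fun s hs =>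
          ⟨fun e => hab s hs (mem_iUnion.2 ⟨j, Or.inl e⟩),
            fun e => hab s hs (mem_iUnion.2 ⟨j, Or.inr e⟩)⟩ with h | h
        · exact absurd (hmin (hw ▸ h w ⟨haw, hbw⟩) hj.le) hj.not_ge
        · exact h s hs
      obtain ⟨s, hs⟩ := exists_subArc (haw.trans hbw : a < b) ⟨le_of_lt haw, le_of_lt hbw⟩
      refine ⟨W.arc (p.symm ⟨_, hx⟩) s, ?_⟩
      rw [g3, Equiv.apply_symm_apply, ← hw, ← hs]
    intro y
    obtain ⟨k, u, rfl⟩ := hc y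
    -- The finitely many cut points of an arc are limits of its other points, and the image of `g`
    -- is closed.
    have h2 : IsClosed ((c k).toFun ⁻¹' range g) := hK.preimage (c k).smooth.continuous
    have h3 : Dense (univ \ F k) := dense_univ.sdiff_finite (hF k)
    have h4 : u ∈ closure (univ \ F k) := h3 u
    exact h2.closure_subset_iff.2 (fun v hv => hsub k v hv.2) h4
  · intro x hx
    obtain ⟨s, hs⟩ := Word.exists_arc x
    generalize W.comp x = i at hs
    subst hs
    have h : ¬ (s = 0 ∨ s = 1) := fun h => hx (Word.arc_mem_boundary.2 ⟨hW i, h⟩)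
    rw [g3]
    push Not at h
    have h' := subArc_mem_Ioo (hlt (p i)) h.1 h.2
    exact (c (p i).1.1).map_interior _ (unitInterval.nonneg'.trans_lt h'.1).ne'
      (h'.2.trans_le unitInterval.le_one').ne
  · rintro ⟨x, hx⟩ h
    obtain ⟨s, hs⟩ := Word.exists_arc x
    generalize W.comp x = i at hs
    subst hs
    rw [hL i s (Word.arc_mem_boundary.1 hx).2 hx]
    have h' : d (p i) s ∈ J.boundary T.carrier := by rw [← g3]; exact h
    show _ = if h : _ then _ else _
    rw [dif_pos h']
    congr 2
    exact g3 i s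
  · intro x y h hne
    obtain ⟨s, hs⟩ := Word.exists_arc x
    obtain ⟨t, ht⟩ := Word.exists_arc y
    generalize W.comp x = i at hs
    generalize W.comp y = j at ht
    subst hs ht
    have e : d (p i) s = d (p j) t := by rw [← g3, ← g3, h]
    have hij : p i = p j → False := fun hij => hne (by
      have := p.injective hij
      subst this
      rw [hinj _ e])
    have hs : s = 0 ∨ s = 1 := by
      by_contra hs
      push Not at hs
      have ht : ¬ (t = 0 ∨ t = 1) := fun ht => hin _ _ hs.1 hs.2 (e ▸ hend _ _ ht)
      push Not at ht
      exact hij (huniq _ _ s t hs.1 hs.2 ht.1 ht.2 e)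
    have ht : t = 0 ∨ t = 1 := by
      by_contra ht
      push Not at ht
      exact hin _ _ ht.1 ht.2 (e ▸ hend _ _ hs)
    have hx := Word.arc_mem_boundary.2 ⟨hW i, hs⟩
    have hy := Word.arc_mem_boundary.2 ⟨hW j, ht⟩
    refine ⟨?_, hx, hy, by rw [hL i s hs, hL j t ht, e]⟩
    rw [g3]
    -- Two different pieces with a common left end, or a common right end, would overlap near it.
    -- Where a left end meets a right end, `boundary_no_cross` shows that the point is interior.
    rcases hs with rfl | rfl <;> rcases ht with rfl | rfl
    · obtain ⟨s, s', a, b, a', b', e⟩ := exists_meet_left T.oriented (hd _) (pd _) (hd _) (pd _) e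
      exact (hij (huniq _ _ s s' a b a' b' e)).elim
    · exact boundary_no_cross T.oriented (hd _) (pd _) (hd _) (pd _) e
    · rw [e]
      exact boundary_no_cross T.oriented (hd _) (pd _) (hd _) (pd _) e.symm
    · obtain ⟨s, s', a, b, a', b', e⟩ := exists_meet_right T.oriented (hd _) (pd _) (hd _) (pd _) e
      exact (hij (huniq _ _ s s' a b a' b' e)).elim

end Covering

end

section

variable {Λ : Type}

/-! ### Diffeomorphisms between disjoint unions -/

section Split

open Set Topology
open scoped Manifold ContDiff

variable {X M N : Type} [TopologicalSpace X] [ChartedSpace unitInterval X] [TopologicalSpace M]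
  [ChartedSpace unitInterval M] [TopologicalSpace N] [ChartedSpace unitInterval N] {c : X → M ⊕ N}

/-- Smoothness of `c'` follows by composing `c` with the map that is the identity on the first
summand and constant on the second. -/
theorem exists_factor_inl (hc : ContMDiff J J ∞ c) (pc : ∀ x, 0 < slope c x)
    (h : ∀ x, ∃ y, c x = Sum.inl y) : ∃ c' : X → M, ContMDiff J J ∞ c' ∧ (∀ x, 0 < slope c' x) ∧
      ∀ x, c x = Sum.inl (c' x) := by
  choose c' hc' using h
  have hs : ContMDiff J J ∞ c' := by
    intro x
    have h1 : ContMDiff J J ∞ (Sum.elim (fun y : M => y) (fun _ : N => c' x)) :=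
      ContMDiff.sumElim contMDiff_id contMDiff_const
    have h2 : c' = Sum.elim (fun y : M => y) (fun _ : N => c' x) ∘ c := by
      funext z
      show _ = Sum.elim _ _ (c z)
      rw [hc']; rfl
    have h3 := h1.comp hc
    rw [← h2] at h3
    exact h3 x
  refine ⟨c', hs, fun x => ?_, hc'⟩
  have h1 := pc x
  rw [show c = Sum.inl ∘ c' from funext hc', slope_comp x
    ((ContMDiff.inl (I := J) (n := ∞)).mdifferentiable (by simp) _)
    (hs.mdifferentiable (by simp) _), slope_inl, one_mul] at h1
  exact h1

theorem exists_factor_inr (hc : ContMDiff J J ∞ c) (pc : ∀ x, 0 < slope c x)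
    (h : ∀ x, ∃ y, c x = Sum.inr y) : ∃ c' : X → N, ContMDiff J J ∞ c' ∧ (∀ x, 0 < slope c' x) ∧
      ∀ x, c x = Sum.inr (c' x) := by
  choose c' hc' using h
  have hs : ContMDiff J J ∞ c' := by
    intro x
    have h1 : ContMDiff J J ∞ (Sum.elim (fun _ : M => c' x) (fun y : N => y)) :=
      ContMDiff.sumElim contMDiff_const contMDiff_id
    have h2 : c' = Sum.elim (fun _ : M => c' x) (fun y : N => y) ∘ c := by
      funext z
      show _ = Sum.elim _ _ (c z)
      rw [hc']; rfl
    have h3 := h1.comp hc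
    rw [← h2] at h3
    exact h3 x
  refine ⟨c', hs, fun x => ?_, hc'⟩
  have h1 := pc x
  rw [show c = Sum.inr ∘ c' from funext hc', slope_comp x
    ((ContMDiff.inr (I := J) (n := ∞)).mdifferentiable (by simp) _)
    (hs.mdifferentiable (by simp) _), slope_inr, one_mul] at h1
  exact h1

omit [ChartedSpace unitInterval X] [ChartedSpace unitInterval M] [ChartedSpace unitInterval N] in
theorem mem_inl_or_inr [PreconnectedSpace X] (hc : Continuous c) :
    (∀ x, ∃ y, c x = Sum.inl y) ∨ ∀ x, ∃ y, c x = Sum.inr y := by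
  have h1 : IsPreconnected (range c) := isPreconnected_range hc
  have h2 : range c ⊆ range (Sum.inl : M → M ⊕ N) ∪ range (Sum.inr : N → M ⊕ N) := by
    rw [range_inl_union_range_inr]; exact subset_univ _
  have h3 : Disjoint (range (Sum.inl : M → M ⊕ N)) (range (Sum.inr : N → M ⊕ N)) := by
    rw [disjoint_iff]
    exact range_inl_inter_range_inr
  rcases h1.subset_or_subset isOpen_range_inl isOpen_range_inr h3 h2 with h | h
  · exact Or.inl fun x => (h (mem_range_self x)).imp fun y e => e.symm
  · exact Or.inr fun x => (h (mem_range_self x)).imp fun y e => e.symm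

theorem strictMono_of_slope {c : unitInterval → unitInterval} (hc : ContMDiff J J ∞ c)
    (pc : ∀ s, 0 < slope c s) : StrictMono c := by
  have o : OrientedAtlas unitInterval := (Mfd.interval () ()).oriented
  have h := rd_strictMonoOn o (e := chartAt unitInterval (c 0))
    (chart_mem_atlas _ _) hc pc le_rfl le_rfl (fun t _ => by
      rw [chartAt_self_eq]; exact mem_univ _)
  intro s t hst
  have := h s.2 t.2 hst
  rw [rd_coe, rd_coe, chartAt_self_eq] at this
  exact this

/-- A diffeomorphism of disjoint unions that respects the summands. -/
theorem exists_tensor_eq {A B A' B' : Mfd Λ} (f : A ⊗ B ⟶ A' ⊗ B') [IsIso f]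
    (h1 : ∀ x, ∃ y, f.toFun (Sum.inl x) = Sum.inl y) (h2 : ∀ x, ∃ y, f.toFun (Sum.inr x) = Sum.inr y) :
    ∃ (f1 : A ⟶ A') (f2 : B ⟶ B'), IsIso f1 ∧ IsIso f2 ∧ f = f1 ⊗ₘ f2 := by
  have hinj := injective_of_isIso f
  obtain ⟨c, c1, c2, c3⟩ := exists_factor_inl (c := f.toFun ∘ Sum.inl)
    (f.smooth.comp ContMDiff.inl) (fun x => pos_comp f.smooth ContMDiff.inl x (f.slope_pos _)
      (pos_inl x)) h1
  obtain ⟨d, d1, d2, d3⟩ := exists_factor_inr (c := f.toFun ∘ Sum.inr)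
    (f.smooth.comp ContMDiff.inr) (fun x => pos_comp f.smooth ContMDiff.inr x (f.slope_pos _)
      (pos_inr x)) h2
  replace c3 : ∀ x, f.toFun (Sum.inl x) = Sum.inl (c x) := c3
  replace d3 : ∀ x, f.toFun (Sum.inr x) = Sum.inr (d x) := d3
  have cinj : Function.Injective c := fun x y e => Sum.inl_injective (hinj (by rw [c3, c3, e]))
  have dinj : Function.Injective d := fun x y e => Sum.inr_injective (hinj (by rw [d3, d3, e]))
  have csurj : Function.Surjective c := fun y => by
    obtain ⟨z | z, hz⟩ := f.surj (Sum.inl y)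
    · exact ⟨z, Sum.inl_injective ((c3 z).symm.trans hz)⟩
    · cases (d3 z).symm.trans hz
  have dsurj : Function.Surjective d := fun y => by
    obtain ⟨z | z, hz⟩ := f.surj (Sum.inr y)
    · cases (c3 z).symm.trans hz
    · exact ⟨z, Sum.inr_injective ((d3 z).symm.trans hz)⟩
  let f1 : A ⟶ A' := ⟨c, c1, c2, csurj, fun x hx h => f.map_interior (Sum.inl x) (fun h' => hx (boundary_inl.1 h'))
          (by rw [c3]; exact boundary_inl.2 h), fun x h => by
      have h' : f.toFun (Sum.inl x.1) ∈ J.boundary (A' ⊗ B').carrier := by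
        rw [c3]; exact boundary_inl.2 h
      have := f.label_boundary ⟨Sum.inl x.1, boundary_inl.2 x.2⟩ h'
      refine Eq.trans ?_ this
      show (A' ⊗ B').label ⟨Sum.inl (c x), boundary_inl.2 h⟩ = _
      congr 2
      exact (c3 _).symm, fun _ _ e hne => absurd (cinj e) hne⟩
  let f2 : B ⟶ B' := ⟨d, d1, d2, dsurj, fun x hx h => f.map_interior (Sum.inr x) (fun h' => hx (boundary_inr.1 h'))
          (by rw [d3]; exact boundary_inr.2 h), fun x h => by
      have h' : f.toFun (Sum.inr x.1) ∈ J.boundary (A' ⊗ B').carrier := by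
        rw [d3]; exact boundary_inr.2 h
      have := f.label_boundary ⟨Sum.inr x.1, boundary_inr.2 x.2⟩ h'
      refine Eq.trans ?_ this
      show (A' ⊗ B').label ⟨Sum.inr (d x), boundary_inr.2 h⟩ = _
      congr 2
      exact (d3 _).symm, fun _ _ e hne => absurd (dinj e) hne⟩
  refine ⟨f1, f2, isIso_of_injective _ cinj, isIso_of_injective _ dinj, Mfd.hom_ext ?_⟩
  rintro (x | x)
  · exact c3 x
  · exact d3 x

end Split

instance Atom.preconnected (t : Atom Λ) : PreconnectedSpace t.mfd.carrier := by
  cases t with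
  | seg a b => exact inferInstanceAs (PreconnectedSpace unitInterval)
  | circ => exact inferInstanceAs (PreconnectedSpace (AddCircle (1 : ℝ)))

/-- A diffeomorphism of disjoint unions that respects one point of connected summands. -/
theorem exists_tensor_eq_of_atom {t t' : Atom Λ} {B B' : Mfd Λ} (f : t.mfd ⊗ B ⟶ t'.mfd ⊗ B')
    [IsIso f] {x : t.mfd.carrier} {y : t'.mfd.carrier} (h : f.toFun (Sum.inl x) = Sum.inl y) :
    ∃ (f1 : t.mfd ⟶ t'.mfd) (f2 : B ⟶ B'), IsIso f1 ∧ IsIso f2 ∧ f = f1 ⊗ₘ f2 := by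
  have hinv : ∀ z, (inv f).toFun (f.toFun z) = z := fun z =>
    congrArg (fun g : t.mfd ⊗ B ⟶ t.mfd ⊗ B => g.toFun z) (IsIso.hom_inv_id f)
  have h1 : ∀ x, ∃ y, f.toFun (Sum.inl x) = Sum.inl y := by
    rcases mem_inl_or_inr (c := f.toFun ∘ Sum.inl) (f.smooth.continuous.comp continuous_inl) with h' | h'
    · exact h'
    · obtain ⟨z, hz⟩ := h' x
      cases h.symm.trans hz
  have h2 : ∀ x, ∃ y, (inv f).toFun (Sum.inl x) = Sum.inl y := by
    rcases mem_inl_or_inr (c := (inv f).toFun ∘ Sum.inl)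
      ((inv f).smooth.continuous.comp continuous_inl) with h' | h'
    · exact h'
    · obtain ⟨z, hz⟩ := h' y
      have e : (inv f).toFun (Sum.inl y) = Sum.inl x :=
        (congrArg (inv f).toFun h).symm.trans (hinv (Sum.inl x))
      cases e.symm.trans hz
  refine exists_tensor_eq f h1 fun z => ?_
  rcases hz : f.toFun (Sum.inr z) with w | w
  · obtain ⟨v, hv⟩ := h2 w
    cases (hinv (Sum.inr z)).symm.trans ((congrArg (inv f).toFun hz).trans hv)
  · exact ⟨w, rfl⟩

/-- An endomorphism of an interval is strictly increasing, so it induces the same order as the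
identity. -/
theorem isotopic_id_of_isIso {a b : Λ} (f : Mfd.interval a b ⟶ Mfd.interval a b) :
    Isotopic f (𝟙 _) :=
  isotopic_of_le_iff fun _ _ =>
    (strictMono_of_slope (c := f.fn) f.smooth f.slope_pos).le_iff_le

/-- The underlying map is increasing and surjective, so it fixes both ends, and morphisms preserve
the labels of ends that stay in the boundary. -/
theorem labels_eq {a b a' b' : Λ} (f : Mfd.interval a b ⟶ Mfd.interval a' b') :
    a = a' ∧ b = b' := by
  have hm : StrictMono (α := unitInterval) f.fn := strictMono_of_slope f.smooth f.slope_pos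
  have h0 : f.fn (0 : unitInterval) = 0 := by
    obtain ⟨x, hx⟩ := f.fn_surj 0
    exact le_antisymm ((hm.monotone (unitInterval.nonneg' (t := x))).trans_eq hx) unitInterval.nonneg'
  have h1 : f.fn (1 : unitInterval) = 1 := by
    obtain ⟨x, hx⟩ := f.fn_surj 1
    exact le_antisymm unitInterval.le_one' (hx.symm.trans_le (hm.monotone (unitInterval.le_one' (t := x))))
  have key : ∀ x : unitInterval, f.fn x = x → ∀ h : x ∈ J.boundary unitInterval,
      (Mfd.interval a' b').label ⟨x, h⟩ = (Mfd.interval a b).label ⟨x, h⟩ := by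
    intro x hx h
    have h' : f.fn x ∈ J.boundary unitInterval := by rw [hx]; exact h
    rw [← f.label_boundary ⟨x, h⟩ h']
    congr 2
    exact hx.symm
  constructor
  · have := key 0 h0 (interval_boundary (a := a) (b := b).2 (Or.inl rfl))
    exact (Mfd.interval_label_zero a b _).symm.trans
      (this.symm.trans (Mfd.interval_label_zero a' b' _))
  · have := key 1 h1 (interval_boundary (a := a) (b := b).2 (Or.inr rfl))
    exact (Mfd.interval_label_one a b _).symm.trans
      (this.symm.trans (Mfd.interval_label_one a' b' _))

end

/-! ### Generation of all morphisms by gluings and closings -/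

section

variable {Λ : Type} {C : Type u} [Category.{v} C] [MonoidalCategory C] [SymmetricCategory C]

/-- The morphisms of cobordisms related to a morphism of `C`. -/
def Gen (D : TrData Λ C) (V W : Word Λ) (f : V.mfd ⟶ W.mfd) : Prop := ∃ φ, R D V W f φ

namespace Gen

variable {D : TrData Λ C} {U V V' W W' : Word Λ}

theorem id (V : Word Λ) : Gen D V V (𝟙 _) := ⟨_, .id V⟩

theorem comp {f : U.mfd ⟶ V.mfd} {g : V.mfd ⟶ W.mfd} (h : Gen D U V f) (h' : Gen D V W g) :
    Gen D U W (f ≫ g) := ⟨_, h.choose_spec.comp h'.choose_spec⟩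

theorem tensor {f : V.mfd ⟶ W.mfd} {g : V'.mfd ⟶ W'.mfd} (h : Gen D V W f) (h' : Gen D V' W' g) :
    Gen D (.tensor V V') (.tensor W W') (f ⊗ₘ g) := ⟨_, h.choose_spec.tensor h'.choose_spec⟩

/-- Chains of isotopies are used because a concatenation of two smooth families need not be smooth.
Each link is absorbed by the constructor `R.isotopy`. -/
theorem isotopy {f g : V.mfd ⟶ W.mfd} (h : Gen D V W f) (h' : Relation.ReflTransGen Isotopic f g) :
    Gen D V W g := by
  induction h' with
  | refl => exact h
  | tail _ h' ih => exact ⟨_, ih.choose_spec.isotopy h'⟩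

end Gen

/-- The number of components. -/
def Word.size : Word Λ → ℕ
  | .unit => 0
  | .atom _ => 1
  | .tensor V W => V.size + W.size

/-- The number of components that are intervals. -/
def Word.segs : Word Λ → ℕ
  | .unit => 0
  | .atom (.seg _ _) => 1
  | .atom .circ => 0
  | .tensor V W => V.segs + W.segs

theorem Word.size_pos {W : Word Λ} (i : W.Pos) : W.size ≠ 0 := by
  induction W with
  | unit => exact Empty.elim i
  | atom t => exact one_ne_zero
  | tensor V W hV hW =>
    rcases i with i | i
    · have := hV i
      simp only [Word.size]; omega
    · have := hW i
      simp only [Word.size]; omega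

theorem Word.exists_pos {W : Word Λ} (h : W.size ≠ 0) : Nonempty W.Pos := by
  induction W with
  | unit => exact absurd rfl h
  | atom t => exact ⟨()⟩
  | tensor V W hV hW =>
    by_cases hv : V.size = 0
    · obtain ⟨i⟩ := hW (by simp only [Word.size] at h; omega)
      exact ⟨Sum.inr i⟩
    · obtain ⟨i⟩ := hV hv
      exact ⟨Sum.inl i⟩

variable (D : TrData Λ C)

/-- A component of a manifold described by a word can be moved to the front. -/
theorem Word.exists_extract {W : Word Λ} (i : W.Pos) {t : Atom Λ} (ht : W.typ i = t) :
    ∃ (W' : Word Λ) (P : W.mfd ≅ (Word.tensor (.atom t) W').mfd)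
      (p : W.Pos → (Word.tensor (.atom t) W').Pos),
      Gen D W (.tensor (.atom t) W') P.hom ∧ Gen D (.tensor (.atom t) W') W P.inv ∧
      Function.Injective p ∧ p i = Sum.inl () ∧
      (∀ j, (Word.tensor (.atom t) W').typ (p j) = W.typ j) ∧
      (∀ j s, P.hom.toFun (W.arc j s) = (Word.tensor (.atom t) W').arc (p j) s) ∧
      W.size = W'.size + 1 ∧ W.segs = (Word.atom t).segs + W'.segs := by
  subst ht
  induction W with
  | unit => exact Empty.elim i
  | atom t =>
    exact ⟨.unit, (ρ_ _).symm, fun _ => Sum.inl (), ⟨_, .runitInv _⟩, ⟨_, .runit _⟩,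
      fun _ _ _ => rfl, rfl, fun _ => rfl, fun _ _ => rfl, rfl, rfl⟩
  | tensor V W hV hW =>
    rcases i with i | i
    · obtain ⟨V', P, p, h1, h2, h3, h4, h5, h6, h7, h8⟩ := hV i
      refine ⟨.tensor V' W, tensorIso P (Iso.refl _) ≪≫ α_ _ _ _,
        fun j => Equiv.sumAssoc _ _ _ (Sum.map p _root_.id j),
        (h1.tensor (.id W)).comp ⟨_, .assoc _ _ _⟩, Gen.comp ⟨_, .assocInv _ _ _⟩ (h2.tensor (.id W)),
        (Equiv.injective _).comp (h3.sumMap Function.injective_id), ?_, ?_, ?_, ?_, ?_⟩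
      · show Equiv.sumAssoc _ _ _ (Sum.inl (p i)) = _
        rw [h4]; rfl
      · rintro (j | j)
        · have h := h5 j
          show Word.typ (.tensor (.atom (V.typ i)) (.tensor V' W)) (Equiv.sumAssoc _ _ _ (Sum.inl (p j))) =
            V.typ j
          rw [← h]
          rcases p j with k | k <;> rfl
        · rfl
      · rintro (j | j) s
        · have h := h6 j s
          show Mfd.Hom.toFun (α_ (Atom.mfd _) V'.mfd W.mfd).hom (Sum.inl (P.hom.toFun (V.arc j s))) =
            Word.arc (.tensor (.atom (V.typ i)) (.tensor V' W)) (Equiv.sumAssoc _ _ _ (Sum.inl (p j))) s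
          rw [h]
          rcases p j with k | k <;> rfl
        · rfl
      · simp only [Word.size] at h7 ⊢; omega
      · simp only [Word.segs] at h8 ⊢
        show V.segs + W.segs = Word.segs (.atom (V.typ i)) + _
        omega
    · obtain ⟨W', P, p, h1, h2, h3, h4, h5, h6, h7, h8⟩ := hW i
      refine ⟨.tensor W' V, β_ _ _ ≪≫ tensorIso P (Iso.refl _) ≪≫ α_ _ _ _,
        fun j => Equiv.sumAssoc _ _ _ (Sum.map p _root_.id (Sum.swap j)),
        Gen.comp ⟨_, .braid _ _⟩ ((h1.tensor (.id V)).comp ⟨_, .assoc _ _ _⟩), ?_,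
        (Equiv.injective _).comp ((h3.sumMap Function.injective_id).comp
          (Equiv.sumComm _ _).injective), ?_, ?_, ?_, ?_, ?_⟩
      · have h : Gen D (.tensor W V) (.tensor V W) (β_ _ _).inv := by
          rw [← SymmetricCategory.braiding_swap_eq_inv_braiding]
          exact ⟨_, .braid _ _⟩
        exact (Gen.comp ⟨_, .assocInv _ _ _⟩ (h2.tensor (.id V))).comp h
      · show Equiv.sumAssoc _ _ _ (Sum.inl (p i)) = _
        rw [h4]; rfl
      · rintro (j | j)
        · rfl
        · have h := h5 j
          show Word.typ (.tensor (.atom (W.typ i)) (.tensor W' V)) (Equiv.sumAssoc _ _ _ (Sum.inl (p j))) =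
            W.typ j
          rw [← h]
          rcases p j with k | k <;> rfl
      · rintro (j | j) s
        · rfl
        · have h := h6 j s
          show Mfd.Hom.toFun (α_ (Atom.mfd _) W'.mfd V.mfd).hom (Sum.inl (P.hom.toFun (W.arc j s))) =
            Word.arc (.tensor (.atom (W.typ i)) (.tensor W' V)) (Equiv.sumAssoc _ _ _ (Sum.inl (p j))) s
          rw [h]
          rcases p j with k | k <;> rfl
      · simp only [Word.size] at h7 ⊢; omega
      · simp only [Word.segs] at h8 ⊢
        show V.segs + W.segs = Word.segs (.atom (W.typ i)) + _
        omega

theorem Iso.inv_apply {S T : Mfd Λ} (P : S ≅ T) {x : S.carrier} {y : T.carrier}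
    (h : P.hom.toFun x = y) : P.inv.toFun y = x := by
  rw [← h]
  exact congrArg (fun g : S ⟶ S => g.toFun x) P.hom_inv_id

theorem Isotopic.chain_comp {S T U : Mfd Λ} (k : S ⟶ T) {f g : T ⟶ U}
    (h : Relation.ReflTransGen Isotopic f g) : Relation.ReflTransGen Isotopic (k ≫ f) (k ≫ g) :=
  h.lift _ fun _ _ h => (Isotopic.refl k).comp h

/-- A cutting of a manifold is, up to a diffeomorphism and isotopies, a composite of gluings. -/
theorem exists_gen_comp {W : Word Λ} {T : Mfd Λ} (f : W.mfd ⟶ T) :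
    ∃ (V : Word Λ) (g : W.mfd ⟶ V.mfd) (e : V.mfd ⟶ T), Gen D W V g ∧ IsIso e ∧
      Relation.ReflTransGen Isotopic f (g ≫ e) := by
  -- Each merging lowers the number of interval components: two intervals become one, or one becomes
  -- a circle.
  generalize hn : W.segs = n
  induction n using Nat.strong_induction_on generalizing W with
  | _ n ih =>
  by_cases hf : Function.Injective f.toFun
  · exact ⟨W, 𝟙 _, f, .id W, isIso_of_injective f hf, by
      rw [Category.id_comp]⟩
  simp only [Function.Injective, not_forall] at hf
  obtain ⟨x, y, hxy, hne⟩ := hf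
  obtain ⟨i, j, a, b, c, hi, hj, h⟩ := glued_ends f hxy hne
  have h : f.toFun (W.arc i 1) = f.toFun (W.arc j 0) := by
    rcases h with ⟨h, h'⟩ | ⟨h, h'⟩
    · rw [← h, ← h', hxy]
    · rw [← h, ← h', hxy]
  -- The induction step common to gluing and closing: `P` brings the components to be merged to the
  -- front, `q` merges them, and the induction hypothesis applies to the remaining factor `g`.
  have finish : ∀ {K K' : Word Λ} (P : W.mfd ≅ K.mfd) (q : K.mfd ⟶ K'.mfd) (g : K'.mfd ⟶ T),
      Gen D W K P.hom → Gen D K K' q → Isotopic (P.inv ≫ f) (q ≫ g) → K'.segs < n →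
      ∃ (V : Word Λ) (g : W.mfd ⟶ V.mfd) (e : V.mfd ⟶ T), Gen D W V g ∧ IsIso e ∧
        Relation.ReflTransGen Isotopic f (g ≫ e) := by
    intro K K' P q g hP hq hi hlt
    obtain ⟨V, g', e, hg, he, hi'⟩ := ih _ hlt g rfl
    refine ⟨V, P.hom ≫ q ≫ g', e, hP.comp (hq.comp hg), he, ?_⟩
    have h1 := Isotopic.chain_comp P.hom ((Relation.ReflTransGen.single hi).trans
      (Isotopic.chain_comp q hi'))
    rwa [Iso.hom_inv_id_assoc, ← Category.assoc q, ← Category.assoc] at h1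
  obtain ⟨W', P, p, h1, h2, h3, h4, h5, h6, -, h8⟩ := Word.exists_extract D i hi
  by_cases hij : i = j
  · subst hij
    rw [hi] at hj
    cases hj
    have e1 : P.hom.toFun (W.arc i 1) = Sum.inl (1 : unitInterval) := (h6 i 1).trans (by rw [h4]; rfl)
    have e0 : P.hom.toFun (W.arc i 0) = Sum.inl (0 : unitInterval) := (h6 i 0).trans (by rw [h4]; rfl)
    obtain ⟨g, hg⟩ := exists_merge_circ (P.inv ≫ f) 
      ((congrArg f.toFun (Iso.inv_apply P e1)).trans
        (h.trans (congrArg f.toFun (Iso.inv_apply P e0)).symm))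
    refine finish (K' := .tensor (.atom .circ) W') P _ g h1 (Gen.tensor ⟨_, .close a⟩ (.id W')) hg ?_
    simp only [Word.segs] at h8 ⊢
    omega
  · obtain ⟨j', hj'⟩ : ∃ j', p j = Sum.inr j' := by
      rcases h : p j with k | k
      · exact absurd (h3 (h4.trans h.symm)) hij
      · exact ⟨k, rfl⟩
    obtain ⟨W'', P', p', h1', h2', h3', h4', h5', h6', -, h8'⟩ :=
      Word.exists_extract D (W := W') (t := .seg b c) j' (by
        rw [← hj, ← h5 j, hj']; rfl)
    let K : Word Λ := .tensor (.tensor (.atom (.seg a b)) (.atom (.seg b c))) W''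
    let E : W.mfd ≅ K.mfd := P ≪≫ tensorIso (Iso.refl _) P' ≪≫ (α_ _ _ _).symm
    have hE : Gen D W K E.hom := h1.comp ((Gen.tensor (.id (.atom (.seg a b))) h1').comp
      ⟨_, .assocInv _ _ _⟩)
    have e1 : E.hom.toFun (W.arc i 1) = Sum.inl (Sum.inl (1 : unitInterval)) := by
      show (α_ (Mfd.interval a b) (Mfd.interval b c) W''.mfd).inv.toFun
        (Sum.map _root_.id P'.hom.toFun (P.hom.toFun (W.arc i 1))) = _
      rw [h6, h4]; rfl
    have e0 : E.hom.toFun (W.arc j 0) = Sum.inl (Sum.inr (0 : unitInterval)) := by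
      show (α_ (Mfd.interval a b) (Mfd.interval b c) W''.mfd).inv.toFun
        (Sum.map _root_.id P'.hom.toFun (P.hom.toFun (W.arc j 0))) = _
      rw [h6, hj']
      show (α_ (Mfd.interval a b) (Mfd.interval b c) W''.mfd).inv.toFun
        (Sum.inr (P'.hom.toFun (W'.arc j' 0))) = _
      rw [h6', h4']; rfl
    obtain ⟨g, hg⟩ := exists_merge_seg (E.inv ≫ f) 
      ((congrArg f.toFun (Iso.inv_apply E e1)).trans
        (h.trans (congrArg f.toFun (Iso.inv_apply E e0)).symm))
    refine finish (K' := .tensor (.atom (.seg a c)) W'') E _ g hE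
      (Gen.tensor ⟨_, .glue a b c⟩ (.id W'')) hg ?_
    simp only [Word.segs] at h8 h8' ⊢
    omega

/-- A word without components is a bracketing of units, so unitors lead from it to the unit and
back. This is the base of the induction in `Gen.of_isIso`. -/
theorem Gen.unit_of_size {W : Word Λ} (h : W.size = 0) :
    (∃ f : W.mfd ⟶ 𝟙_ (Mfd Λ), Gen D W .unit f) ∧ (∃ f : 𝟙_ (Mfd Λ) ⟶ W.mfd, Gen D .unit W f) := by
  induction W with
  | unit => exact ⟨⟨_, .id _⟩, ⟨_, .id _⟩⟩
  | atom t => cases h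
  | tensor V W hV hW =>
    simp only [Word.size, Nat.add_eq_zero_iff] at h
    obtain ⟨⟨f, hf⟩, ⟨g, hg⟩⟩ := hV h.1
    obtain ⟨⟨f', hf'⟩, ⟨g', hg'⟩⟩ := hW h.2
    exact ⟨⟨_, (hf.tensor hf').comp ⟨_, .runit _⟩⟩, ⟨_, Gen.comp ⟨_, .runitInv _⟩ (hg.tensor hg')⟩⟩

/-- A diffeomorphism between components is isotopic to the identity. -/
theorem Gen.atom {t t' : Atom Λ} (f : t.mfd ⟶ t'.mfd) [IsIso f] : Gen D (.atom t) (.atom t') f := by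
  cases t with
  | seg a b =>
    cases t' with
    | seg a' b' =>
      obtain ⟨rfl, rfl⟩ := labels_eq f
      exact (Gen.id _).isotopy (.single (isotopic_id_of_isIso f).symm)
    | circ =>
      exact absurd ((boundary_of_isIso f).2 (interval_boundary.2 (Or.inl rfl)))
        (not_mem_boundary_circ _)
  | circ =>
    cases t' with
    | seg a b =>
      exact absurd ((boundary_of_isIso (inv f)).2 (interval_boundary.2 (Or.inl rfl)))
        (not_mem_boundary_circ _)
    | circ => exact (Gen.id _).isotopy (.single (isotopic_circle f).symm)

/-- Induction on the number of components: bring a component of the source, and the component of the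
target onto which it is mapped, to the front. The diffeomorphism then splits off a diffeomorphism of
single components. -/
theorem Gen.of_isIso {W V : Word Λ} (f : W.mfd ⟶ V.mfd) [IsIso f] : Gen D W V f := by
  generalize hn : W.size = n
  induction n generalizing W V with
  | zero =>
    have hW : ∀ x : W.mfd.carrier, False := fun x => Word.size_pos (W.comp x) hn
    have hV : V.size = 0 := by
      by_contra h
      obtain ⟨i⟩ := Word.exists_pos h
      exact hW ((f.surj (V.arc i 0)).choose)
    obtain ⟨⟨g, hg⟩, -⟩ := Gen.unit_of_size D hn
    obtain ⟨-, ⟨g', hg'⟩⟩ := Gen.unit_of_size D hV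
    rw [show f = g ≫ g' from Mfd.hom_ext fun x => (hW x).elim]
    exact hg.comp hg'
  | succ n ih =>
    obtain ⟨i⟩ := Word.exists_pos (W := W) (by omega)
    obtain ⟨W', P, p, h1, h2, -, h4, -, h6, h7, -⟩ := Word.exists_extract D i rfl
    obtain ⟨s, hs⟩ := Word.exists_arc (f.toFun (W.arc i 0))
    obtain ⟨V', P', p', h1', h2', -, h4', -, h6', -, -⟩ :=
      Word.exists_extract D (V.comp (f.toFun (W.arc i 0))) rfl
    have e0 : P.hom.toFun (W.arc i 0) = Sum.inl (Word.arc (.atom (W.typ i)) () 0) :=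
      (h6 i 0).trans (by rw [h4]; rfl)
    have e1 : P'.hom.toFun (f.toFun (W.arc i 0)) = Sum.inl (Word.arc (.atom (V.typ _)) () s) :=
      (congrArg P'.hom.toFun hs).symm.trans ((h6' _ s).trans (by rw [h4']; rfl))
    obtain ⟨f1, f2, i1, i2, e⟩ := exists_tensor_eq_of_atom (P.inv ≫ f ≫ P'.hom)
      (x := Word.arc (.atom (W.typ i)) () 0) (by
        show P'.hom.toFun (f.toFun (P.inv.toFun _)) = _
        rw [Iso.inv_apply P e0]
        exact e1)
    have : f = P.hom ≫ (f1 ⊗ₘ f2) ≫ P'.inv := by rw [← e]; simp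
    rw [this]
    exact h1.comp ((Gen.tensor (Gen.atom D f1) (ih f2 (by omega))).comp h2')

/-- Merge until a diffeomorphism remains, generate the diffeomorphism, and return along the
isotopies. This makes `R` a total relation. -/
theorem Gen.total {W V : Word Λ} (f : W.mfd ⟶ V.mfd) : Gen D W V f := by
  obtain ⟨U, g, e, hg, he, hi⟩ := exists_gen_comp D f
  refine (hg.comp (Gen.of_isIso D e)).isotopy ?_
  have : Std.Symm (Isotopic (S := W.mfd) (T := V.mfd)) := ⟨fun _ _ => Isotopic.symm⟩
  exact Std.Symm.symm _ _ hi

end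

section

variable {Λ : Type}

/-! ### Linear and cyclic orders, and their invariance under isotopy -/

section Order

open Set

/-- Lists of coordinates that are increasing, respectively increasing in the cyclic order. -/
def Srt : Atom Λ → List ℝ → Prop
  | .seg _ _ => fun xs => xs.Pairwise (· < ·)
  | .circ => fun xs => ∃ y : ℝ, xs.Pairwise fun x x' => Int.fract (x - y) < Int.fract (x' - y)

theorem geo_iff {ι κ : Type} {Q : ι → κ → ℝ → Prop} {p : κ × Atom Λ} {w : List (ι × Atom Λ)} :
    Geo Q p w ↔ ∃ xs : List ℝ, List.Forall₂ (fun i x => Q i.1 p.1 x) w xs ∧ Srt p.2 xs := by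
  rcases p with ⟨k, _ | _⟩ <;> rfl

/-- A change of base point in the cyclic coordinate: the points that come before the new base point
`a` are moved by a full turn. -/
theorem fract_sub (x y a : ℝ) : Int.fract (x - a) =
    if Int.fract (a - y) ≤ Int.fract (x - y) then Int.fract (x - y) - Int.fract (a - y)
    else Int.fract (x - y) - Int.fract (a - y) + 1 := by
  have h1 := Int.fract_add_floor (x - y)
  have h2 := Int.fract_add_floor (a - y)
  have h3 := Int.fract_nonneg (x - y)
  have h4 := Int.fract_nonneg (a - y)
  have h5 := Int.fract_lt_one (x - y)
  have h6 := Int.fract_lt_one (a - y)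
  split_ifs with h
  · refine Int.fract_eq_iff.2 ⟨by linarith, by linarith, ⌊x - y⌋ - ⌊a - y⌋, ?_⟩
    push_cast; linarith
  · push Not at h
    refine Int.fract_eq_iff.2 ⟨by linarith, by linarith, ⌊x - y⌋ - ⌊a - y⌋ - 1, ?_⟩
    push_cast; linarith

/-- A cyclically ordered list can be rotated. -/
theorem pairwise_rotate {α : Type} {X : α → ℝ} {l1 l2 : List α} {a : α} {y : ℝ}
    (h : (l1 ++ a :: l2).Pairwise fun i j => Int.fract (X i - y) < Int.fract (X j - y)) :
    ((a :: l2) ++ l1).Pairwise fun i j => Int.fract (X i - X a) < Int.fract (X j - X a) := by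
  obtain ⟨h1, h2, h3⟩ := List.pairwise_append.1 h
  have hl : ∀ i ∈ l1, Int.fract (X i - X a) = Int.fract (X i - y) - Int.fract (X a - y) + 1 := by
    intro i hi
    rw [fract_sub _ y, if_neg (not_le.2 (h3 i hi a (by simp)))]
  have hr : ∀ i ∈ a :: l2, Int.fract (X i - X a) = Int.fract (X i - y) - Int.fract (X a - y) := by
    intro i hi
    rw [fract_sub _ y, if_pos]
    rcases List.mem_cons.1 hi with rfl | hi
    · exact le_rfl
    · exact ((List.pairwise_cons.1 h2).1 i hi).le
  refine List.pairwise_append.2 ⟨h2.imp_of_mem fun hi hj h => ?_, h1.imp_of_mem fun hi hj h => ?_,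
    fun i hi j hj => ?_⟩
  · rw [hr _ hi, hr _ hj]; linarith
  · rw [hl _ hi, hl _ hj]; linarith
  · rw [hr _ hi, hl _ hj]
    linarith [Int.fract_lt_one (X i - y), Int.fract_nonneg (X j - y)]

/-- The base point of the cyclic order may be taken to be the first entry, which removes the
existential quantifier. -/
theorem srt_circ_cons {α : Type} {X : α → ℝ} {a : α} {l : List α} :
    Srt (.circ : Atom Λ) ((a :: l).map X) ↔
      (a :: l).Pairwise fun i j => Int.fract (X i - X a) < Int.fract (X j - X a) := by
  constructor
  · rintro ⟨y, h⟩
    rw [List.pairwise_map] at h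
    have := pairwise_rotate (X := X) (l1 := []) h
    simpa using this
  · intro h
    exact ⟨X a, List.pairwise_map.2 h⟩

theorem fract_fract_sub (x y : ℝ) : Int.fract (Int.fract x - Int.fract y) = Int.fract (x - y) := by
  rw [Int.fract_eq_fract]
  refine ⟨⌊y⌋ - ⌊x⌋, ?_⟩
  rw [← Int.self_sub_floor, ← Int.self_sub_floor]
  push_cast
  ring

/-- By the intermediate value theorem, functions that never agree keep their order. -/
theorem lt_of_continuous {F G : ℝ → ℝ} (hF : Continuous F) (hG : Continuous G) (h : F 0 < G 0)
    (h' : ∀ s ∈ Icc (0 : ℝ) 1, F s ≠ G s) : ∀ s ∈ Icc (0 : ℝ) 1, F s < G s := by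
  intro s hs
  by_contra hn
  obtain ⟨t, ht, e⟩ := intermediate_value_Icc hs.1 ((hF.sub hG).continuousOn (s := Icc 0 s))
    ⟨(sub_neg.2 h).le, sub_nonneg.2 (not_lt.1 hn)⟩
  exact h' t ⟨ht.1, ht.2.trans hs.2⟩ (sub_eq_zero.1 e)

end Order

section Dev

open Set
open scoped Manifold ContDiff

/-- The reduction of a lift of the coordinate of a component. -/
def Atom.read : Atom Λ → ℝ → ℝ
  | .seg _ _ => fun x => x
  | .circ => Int.fract

theorem Word.coord_circ (x : ℝ) :
    Word.coord (.atom (.circ : Atom Λ)) (x : Circ) = Int.fract x := by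
  show ((AddCircle.equivIco (1 : ℝ) 0 (x : AddCircle (1 : ℝ)) : ℝ)) = _
  rw [AddCircle.coe_equivIco_mk_apply]
  simp

theorem Word.ext_coord {W : Word Λ} {x y : W.mfd.carrier} (h : W.comp x = W.comp y)
    (h' : W.coord x = W.coord y) : x = y := by
  induction W with
  | unit => exact Empty.elim x
  | atom t =>
    cases t with
    | seg a b => exact Subtype.ext h'
    | circ => exact (AddCircle.equivIco (1 : ℝ) 0).injective (Subtype.ext h')
  | tensor V W hV hW =>
    rcases x with x | x <;> rcases y with y | y
    · exact congrArg Sum.inl (hV (Sum.inl_injective h) h')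
    · cases h
    · cases h
    · exact congrArg Sum.inr (hW (Sum.inr_injective h) h')

/-- The coordinate of a path, as a function of a real variable. -/
theorem Word.exists_dev {W : Word Λ} {c : unitInterval → W.mfd.carrier} (hc : Continuous c) :
    ∃ (k : W.Pos) (G : ℝ → ℝ), Continuous G ∧ (∀ s, W.comp (c s) = k) ∧
      (∀ s : unitInterval, W.coord (c s) = (W.typ k).read (G s)) ∧
      (ContMDiff J J ∞ c → (∀ s, 0 < slope c s) → StrictMonoOn G (Icc 0 1)) := by
  induction W with
  | unit => exact Empty.elim (c 0)
  | atom t =>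
    cases t with
    | seg a b =>
      have hc' : Continuous (fun s : unitInterval => (c s : unitInterval)) := hc
      refine ⟨(), fun t => Subtype.val (p := (· ∈ unitInterval)) (c (projIcc 0 1 zero_le_one t)),
        continuous_subtype_val.comp (hc'.comp continuous_projIcc01), fun _ => rfl, fun s => ?_,
        fun h h' s hs t ht hst => ?_⟩
      · show Subtype.val (p := (· ∈ unitInterval)) (c s) = Subtype.val (p := (· ∈ unitInterval)) (c (projIcc 0 1 zero_le_one s))
        rw [projIcc01_coe]
      · refine strictMono_of_slope (c := fun s => c s) h h' ?_
        rw [projIcc_of_mem _ hs, projIcc_of_mem _ ht]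
        exact hst
    | circ =>
      obtain ⟨G, hG, h⟩ := exists_lift (c := fun t => c (projIcc 0 1 zero_le_one t))
        (hc.comp continuous_projIcc01)
      refine ⟨(), G, hG, fun _ => rfl, fun s => ?_, fun h1 h2 =>
        lift_strictMonoOn (c := c) h1 h2 hG fun t _ => h t⟩
      have e := h s
      rw [projIcc01_coe] at e
      have e2 := Word.coord_circ (Λ := Λ) (G s)
      rw [e] at e2
      exact e2
  | tensor V W hV hW =>
    rcases mem_inl_or_inr (M := V.mfd.carrier) (N := W.mfd.carrier) hc with h | h
    · choose d hd using h
      obtain rfl : c = Sum.inl ∘ d := funext hd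
      have hd' : Continuous d := Topology.IsEmbedding.inl.continuous_iff.2 hc
      obtain ⟨k, G, h1, h2, h3, h4⟩ := hV hd'
      refine ⟨Sum.inl k, G, h1, fun s => congrArg Sum.inl (h2 s), h3, fun h5 h6 => ?_⟩
      obtain ⟨e, e1, e2, e3⟩ := exists_factor_inl h5 h6 fun s => ⟨d s, rfl⟩
      obtain rfl : d = e := funext fun s => Sum.inl_injective (e3 s)
      exact h4 e1 e2
    · choose d hd using h
      obtain rfl : c = Sum.inr ∘ d := funext hd
      have hd' : Continuous d := Topology.IsEmbedding.inr.continuous_iff.2 hc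
      obtain ⟨k, G, h1, h2, h3, h4⟩ := hW hd'
      refine ⟨Sum.inr k, G, h1, fun s => congrArg Sum.inr (h2 s), h3, fun h5 h6 => ?_⟩
      obtain ⟨e, e1, e2, e3⟩ := exists_factor_inr h5 h6 fun s => ⟨d s, rfl⟩
      obtain rfl : d = e := funext fun s => Sum.inr_injective (e3 s)
      exact h4 e1 e2

end Dev

section IsotopyInvariance

open Set

variable {V W : Word Λ}

/-- The component of the target that contains the image of a component. -/
def tgt (f : V.mfd ⟶ W.mfd) (i : V.Pos) : W.Pos := W.comp (f.toFun (V.arc i 0))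

/-- The coordinate of the image of the left end of a component. -/
def start (f : V.mfd ⟶ W.mfd) (i : V.Pos) : ℝ := W.coord (f.toFun (V.arc i 0))

/-- Component and coordinate determine a point, and left ends of distinct components have distinct
images by `eq_of_left`. -/
theorem eq_of_start (f : V.mfd ⟶ W.mfd) {i j : V.Pos} (h : tgt f i = tgt f j)
    (h' : start f i = start f j) : i = j :=
  eq_of_left f (Word.ext_coord h h')

/-- Along an isotopy the image of each left end moves continuously. It stays in one component of the
target, and its coordinate lifts to a continuous real function `G`. -/
theorem Isotopic.exists_dev {f g : V.mfd ⟶ W.mfd} (h : Isotopic f g) :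
    ∃ (σ : unitInterval → (V.mfd ⟶ W.mfd)), σ 0 = f ∧ σ 1 = g ∧ ∀ i, ∃ G : ℝ → ℝ, Continuous G ∧
      (∀ s, tgt (σ s) i = tgt f i) ∧
      ∀ s : unitInterval, start (σ s) i = (W.typ (tgt f i)).read (G s) := by
  obtain ⟨σ, ⟨F, hF, hFσ⟩, rfl, rfl⟩ := h
  let γ : unitInterval → stdSimplex ℝ (Fin 2) := fun s => ⟨![1 - s, s], by
    constructor
    · intro i
      fin_cases i
      · exact sub_nonneg.2 s.2.2
      · exact s.2.1
    · simp⟩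
  have hγ : Continuous fun s => (γ s : Fin 2 → ℝ) := by
    refine continuous_pi fun i => ?_
    fin_cases i
    · exact continuous_const.sub continuous_subtype_val
    · exact continuous_subtype_val
  have h0 : γ 0 = stdSimplex.vertex 0 := by
    refine Subtype.ext (funext fun i => ?_)
    fin_cases i <;> simp [γ]
  have h1 : γ 1 = stdSimplex.vertex 1 := by
    refine Subtype.ext (funext fun i => ?_)
    fin_cases i <;> simp [γ]
  refine ⟨fun s => σ (γ s), congrArg σ h0, congrArg σ h1, fun i => ?_⟩
  have hc : Continuous fun s => (σ (γ s)).toFun (V.arc i 0) := by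
    have := hF.continuousOn.comp_continuous (f := fun s : unitInterval => ((γ s : Fin 2 → ℝ), V.arc i 0))
      (hγ.prodMk continuous_const) (fun s => ⟨(γ s).2, mem_univ _⟩)
    refine this.congr fun s => hFσ (γ s) _
  obtain ⟨k, G, hG, h2, h3, -⟩ := Word.exists_dev hc
  have hk : tgt (σ (stdSimplex.vertex 0)) i = k := by rw [← h0]; exact h2 0
  exact ⟨G, hG, fun s => (h2 s).trans hk.symm, fun s => by rw [hk]; exact h3 s⟩

theorem Isotopic.tgt_eq {f g : V.mfd ⟶ W.mfd} (h : Isotopic f g) (i : V.Pos) : tgt g i = tgt f i := by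
  obtain ⟨σ, -, rfl, hσ⟩ := h.exists_dev
  obtain ⟨-, -, h, -⟩ := hσ i
  exact h 1

/-- Left ends of distinct components do not collide during the isotopy. On an interval this
preserves the order directly. On a circle the differences of lifts of distinct left ends never
become integers, so the cyclic order is preserved as well. -/
theorem Isotopic.srt {f g : V.mfd ⟶ W.mfd} (h : Isotopic f g) {l : List V.Pos} {k : W.Pos}
    (hl : ∀ i ∈ l, tgt f i = k) (hs : Srt (W.typ k) (l.map (start f))) :
    Srt (W.typ k) (l.map (start g)) := by
  obtain ⟨σ, rfl, rfl, hσ⟩ := h.exists_dev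
  choose G hG hk hx using hσ
  have hk' : ∀ i ∈ l, ∀ s, tgt (σ s) i = k := fun i hi s => (hk i s).trans (hl i hi)
  have hx' : ∀ i ∈ l, ∀ s : unitInterval, start (σ s) i = (W.typ k).read (G i s) := fun i hi s => by
    rw [hx, hl i hi]
  have hne : ∀ i ∈ l, ∀ j ∈ l, i ≠ j → ∀ s : unitInterval,
      (W.typ k).read (G i s) ≠ (W.typ k).read (G j s) := fun i hi j hj hij s h =>
    hij (eq_of_start (σ s) ((hk' i hi s).trans (hk' j hj s).symm) (by
      rw [hx' i hi, hx' j hj, h]))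
  generalize W.typ k = t at hs hx' hne
  cases t with
  | seg a b =>
    refine List.pairwise_map.2 ((List.pairwise_map.1 hs).imp_of_mem fun {i j} hi hj h => ?_)
    have h0 := hx' i hi 0
    have h0' := hx' j hj 0
    have h1 := hx' i hi 1
    have h1' := hx' j hj 1
    rw [h0, h0'] at h
    rw [h1, h1']
    exact lt_of_continuous (hG i) (hG j) h (fun s hs => hne i hi j hj (fun e => by
      rw [e] at h; exact lt_irrefl _ h) ⟨s, hs⟩) 1 ⟨zero_le_one, le_rfl⟩
  | circ =>
    rcases l with _ | ⟨a, l⟩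
    · exact ⟨0, List.Pairwise.nil⟩
    rw [srt_circ_cons] at hs ⊢
    have ha : a ∈ a :: l := by simp
    have hfr : ∀ i ∈ a :: l, ∀ s : unitInterval,
        Int.fract (start (σ s) i - start (σ s) a) = Int.fract (G i s - G a s) := fun i hi s => by
      rw [hx' i hi, hx' a ha]
      exact fract_fract_sub _ _
    -- The number of full turns by which the lift of `i` is ahead of that of `a`; it stays constant
    -- along the isotopy.
    let n : V.Pos → ℤ := fun i => ⌊G i 0 - G a 0⌋
    have hint : ∀ i ∈ a :: l, ∀ j ∈ a :: l, i ≠ j → ∀ s ∈ Icc (0 : ℝ) 1, ∀ m : ℤ,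
        G i s - G j s ≠ m := fun i hi j hj hij s hs m e => hne i hi j hj hij ⟨s, hs⟩ (by
      show Int.fract (G i s) = Int.fract (G j s)
      rw [Int.fract_eq_fract]
      exact ⟨m, e⟩)
    -- The cyclic coordinate based at `a` is therefore the continuous function `G i - G a - n i`, to
    -- which `lt_of_continuous` applies.
    have hH : ∀ i ∈ a :: l, ∀ s ∈ Icc (0 : ℝ) 1, Int.fract (G i s - G a s) = G i s - G a s - n i := by
      intro i hi
      by_cases hia : i = a
      · subst hia
        intro s _
        simp [n]
      have h0 : (0 : ℝ) ∈ Icc (0 : ℝ) 1 := ⟨le_rfl, zero_le_one⟩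
      have hc : Continuous fun s => G i s - G a s - n i := ((hG i).sub (hG a)).sub continuous_const
      have a1 := lt_of_continuous continuous_const hc (lt_of_le_of_ne
        (sub_nonneg.2 (Int.floor_le _)) fun e => hint i hi a ha hia 0 h0 (n i)
          (sub_eq_zero.1 e.symm)) fun s hs e => hint i hi a ha hia s hs (n i)
          (sub_eq_zero.1 e.symm)
      have a2 := lt_of_continuous hc (continuous_const (y := (1 : ℝ))) (by
        have := Int.lt_floor_add_one (G i 0 - G a 0)
        show G i 0 - G a 0 - (⌊G i 0 - G a 0⌋ : ℝ) < 1
        linarith) fun s hs e => hint i hi a ha hia s hs (n i + 1) (by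
          push_cast; linarith)
      intro s hs
      exact Int.fract_eq_iff.2 ⟨(a1 s hs).le, a2 s hs, n i, by ring⟩
    refine hs.imp_of_mem fun {i j} hi hj h => ?_
    have e0 : ((0 : unitInterval) : ℝ) = 0 := rfl
    have e1 : ((1 : unitInterval) : ℝ) = 1 := rfl
    rw [hfr i hi, hfr j hj, e0, hH i hi _ ⟨le_rfl, zero_le_one⟩,
      hH j hj _ ⟨le_rfl, zero_le_one⟩] at h
    rw [hfr i hi, hfr j hj, e1, hH i hi _ ⟨zero_le_one, le_rfl⟩, hH j hj _ ⟨zero_le_one, le_rfl⟩]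
    have hij : i ≠ j := fun e => by
      rw [e] at h
      exact lt_irrefl _ h
    exact lt_of_continuous (((hG i).sub (hG a)).sub continuous_const)
      (((hG j).sub (hG a)).sub continuous_const) h (fun s hs e => hint i hi j hj hij s hs
        (n i - n j) (by
          have e : G i s - G a s - n i = G j s - G a s - n j := e
          push_cast; linarith)) 1 ⟨zero_le_one, le_rfl⟩

end IsotopyInvariance

end

/-! ### Isotopy invariance and uniqueness of normal forms -/

section

variable {Λ : Type} {C : Type u} [Category.{v} C] [MonoidalCategory C]

/-- A list of names and coordinates, in terms of the components that have these names and
coordinates. -/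
theorem geo_iff_exists {ι κ α : Type} {r : α → ι} {P : α → κ} {X : α → ℝ} {p : κ × Atom Λ}
    {w : List (ι × Atom Λ)} :
    Geo (fun k t x => ∃ i, r i = k ∧ P i = t ∧ X i = x) p w ↔
      ∃ l : List α, List.Forall₂ (fun e i => r i = e.1 ∧ P i = p.1) w l ∧ Srt p.2 (l.map X) := by
  have key : ∀ (w : List (ι × Atom Λ)) (xs : List ℝ),
      List.Forall₂ (fun e x => ∃ i, r i = e.1 ∧ P i = p.1 ∧ X i = x) w xs ↔
      ∃ l : List α, List.Forall₂ (fun e i => r i = e.1 ∧ P i = p.1) w l ∧ xs = l.map X := by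
    intro w
    induction w with
    | nil =>
      intro xs
      rw [List.forall₂_nil_left_iff]
      constructor
      · rintro rfl
        exact ⟨[], .nil, rfl⟩
      · rintro ⟨l, hl, rfl⟩
        rw [List.forall₂_nil_left_iff] at hl
        rw [hl]; rfl
    | cons e w ih =>
      intro xs
      rw [List.forall₂_cons_left_iff]
      constructor
      · rintro ⟨x, xs', ⟨i, h1, h2, rfl⟩, h, rfl⟩
        obtain ⟨l, hl, rfl⟩ := (ih _).1 h
        exact ⟨i :: l, .cons ⟨h1, h2⟩ hl, rfl⟩
      · rintro ⟨l, hl, rfl⟩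
        obtain ⟨i, l', h, hl', rfl⟩ := List.forall₂_cons_left_iff.1 hl
        exact ⟨_, _, ⟨i, h.1, h.2, rfl⟩, (ih _).2 ⟨l', hl', rfl⟩, rfl⟩
  rw [geo_iff]
  constructor
  · rintro ⟨xs, h, hs⟩
    obtain ⟨l, hl, rfl⟩ := (key _ _).1 h
    exact ⟨l, hl, hs⟩
  · rintro ⟨l, hl, hs⟩
    exact ⟨_, (key _ _).2 ⟨l, hl, rfl⟩, hs⟩

theorem geo_of_exists {ι κ α : Type} {r : α → ι} {X : α → ℝ} {Q : ι → κ → ℝ → Prop}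
    {p : κ × Atom Λ} {w : List (ι × Atom Λ)} {l : List α}
    (h : List.Forall₂ (fun e i => r i = e.1 ∧ Q e.1 p.1 (X i)) w l) (hs : Srt p.2 (l.map X)) :
    Geo Q p w :=
  geo_iff.2 ⟨_, List.forall₂_map_right_iff.2 (h.imp fun _ _ h => h.2), hs⟩

variable [SymmetricCategory C] {D : TrData Λ C} {V W : Word Λ}

theorem forall₂_mem {α β : Type} {S : α → β → Prop} {l : List α} {m : List β}
    (h : List.Forall₂ S l m) : ∀ b ∈ m, ∃ a ∈ l, S a b := by
  induction h with
  | nil => simp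
  | cons h _ ih =>
    intro b hb
    rcases List.mem_cons.1 hb with rfl | hb
    · exact ⟨_, by simp, h⟩
    · obtain ⟨a, ha, h⟩ := ih b hb
      exact ⟨a, by simp [ha], h⟩

/-- Apply the hypothesis with the smallest relation satisfied by `f`, namely that of actual
positions under `f`. The resulting lists are then made of actual components, and `Isotopic.srt`
carries their order over to `g`. -/
theorem N.isotopy {f g : V.mfd ⟶ W.mfd} {φ} (h : N D V W f φ) (hi : Isotopic f g) : N D V W g φ := by
  intro ι κ r r' Q hr' hQ
  obtain ⟨m, Ψ, c, hf, hc, e⟩ := h ι κ r r'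
    (fun k t x => ∃ i, r i = k ∧ r' (tgt f i) = t ∧ start f i = x) hr' fun i => ⟨i, rfl, rfl, rfl⟩
  refine ⟨m, Ψ, c, hf.mono fun p hp w hw hg => ?_, hc, e⟩
  obtain ⟨k, rfl⟩ := Word.mem_enum.1 hp
  obtain ⟨l, hl, hs⟩ := geo_iff_exists.1 hg
  have hk : ∀ i ∈ l, tgt f i = k := fun i hi => by
    obtain ⟨a, -, h⟩ := forall₂_mem hl i hi
    exact hr' h.2
  refine geo_of_exists (r := r) (X := start g) (hl.imp fun a i h => ⟨h.1, ?_⟩) (hi.srt hk hs)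
  have h1 := hQ i
  change Q (r i) (r' (tgt g i)) (start g i) at h1
  rw [hi.tgt_eq i, h.1, h.2] at h1
  exact h1

/-- Name every component by itself and let `Q` record the positions under `f`. Both normal forms
then multiply the same factors into each component of the target, in the same order up to rotation,
so they differ by a canonical isomorphism. By `Can.unique` that isomorphism makes no difference. -/
theorem N.unique (hD : D.IsTr) {f : V.mfd ⟶ W.mfd} {φ ψ} (h : N D V W f φ) (h' : N D V W f ψ) :
    φ = ψ := by
  let Q : V.Pos → W.Pos → ℝ → Prop := fun i t x => tgt f i = t ∧ start f i = x
  have hid : Function.Injective (fun k : W.Pos => k) := fun _ _ h => h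
  obtain ⟨m, Ψ, c, hf, hc, e⟩ := h _ _ (fun i => i) (fun k => k) Q hid fun i => ⟨rfl, rfl⟩
  obtain ⟨m', Ψ', c', hf', hc', e'⟩ := h' _ _ (fun i => i) (fun k => k) Q hid fun i => ⟨rfl, rfl⟩
  have hQ : ∀ (p : W.Pos × Atom Λ) (w : List (V.Pos × Atom Λ)), Geo Q p w →
      (∀ i ∈ w, tgt f i.1 = p.1) ∧ Srt p.2 (w.map fun i => start f i.1) := by
    intro p w hw
    obtain ⟨xs, hxs, hs⟩ := geo_iff.1 hw
    have key : ∀ (w : List (V.Pos × Atom Λ)) (xs : List ℝ),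
        List.Forall₂ (fun i x => Q i.1 p.1 x) w xs → (∀ i ∈ w, tgt f i.1 = p.1) ∧
          xs = w.map fun i => start f i.1 := by
      intro w xs h
      induction h with
      | nil => simp
      | cons h _ ih =>
        refine ⟨fun i hi => ?_, by rw [ih.2, ← h.2]; rfl⟩
        rcases List.mem_cons.1 hi with rfl | hi
        · exact h.1
        · exact ih.1 i hi
    obtain ⟨h1, rfl⟩ := key w xs hxs
    exact ⟨h1, hs⟩
  obtain ⟨d, hd, e2⟩ := Fam.unique (D := D) (G := Geo Q) (G' := Geo Q) (tgt f)
    (fun p w hw => (hQ p w hw).1) (fun p w hw => (hQ p w hw).1) (by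
      intro p w w' φ φ' hw hw' hp hφ hφ'
      have h1 := (hQ p w hw).2
      have h2 := (hQ p w' hw').2
      rcases p with ⟨k, ⟨a, b⟩ | _⟩
      -- On an interval both lists are strictly increasing and permutations of each other, hence
      -- equal.
      · obtain rfl : w = w' := List.Perm.eq_of_pairwise (fun i j _ _ h h' => absurd h (lt_asymm h'))
          (List.pairwise_map.1 h1) (List.pairwise_map.1 h2) hp
        exact ⟨_, Can.refl _, by rw [hφ.unique hφ', Category.id_comp]⟩
      · rcases w with _ | ⟨i, w⟩
        · exact absurd rfl hφ.ne_nil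
        rw [srt_circ_cons] at h1
        -- On a circle the second list is rotated so that it starts with the head `i` of the first.
        -- With `i` as base point both are strictly increasing, hence equal, and `Chain.rotate`
        -- compares the products.
        obtain ⟨l1, l2, rfl⟩ := List.append_of_mem (hp.subset (List.mem_cons_self ..))
        obtain ⟨y, h2⟩ := h2
        rw [List.pairwise_map] at h2
        have h3 := pairwise_rotate (X := fun i : V.Pos × Atom Λ => start f i.1) h2
        have e : i :: w = (i :: l2) ++ l1 := List.Perm.eq_of_pairwise
          (fun i j _ _ h h' => absurd h (lt_asymm h')) h1 h3 (hp.trans List.perm_append_comm)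
        rcases eq_or_ne l1 [] with rfl | hl1
        · rw [List.append_nil] at e
          cases e
          exact ⟨_, Can.refl _, by rw [hφ.unique hφ', Category.id_comp]⟩
        · obtain ⟨d, ψ, hd, hψ, rfl⟩ := hφ'.rotate hD hl1 (List.cons_ne_nil _ _)
          obtain rfl : w = l2 ++ l1 := (List.cons.inj e).2
          obtain ⟨d', hd', h4, h5⟩ := hd.symm
          exact ⟨d', hd', by rw [reassoc_of% h5]; exact hφ.unique hψ⟩)
    (Word.enum_nodup hid) hf hf' (hc.symm.choose_spec.1.perm.trans hc'.perm)
  -- The names are the components themselves, so there are no repetitions and coherence applies.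
  have hn : (V.enum fun i => i).Nodup :=
    List.Nodup.of_map _ (Word.enum_nodup (W := V) (r := fun i => i) fun _ _ h => h)
  have e3 := (hc.trans hd).unique hn hc'
  rw [← cancel_mono (D.flat W fun k => k).hom, e, e', e2, ← e3]
  simp only [Category.assoc]

end

section

variable {Λ : Type} {U V W : Word Λ}

/-! ### Orders and normal forms under composition -/

section Composition

open Set
open scoped Manifold ContDiff

theorem Word.coord_arc {W : Word Λ} (i : W.Pos) (s : unitInterval) :
    W.coord (W.arc i s) = (W.typ i).read s := by
  induction W with
  | unit => exact Empty.elim i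
  | atom t =>
    cases t with
    | seg a b => rfl
    | circ => exact Word.coord_circ (s : ℝ)
  | tensor V W hV hW =>
    rcases i with i | i
    · exact hV i
    · exact hW i

theorem exists_lifts (g : V.mfd ⟶ W.mfd) : ∃ G : V.Pos → ℝ → ℝ, ∀ q, Continuous (G q) ∧
    StrictMonoOn (G q) (Icc 0 1) ∧ (∀ s, W.comp (g.toFun (V.arc q s)) = tgt g q) ∧
    ∀ s : unitInterval, W.coord (g.toFun (V.arc q s)) = (W.typ (tgt g q)).read (G q s) := by
  have h : ∀ q, ∃ G : ℝ → ℝ, Continuous G ∧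
    StrictMonoOn G (Icc 0 1) ∧ (∀ s, W.comp (g.toFun (V.arc q s)) = tgt g q) ∧
    ∀ s : unitInterval, W.coord (g.toFun (V.arc q s)) = (W.typ (tgt g q)).read (G s) := by
    intro q
    obtain ⟨k, G, h1, h2, h3, h4⟩ := Word.exists_dev (contMDiff_comp_arc g q).continuous
    obtain rfl : tgt g q = k := h2 0
    exact ⟨G, h1, h4 (contMDiff_comp_arc g q) (slope_comp_arc g q), h2, h3⟩
  choose G hG using h
  exact ⟨G, hG⟩

/-- The image of a left end is not the right end of an interval, by `boundary_no_cross`; on a circle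
the parameter `1` can be replaced by `0`. With `s < 1` the coordinate equals the parameter for both
types of components. -/
theorem exists_start (f : U.mfd ⟶ V.mfd) (i : U.Pos) : ∃ s : unitInterval, (s : ℝ) < 1 ∧
    f.toFun (U.arc i 0) = V.arc (tgt f i) s ∧ start f i = s := by
  obtain ⟨s, hs⟩ := Word.exists_arc (f.toFun (U.arc i 0))
  change V.arc (tgt f i) s = _ at hs
  have hst : start f i = (V.typ (tgt f i)).read s := by
    rw [← Word.coord_arc, hs]; rfl
  by_cases h1 : s = 1
  · subst h1
    cases ht : V.typ (tgt f i) with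
    | seg a b =>
      have hb : f.toFun (U.arc i 0) ∉ J.boundary V.mfd.carrier :=
        boundary_no_cross (c := f.toFun ∘ U.arc i) (c' := V.arc (tgt f i)) V.mfd.oriented
          (contMDiff_comp_arc f i) (slope_comp_arc f i) (Word.contMDiff_arc _) (Word.slope_arc _)
          hs.symm
      rw [← hs] at hb
      exact absurd (Word.arc_mem_boundary.2 ⟨⟨a, b, ht⟩, Or.inr rfl⟩) hb
    | circ =>
      rw [ht] at hst
      have h0 : start f i = 0 := hst.trans (by
        exact Int.fract_one)
      refine ⟨0, zero_lt_one, Word.ext_coord ?_ ?_, h0⟩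
      · rw [Word.comp_arc]; rfl
      · refine h0.trans ?_
        rw [Word.coord_arc, ht]
        exact Int.fract_zero.symm
  · have h2 : (s : ℝ) < 1 := lt_of_le_of_ne s.2.2 fun h => h1 (Subtype.ext h)
    refine ⟨s, h2, hs.symm, hst.trans ?_⟩
    cases V.typ (tgt f i) with
    | seg a b => rfl
    | circ => exact Int.fract_eq_self.2 ⟨s.2.1, h2⟩

/-- Points inside an interval component are not boundary points, so no left end is identified with
them. -/
theorem not_hit (g : V.mfd ⟶ W.mfd) {q q' : V.Pos} {a b : Λ} (hq : V.typ q = .seg a b)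
    {s : unitInterval} (h0 : s ≠ 0) (h1 : s ≠ 1) : g.toFun (V.arc q s) ≠ g.toFun (V.arc q' 0) := by
  intro h
  by_cases he : V.arc q s = V.arc q' 0
  · have h2 := congrArg V.comp he
    rw [Word.comp_arc, Word.comp_arc] at h2
    subst h2
    exact h0 (Word.arc_injective hq he)
  · obtain ⟨-, hx, -⟩ := g.glue _ _ h he
    rcases (Word.arc_mem_boundary.1 hx).2 with h | h
    · exact h0 h
    · exact h1 h

variable {g : V.mfd ⟶ W.mfd} {G : V.Pos → ℝ → ℝ} (hG : ∀ q, Continuous (G q) ∧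
    StrictMonoOn (G q) (Icc 0 1) ∧ (∀ s, W.comp (g.toFun (V.arc q s)) = tgt g q) ∧
    ∀ s : unitInterval, W.coord (g.toFun (V.arc q s)) = (W.typ (tgt g q)).read (G q s))
include hG

theorem tgt_comp (f : U.mfd ⟶ V.mfd) (i : U.Pos) : tgt (f ≫ g) i = tgt g (tgt f i) := by
  obtain ⟨s, -, h, -⟩ := exists_start f i
  show W.comp (g.toFun (f.toFun (U.arc i 0))) = _
  rw [h, (hG _).2.2.1]

theorem start_comp (f : U.mfd ⟶ V.mfd) (i : U.Pos) :
    start (f ≫ g) i = (W.typ (tgt g (tgt f i))).read (G (tgt f i) (start f i)) := by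
  obtain ⟨s, -, h, h'⟩ := exists_start f i
  show W.coord (g.toFun (f.toFun (U.arc i 0))) = _
  rw [h, (hG _).2.2.2, h']

theorem start_eq (q : V.Pos) : start g q = (W.typ (tgt g q)).read (G q 0) := (hG q).2.2.2 0

theorem exists_eq_of_mem (q : V.Pos) {x : ℝ} (hx : x ∈ Ioo (G q 0) (G q 1)) :
    ∃ s : unitInterval, s ≠ 0 ∧ s ≠ 1 ∧ G q s = x := by
  obtain ⟨s, hs, e⟩ := intermediate_value_Icc zero_le_one ((hG q).1.continuousOn (s := Icc 0 1))
    ⟨hx.1.le, hx.2.le⟩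
  refine ⟨⟨s, hs⟩, ?_, ?_, e⟩
  · rintro h
    rw [← e, show s = 0 from congrArg Subtype.val h] at hx
    exact lt_irrefl _ hx.1
  · rintro h
    rw [← e, show s = 1 from congrArg Subtype.val h] at hx
    exact lt_irrefl _ hx.2

theorem read_ne_start {q q' : V.Pos} {a b : Λ} (hq : V.typ q = .seg a b) (h : tgt g q' = tgt g q)
    {x : ℝ} (hx : x ∈ Ioo (G q 0) (G q 1)) : (W.typ (tgt g q)).read x ≠ start g q' := by
  intro e
  obtain ⟨s, h0, h1, rfl⟩ := exists_eq_of_mem hG q hx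
  refine not_hit g hq h0 h1 (Word.ext_coord (y := g.toFun (V.arc q' 0)) ?_ ?_)
  · rw [(hG q).2.2.1]; exact h.symm
  · rw [(hG q).2.2.2]; exact e

omit hG in
theorem start_mem (f : U.mfd ⟶ V.mfd) (i : U.Pos) : start f i ∈ Ico (0 : ℝ) 1 := by
  obtain ⟨s, h1, -, h⟩ := exists_start f i
  rw [h]
  exact ⟨s.2.1, h1⟩

/-- Otherwise the left end of `q'` would lie strictly inside the image of `q`, against
`read_ne_start`. -/
theorem le_of_start_lt {q q' : V.Pos} {a b a' b' : Λ} (hq : V.typ q = .seg a b)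
    (h : tgt g q' = tgt g q) (ht : W.typ (tgt g q) = .seg a' b') (hs : start g q < start g q') :
    G q 1 ≤ G q' 0 := by
  by_contra hn
  have e1 := start_eq hG q
  have e2 := start_eq hG q'
  have h' := read_ne_start hG hq h (x := G q' 0)
  rw [h] at e2
  rw [ht] at e1 e2 h'
  rw [e1, e2] at hs
  exact h' ⟨hs, not_le.1 hn⟩ e2.symm

/-- Reduction modulo `1`: the lift of the left end of `q`, moved back by its distance from `z` along
the circle, is a lift of `z`. -/
theorem fract_start_sub {q : V.Pos} (ht : W.typ (tgt g q) = .circ) (x z : ℝ) :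
    Int.fract (G q 0 + x - Int.fract (start g q - z)) = Int.fract (z + x) := by
  have e1 := start_eq hG q
  rw [ht] at e1
  have e1 : start g q = Int.fract (G q 0) := e1
  rw [Int.fract_eq_fract]
  refine ⟨⌊G q 0⌋ + ⌊start g q - z⌋, ?_⟩
  rw [← Int.self_sub_floor, e1, ← Int.self_sub_floor]
  push_cast
  ring

/-- The cyclic counterpart of `le_of_start_lt`. The number `u` is the distance from the base point
`z` to the left end of `q'`; if `q` starts before reaching it, `q` also ends before it. -/
theorem length_le {q q' : V.Pos} {a b : Λ} (hq : V.typ q = .seg a b)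
    (h : tgt g q' = tgt g q) (ht : W.typ (tgt g q) = .circ) {z u : ℝ}
    (hu : Int.fract (z + u) = start g q') (hz : Int.fract (start g q - z) < u) :
    Int.fract (start g q - z) + (G q 1 - G q 0) ≤ u := by
  by_contra hn
  have h' := read_ne_start hG hq h (x := G q 0 + u - Int.fract (start g q - z))
    ⟨by linarith, by linarith⟩
  rw [ht] at h'
  exact h' ((fract_start_sub hG ht _ _).trans hu)

theorem fract_start {q : V.Pos} (ht : W.typ (tgt g q) = .circ) : Int.fract (start g q) = start g q := by
  have e1 := start_eq hG q
  rw [ht] at e1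
  rw [e1]
  exact Int.fract_fract _

/-- The lift over a circle component increases by a positive integer. If this were at least `2`, the
image would return to its starting point at an interior parameter, and two distinct points of a
circle would be identified. -/
theorem circ_length {q : V.Pos} (hq : V.typ q = .circ) (ht : W.typ (tgt g q) = .circ) :
    G q 1 = G q 0 + 1 := by
  obtain ⟨-, hm, hc, hx⟩ := hG q
  have e : V.arc q 1 = V.arc q 0 := Word.ext_coord (by rw [Word.comp_arc, Word.comp_arc]) (by
    rw [Word.coord_arc, Word.coord_arc, hq]
    show Int.fract (1 : ℝ) = Int.fract (0 : ℝ)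
    rw [Int.fract_one, Int.fract_zero])
  have h1 := (hx 1).symm.trans ((congrArg (fun x => W.coord (g.toFun x)) e).trans (hx 0))
  rw [ht] at h1
  obtain ⟨n, hn⟩ := Int.fract_eq_fract.1 (show Int.fract (G q 1) = Int.fract (G q 0) from h1)
  have h2 : G q 0 < G q 1 := hm ⟨le_rfl, zero_le_one⟩ ⟨zero_le_one, le_rfl⟩ zero_lt_one
  have h3 : 0 < n := by
    have : (0 : ℝ) < n := by linarith
    exact_mod_cast this
  rcases eq_or_lt_of_le (show 1 ≤ n from h3) with h4 | h4
  · rw [← h4] at hn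
    push_cast at hn
    linarith
  have h5 : (2 : ℝ) ≤ n := by exact_mod_cast h4
  obtain ⟨s, s0, s1, hs⟩ := exists_eq_of_mem hG q (x := G q 0 + 1) ⟨by linarith, by linarith⟩
  have h6 : g.toFun (V.arc q s) = g.toFun (V.arc q 0) := Word.ext_coord ((hc s).trans (hc 0).symm) (by
    rw [hx, hx, hs, ht]
    exact Int.fract_add_one _)
  have h7 : V.arc q s ≠ V.arc q 0 := by
    intro h
    have h8 := congrArg V.coord h
    rw [Word.coord_arc, Word.coord_arc, hq] at h8
    have h8 : Int.fract (s : ℝ) = Int.fract (0 : ℝ) := h8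
    rw [Int.fract_zero, Int.fract_eq_self.2 ⟨s.2.1, lt_of_le_of_ne s.2.2 fun h =>
      s1 (Subtype.ext h)⟩] at h8
    exact s0 (Subtype.ext h8)
  obtain ⟨-, hb, -⟩ := g.glue _ _ h6 h7
  obtain ⟨⟨a, b, h8⟩, -⟩ := Word.arc_mem_boundary.1 hb
  rw [hq] at h8
  cases h8

/-- Measured from the left end of some `q'`, the position of `i` is that of the interval containing
it plus the length travelled along this interval. There is no reduction modulo `1` because the
interval ends before the base point is reached again. -/
theorem fract_start_comp (f : U.mfd ⟶ V.mfd) {i : U.Pos} {a b : Λ} (hq : V.typ (tgt f i) = .seg a b)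
    (ht : W.typ (tgt g (tgt f i)) = .circ) {q' : V.Pos} (h : tgt g q' = tgt g (tgt f i)) :
    Int.fract (start (f ≫ g) i - start g q') = Int.fract (start g (tgt f i) - start g q') +
      (G (tgt f i) (start f i) - G (tgt f i) 0) := by
  -- A full turn leads back to the left end of `q'`.
  have h1 := length_le hG hq h ht (z := start g q') (u := 1) (by
    rw [Int.fract_add_one]
    exact fract_start hG (h.symm ▸ ht)) (Int.fract_lt_one _)
  have h2 := start_mem f i
  have h3 := (hG (tgt f i)).2.1.monotoneOn (left_mem_Icc.2 zero_le_one) ⟨h2.1, h2.2.le⟩ h2.1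
  have h4 := (hG (tgt f i)).2.1 ⟨h2.1, h2.2.le⟩ (right_mem_Icc.2 zero_le_one) h2.2
  have h5 := start_comp hG f i
  have h6 := start_eq hG (tgt f i)
  rw [ht] at h5 h6
  have h5 : start (f ≫ g) i = Int.fract (G (tgt f i) (start f i)) := h5
  have h6 : start g (tgt f i) = Int.fract (G (tgt f i) 0) := h6
  have h7 := Int.fract_nonneg (start g (tgt f i) - start g q')
  refine Int.fract_eq_iff.2 ⟨by linarith, by linarith,
    ⌊G (tgt f i) 0⌋ + ⌊start g (tgt f i) - start g q'⌋ - ⌊G (tgt f i) (start f i)⌋, ?_⟩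
  rw [h5, ← Int.self_sub_floor (start g (tgt f i) - start g q'), ← Int.self_sub_floor, h6,
    ← Int.self_sub_floor (G (tgt f i) 0)]
  push_cast
  ring

omit hG in
theorem pairwise_forall₂ {α β : Type} {S : α → α → Prop} {S' : β → β → Prop} {T : α → β → Prop}
    {l : List α} {m : List β} (hl : l.Pairwise S) (h : List.Forall₂ T l m)
    (hT : ∀ a ∈ l, ∀ a' ∈ l, ∀ b b', S a a' → T a b → T a' b' → S' b b') : m.Pairwise S' := by
  induction h with
  | nil => exact .nil
  | @cons a b l m hab h ih =>
    rw [List.pairwise_cons] at hl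
    refine List.pairwise_cons.2 ⟨fun b' hb' => ?_, ih hl.2 fun a ha a' ha' =>
      hT a (List.mem_cons_of_mem _ ha) a' (List.mem_cons_of_mem _ ha')⟩
    obtain ⟨a', ha', h'⟩ := forall₂_mem h b' hb'
    exact hT _ (by simp) _ (by simp [ha']) _ _ (hl.1 a' ha') hab h'

/-- Inside one component of `V` the lift of `g` is increasing and preserves order. Different
components of `V` occupy consecutive stretches of the target. So listing the components of `U` block
by block gives their order under the composite. -/
theorem srt_flatten (f : U.mfd ⟶ V.mfd) {k : W.Pos} {l : List V.Pos} {ls : List (List U.Pos)}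
    (hk : ∀ q ∈ l, tgt g q = k) (hs : Srt (W.typ k) (l.map (start g)))
    (hls : List.Forall₂ (fun q li => (∀ i ∈ li, tgt f i = q) ∧ Srt (V.typ q) (li.map (start f))) l ls)
    (htyp : (W.typ k = .circ ∧ ∃ q, l = [q] ∧ V.typ q = .circ) ∨ ∀ q ∈ l, ∃ a b, V.typ q = .seg a b) :
    Srt (W.typ k) (ls.flatten.map (start (f ≫ g))) := by
  have hmono : ∀ (i j : U.Pos), tgt f i = tgt f j → start f i < start f j →
      G (tgt f i) (start f i) < G (tgt f i) (start f j) := fun i j _ h =>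
    (hG _).2.1 (Ico_subset_Icc_self (start_mem f i)) (Ico_subset_Icc_self (start_mem f j)) h
  have hlow : ∀ i, G (tgt f i) 0 ≤ G (tgt f i) (start f i) := fun i =>
    (hG _).2.1.monotoneOn (left_mem_Icc.2 zero_le_one) (Ico_subset_Icc_self (start_mem f i))
      (start_mem f i).1
  have hhigh : ∀ i, G (tgt f i) (start f i) < G (tgt f i) 1 := fun i =>
    (hG _).2.1 (Ico_subset_Icc_self (start_mem f i)) (right_mem_Icc.2 zero_le_one) (start_mem f i).2
  rcases htyp with ⟨hc, q, rfl, hq⟩ | hseg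
  · rw [hc]
    obtain ⟨li, _, ⟨h1, h2⟩, h3, rfl⟩ := List.forall₂_cons_left_iff.1 hls
    obtain rfl := List.forall₂_nil_left_iff.1 h3
    rw [List.flatten_cons, List.flatten_nil, List.append_nil]
    rcases li with _ | ⟨a, li⟩
    · exact ⟨0, .nil⟩
    rw [hq, srt_circ_cons] at h2
    rw [srt_circ_cons]
    obtain rfl := hk q (by simp)
    -- A circle maps once around a circle. Since the lift has length one, `key` and `key'` express
    -- the cyclic coordinates before and after by the same case distinction.
    have hlen := circ_length hG hq hc
    have key : ∀ i ∈ a :: li, Int.fract (start (f ≫ g) i - start (f ≫ g) a) =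
        if start f a ≤ start f i then G q (start f i) - G q (start f a)
        else G q (start f i) - G q (start f a) + 1 := by
      have e : ∀ i ∈ a :: li, start (f ≫ g) i = Int.fract (G q (start f i)) ∧
          Int.fract (G q (start f i) - G q 0) = G q (start f i) - G q 0 := by
        intro i hi
        have h3 := start_comp hG f i
        have h4 := hlow i
        have h5 := hhigh i
        rw [h1 i hi, hc] at h3
        rw [h1 i hi] at h4 h5
        exact ⟨h3, Int.fract_eq_self.2 ⟨by linarith, by linarith⟩⟩
      intro i hi
      rw [(e i hi).1, (e a (by simp)).1, fract_fract_sub, fract_sub _ (G q 0), (e i hi).2,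
        (e a (by simp)).2]
      have : G q (start f a) - G q 0 ≤ G q (start f i) - G q 0 ↔ start f a ≤ start f i := by
        rw [sub_le_sub_iff_right]
        exact (hG q).2.1.le_iff_le (Ico_subset_Icc_self (start_mem f a))
          (Ico_subset_Icc_self (start_mem f i))
      simp only [this]
      split_ifs <;> ring
    have key' : ∀ i ∈ a :: li, Int.fract (start f i - start f a) =
        if start f a ≤ start f i then start f i - start f a else start f i - start f a + 1 := by
      intro i hi
      have h3 := start_mem f i
      have h4 := start_mem f a
      split_ifs with h
      · exact Int.fract_eq_self.2 ⟨by linarith, by linarith [h3.2, h4.1]⟩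
      · push Not at h
        refine Int.fract_eq_iff.2 ⟨by linarith [h3.1, h4.2], by linarith, -1, by push_cast; ring⟩
    refine h2.imp_of_mem fun {i j} hi hj h => ?_
    rw [key i hi, key j hj]
    rw [key' i hi, key' j hj] at h
    have hm := (hG q).2.1
    have mi := Ico_subset_Icc_self (start_mem f i)
    have mj := Ico_subset_Icc_self (start_mem f j)
    have ma := Ico_subset_Icc_self (start_mem f a)
    have bi := hhigh i
    have bj := hlow j
    rw [h1 i hi] at bi
    rw [h1 j hj] at bj
    split_ifs at h ⊢ with c1 c2 c2
    · have := hm mi mj (by linarith)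
      linarith
    · linarith
    · exfalso
      linarith [(start_mem f j).2, (start_mem f i).1]
    · have := hm mi mj (by linarith)
      linarith
  · cases ht : W.typ k with
    | seg a' b' =>
      rw [ht] at hs
      show List.Pairwise _ (List.map _ _)
      rw [List.pairwise_map, List.pairwise_flatten]
      have hst : ∀ i, tgt f i ∈ l → start (f ≫ g) i = G (tgt f i) (start f i) := fun i hi => by
        rw [start_comp hG, hk _ hi, ht]; rfl
      constructor
      · intro li hli
        obtain ⟨q, hq, h1, h2⟩ := forall₂_mem hls li hli
        obtain ⟨a, b, hab⟩ := hseg q hq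
        rw [hab] at h2
        refine (List.pairwise_map.1 h2).imp_of_mem fun {i j} hi hj h => ?_
        have hi' := h1 i hi
        have hj' := h1 j hj
        rw [hst i (hi'.symm ▸ hq), hst j (hj'.symm ▸ hq), hj', ← hi']
        exact hmono i j (hi'.trans hj'.symm) h
      · refine pairwise_forall₂ (List.pairwise_map.1 hs) hls
          fun q hq q' hq' li li' h h1 h2 i hi j hj => ?_
        obtain rfl := h1.1 i hi
        obtain rfl := h2.1 j hj
        rw [hst i hq, hst j hq']
        obtain ⟨a, b, hab⟩ := hseg _ hq
        have hkk := hk _ hq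
        have := le_of_start_lt hG hab ((hk _ hq').trans hkk.symm) (by rw [hkk, ht]) h
        linarith [hhigh i, hlow j]
    | circ =>
      rcases l with _ | ⟨c, l⟩
      · obtain rfl := List.forall₂_nil_left_iff.1 hls
        exact ⟨0, .nil⟩
      rw [ht, srt_circ_cons] at hs
      -- All positions are measured from the left end of the first interval `c`, so that no interval
      -- passes the base point.
      have hst : ∀ i, tgt f i ∈ c :: l → Int.fract (start (f ≫ g) i - start g c) =
          Int.fract (start g (tgt f i) - start g c) +
            (G (tgt f i) (start f i) - G (tgt f i) 0) := fun i hi => by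
        obtain ⟨a, b, hab⟩ := hseg _ hi
        exact fract_start_comp hG f hab (by rw [hk _ hi, ht]) ((hk c (by simp)).trans (hk _ hi).symm)
      refine ⟨start g c, ?_⟩
      rw [List.pairwise_map, List.pairwise_flatten]
      constructor
      · intro li hli
        obtain ⟨q, hq, h1, h2⟩ := forall₂_mem hls li hli
        obtain ⟨a, b, hab⟩ := hseg q hq
        rw [hab] at h2
        refine (List.pairwise_map.1 h2).imp_of_mem fun {i j} hi hj h => ?_
        have hi' := h1 i hi
        have hj' := h1 j hj
        have := hmono i j (hi'.trans hj'.symm) h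
        rw [hst i (hi'.symm ▸ hq), hst j (hj'.symm ▸ hq), hj', ← hi']
        linarith
      · refine pairwise_forall₂ hs hls fun q hq q' hq' li li' h h1 h2 i hi j hj => ?_
        obtain rfl := h1.1 i hi
        obtain rfl := h2.1 j hj
        rw [hst i hq, hst j hq']
        obtain ⟨a, b, hab⟩ := hseg _ hq
        have hkk := hk _ hq
        have hkk' := hk _ hq'
        have := length_le hG hab (hkk'.trans hkk.symm) (by rw [hkk, ht]) (z := start g c)
          (u := Int.fract (start g (tgt f j) - start g c)) (by
            conv_rhs => rw [← fract_start hG (q := tgt f j) (by rw [hkk', ht])]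
            rw [Int.fract_eq_fract]
            refine ⟨-⌊start g (tgt f j) - start g c⌋, ?_⟩
            rw [← Int.self_sub_floor]
            push_cast
            ring) h
        linarith [hhigh i, hlow j]

end Composition

end

section

variable {Λ : Type} {C : Type u} [Category.{v} C] [MonoidalCategory C] {D : TrData Λ C}
  {U V W : Word Λ}

/-- It recovers actual components of `U` from the names in a family, one list for each factor, so
that `srt_flatten` can be applied. -/
theorem Fam.exists_lists {ι : Type} {f : U.mfd ⟶ V.mfd} {r : U.Pos → ι}
    {w : List (V.Pos × Atom Λ)} {n : List (ι × Atom Λ)} {Φ}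
    (h : Fam D (Geo fun k t x => ∃ i, r i = k ∧ tgt f i = t ∧ start f i = x) w n Φ) :
    ∃ ls : List (List U.Pos), List.Forall₂ (fun e li => (∀ i ∈ li, tgt f i = e.1) ∧
      Srt e.2 (li.map (start f))) w ls ∧ List.Forall₂ (fun e i => r i = e.1) n ls.flatten := by
  induction h with
  | nil => exact ⟨[], .nil, .nil⟩
  | cons p hc hg h ih =>
    obtain ⟨ls, h1, h2⟩ := ih
    obtain ⟨l, hl, hs⟩ := geo_iff_exists.1 hg
    refine ⟨l :: ls, .cons ⟨fun i hi => ?_, hs⟩ h1, ?_⟩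
    · obtain ⟨a, -, h⟩ := forall₂_mem hl i hi
      exact h.2
    · rw [List.flatten_cons]
      exact List.rel_append (hl.imp fun _ _ h => h.1) h2

variable [SymmetricCategory C]

/-- The normal form of `φ` is rearranged so that its targets appear in the order in which the normal
form of `ψ` multiplies them. Products of products are products by `Fam.comp`, and the order of the
factors is right by `srt_flatten`. -/
theorem N.comp (hD : D.IsTr) {f : U.mfd ⟶ V.mfd} {g : V.mfd ⟶ W.mfd} {φ ψ} (h : N D U V f φ)
    (h' : N D V W g ψ) : N D U W (f ≫ g) (φ ≫ ψ) := by
  intro ι κ r r' Q hr' hQ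
  obtain ⟨G, hG⟩ := exists_lifts g
  -- The intermediate components are named by themselves, so their names determine them.
  obtain ⟨m, Ψ, c, hf, hc, e⟩ := h ι V.Pos r (fun i => i)
    (fun k t x => ∃ i, r i = k ∧ tgt f i = t ∧ start f i = x) (fun _ _ h => h)
    fun i => ⟨i, rfl, rfl, rfl⟩
  obtain ⟨m', Ψ', c', hf', hc', e'⟩ := h' V.Pos κ (fun i => i) r'
    (fun k t x => ∃ i, i = k ∧ r' (tgt g i) = t ∧ start g i = x) hr' fun i => ⟨i, rfl, rfl, rfl⟩
  obtain ⟨n, d, Θ, hf2, hd, e2⟩ := hf.can hc'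
  obtain ⟨n', d', Θ', hf3, hd', e3⟩ := hf'.comp (G'' := Geo Q) hD (by
    intro p hp w n χ Φ hw hχ hg hΦ
    obtain ⟨k, rfl⟩ := Word.mem_enum.1 hp
    obtain ⟨l, hl, hs⟩ := geo_iff_exists.1 hg
    obtain ⟨ls, h1, h2⟩ := hΦ.exists_lists
    have htyp : ∀ e ∈ w, e.2 = V.typ e.1 := by
      intro e he
      obtain ⟨i, hi⟩ := Word.mem_enum.1 (hc'.perm.symm.subset (hw he))
      rw [hi]
    obtain rfl : l = w.map Prod.fst := by
      have : ∀ (w : List (V.Pos × Atom Λ)) (l : List V.Pos), List.Forall₂ (fun e i => i = e.1 ∧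
          r' (tgt g i) = r' k) w l → l = w.map Prod.fst := by
        intro w l h
        induction h with
        | nil => rfl
        | cons h _ ih => rw [ih, h.1]; rfl
      exact this w l hl
    have hk : ∀ q ∈ w.map Prod.fst, tgt g q = k := fun q hq => by
      obtain ⟨a, -, h⟩ := forall₂_mem hl q hq
      exact hr' h.2
    have hls : List.Forall₂ (fun q li => (∀ i ∈ li, tgt f i = q) ∧ Srt (V.typ q) (li.map (start f)))
        (w.map Prod.fst) ls := by
      rw [List.forall₂_map_left_iff]
      refine ((List.forall₂_and_left _ _).2 ⟨htyp, h1⟩).imp fun e li h => ⟨h.2.1, ?_⟩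
      rw [← h.1]
      exact h.2.2
    have hsrt := srt_flatten hG f hk hs hls (by
      rcases hχ.all_seg with ⟨h, i, rfl⟩ | h
      · exact Or.inl ⟨h, i, rfl, (htyp (i, .circ) (by simp)).symm⟩
      · right
        intro q hq
        obtain ⟨e, he, rfl⟩ := List.mem_map.1 hq
        have := h e he
        rw [htyp e he] at this
        cases ht : V.typ e.1 with
        | seg a b => exact ⟨a, b, rfl⟩
        | circ => exact absurd ht this)
    have hmem : ∀ i ∈ ls.flatten, tgt (f ≫ g) i = k := by
      intro i hi
      obtain ⟨li, hli, hi⟩ := List.mem_flatten.1 hi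
      obtain ⟨q, hq, h, -⟩ := forall₂_mem hls li hli
      rw [tgt_comp hG, h i hi, hk q hq]
    have hmem' : List.Forall₂ (fun e i => i ∈ ls.flatten ∧ r i = e.1) n ls.flatten := by
      have : ∀ (n : List (ι × Atom Λ)) (l : List U.Pos), List.Forall₂ (fun e i => r i = e.1) n l →
          List.Forall₂ (fun e i => i ∈ l ∧ r i = e.1) n l := by
        intro n l h
        induction h with
        | nil => exact .nil
        | cons h _ ih => exact .cons ⟨by simp, h⟩ (ih.imp fun _ _ h => ⟨by simp [h.1], h.2⟩)
      exact this _ _ h2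
    refine geo_of_exists (r := r) (X := start (f ≫ g)) (hmem'.imp fun a i h => ⟨h.2, ?_⟩) hsrt
    have h4 := hQ i
    change Q (r i) (r' (tgt (f ≫ g) i)) (start (f ≫ g) i) at h4
    rwa [hmem i h.1, h.2] at h4) hf2
  refine ⟨n', Θ', _, hf3, (hc.trans hd).trans hd', ?_⟩
  rw [Category.assoc, e', reassoc_of% e, reassoc_of% e2, e3]
  simp only [Category.assoc]

/-- Composition and isotopy are the cases with geometric content. -/
theorem R.normal (hD : D.IsTr) {f : V.mfd ⟶ W.mfd} {φ} (h : R D V W f φ) : N D V W f φ := by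
  induction h with
  | id V => exact N.id V
  | comp _ _ h h' => exact h.comp hD h'
  | tensor _ _ h h' => exact h.tensor h'
  | assoc U V W => exact N.assoc U V W
  | runit V => exact N.runit V
  | runitInv V => exact N.runitInv V
  | braid V W => exact N.braid V W
  | glue a b c => exact N.glue a b c
  | close a => exact N.close a
  | isotopy _ h ih => exact ih.isotopy h

/-- The relation between morphisms of cobordisms and morphisms of `C` is a function. -/
theorem R.unique (hD : D.IsTr) {f : V.mfd ⟶ W.mfd} {φ ψ} (h : R D V W f φ) (h' : R D V W f ψ) :
    φ = ψ :=
  (h.normal hD).unique hD (h'.normal hD)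

end

section

variable {Λ : Type}

/-! ### The extension of data to a symmetric monoidal functor -/

section Presentation

/-- Cut `S` into intervals; by `exists_gen_comp` the cutting is, up to isotopy, a composite of
gluings followed by a diffeomorphism `e`, whose source is described by a word. -/
theorem exists_presentation [Nonempty Λ] (S : Mfd Λ) :
    ∃ V : Word Λ, Nonempty (V.mfd ≅ S) := by
  obtain ⟨W, -, ⟨f⟩⟩ := exists_cutting S (Classical.arbitrary Λ)
  -- The tautological data, which serve only to state generation.
  let D : TrData Λ (Mfd Λ) := { obj := Atom.mfd, mul := Mfd.glue, tr := Mfd.close }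
  obtain ⟨V, g, e, -, he, -⟩ := exists_gen_comp D f
  exact ⟨V, ⟨asIso e⟩⟩

variable [Nonempty Λ]

/-- A word describing a given manifold up to diffeomorphism. -/
def Mfd.word (S : Mfd Λ) : Word Λ := (exists_presentation S).choose

/-- A diffeomorphism with the manifold described by a word. -/
def Mfd.presentation (S : Mfd Λ) : S.word.mfd ≅ S := (exists_presentation S).choose_spec.some

end Presentation

variable {C : Type u} [Category.{v} C] [MonoidalCategory C] [SymmetricCategory C]

section Extension

variable (D : TrData Λ C)

/-- The value of the extension of `D` on a morphism between manifolds described by words. -/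
def TrData.map (V W : Word Λ) (f : V.mfd ⟶ W.mfd) : D.ev V ⟶ D.ev W := (Gen.total D f).choose

variable {D}

theorem R.map {V W : Word Λ} (f : V.mfd ⟶ W.mfd) : R D V W f (D.map V W f) :=
  (Gen.total D f).choose_spec

/-- The identities required of the extension are proved by this: both sides are related by `R` to
cobordisms, and the equality of the latter is a formal computation. -/
theorem R.eq (hD : D.IsTr) {V W : Word Λ} {f g : V.mfd ⟶ W.mfd} {φ ψ} (h : R D V W f φ)
    (h' : R D V W g ψ) (e : f = g) : φ = ψ := by
  subst e; exact h.unique hD h'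

theorem TrData.map_eq (hD : D.IsTr) {V W : Word Λ} {f : V.mfd ⟶ W.mfd} {φ} (h : R D V W f φ) :
    D.map V W f = φ := (R.map f).unique hD h

theorem TrData.map_isotopic (hD : D.IsTr) {V W : Word Λ} {f g : V.mfd ⟶ W.mfd}
    (h : Isotopic f g) : D.map V W f = D.map V W g :=
  ((R.map f).isotopy h).unique hD (R.map g)

/-- Diffeomorphisms are sent to isomorphisms. -/
@[simps]
def TrData.mapIso (hD : D.IsTr) (V W : Word Λ) (e : V.mfd ≅ W.mfd) : D.ev V ≅ D.ev W where
  hom := D.map V W e.hom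
  inv := D.map W V e.inv
  hom_inv_id := ((R.map e.hom).comp (R.map e.inv)).eq hD (.id V) (by simp)
  inv_hom_id := ((R.map e.inv).comp (R.map e.hom)).eq hD (.id W) (by simp)

theorem R.whiskerRight {V W : Word Λ} {f : V.mfd ⟶ W.mfd} {φ} (h : R D V W f φ) (U : Word Λ) :
    R D (.tensor V U) (.tensor W U) (f ▷ U.mfd) (φ ▷ D.ev U) := by
  rw [← tensorHom_id, ← tensorHom_id]
  exact h.tensor (.id U)

theorem R.whiskerLeft (U : Word Λ) {V W : Word Λ} {f : V.mfd ⟶ W.mfd} {φ} (h : R D V W f φ) :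
    R D (.tensor U V) (.tensor U W) (U.mfd ◁ f) (D.ev U ◁ φ) := by
  rw [← MonoidalCategory.id_tensorHom, ← MonoidalCategory.id_tensorHom]
  exact (R.id U).tensor h

end Extension

variable [Nonempty Λ] {D : TrData Λ C} (hD : D.IsTr)

/-- The extension of `D` to a functor. -/
@[simps]
def TrData.functor : Mfd Λ ⥤ C where
  obj S := D.ev S.word
  map {S T} f := D.map S.word T.word (S.presentation.hom ≫ f ≫ T.presentation.inv)
  map_id S := TrData.map_eq hD (by
    rw [Category.id_comp, Iso.hom_inv_id]
    exact .id _)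
  map_comp {S T U} f g := TrData.map_eq hD (by
    have := (R.map (D := D) (S.presentation.hom ≫ f ≫ T.presentation.inv)).comp
      (R.map (V := T.word) (W := U.word) (T.presentation.hom ≫ g ≫ U.presentation.inv))
    simpa using this)

/-- The extension of `D` is symmetric monoidal. -/
def TrData.coreMonoidal : (TrData.functor hD).CoreMonoidal where
  εIso := TrData.mapIso hD .unit (𝟙_ (Mfd Λ)).word (𝟙_ (Mfd Λ)).presentation.symm
  μIso S T := TrData.mapIso hD (.tensor S.word T.word) (S ⊗ T).word
    ((S.presentation ⊗ᵢ T.presentation) ≪≫ (S ⊗ T).presentation.symm)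
  μIso_hom_natural_left {S T} f U := by
    refine (((R.map _).whiskerRight U.word).comp (R.map (V := .tensor T.word U.word) _)).eq hD
      ((R.map (V := .tensor S.word U.word) _).comp (R.map (V := (S ⊗ U).word) _)) ?_
    simp [MonoidalCategory.tensorHom_def, whisker_exchange_assoc]
  μIso_hom_natural_right {S T} U f := by
    refine (((R.map _).whiskerLeft U.word).comp (R.map (V := .tensor U.word T.word) _)).eq hD
      ((R.map (V := .tensor U.word S.word) _).comp (R.map (V := (U ⊗ S).word) _)) ?_
    simp [MonoidalCategory.tensorHom_def, whisker_exchange_assoc]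
  associativity S T U := by
    refine (((R.map (V := .tensor S.word T.word) (W := (S ⊗ T).word) _).whiskerRight U.word).comp
      ((R.map (V := .tensor (S ⊗ T).word U.word) (W := ((S ⊗ T) ⊗ U).word) _).comp
      (R.map (V := ((S ⊗ T) ⊗ U).word) (W := (S ⊗ T ⊗ U).word) _))).eq hD
      ((R.assoc S.word T.word U.word).comp
      (((R.map (V := .tensor T.word U.word) (W := (T ⊗ U).word) _).whiskerLeft S.word).comp
      (R.map (V := .tensor S.word (T ⊗ U).word) (W := (S ⊗ T ⊗ U).word) _))) ?_
    simp only [Category.assoc, Iso.trans_hom, Iso.symm_hom, tensorIso_hom, Iso.inv_hom_id_assoc,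
      whiskerRight_comp_tensorHom_assoc, whiskerLeft_comp_tensorHom_assoc, Iso.inv_hom_id,
      Category.comp_id, associator_naturality_assoc]
  left_unitality S := by
    refine (R.lunit S.word).eq hD
      (((R.map (V := .unit) (W := (𝟙_ (Mfd Λ)).word) _).whiskerRight S.word).comp
      ((R.map (V := .tensor (𝟙_ (Mfd Λ)).word S.word) (W := (𝟙_ (Mfd Λ) ⊗ S).word) _).comp
      (R.map (V := (𝟙_ (Mfd Λ) ⊗ S).word) (W := S.word) _))) ?_
    simp [MonoidalCategory.tensorHom_def]
  right_unitality S := by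
    refine (R.runit S.word).eq hD
      (((R.map (V := .unit) (W := (𝟙_ (Mfd Λ)).word) _).whiskerLeft S.word).comp
      ((R.map (V := .tensor S.word (𝟙_ (Mfd Λ)).word) (W := (S ⊗ 𝟙_ (Mfd Λ)).word) _).comp
      (R.map (V := (S ⊗ 𝟙_ (Mfd Λ)).word) (W := S.word) _))) ?_
    simp [MonoidalCategory.tensorHom_def, whisker_exchange_assoc]

instance : (TrData.functor hD).Monoidal := (TrData.coreMonoidal hD).toMonoidal

instance : (TrData.functor hD).Braided where
  braided S T := by
    refine ((R.map (V := .tensor S.word T.word) (W := (S ⊗ T).word) _).comp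
      (R.map (V := (S ⊗ T).word) (W := (T ⊗ S).word) _)).eq hD
      ((R.braid S.word T.word).comp
      (R.map (V := .tensor T.word S.word) (W := (T ⊗ S).word) _)) ?_
    simp

end

section

variable {Λ : Type} {C : Type u} [Category.{v} C]

/-! ### Simplicial functors and isotopy invariance -/

section Simplicial

/-- A functor on cobordisms that is invariant under isotopies is simplicial. -/
theorem exists_simplicial {F : Mfd Λ ⥤ C}
    (hF : ∀ {S T : Mfd Λ} {f g : S ⟶ T}, Isotopic f g → F.map f = F.map g) (S T : Mfd Λ) :
    ∃ φ : Mfd.simplicialHom S T ⋙ uliftFunctor.{v} ⟶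
        (Functor.const SimplexCategoryᵒᵖ).obj (ULift.{0} (F.obj S ⟶ F.obj T)),
      ∀ f : S ⟶ T, (φ.app (Opposite.op (SimplexCategory.mk 0))
        ⟨⟨fun _ => f, Mfd.isSmoothFamily_const 0 f⟩⟩).down = F.map f := by
  refine ⟨{ app := fun n => TypeCat.ofHom fun σ => ⟨F.map (σ.down.1 (stdSimplex.vertex 0))⟩
            naturality := fun n m f => ?_ }, fun f => rfl⟩
  ext ⟨σ⟩
  refine congrArg ULift.up (hF ?_)
  -- A simplex is evaluated at its vertex `0`. A simplicial operator replaces this vertex by its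
  -- image, and the edge between the two vertices is an isotopy.
  refine ⟨_, σ.2.comp_map (l := 1) ![f.unop.toOrderHom 0, 0], ?_, ?_⟩
  · show σ.1 (stdSimplex.map _ _) = σ.1 (stdSimplex.map _ _)
    rw [stdSimplex.map_vertex, stdSimplex.map_vertex]; rfl
  · rw [stdSimplex.map_vertex]; rfl

variable [MonoidalCategory C] [SymmetricCategory C]

/-- The target is a constant simplicial set, so by naturality the value on a 1-simplex agrees with
the values on both of its vertices. -/
theorem Operad.map_isotopic (P : Operad Λ C) {S T : Mfd Λ} {f g : S ⟶ T} (h : Isotopic f g) :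
    P.functor.map f = P.functor.map g := by
  obtain ⟨σ, hσ, rfl, rfl⟩ := h
  obtain ⟨φ, hφ⟩ := P.simplicial S T
  have key (i : Fin 2) : P.functor.map (σ (stdSimplex.vertex i)) =
      (φ.app (Opposite.op (SimplexCategory.mk 1)) ⟨⟨σ, hσ⟩⟩).down := by
    rw [← hφ]
    have := ConcreteCategory.congr_hom (φ.naturality (SimplexCategory.const (.mk 0) (.mk 1) i).op) ⟨⟨σ, hσ⟩⟩
    refine (congrArg ULift.down ?_).trans (congrArg ULift.down this)
    refine congrArg (φ.app _) (congrArg ULift.up (Subtype.ext (funext fun t => ?_)))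
    show _ = σ (stdSimplex.map _ t)
    obtain rfl : t = stdSimplex.vertex 0 := Subsingleton.elim _ _
    rw [stdSimplex.map_vertex]
    rfl
  exact (key 0).trans (key 1).symm

end Simplicial

end

section

variable {Λ : Type}

/-! ### Associativity and cyclic invariance for a modular operad -/

section Relations

/-- Both bracketings lay three intervals end to end in the same order, with different proportions.
In terms of real numbers each of the nine cases is linear arithmetic, and `isotopic_of_le_iff` then
gives the isotopy. -/
theorem le_iff_of_glue_assoc (p q : (unitInterval ⊕ unitInterval) ⊕ unitInterval) :
    Sum.elim (Sum.elim (fun x : unitInterval => (x : ℝ) / 2 / 2) fun x : unitInterval => ((x : ℝ) + 1) / 2 / 2)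
        (fun x : unitInterval => ((x : ℝ) + 1) / 2) p ≤
      Sum.elim (Sum.elim (fun x : unitInterval => (x : ℝ) / 2 / 2) fun x : unitInterval => ((x : ℝ) + 1) / 2 / 2)
        (fun x : unitInterval => ((x : ℝ) + 1) / 2) q ↔
    Sum.elim (Sum.elim (fun x : unitInterval => (x : ℝ) / 2) fun x : unitInterval => ((x : ℝ) / 2 + 1) / 2)
        (fun x : unitInterval => (((x : ℝ) + 1) / 2 + 1) / 2) p ≤
      Sum.elim (Sum.elim (fun x : unitInterval => (x : ℝ) / 2) fun x : unitInterval => ((x : ℝ) / 2 + 1) / 2)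
        (fun x : unitInterval => (((x : ℝ) + 1) / 2 + 1) / 2) q := by
  rcases p with (x | x) | x <;> rcases q with (y | y) | y <;>
    simp only [Sum.elim_inl, Sum.elim_inr] <;> have := x.2.1 <;> have := x.2.2 <;>
    have := y.2.1 <;> have := y.2.2 <;> constructor <;> intro <;> linarith

theorem isotopic_glue_assoc (a b c d : Λ) :
    Isotopic (Mfd.glue a b c ▷ Mfd.interval c d ≫ Mfd.glue a c d)
      ((α_ _ _ _).hom ≫ Mfd.interval a b ◁ Mfd.glue b c d ≫ Mfd.glue a b d) := by
  refine isotopic_of_le_iff fun p q => ?_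
  have h := le_iff_of_glue_assoc p q
  rcases p with (x | x) | x <;> rcases q with (y | y) | y <;> exact h

/-- The two ways of forming a circle from two intervals differ by the rotation by `1 / 2`, which is
isotopic to the identity. -/
theorem isotopic_glue_close (a b : Λ) :
    Isotopic (Mfd.glue a b a ≫ Mfd.close a) ((β_ _ _).hom ≫ Mfd.glue b a b ≫ Mfd.close b) := by
  have key (x : unitInterval) : wrap (halfRight x) = (((halfLeft x : ℝ) + 1 / 2 : ℝ) : Circ) ∧
      wrap (halfLeft x) = (((halfRight x : ℝ) + 1 / 2 : ℝ) : Circ) := by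
    constructor
    · exact congrArg (fun r : ℝ => (r : Circ)) (by simp only [halfLeft, halfRight]; ring)
    · refine circ_coe_eq.2 ⟨-1, ?_⟩
      simp only [halfLeft, halfRight]
      push_cast
      ring
  have h : (β_ _ _).hom ≫ Mfd.glue b a b ≫ Mfd.close b =
      (Mfd.glue a b a ≫ Mfd.close a) ≫ circMap (isCircLift_add (1 / 2)) := by
    refine Mfd.hom_ext ?_
    rintro (x | x)
    · exact (key x).1.trans (circMap_coe (Λ := Λ) (isCircLift_add (1 / 2)) _).symm
    · exact (key x).2.trans (circMap_coe (Λ := Λ) (isCircLift_add (1 / 2)) _).symm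
  rw [h]
  have := (Isotopic.refl (Mfd.glue a b a ≫ Mfd.close a)).comp
    (isotopic_circMap (isCircLift_add 0) (isCircLift_add (1 / 2)))
  rwa [circMap_zero, Category.comp_id] at this

end Relations

variable {C : Type u} [Category.{v} C] [MonoidalCategory C] [SymmetricCategory C]

open Functor.LaxMonoidal

theorem Operad.mul_assoc (P : Operad Λ C) (a b c d : Λ) :
    P.mul a b c ▷ P.functor.obj (Mfd.interval c d) ≫ P.mul a c d =
      (α_ _ _ _).hom ≫ P.functor.obj (Mfd.interval a b) ◁ P.mul b c d ≫ P.mul a b d := by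
  have h := P.map_isotopic (isotopic_glue_assoc a b c d)
  simp only [Functor.map_comp] at h
  simp only [mul, comp_whiskerRight, Category.assoc, MonoidalCategory.whiskerLeft_comp,
    μ_natural_left_assoc, μ_natural_right_assoc, h]
  simp

theorem Operad.mul_trace (P : Operad Λ C) (a b : Λ) :
    P.mul a b a ≫ P.trace a = (β_ _ _).hom ≫ P.mul b a b ≫ P.trace b := by
  have h := P.map_isotopic (isotopic_glue_close a b)
  simp only [Functor.map_comp] at h
  simp only [mul, trace, Category.assoc, h]
  simp

/-- The values of a functor on intervals and circles. -/
@[reducible]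
def Operad.toTr (P : Operad Λ C) : TrData Λ C where
  obj t := P.functor.obj t.mfd
  mul := P.mul
  tr := P.trace

end

/-! ### Functors and transformations determined by intervals and circles -/

section

variable {Λ : Type} {C : Type u} [Category.{v} C] [MonoidalCategory C] [SymmetricCategory C]

open Functor.LaxMonoidal

section Extension

variable [Nonempty Λ] {D : TrData Λ C} (hD : D.IsTr)

/-- The symmetric monoidal functor extending `D`. -/
def TrData.operad : Operad Λ C where
  functor := TrData.functor hD
  simplicial := exists_simplicial fun {S T _ _} h =>
    TrData.map_isotopic hD ((Isotopic.refl S.presentation.hom).comp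
      (h.comp (Isotopic.refl T.presentation.inv)))

/-- The functor extending `D` has the prescribed values on intervals and circles. -/
def TrData.operadIso (t : Atom Λ) : (TrData.operad hD).functor.obj t.mfd ≅ D.obj t :=
  TrData.mapIso hD t.mfd.word (.atom t) t.mfd.presentation

/-- Both sides are related by `R` to the gluing preceded by the presentations of the two intervals.
-/
theorem TrData.operad_mul (a b c : Λ) :
    (TrData.operad hD).mul a b c ≫ (TrData.operadIso hD (.seg a c)).hom =
      ((TrData.operadIso hD (.seg a b)).hom ⊗ₘ (TrData.operadIso hD (.seg b c)).hom) ≫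
        D.mul a b c := by
  refine (Category.assoc _ _ _).trans (((R.map (V := .tensor (Mfd.interval a b).word
      (Mfd.interval b c).word) (W := (Mfd.interval a b ⊗ Mfd.interval b c).word) _).comp
    ((R.map (V := (Mfd.interval a b ⊗ Mfd.interval b c).word) (W := (Mfd.interval a c).word) _).comp
    (R.map (V := (Mfd.interval a c).word) (W := .atom (.seg a c)) _))).eq hD
    (((R.map (V := (Mfd.interval a b).word) (W := .atom (.seg a b)) _).tensor
      (R.map (V := (Mfd.interval b c).word) (W := .atom (.seg b c)) _)).comp (R.glue a b c)) ?_)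
  simp

theorem TrData.operad_trace (a : Λ) :
    (TrData.operad hD).trace a ≫ (TrData.operadIso hD .circ).hom =
      (TrData.operadIso hD (.seg a a)).hom ≫ D.tr a := by
  refine ((R.map (V := (Mfd.interval a a).word) (W := (Mfd.circle Λ).word) _).comp
    (R.map (V := (Mfd.circle Λ).word) (W := .atom .circ) _)).eq hD
    ((R.map (V := (Mfd.interval a a).word) (W := .atom (.seg a a)) _).comp (R.close a)) ?_
  simp

end Extension

section Homs

/-- A family of morphisms commuting with the operations. -/
@[ext]
structure TrData.Hom (D E : TrData Λ C) where
  app (t : Atom Λ) : D.obj t ⟶ E.obj t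
  mul (a b c : Λ) : D.mul a b c ≫ app (.seg a c) = (app (.seg a b) ⊗ₘ app (.seg b c)) ≫ E.mul a b c
  tr (a : Λ) : D.tr a ≫ app .circ = app (.seg a a) ≫ E.tr a

variable {D E : TrData Λ C}

/-- The morphism between the tensor products described by a word. -/
def TrData.Hom.ev (h : TrData.Hom D E) : ∀ W : Word Λ, D.ev W ⟶ E.ev W
  | .unit => 𝟙 (𝟙_ C)
  | .atom t => h.app t
  | .tensor V W => h.ev V ⊗ₘ h.ev W

/-- A morphism of data commutes with the generators, hence with everything built from them in the
same way. -/
theorem R.hom (h : TrData.Hom D E) {V W : Word Λ} {f : V.mfd ⟶ W.mfd} {φ} (hf : R D V W f φ) :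
    ∃ ψ, R E V W f ψ ∧ φ ≫ h.ev W = h.ev V ≫ ψ := by
  induction hf with
  | id V => exact ⟨_, .id V, by simp⟩
  | comp _ _ ih ih' =>
    obtain ⟨ψ, hψ, e⟩ := ih
    obtain ⟨ψ', hψ', e'⟩ := ih'
    exact ⟨_, hψ.comp hψ', by rw [Category.assoc, e', reassoc_of% e]⟩
  | tensor _ _ ih ih' =>
    obtain ⟨ψ, hψ, e⟩ := ih
    obtain ⟨ψ', hψ', e'⟩ := ih'
    exact ⟨_, hψ.tensor hψ', by simp [TrData.Hom.ev, e, e']⟩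
  | assoc U V W => exact ⟨_, .assoc U V W, by simp [TrData.Hom.ev]⟩
  | runit V => exact ⟨_, .runit V, by simp [TrData.Hom.ev]⟩
  | runitInv V => exact ⟨_, .runitInv V, by simp [TrData.Hom.ev]⟩
  | braid V W => exact ⟨_, .braid V W, by simp [TrData.Hom.ev]⟩
  | glue a b c => exact ⟨_, .glue a b c, h.mul a b c⟩
  | close a => exact ⟨_, .close a, h.tr a⟩
  | isotopy _ hi ih =>
    obtain ⟨ψ, hψ, e⟩ := ih
    exact ⟨ψ, hψ.isotopy hi, e⟩

/-- The value of a symmetric monoidal functor on the manifold described by a word. -/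
def Operad.evIso (P : Operad Λ C) : ∀ W : Word Λ, P.toTr.ev W ≅ P.functor.obj W.mfd
  | .unit => Functor.Monoidal.εIso P.functor
  | .atom _ => Iso.refl _
  | .tensor V W => (P.evIso V ⊗ᵢ P.evIso W) ≪≫ Functor.Monoidal.μIso P.functor _ _

/-- For the data of a given functor, `R` describes the values of that functor on morphisms. Isotopy
invariance of `P` enters in the last case. -/
theorem R.evIso (P : Operad Λ C) {V W : Word Λ} {f : V.mfd ⟶ W.mfd} {φ} (h : R P.toTr V W f φ) :
    φ ≫ (P.evIso W).hom = (P.evIso V).hom ≫ P.functor.map f := by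
  induction h with
  | id V => simp
  | comp _ _ ih ih' => rw [Category.assoc, ih', reassoc_of% ih, Functor.map_comp]
  | tensor _ _ ih ih' =>
    simp only [Operad.evIso, Iso.trans_hom, tensorIso_hom, Functor.Monoidal.μIso_hom,
      Category.assoc, ← μ_natural, tensorHom_comp_tensorHom_assoc, ih, ih']
  | assoc U V W =>
    have h := Functor.LaxMonoidal.associativity P.functor U.mfd V.mfd W.mfd
    have h1 := tensorHom_comp_tensorHom (((P.evIso U).hom ⊗ₘ (P.evIso V).hom)) (P.evIso W).hom
      (μ P.functor U.mfd V.mfd) (𝟙 _)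
    have h2 := tensorHom_comp_tensorHom (P.evIso U).hom ((P.evIso V).hom ⊗ₘ (P.evIso W).hom)
      (𝟙 _) (μ P.functor V.mfd W.mfd)
    rw [Category.comp_id] at h1 h2
    simp only [Operad.evIso, Iso.trans_hom, tensorIso_hom, Functor.Monoidal.μIso_hom,
      Category.assoc, ← h1, ← h2, tensorHom_id, MonoidalCategory.id_tensorHom]
    rw [h, associator_naturality_assoc]
  | runit V =>
    simp only [Operad.evIso, Iso.trans_hom, tensorIso_hom, Functor.Monoidal.μIso_hom,
      Functor.Monoidal.εIso_hom, Category.assoc]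
    rw [← rightUnitor_naturality, right_unitality, MonoidalCategory.tensorHom_def, Category.assoc]
  | runitInv V =>
    simp only [Operad.evIso, Iso.trans_hom, tensorIso_hom, Functor.Monoidal.μIso_hom,
      Functor.Monoidal.εIso_hom]
    rw [Iso.inv_comp_eq, ← rightUnitor_naturality_assoc, right_unitality,
      MonoidalCategory.tensorHom_def]
    simp [← Functor.map_comp]
  | braid V W => simp [Operad.evIso]
  | glue a b c => simp [Operad.evIso, Operad.mul]
  | close a => simp [Operad.evIso, Operad.trace]
  | isotopy _ hi ih => rw [ih, P.map_isotopic hi]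

end Homs

end

section

variable {Λ : Type} {C : Type u} [Category.{v} C] [MonoidalCategory C] [SymmetricCategory C]
variable {P Q : Operad Λ C}

open Functor.LaxMonoidal

namespace TrData.Hom

/-- The morphism between the values on the manifold described by a word. -/
def wordApp (h : TrData.Hom P.toTr Q.toTr) (V : Word Λ) :
    P.functor.obj V.mfd ⟶ Q.functor.obj V.mfd :=
  (P.evIso V).inv ≫ h.ev V ≫ (Q.evIso V).hom

variable (h : TrData.Hom P.toTr Q.toTr)

/-- By `Gen.total` the morphism `f` is built from generators. The square of `R.hom` is then
transported to the functors by `R.evIso`. -/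
theorem wordApp_naturality {V W : Word Λ} (f : V.mfd ⟶ W.mfd) :
    P.functor.map f ≫ h.wordApp W = h.wordApp V ≫ Q.functor.map f := by
  have h1 : R P.toTr V W f _ := R.map f
  obtain ⟨ψ, h2, e⟩ := h1.hom h
  have e1 := h1.evIso
  have e2 := h2.evIso
  rw [wordApp, wordApp, ← cancel_epi (P.evIso V).hom, ← reassoc_of% e1]
  simp only [Category.assoc, Iso.hom_inv_id_assoc, reassoc_of% e, e2]

theorem wordApp_unit : ε P.functor ≫ h.wordApp .unit = ε Q.functor := by
  simp [wordApp, TrData.Hom.ev, Operad.evIso]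

theorem wordApp_tensor (V W : Word Λ) : μ P.functor V.mfd W.mfd ≫ h.wordApp (.tensor V W) =
    (h.wordApp V ⊗ₘ h.wordApp W) ≫ μ Q.functor V.mfd W.mfd := by
  simp only [wordApp, TrData.Hom.ev, Operad.evIso, Iso.trans_inv, tensorIso_inv, Iso.trans_hom,
    tensorIso_hom, Functor.Monoidal.μIso_hom, Functor.Monoidal.μIso_inv, Category.assoc,
    Functor.Monoidal.μ_δ_assoc, tensorHom_comp_tensorHom_assoc]

variable [Nonempty Λ]

/-- The extension of a family of morphisms to all manifolds. -/
def extend : P.functor ⟶ Q.functor where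
  app S := P.functor.map S.presentation.inv ≫ h.wordApp S.word ≫ Q.functor.map S.presentation.hom
  naturality S T f := by
    have := h.wordApp_naturality (V := S.word) (W := T.word)
      (S.presentation.hom ≫ f ≫ T.presentation.inv)
    rw [← cancel_epi (P.functor.map S.presentation.hom),
      ← cancel_mono (Q.functor.map T.presentation.inv)]
    simpa [← Functor.map_comp, ← Functor.map_comp_assoc] using this

/-- The extension is defined through a chosen presentation; naturality with respect to the
presentation shows that on a word it has the expected value. -/
theorem extend_app_word (V : Word Λ) : h.extend.app V.mfd = h.wordApp V := by
  have := h.wordApp_naturality (V := V.mfd.word) (W := V) V.mfd.presentation.hom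
  refine (congrArg (P.functor.map V.mfd.presentation.inv ≫ ·) this.symm).trans ?_
  simp [← Functor.map_comp_assoc]

theorem extend_isMonoidal : NatTrans.IsMonoidal h.extend where
  unit := (congrArg (ε P.functor ≫ ·) (h.extend_app_word .unit)).trans h.wordApp_unit
  tensor S T := by
    have h1 := h.extend.naturality (S.presentation.inv ⊗ₘ T.presentation.inv)
    have h2 := h.extend_app_word (.tensor S.word T.word)
    have h3 := h.wordApp_tensor S.word T.word
    have h4 := h.extend.naturality S.presentation.inv
    have h5 := h.extend.naturality T.presentation.inv
    rw [h.extend_app_word] at h4 h5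
    rw [← cancel_mono (Q.functor.map (S.presentation.inv ⊗ₘ T.presentation.inv)), Category.assoc,
      ← h1]
    have h6 := μ_natural (F := P.functor) S.presentation.inv T.presentation.inv
    have h7 := μ_natural (F := Q.functor) S.presentation.inv T.presentation.inv
    rw [← reassoc_of% h6, Category.assoc, ← h7, tensorHom_comp_tensorHom_assoc, ← h4, ← h5,
      ← tensorHom_comp_tensorHom_assoc, ← h3]
    exact congrArg (fun x => _ ≫ _ ≫ x) h2

end TrData.Hom

/-- The restriction of a morphism to intervals and circles. -/
@[simps]
def Operad.Hom.restrict (f : Operad.Hom P Q) : TrData.Hom P.toTr Q.toTr where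
  app t := f.app.app t.mfd
  mul := Operad.mul_app f
  tr := Operad.trace_app f

/-- A monoidal transformation is determined on disjoint unions by its components on the summands. -/
theorem Operad.Hom.app_word (f : Operad.Hom P Q) (V : Word Λ) :
    f.app.app V.mfd = f.restrict.wordApp V := by
  have := f.isMonoidal
  rw [TrData.Hom.wordApp, Iso.eq_inv_comp]
  induction V with
  | unit => simp [TrData.Hom.ev, Operad.evIso]
  | atom t => simp [TrData.Hom.ev, Operad.evIso]
  | tensor V W hV hW =>
    simp only [TrData.Hom.ev, Operad.evIso, Iso.trans_hom, tensorIso_hom,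
      Functor.Monoidal.μIso_hom, Category.assoc, NatTrans.IsMonoidal.tensor,
      tensorHom_comp_tensorHom_assoc, hV, hW]

variable [Nonempty Λ]

/-- Every manifold is diffeomorphic to one described by a word, so naturality reduces the claim to
`Operad.Hom.app_word`. -/
theorem Operad.Hom.restrict_injective {f g : Operad.Hom P Q} (h : f.restrict = g.restrict) :
    f = g := by
  refine Operad.Hom.ext (NatTrans.ext (funext fun S => ?_))
  rw [← cancel_epi (P.functor.map S.presentation.hom), NatTrans.naturality, NatTrans.naturality,
    f.app_word, g.app_word, h]

theorem Operad.Hom.restrict_surjective (h : TrData.Hom P.toTr Q.toTr) :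
    ∃ f : Operad.Hom P Q, f.restrict = h := by
  refine ⟨⟨h.extend, h.extend_isMonoidal⟩, TrData.Hom.ext (funext fun t => ?_)⟩
  refine (h.extend_app_word (.atom t)).trans ?_
  simp [TrData.Hom.wordApp, TrData.Hom.ev, Operad.evIso]

end

/-! ### The two equivalences of categories -/

section

variable {C : Type u} [Category.{v} C]

theorem inv_square {X Y X' Y' : C} {m : X ⟶ Y} {m' : X' ⟶ Y'} (f : X ≅ X') (g : Y ≅ Y')
    (h : m ≫ g.hom = f.hom ≫ m') : m' ≫ g.inv = f.inv ≫ m := by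
  rw [Iso.comp_inv_eq, Category.assoc, h, Iso.inv_hom_id_assoc]

variable [MonoidalCategory C]

theorem inv_square_tensor {X Y Z X' Y' Z' : C} {m : X ⊗ Y ⟶ Z} {m' : X' ⊗ Y' ⟶ Z'} (f : X ≅ X')
    (g : Y ≅ Y') (k : Z ≅ Z') (h : m ≫ k.hom = (f.hom ⊗ₘ g.hom) ≫ m') :
    m' ≫ k.inv = (f.inv ⊗ₘ g.inv) ≫ m := inv_square (f ⊗ᵢ g) k h

/-- An isomorphism is given by isomorphisms commuting with the structure morphisms. -/
def AlgTraceData.mkIso {X Y : AlgTraceData C} (A : X.A ≅ Y.A) (M : X.M ≅ Y.M)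
    (mul : X.mul ≫ A.hom = (A.hom ⊗ₘ A.hom) ≫ Y.mul) (tr : X.tr ≫ M.hom = A.hom ≫ Y.tr) :
    X ≅ Y where
  hom := { A := A.hom, M := M.hom, mul := mul, tr := tr }
  inv := { A := A.inv, M := M.inv, mul := inv_square_tensor A A A mul, tr := inv_square A M tr }
  hom_inv_id := AlgTraceData.Hom.ext A.hom_inv_id M.hom_inv_id
  inv_hom_id := AlgTraceData.Hom.ext A.inv_hom_id M.inv_hom_id

/-- An isomorphism is given by isomorphisms commuting with the structure morphisms. -/
def MoritaTraceData.mkIso {X Y : MoritaTraceData C} (A : X.A ≅ Y.A) (B : X.B ≅ Y.B) (Q : X.Q ≅ Y.Q)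
    (R : X.R ≅ Y.R) (M : X.M ≅ Y.M)
    (mulA : X.mulA ≫ A.hom = (A.hom ⊗ₘ A.hom) ≫ Y.mulA)
    (mulB : X.mulB ≫ B.hom = (B.hom ⊗ₘ B.hom) ≫ Y.mulB)
    (lQ : X.lQ ≫ Q.hom = (A.hom ⊗ₘ Q.hom) ≫ Y.lQ)
    (rQ : X.rQ ≫ Q.hom = (Q.hom ⊗ₘ B.hom) ≫ Y.rQ)
    (lR : X.lR ≫ R.hom = (B.hom ⊗ₘ R.hom) ≫ Y.lR)
    (rR : X.rR ≫ R.hom = (R.hom ⊗ₘ A.hom) ≫ Y.rR)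
    (α : X.α ≫ A.hom = (Q.hom ⊗ₘ R.hom) ≫ Y.α)
    (β : X.β ≫ B.hom = (R.hom ⊗ₘ Q.hom) ≫ Y.β)
    (trA : X.trA ≫ M.hom = A.hom ≫ Y.trA)
    (trB : X.trB ≫ M.hom = B.hom ≫ Y.trB) : X ≅ Y where
  hom :=
    { A := A.hom, B := B.hom, Q := Q.hom, R := R.hom, M := M.hom, mulA := mulA, mulB := mulB
      lQ := lQ, rQ := rQ, lR := lR, rR := rR, α := α, β := β, trA := trA, trB := trB }
  inv :=
    { A := A.inv, B := B.inv, Q := Q.inv, R := R.inv, M := M.inv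
      mulA := inv_square_tensor A A A mulA
      mulB := inv_square_tensor B B B mulB
      lQ := inv_square_tensor A Q Q lQ
      rQ := inv_square_tensor Q B Q rQ
      lR := inv_square_tensor B R R lR
      rR := inv_square_tensor R A R rR
      α := inv_square_tensor Q R A α
      β := inv_square_tensor R Q B β
      trA := inv_square A M trA
      trB := inv_square B M trB }
  hom_inv_id := MoritaTraceData.Hom.ext A.hom_inv_id B.hom_inv_id Q.hom_inv_id R.hom_inv_id
    M.hom_inv_id
  inv_hom_id := MoritaTraceData.Hom.ext A.inv_hom_id B.inv_hom_id Q.inv_hom_id R.inv_hom_id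
    M.inv_hom_id

variable [SymmetricCategory C]

section Alg

theorem ModularOperad.isAlgebraWithTrace (P : ModularOperad C) :
    AlgTraceData.algebraWithTrace C ((ModularOperad.data C).obj P) where
  assoc := P.mul_assoc () () () ()
  trace := (P.mul_trace () ()).symm

/-- An algebra with trace, as a family of operations. -/
def AlgTraceData.toTr (X : AlgTraceData C) : TrData Unit C where
  obj
    | .seg _ _ => X.A
    | .circ => X.M
  mul _ _ _ := X.mul
  tr _ := X.tr

theorem AlgTraceData.isTr {X : AlgTraceData C} (h : X.IsAlgebraWithTrace) : X.toTr.IsTr where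
  assoc _ _ _ _ := h.assoc
  cyc _ _ := h.trace.symm

instance : (ModularOperad.data C).Faithful where
  map_injective {P Q f g} h := by
    refine Operad.Hom.restrict_injective (TrData.Hom.ext (funext fun t => ?_))
    rcases t with _ | _
    · exact congrArg AlgTraceData.Hom.A h
    · exact congrArg AlgTraceData.Hom.M h

instance : (ModularOperad.data C).Full where
  map_surjective {P Q} f := by
    obtain ⟨g, hg⟩ := Operad.Hom.restrict_surjective (P := P) (Q := Q)
      { app := fun t => match t with
          | .seg _ _ => f.A
          | .circ => f.M
        mul := fun _ _ _ => f.mul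
        tr := fun _ => f.tr }
    have hg' := fun t => congrFun (congrArg TrData.Hom.app hg) t
    exact ⟨g, AlgTraceData.Hom.ext (hg' (.seg () ())) (hg' .circ)⟩

instance : ((AlgTraceData.algebraWithTrace C).lift (ModularOperad.data C)
    ModularOperad.isAlgebraWithTrace).EssSurj where
  mem_essImage X := by
    have hX := AlgTraceData.isTr X.2
    exact ⟨TrData.operad hX, ⟨ObjectProperty.isoMk _ (AlgTraceData.mkIso
      (TrData.operadIso hX (.seg () ())) (TrData.operadIso hX .circ)
      (TrData.operad_mul hX () () ()) (TrData.operad_trace hX ()))⟩⟩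

end Alg

section Morita

/-- The sixteen axioms without traces are associativity for the sixteen sequences of four labels;
the trace axioms are cyclic invariance for pairs of labels. -/
theorem ModularDioperad.isMoritaContextWithTrace (P : ModularDioperad C) :
    MoritaTraceData.moritaContextWithTrace C ((ModularDioperad.data C).obj P) where
  assocA := P.mul_assoc _ _ _ _
  assocB := P.mul_assoc _ _ _ _
  lQ_assoc := P.mul_assoc _ _ _ _
  rQ_assoc := P.mul_assoc _ _ _ _
  lQ_rQ := P.mul_assoc _ _ _ _
  lR_assoc := P.mul_assoc _ _ _ _
  rR_assoc := P.mul_assoc _ _ _ _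
  lR_rR := P.mul_assoc _ _ _ _
  α_balanced := P.mul_assoc _ _ _ _
  β_balanced := P.mul_assoc _ _ _ _
  α_left := P.mul_assoc _ _ _ _
  α_right := P.mul_assoc _ _ _ _
  β_left := P.mul_assoc _ _ _ _
  β_right := P.mul_assoc _ _ _ _
  compatQ := P.mul_assoc _ _ _ _
  compatR := P.mul_assoc _ _ _ _
  traceA := (P.mul_trace _ _).symm
  traceB := (P.mul_trace _ _).symm
  trace_compat := P.mul_trace _ _

/-- The sign of a unit of `ℤ`: `1` is positive. -/
def isPos (a : ℤˣ) : Bool :=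
  match a.val with
  | .ofNat _ => true
  | .negSucc _ => false

namespace MoritaTraceData

variable (X : MoritaTraceData C)

/-- The four modules of a Morita context, indexed by pairs of signs. -/
@[reducible]
def obj : Bool → Bool → C
  | true, true => X.A
  | false, false => X.B
  | true, false => X.Q
  | false, true => X.R

/-- The eight operations of a Morita context. -/
@[reducible]
def op : ∀ a b c : Bool, X.obj a b ⊗ X.obj b c ⟶ X.obj a c
  | true, true, true => X.mulA
  | false, false, false => X.mulB
  | true, true, false => X.lQ
  | true, false, false => X.rQ
  | false, false, true => X.lR
  | false, true, true => X.rR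
  | true, false, true => X.α
  | false, true, false => X.β

/-- The two traces of a Morita context with trace. -/
@[reducible]
def opTr : ∀ a : Bool, X.obj a a ⟶ X.M
  | true => X.trA
  | false => X.trB

variable {X} in
theorem op_assoc (h : X.IsMoritaContextWithTrace) (a b c d : Bool) :
    X.op a b c ▷ X.obj c d ≫ X.op a c d =
      (α_ _ _ _).hom ≫ X.obj a b ◁ X.op b c d ≫ X.op a b d := by
  rcases a <;> rcases b <;> rcases c <;> rcases d
  -- The cases are in lexicographic order of the four signs, with `false` before `true`.
  exacts [h.assocB, h.lR_assoc, h.β_left, h.lR_rR, h.β_right, h.compatR, h.β_balanced, h.rR_assoc,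
    h.rQ_assoc, h.α_balanced, h.compatQ, h.α_right, h.lQ_rQ, h.α_left, h.lQ_assoc, h.assocA]

variable {X} in
theorem op_cyc (h : X.IsMoritaContextWithTrace) (a b : Bool) :
    X.op a b a ≫ X.opTr a = (β_ _ _).hom ≫ X.op b a b ≫ X.opTr b := by
  rcases a <;> rcases b
  · exact h.traceB.symm
  · show X.β ≫ X.trB = (β_ X.R X.Q).hom ≫ X.α ≫ X.trA
    rw [h.trace_compat, SymmetricCategory.symmetry_assoc]
  · exact h.trace_compat
  · exact h.traceA.symm

/-- A Morita context with trace, as a family of operations. -/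
def toTr : TrData ℤˣ C where
  obj
    | .seg a b => X.obj (isPos a) (isPos b)
    | .circ => X.M
  mul a b c := X.op (isPos a) (isPos b) (isPos c)
  tr a := X.opTr (isPos a)

variable {X} in
theorem isTr (h : X.IsMoritaContextWithTrace) : X.toTr.IsTr where
  assoc a b c d := op_assoc h (isPos a) (isPos b) (isPos c) (isPos d)
  cyc a b := op_cyc h (isPos a) (isPos b)

end MoritaTraceData

/-- A function on `ℤˣ` cannot be defined by matching on `1` and `-1`. The family is therefore
constructed with transport, and only its two values are used. -/
theorem exists_units_family {X : ℤˣ → Type v} (x : X 1) (y : X (-1)) :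
    ∃ h : ∀ a, X a, h 1 = x ∧ h (-1) = y :=
  ⟨fun a => if h : a = 1 then h ▸ x else ((Int.units_eq_one_or a).resolve_left h) ▸ y,
    by simp, by simp⟩

instance : (ModularDioperad.data C).Faithful where
  map_injective {P Q f g} h := by
    refine Operad.Hom.restrict_injective (TrData.Hom.ext (funext fun t => ?_))
    rcases t with ⟨a, b⟩ | _
    · rcases Int.units_eq_one_or a with rfl | rfl <;> rcases Int.units_eq_one_or b with rfl | rfl
      · exact congrArg MoritaTraceData.Hom.A h
      · exact congrArg MoritaTraceData.Hom.Q h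
      · exact congrArg MoritaTraceData.Hom.R h
      · exact congrArg MoritaTraceData.Hom.B h
    · exact congrArg MoritaTraceData.Hom.M h

instance : (ModularDioperad.data C).Full where
  map_surjective {P Q} f := by
    obtain ⟨k, k1, k2⟩ := exists_units_family
      (X := fun b => P.functor.obj (Mfd.interval 1 b) ⟶ Q.functor.obj (Mfd.interval 1 b)) f.A f.Q
    obtain ⟨l, l1, l2⟩ := exists_units_family (X := fun b =>
      P.functor.obj (Mfd.interval (-1) b) ⟶ Q.functor.obj (Mfd.interval (-1) b)) f.R f.B
    obtain ⟨m, m1, m2⟩ := exists_units_family (X := fun a => ∀ b,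
      P.functor.obj (Mfd.interval a b) ⟶ Q.functor.obj (Mfd.interval a b)) k l
    have hA : m 1 1 = f.A := by rw [m1, k1]
    have hQ : m 1 (-1) = f.Q := by rw [m1, k2]
    have hR : m (-1) 1 = f.R := by rw [m2, l1]
    have hB : m (-1) (-1) = f.B := by rw [m2, l2]
    obtain ⟨g, hg⟩ := Operad.Hom.restrict_surjective (P := P) (Q := Q)
      { app := fun t => match t with
          | .seg a b => m a b
          | .circ => f.M
        mul := fun a b c => by
          show P.mul a b c ≫ m a c = (m a b ⊗ₘ m b c) ≫ Q.mul a b c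
          rcases Int.units_eq_one_or a with rfl | rfl <;>
            rcases Int.units_eq_one_or b with rfl | rfl <;>
            rcases Int.units_eq_one_or c with rfl | rfl <;> simp only [hA, hB, hQ, hR]
          exacts [f.mulA, f.lQ, f.α, f.rQ, f.rR, f.β, f.lR, f.mulB]
        tr := fun a => by
          show P.trace a ≫ f.M = m a a ≫ Q.trace a
          rcases Int.units_eq_one_or a with rfl | rfl <;> simp only [hA, hB]
          exacts [f.trA, f.trB] }
    have hg' := fun t => congrFun (congrArg TrData.Hom.app hg) t
    exact ⟨g, MoritaTraceData.Hom.ext ((hg' (.seg 1 1)).trans hA) ((hg' (.seg (-1) (-1))).trans hB)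
      ((hg' (.seg 1 (-1))).trans hQ) ((hg' (.seg (-1) 1)).trans hR) (hg' .circ)⟩

/-- Since `isPos` evaluates on `1` and `-1` by computation, the components of `X.toTr` are
definitionally those of `X`. The isomorphisms and squares for the extension thus have the required
types as they stand. -/
instance : ((MoritaTraceData.moritaContextWithTrace C).lift (ModularDioperad.data C)
    ModularDioperad.isMoritaContextWithTrace).EssSurj where
  mem_essImage X := by
    have hX := MoritaTraceData.isTr X.2
    exact ⟨TrData.operad hX, ⟨ObjectProperty.isoMk _ (MoritaTraceData.mkIso
      (TrData.operadIso hX (.seg 1 1)) (TrData.operadIso hX (.seg (-1) (-1)))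
      (TrData.operadIso hX (.seg 1 (-1))) (TrData.operadIso hX (.seg (-1) 1))
      (TrData.operadIso hX .circ)
      (TrData.operad_mul hX 1 1 1) (TrData.operad_mul hX (-1) (-1) (-1))
      (TrData.operad_mul hX 1 1 (-1)) (TrData.operad_mul hX 1 (-1) (-1))
      (TrData.operad_mul hX (-1) (-1) 1) (TrData.operad_mul hX (-1) 1 1)
      (TrData.operad_mul hX 1 (-1) 1) (TrData.operad_mul hX (-1) 1 (-1))
      (TrData.operad_trace hX 1) (TrData.operad_trace hX (-1)))⟩⟩

end Morita

end

end OneCob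

end

/-- The three parts of each equivalence are found as instances: essential surjectivity as shown
above, fullness and faithfulness from those of the functors `data`, through the lift to a full
subcategory. -/
theorem mainTheorem6 (C : Type u) [Category.{v} C] [MonoidalCategory C]
    [SymmetricCategory C] :
    (∃ h : ∀ P : OneCob.ModularDioperad C,
        OneCob.MoritaTraceData.moritaContextWithTrace C ((OneCob.ModularDioperad.data C).obj P),
      ((OneCob.MoritaTraceData.moritaContextWithTrace C).lift
        (OneCob.ModularDioperad.data C) h).IsEquivalence) ∧
    (∃ h : ∀ P : OneCob.ModularOperad C,
        OneCob.AlgTraceData.algebraWithTrace C ((OneCob.ModularOperad.data C).obj P),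
      ((OneCob.AlgTraceData.algebraWithTrace C).lift
        (OneCob.ModularOperad.data C) h).IsEquivalence) := ⟨⟨OneCob.ModularDioperad.isMoritaContextWithTrace, { }⟩,
    ⟨OneCob.ModularOperad.isAlgebraWithTrace, { }⟩⟩
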